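/- Let $p$ be an odd prime, let $\psi_p:\mathbb{Q}_p\to\mathbb{C}^\times$ be an additive character with kernel $\mathbb{Z}_p$, and write $\overline{\psi}_p=\psi_p^{-1}$, $\psi^a(x)=\psi(ax)$. Let $(\cdot,\cdot)_p$ be the Hilbert symbol, $\gamma(\psi)$ the Weil index of $x\mapsto\psi(x^2)$, and $\chi_\psi(a)=(a,-1)_p\,\gamma(\psi^a)/\gamma(\psi)$. Let $\widetilde{\mathrm{SL}}_2(\mathbb{Q}_p)=\mathrm{SL}_2(\mathbb{Q}_p)\times\{\pm1\}$ with product $[g_1,\epsilon_1][g_2,\epsilon_2]=[g_1g_2,\epsilon(g_1,g_2)\epsilon_1\epsilon_2]$, where $\epsilon(g_1,g_2)=(x(g_1)x(g_1g_2),x(g_2)x(g_1g_2))_p$ and, for $g=\begin{pmatrix}a&b\\c&d\end{pmatrix}$, $x(g)=c$ if $c\ne0$ and $x(g)=d$ if $c=0$. Embed $\mathrm{SL}_2(\mathbb{Z}_p)$ by $k=\begin{pmatrix}a&b\\c&d\end{pmatrix}\mapsto[k,s_p(k)]$, where $s_p(k)=(c,d)_p$ if $cd\neq0$ and $\mathrm{ord}_p(c)$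 is odd, and $s_p(k)=1$ otherwise. Let $\Gamma_0\subset\mathrm{SL}_2(\mathbb{Z}_p)$ and $K_0\subset\mathrm{GL}_2(\mathbb{Z}_p)$ be the subgroups given by $c\equiv0\pmod p$, and let $s=\begin{pmatrix}0&1\\-1&0\end{pmatrix}$, $n(x)=\begin{pmatrix}1&x\\0&1\end{pmatrix}$. The Haar measures give $\mathbb{Z}_p$ and $\mathrm{GL}_2(\mathbb{Z}_p)$ volume $1$ and $\mathrm{SL}_2(\mathbb{Z}_p)$ volume $\zeta_p(2)^{-1}=1-p^{-2}$. Let $\pi_p=\xi_1\mathrm{St}_p$ and $\tau_p=\xi_2\mathrm{St}_p$, where $\xi_1,\xi_2$ are unramified characters of $\mathbb{Q}_p^\times$ and $\xi_1^2=1$; put $w_p=\varepsilon(1/2,\pi_p)=-\xi_1(p)$. Let $D\in\mathbb{Z}_p^\times$ with $\left(\frac Dp\right)=w_p$, let $\delta\in\mathbb{Z}_p^\times$ be a non-square, and put $\psi=\overline{\psi}_p^{D}$. (a) Let $\tilde\pi_p=\tilde\sigma^{\delta}(\psi)$ be the special representation of $\widetilde{\mathrm{SL}}_2(\mathbb{Q}_p)$,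 acting by right translation on the locally constant functions $\tilde\varphi$ on $\widetilde{\mathrm{SL}}_2(\mathbb{Q}_p)$ with $\tilde\varphi\left(\left[\begin{pmatrix}a&*\\0&a^{-1}\end{pmatrix},\epsilon\right]g\right)=\epsilon\,\chi_\psi(a)\,(\delta,a)_p\,|a|_p^{3/2}\,\tilde\varphi(g)$ and $\int_{\mathbb{Q}_p}\tilde\varphi([s,1][n(x),1])\,\psi(-\delta\Delta^2x)\,dx=0$ for all $\Delta\in\mathbb{Q}_p$. Let $\mathbf h_p\in\tilde\pi_p$ be a nonzero vector fixed by the image of $\Gamma_0$. (b) Realize $\tau_p$ as the irreducible subrepresentation of $\pi(\xi_2|\cdot|_p^{1/2},\xi_2|\cdot|_p^{-1/2})$, that is, as the space of locally constant functions $\varphi$ on $\mathrm{GL}_2(\mathbb{Q}_p)$ with $\varphi\left(\begin{pmatrix}a&b\\0&d\end{pmatrix}x\right)=\xi_2(ad)\,|a/d|_p\,\varphi(x)$ and $\int_{\mathrm{GL}_2(\mathbb{Z}_p)}\varphi(k)\,dk=0$. Let $\mathbf g_p\in\tau_p$ be a nonzero $K_0$-fixed vector. (c) Let $\omega_{\overline{\psi}_p}$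 be the Weil representation of $\widetilde{\mathrm{SL}}_2(\mathbb{Q}_p)$ on $\mathcal{S}(\mathbb{Q}_p)$ for the quadratic form $Q(x)=x^2$, and let $\pmb\phi_p=\mathbf 1_{\mathbb{Z}_p}$. Let $\langle\cdot,\cdot\rangle$ denote $\int f_1\overline{f_2}$ over $\mathrm{SL}_2(\mathbb{Z}_p)$ (embedded in $\widetilde{\mathrm{SL}}_2(\mathbb{Q}_p)$), over $\mathrm{GL}_2(\mathbb{Z}_p)$, and over $\mathbb{Q}_p$ in the three cases, and define $$\mathcal I_p^\sharp=\frac{L(1,\pi_p,\mathrm{ad})\,L(1,\tau_p,\mathrm{ad})}{L(1/2,\pi_p\times\mathrm{ad}\,\tau_p)}\int_{\mathrm{SL}_2(\mathbb{Q}_p)}\frac{\overline{\langle\tilde\pi_p([g,1])\mathbf h_p,\mathbf h_p\rangle}}{\langle\mathbf h_p,\mathbf h_p\rangle}\,\frac{\langle\tau_p(g)\mathbf g_p,\mathbf g_p\rangle}{\langle\mathbf g_p,\mathbf g_p\rangle}\,\frac{\langle\omega_{\overline{\psi}_p}([g,1])\pmb\phi_p,\pmb\phi_p\rangle}{\langle\pmb\phi_p,\pmb\phi_p\rangle}\,dg,$$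 the $L$-factors (and the root number $w_p$) being those of the associated Weil--Deligne representations. Then $$\mathcal I_p^\sharp=\frac1p.$$ -/

import Mathlib

open MeasureTheory Filter Topology
open scoped Matrix ComplexConjugate TensorProduct MatrixGroups

noncomputable section

namespace LocalPeriod

variable (p : ℕ) [Fact p.Prime]

/-! ### Groups and Haar measures -/

/-- The group `SL₂(ℚ_p)`. -/
abbrev SL2 : Type := Matrix.SpecialLinearGroup (Fin 2) ℚ_[p]

/-- The group `GL₂(ℚ_p)`. -/
abbrev GL2 : Type := GL (Fin 2) ℚ_[p]

instance : MeasurableSpace ℚ_[p] := borel _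
instance : BorelSpace ℚ_[p] := ⟨rfl⟩
instance : MeasurableSpace (SL2 p) := borel _
instance : BorelSpace (SL2 p) := ⟨rfl⟩
instance : MeasurableSpace (GL2 p) := borel _
instance : BorelSpace (GL2 p) := ⟨rfl⟩

/-- The `2 × 2` matrices with entries in `ℤ_p`. -/
def integralMatrices : Set (Matrix (Fin 2) (Fin 2) ℚ_[p]) := {A | ∀ i j, ‖A i j‖ ≤ 1}

lemma isCompact_integralMatrices : IsCompact (integralMatrices p) := by
  have h : integralMatrices p =
      Set.pi Set.univ fun _ : Fin 2 =>
        (Set.pi Set.univ fun _ : Fin 2 => Metric.closedBall (0 : ℚ_[p]) 1) := by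
    ext A
    constructor
    · intro hA i _ j _
      simpa using hA i j
    · intro hA i j
      simpa using hA i trivial j trivial
  rw [h]
  exact isCompact_univ_pi fun _ => isCompact_univ_pi fun _ => isCompact_closedBall _ _

lemma isOpen_integralMatrices : IsOpen (integralMatrices p) := by
  have h : integralMatrices p =
      ⋂ i : Fin 2, ⋂ j : Fin 2, (fun A : Matrix (Fin 2) (Fin 2) ℚ_[p] => A i j) ⁻¹'
        Metric.closedBall (0 : ℚ_[p]) 1 := by
    ext A
    simp [integralMatrices]
  rw [h]
  refine isOpen_iInter_of_finite fun i => isOpen_iInter_of_finite fun j => ?_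
  exact (IsUltrametricDist.isOpen_closedBall (0 : ℚ_[p]) one_ne_zero).preimage (by fun_prop)

lemma one_mem_integralMatrices : (1 : Matrix (Fin 2) (Fin 2) ℚ_[p]) ∈ integralMatrices p := by
  intro i j
  rw [Matrix.one_apply]
  split_ifs <;> simp

/-- `SL₂(ℤ_p)`, as a compact open subset of `SL₂(ℚ_p)`. -/
def slIntegral : TopologicalSpace.PositiveCompacts (SL2 p) where
  carrier := {k | (k : Matrix (Fin 2) (Fin 2) ℚ_[p]) ∈ integralMatrices p}
  isCompact' :=
    Matrix.SpecialLinearGroup.isClosedEmbedding_val.isCompact_preimage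
      (isCompact_integralMatrices p)
  interior_nonempty' := by
    have h : IsOpen {k : SL2 p | (k : Matrix (Fin 2) (Fin 2) ℚ_[p]) ∈ integralMatrices p} :=
      (isOpen_integralMatrices p).preimage continuous_subtype_val
    rw [h.interior_eq]
    exact ⟨1, by simpa using one_mem_integralMatrices p⟩

/-- `GL₂(ℤ_p)`, as a compact open subset of `GL₂(ℚ_p)`: the matrices that are integral together
with their inverses. -/
def glIntegral : TopologicalSpace.PositiveCompacts (GL2 p) where
  carrier := {k | (k : Matrix (Fin 2) (Fin 2) ℚ_[p]) ∈ integralMatrices p ∧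
    ((k⁻¹ : GL2 p) : Matrix (Fin 2) (Fin 2) ℚ_[p]) ∈ integralMatrices p}
  isCompact' := by
    have h := Units.isClosedEmbedding_embedProduct
      (α := Matrix (Fin 2) (Fin 2) ℚ_[p])
    exact h.isCompact_preimage ((isCompact_integralMatrices p).prod
      (MulOpposite.opHomeomorph.symm.isClosedEmbedding.isCompact_preimage
        (isCompact_integralMatrices p)))
  interior_nonempty' := by
    have h : IsOpen {k : GL2 p | (k : Matrix (Fin 2) (Fin 2) ℚ_[p]) ∈ integralMatrices p ∧
        ((k⁻¹ : GL2 p) : Matrix (Fin 2) (Fin 2) ℚ_[p]) ∈ integralMatrices p} :=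
      ((isOpen_integralMatrices p).preimage Units.continuous_val).inter
        ((isOpen_integralMatrices p).preimage (Units.continuous_val.comp continuous_inv))
    rw [h.interior_eq]
    exact ⟨1, by simpa using one_mem_integralMatrices p⟩

/-- `ℤ_p`, as a compact open subset of `ℚ_p`. -/
def padicIntegral : TopologicalSpace.PositiveCompacts ℚ_[p] where
  carrier := Metric.closedBall 0 1
  isCompact' := isCompact_closedBall _ _
  interior_nonempty' := by
    rw [(IsUltrametricDist.isOpen_closedBall (0 : ℚ_[p]) one_ne_zero).interior_eq]
    exact ⟨0, by simp⟩

/-- The Haar measure on `ℚ_p` with `vol(ℤ_p) = 1`. -/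
def padicHaar : Measure ℚ_[p] := Measure.addHaarMeasure (padicIntegral p)

/-- The Haar measure on `GL₂(ℚ_p)` with `vol(GL₂(ℤ_p)) = 1`. -/
def glHaar : Measure (GL2 p) := Measure.haarMeasure (glIntegral p)

/-- The Haar measure on `SL₂(ℚ_p)` with `vol(SL₂(ℤ_p)) = ζ_p(2)⁻¹ = 1 - p⁻²`. -/
def slHaar : Measure (SL2 p) :=
  ENNReal.ofReal (1 - (p : ℝ)⁻¹ ^ 2) • Measure.haarMeasure (slIntegral p)

/-- `K₀(p) ⊂ GL₂(ℤ_p)`. -/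
def glGamma0 : Set (GL2 p) := {k | k ∈ glIntegral p ∧ ‖k 1 0‖ < 1}

/-- `Γ₀(p) ⊂ SL₂(ℤ_p)`. -/
def slGamma0 : Set (SL2 p) := {k | k ∈ slIntegral p ∧ ‖k 1 0‖ < 1}

variable {p}

/-! ### Hilbert symbol and the metaplectic group -/

open Classical in
/-- The Hilbert symbol `(a, b)_p`, for nonzero `a`, `b`. -/
def hilbertSymbol (a b : ℚ_[p]) : ℤˣ :=
  if ∃ x y z : ℚ_[p], (x, y, z) ≠ (0, 0, 0) ∧ z ^ 2 = a * x ^ 2 + b * y ^ 2 then 1 else -1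

open Classical in
/-- `x(g) = c` if `c ≠ 0`, and `x(g) = d` if `c = 0`. -/
def xCoord (g : SL2 p) : ℚ_[p] := if g 1 0 ≠ 0 then g 1 0 else g 1 1

/-- The Kubota cocycle of `SL₂(ℚ_p)`. -/
def cocycle (g₁ g₂ : SL2 p) : ℤˣ :=
  hilbertSymbol (xCoord g₁ * xCoord (g₁ * g₂)) (xCoord g₂ * xCoord (g₁ * g₂))

variable (p) in
/-- The metaplectic double cover of `SL₂(ℚ_p)`: pairs `[g, ε]`, multiplied with the help of the
Kubota cocycle. -/
@[ext]
structure Mp where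
  /-- the component in `SL₂(ℚ_p)` -/
  g : SL2 p
  /-- the sign -/
  ε : ℤˣ

instance : Mul (Mp p) := ⟨fun x y => ⟨x.g * y.g, cocycle x.g y.g * x.ε * y.ε⟩⟩

open Classical in
/-- The sign `s_p` that splits the cover over `SL₂(ℤ_p)` (`p` odd). -/
def splitSign (k : SL2 p) : ℤˣ :=
  if k 1 0 * k 1 1 ≠ 0 ∧ Odd (Padic.valuation (k 1 0)) then hilbertSymbol (k 1 0) (k 1 1) else 1

/-- The splitting `k ↦ [k, s_p(k)]` over `SL₂(ℤ_p)`. -/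
def split (k : SL2 p) : Mp p := ⟨k, splitSign k⟩

/-- `t(a) = diag(a, a⁻¹)`. -/
def tMat (a : ℚ_[p]ˣ) : SL2 p :=
  ⟨!![(a : ℚ_[p]), 0; 0, (a⁻¹ : ℚ_[p]ˣ)], by simp [Matrix.det_fin_two]⟩

/-- The unipotent matrix `n(b)`. -/
def nMat (b : ℚ_[p]) : SL2 p := ⟨!![1, b; 0, 1], by simp [Matrix.det_fin_two]⟩

/-- The Weyl element `s`. -/
def sMat : SL2 p := ⟨!![0, 1; -1, 0], by simp [Matrix.det_fin_two]⟩

/-! ### Weil index and Weil representation -/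

/-- The Weil index `γ(ψ)` of `x ↦ ψ(x²)`: the common phase of the integrals of `ψ(x²)` over
`p⁻ⁿ ℤ_p` for large `n`. -/
def weilIndex (ψ : AddChar ℚ_[p] Circle) : ℂ :=
  limUnder atTop fun n : ℕ =>
    (∫ x in Metric.closedBall (0 : ℚ_[p]) ((p : ℝ) ^ n), (ψ (x ^ 2) : ℂ) ∂padicHaar p) /
      ‖∫ x in Metric.closedBall (0 : ℚ_[p]) ((p : ℝ) ^ n), (ψ (x ^ 2) : ℂ) ∂padicHaar p‖

/-- `χ_ψ(a) = (a, -1)_p γ(ψ^a) / γ(ψ)`, where `ψ^a(x) = ψ(ax)`. -/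
def chiPsi (ψ : AddChar ℚ_[p] Circle) (a : ℚ_[p]) : ℂ :=
  ((hilbertSymbol a (-1) : ℤ) : ℂ) * weilIndex (ψ.mulShift a) / weilIndex ψ

/-- The operator `ω_ψ[n(b), 1]` of the Weil representation. -/
def weilN (ψ : AddChar ℚ_[p] Circle) (b : ℚ_[p]) (φ : ℚ_[p] → ℂ) : ℚ_[p] → ℂ :=
  fun x => ψ (b * x ^ 2) * φ x

/-- The operator `ω_ψ[t(a), 1]` of the Weil representation. -/
def weilT (ψ : AddChar ℚ_[p] Circle) (a : ℚ_[p]) (φ : ℚ_[p] → ℂ) : ℚ_[p] → ℂ :=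
  fun x => chiPsi ψ a * ((‖a‖ ^ (1 / 2 : ℝ) : ℝ) : ℂ) * φ (a * x)

/-- The operator `ω_ψ[s, 1]` of the Weil representation. -/
def weilS (ψ : AddChar ℚ_[p] Circle) (φ : ℚ_[p] → ℂ) : ℚ_[p] → ℂ :=
  fun x => weilIndex ψ * ∫ y, φ y * ψ (2 * x * y) ∂padicHaar p

open Classical in
/-- The Weil representation `ω_ψ` of the metaplectic group on functions on the quadratic space
`ℚ_p` with `Q(x) = x²`. For `g = (a b; c d)` one has `[g, ε] = [1, ε] [n(ab), 1] [t(a), 1]` if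
`c = 0`, and `[g, ε] = [1, ε e] [n(a/c), 1] [t(-1/c), 1] [s, 1] [n(d/c), 1]` if `c ≠ 0`, where
`e` is the cocycle of `t(-1/c)` and `s`. -/
def weilRep (ψ : AddChar ℚ_[p] Circle) (x : Mp p) (φ : ℚ_[p] → ℂ) : ℚ_[p] → ℂ :=
  if hc : x.g 1 0 = 0 then
    ((x.ε : ℤ) : ℂ) • weilN ψ (x.g 0 0 * x.g 0 1) (weilT ψ (x.g 0 0) φ)
  else
    (((x.ε * cocycle (tMat (-(Units.mk0 (x.g 1 0) hc)⁻¹)) sMat : ℤˣ) : ℤ) : ℂ) •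
      weilN ψ (x.g 0 0 / x.g 1 0)
        (weilT ψ (-(x.g 1 0)⁻¹) (weilS ψ (weilN ψ (x.g 1 1 / x.g 1 0) φ)))

/-- The characteristic function of `ℤ_p`. -/
def charZp : ℚ_[p] → ℂ := Set.indicator (Metric.closedBall 0 1) 1

/-- `⟨φ₁, φ₂⟩ = ∫_{ℚ_p} φ₁ \bar φ₂`. -/
def weilPairing (φ₁ φ₂ : ℚ_[p] → ℂ) : ℂ := ∫ x, φ₁ x * conj (φ₂ x) ∂padicHaar p

/-- The normalized matrix coefficient of `φ` for the Weil representation. -/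
def weilCoeff (ψ : AddChar ℚ_[p] Circle) (φ : ℚ_[p] → ℂ) (g : SL2 p) : ℂ :=
  weilPairing (weilRep ψ ⟨g, 1⟩ φ) φ / weilPairing φ φ

/-! ### The special representation of the metaplectic group -/

/-- Local constancy on the metaplectic group, whose topology is the one for which the splitting
over `SL₂(ℤ_p)` is an open embedding. -/
def MpLocallyConstant (φ : Mp p → ℂ) : Prop :=
  ∀ x : Mp p, ∃ n : ℕ, ∀ k ∈ slIntegral p,
    (∀ i j, ‖k i j - (1 : Matrix (Fin 2) (Fin 2) ℚ_[p]) i j‖ ≤ (p : ℝ)⁻¹ ^ n) →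
      φ (x * split k) = φ x

/-- Membership in the space of the special representation `σ̃^δ(ψ)` of the metaplectic group, on
which the group acts by right translation. Here `χ_δ(a) = (δ, a)_p`. -/
structure IsMpSpecial (ψ : AddChar ℚ_[p] Circle) (δ : ℚ_[p]) (φ : Mp p → ℂ) : Prop where
  locallyConstant : MpLocallyConstant φ
  transform : ∀ (b : SL2 p) (ε : ℤˣ) (x : Mp p), b 1 0 = 0 →
    φ (⟨b, ε⟩ * x) = ((ε : ℤ) : ℂ) * chiPsi ψ (b 0 0) * ((hilbertSymbol δ (b 0 0) : ℤ) : ℂ) *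
      ((‖b 0 0‖ ^ (3 / 2 : ℝ) : ℝ) : ℂ) * φ x
  vanishing : ∀ Δ : ℚ_[p],
    ∫ x, φ (⟨sMat, 1⟩ * ⟨nMat x, 1⟩) * ψ (-(δ * Δ ^ 2 * x)) ∂padicHaar p = 0

/-- A newvector of `σ̃^δ(ψ)`: a nonzero vector fixed by the image of `Γ₀(p)` under the
splitting. -/
structure IsMpNewvector (ψ : AddChar ℚ_[p] Circle) (δ : ℚ_[p]) (φ : Mp p → ℂ) : Prop where
  mem : IsMpSpecial ψ δ φ
  ne_zero : φ ≠ 0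
  fixed : ∀ k ∈ slGamma0 p, ∀ x, φ (x * split k) = φ x

/-- `⟨φ₁, φ₂⟩ = ∫_{SL₂(ℤ_p)} φ₁ \bar φ₂`, with `SL₂(ℤ_p)` embedded by the splitting. -/
def mpPairing (φ₁ φ₂ : Mp p → ℂ) : ℂ :=
  ∫ k in (slIntegral p : Set (SL2 p)), φ₁ (split k) * conj (φ₂ (split k)) ∂slHaar p

/-- The normalized matrix coefficient of `φ`, at the lift `[g, 1]` of `g`. -/
def mpCoeff (φ : Mp p → ℂ) (g : SL2 p) : ℂ :=
  mpPairing (fun x => φ (x * ⟨g, 1⟩)) φ / mpPairing φ φ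

/-! ### The special representation of `GL₂` -/

/-- A character of `ℚ_p^×` is unramified if it is trivial on `ℤ_p^×`. -/
def IsUnramified (ξ : ℚ_[p]ˣ →* ℂˣ) : Prop := ∀ u : ℚ_[p]ˣ, ‖(u : ℚ_[p])‖ = 1 → ξ u = 1

/-- Membership in the space of `ξ St` (`ξ` unramified), the irreducible subrepresentation of
`π(ξ|·|^{1/2}, ξ|·|^{-1/2})`. It is the kernel of the `GL₂(ℚ_p)`-equivariant projection
`φ ↦ ∫_{GL₂(ℤ_p)} φ(k) dk` of the induced representation onto the character `ξ ∘ det`. -/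
structure IsGLSpecial (ξ : ℚ_[p]ˣ →* ℂˣ) (φ : GL2 p → ℂ) : Prop where
  locallyConstant : IsLocallyConstant φ
  transform : ∀ b x : GL2 p, b 1 0 = 0 →
    φ (b * x) = (ξ (Matrix.GeneralLinearGroup.det b) : ℂ) * ((‖b 0 0 / b 1 1‖ : ℝ) : ℂ) * φ x
  vanishing : ∫ k in (glIntegral p : Set (GL2 p)), φ k ∂glHaar p = 0

/-- A newvector of `ξ St`: a nonzero vector fixed by `K₀(p)`. -/
structure IsGLNewvector (ξ : ℚ_[p]ˣ →* ℂˣ) (φ : GL2 p → ℂ) : Prop where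
  mem : IsGLSpecial ξ φ
  ne_zero : φ ≠ 0
  fixed : ∀ k ∈ glGamma0 p, ∀ x, φ (x * k) = φ x

/-- `⟨φ₁, φ₂⟩ = ∫_{GL₂(ℤ_p)} φ₁ \bar φ₂`. -/
def glPairing (φ₁ φ₂ : GL2 p → ℂ) : ℂ :=
  ∫ k in (glIntegral p : Set (GL2 p)), φ₁ k * conj (φ₂ k) ∂glHaar p

/-- The normalized matrix coefficient of `φ` at `g ∈ SL₂(ℚ_p)`. -/
def glCoeff (φ : GL2 p → ℂ) (g : SL2 p) : ℂ :=
  glPairing (fun x => φ (x * Matrix.SpecialLinearGroup.toGL g)) φ / glPairing φ φ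

/-! ### Weil–Deligne parameters, `L`-factors and root numbers -/

variable (p) in
/-- A Weil–Deligne representation of `ℚ_p` on which inertia acts trivially: the action `Φ` of a
geometric Frobenius and the monodromy operator `N`, with `Φ N Φ⁻¹ = p⁻¹ N`. -/
structure WDRep (V : Type) [AddCommGroup V] [Module ℂ V] where
  /-- geometric Frobenius -/
  Φ : V ≃ₗ[ℂ] V
  /-- monodromy -/
  N : V →ₗ[ℂ] V
  comm : ∀ v, Φ (N v) = (p : ℂ)⁻¹ • N (Φ v)

namespace WDRep

variable {V W : Type} [AddCommGroup V] [Module ℂ V] [AddCommGroup W] [Module ℂ W]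

lemma map_ker (ρ : WDRep p V) :
    ∀ v ∈ LinearMap.ker ρ.N, (ρ.Φ : V →ₗ[ℂ] V) v ∈ LinearMap.ker ρ.N := by
  intro v hv
  rw [LinearMap.mem_ker] at hv ⊢
  have h := ρ.comm v
  rw [hv, map_zero] at h
  have hp : (p : ℂ)⁻¹ ≠ 0 := inv_ne_zero (Nat.cast_ne_zero.mpr (Fact.out : p.Prime).ne_zero)
  exact (smul_eq_zero.mp h.symm).resolve_left hp

/-- The `L`-factor `L(s, ρ) = det(1 - p⁻ˢ Φ | ker N)⁻¹`. -/
def LFactor (ρ : WDRep p V) (s : ℂ) : ℂ :=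
  (LinearMap.det (LinearMap.id - (p : ℂ) ^ (-s) • (ρ.Φ : V →ₗ[ℂ] V).restrict ρ.map_ker))⁻¹

/-- The `ε`-factor `ε(s, ρ) = det(-p⁻ˢ Φ | V / ker N)`, with respect to an additive character
of conductor `ℤ_p` and the self-dual measure. -/
def epsFactor (ρ : WDRep p V) (s : ℂ) : ℂ :=
  LinearMap.det (-((p : ℂ) ^ (-s) •
    (LinearMap.ker ρ.N).mapQ (LinearMap.ker ρ.N) (ρ.Φ : V →ₗ[ℂ] V) ρ.map_ker))

/-- Tensor product: `Φ ⊗ Φ'` and `N ⊗ 1 + 1 ⊗ N'`. -/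
def tensor (ρ : WDRep p V) (σ : WDRep p W) : WDRep p (V ⊗[ℂ] W) where
  Φ := TensorProduct.congr ρ.Φ σ.Φ
  N := TensorProduct.map ρ.N LinearMap.id + TensorProduct.map LinearMap.id σ.N
  comm v := by
    induction v with
    | zero => simp
    | tmul x y =>
      simp [ρ.comm, σ.comm, TensorProduct.smul_tmul']
    | add x y hx hy =>
      simp only [map_add, smul_add] at *
      rw [hx, hy]

/-- The adjoint representation on the endomorphisms of trace zero: `X ↦ Φ X Φ⁻¹` and
`X ↦ N X - X N`. -/
def ad (ρ : WDRep p V) : WDRep p (LinearMap.ker (LinearMap.trace ℂ V)) where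
  Φ := ρ.Φ.conj.ofSubmodules _ _ (by
    ext X
    simp only [Submodule.mem_map_equiv, LinearMap.mem_ker]
    rw [← LinearMap.trace_conj' (ρ.Φ.conj.symm X) ρ.Φ, LinearEquiv.apply_symm_apply])
  N := (LinearMap.mulLeft ℂ (A := Module.End ℂ V) ρ.N -
      LinearMap.mulRight ℂ (A := Module.End ℂ V) ρ.N).restrict
    (fun X _ => by
      simp [LinearMap.mem_ker, LinearMap.trace_mul_comm ℂ ρ.N X])
  comm X := by
    apply Subtype.ext
    ext v
    have h : ∀ w, ρ.N (ρ.Φ.symm w) = (p : ℂ)⁻¹ • ρ.Φ.symm (ρ.N w) := by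
      intro w
      apply ρ.Φ.injective
      rw [ρ.comm, map_smul, LinearEquiv.apply_symm_apply, LinearEquiv.apply_symm_apply]
    change ρ.Φ (ρ.N (X.1 (ρ.Φ.symm v)) - X.1 (ρ.N (ρ.Φ.symm v))) =
      (p : ℂ)⁻¹ • (ρ.N (ρ.Φ (X.1 (ρ.Φ.symm v))) - ρ.Φ (X.1 (ρ.Φ.symm (ρ.N v))))
    simp only [map_sub, h, map_smul, smul_sub, ρ.comm]

end WDRep

variable (p) in
/-- The uniformizer `p`, as an element of `ℚ_p^×`. -/
def uniformizer : ℚ_[p]ˣ :=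
  Units.mk0 (p : ℚ_[p]) (Nat.cast_ne_zero.mpr (Fact.out : p.Prime).ne_zero)

variable (p) in
/-- `p^{1/2}` as an element of `ℂ^×`. -/
def sqrtP : ℂˣ :=
  Units.mk0 ((√(p : ℝ) : ℝ) : ℂ) (Complex.ofReal_ne_zero.mpr
    (Real.sqrt_ne_zero'.mpr (Nat.cast_pos.mpr (Fact.out : p.Prime).pos)))

/-- The Weil–Deligne representation of `ξ St` (`ξ` unramified): it has a basis `e₀`, `e₁ = N e₀`
with `N e₁ = 0`, `Φ e₀ = ξ(p) p^{1/2} e₀` and `Φ e₁ = ξ(p) p^{-1/2} e₁`. -/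
def steinbergWD (ξ : ℚ_[p]ˣ →* ℂˣ) : WDRep p (ℂ × ℂ) where
  Φ := (LinearEquiv.smulOfUnit (ξ (uniformizer p) * sqrtP p)).prodCongr
    (LinearEquiv.smulOfUnit (ξ (uniformizer p) * (sqrtP p)⁻¹))
  N := LinearMap.inr ℂ ℂ ℂ ∘ₗ LinearMap.fst ℂ ℂ ℂ
  comm v := by
    have h2 : ((√(p : ℝ) : ℝ) : ℂ) * ((√(p : ℝ) : ℝ) : ℂ) = p := by
      rw [← Complex.ofReal_mul, Real.mul_self_sqrt (Nat.cast_nonneg p), Complex.ofReal_natCast]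
    have h0 : ((√(p : ℝ) : ℝ) : ℂ) ≠ 0 := (sqrtP p).ne_zero
    ext
    · simp
    · simp [LinearEquiv.smulOfUnit, Units.smul_def, sqrtP, ← h2]
      field_simp

/-! ### The regularized local period -/

/-- `α_p^♯(h, g, φ)`: the integral over `SL₂(ℚ_p)` of the product of the normalized matrix
coefficients. -/
def alphaSharp (ψ : AddChar ℚ_[p] Circle) (h : Mp p → ℂ) (g : GL2 p → ℂ) (φ : ℚ_[p] → ℂ) : ℂ :=
  ∫ x : SL2 p, conj (mpCoeff h x) * glCoeff g x * weilCoeff ψ φ x ∂slHaar p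

/-- `I_p^♯(h, g, φ)` for `π_p = ξ₁ St` and `τ_p = ξ₂ St`; here `ψ` is the additive character that
defines the Weil representation. -/
def periodSharp (ψ : AddChar ℚ_[p] Circle) (ξ₁ ξ₂ : ℚ_[p]ˣ →* ℂˣ)
    (h : Mp p → ℂ) (g : GL2 p → ℂ) (φ : ℚ_[p] → ℂ) : ℂ :=
  (steinbergWD ξ₁).ad.LFactor 1 * (steinbergWD ξ₂).ad.LFactor 1 /
      ((steinbergWD ξ₁).tensor (steinbergWD ξ₂).ad).LFactor (1 / 2) *
    alphaSharp ψ h g φ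

end LocalPeriod

end

open MeasureTheory Filter Topology
open scoped Matrix ComplexConjugate TensorProduct MatrixGroups

noncomputable section

namespace LocalPeriod

variable {p : ℕ} [Fact p.Prime]

section

/-! ### Square classes and the Hilbert symbol -/

/-! The integrand is a product `T * G` of functions on `SL₂(ℚ_p)`: `T` is the conjugate coefficient
of `h` times the Weil coefficient, and `G` is the coefficient of `g`. In `T` the cocycle signs of
the two genuine factors cancel, and the Weil vector is fixed by the split `SL₂(ℤ_p)`, so `T` has the
same invariance as a coefficient of the newvector `h`. Both `T` and `G` are bi-invariant under
`Γ₀(p)`, and on either side their sums over the `p + 1` Iwahori cosets in `SL₂(ℤ_p)` vanish, because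
a special representation has no spherical vector. This is `IsSteinbergCoeff`. It determines the
values on all double cosets from those at `t^n = diag(p^n, p^(-n))` with `n ≥ 0`.

The values at `t^n` come from three inputs. The Weil representation on `1_{ℤ_p}` is explicit
(`weilRep_charZp`): its phase `rowPhase` depends only on the bottom row, and `rowPhase_mul` shows
that right translation by `SL₂(ℤ_p)` changes it by the cocycle times the splitting sign. This rests
on Gauss sums (`weilIndex_mulShift`, `gam_mul`) and the tame symbol (`hilbertSymbol_eq`). An
anti-automorphism carries the result to the left side (`weilMC_mul_left`). A newvector takes two
values `α`, `β` on the Iwahori subgroup and its complement, and `α + p β = 0`. For `GL₂` this is the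
vanishing of the mean over `GL₂(ℤ_p)`. For the metaplectic group it is the case `Δ = 0` of the
defining condition, where the shells of odd valuation cancel because `δ` is not a square. The
coefficient is a weighted average over the maximal compact subgroup; `MatrixGroup.sphAvg_tp` reduces
it at `t^n` to one value and one integral over `ℤ_p`. The result is `G(t^n) = p^(-2n)` and `T(t^n) =
(η p^(-2))^n`, where `η = -(D/p) = ξ₁(p)` by the root number condition.

Summing over the Cartan decomposition gives a geometric series, so that `∫ T G = p⁻¹ (1 - p⁻²) (1 +
η p⁻¹) / (1 - η p⁻²)`. The `L`-factors contribute `(1 - p⁻²)⁻² (1 - η p⁻²) (1 - η p⁻¹)`, and `η² =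
1` makes the product equal to `p⁻¹`. -/

lemma cast_p_ne_zero : (p : ℚ_[p]) ≠ 0 := Nat.cast_ne_zero.mpr (Fact.out : p.Prime).ne_zero

lemma one_lt_cast_p : (1 : ℝ) < p := by exact_mod_cast (Fact.out : p.Prime).one_lt

lemma cast_p_pos : (0 : ℝ) < p := one_pos.trans one_lt_cast_p

lemma norm_lt_one_iff_le {x : ℚ_[p]} : ‖x‖ < 1 ↔ ‖x‖ ≤ (p : ℝ)⁻¹ := by
  have h := Padic.norm_le_pow_iff_norm_lt_pow_add_one x (-1)
  simpa using h.symm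

lemma ringChar_zmod_ne_two (hp : p ≠ 2) : ringChar (ZMod p) ≠ 2 := by
  rwa [ZMod.ringChar_zmod_n]

lemma two_ne_zero_zmod (hp : p ≠ 2) : (2 : ZMod p) ≠ 0 :=
  Ring.two_ne_zero (ringChar_zmod_ne_two hp)

lemma norm_two (hp : p ≠ 2) : ‖(2 : ℚ_[p])‖ = 1 := by
  have h : ‖((2 : ℤ) : ℚ_[p])‖ = 1 := by
    refine le_antisymm (Padic.norm_int_le_one 2) (not_lt.mp fun hlt => ?_)
    rw [Padic.norm_intCast_lt_one_iff] at hlt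
    have h2 : p ∣ 2 := by exact_mod_cast hlt
    exact hp ((Nat.prime_dvd_prime_iff_eq (Fact.out : p.Prime) Nat.prime_two).mp h2)
  simpa using h

lemma padicInt_norm_lt_one_iff (x : ℤ_[p]) : ‖x‖ < 1 ↔ PadicInt.toZMod x = 0 := by
  rw [← RingHom.mem_ker, PadicInt.ker_toZMod, PadicInt.mem_nonunits.symm]
  rfl

lemma exists_padicInt_coe {x : ℚ_[p]} (hx : ‖x‖ ≤ 1) : ∃ u : ℤ_[p], (u : ℚ_[p]) = x :=
  ⟨⟨x, hx⟩, rfl⟩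

/-- A `p`-adic integer that is a nonzero square modulo `p` is a square (`p` odd). -/
lemma padicInt_isSquare_of_toZMod (hp : p ≠ 2) {u : ℤ_[p]} (hu : ‖u‖ = 1)
    (h : IsSquare (PadicInt.toZMod u)) : IsSquare u := by
  obtain ⟨r, hr⟩ := h
  set a : ℤ_[p] := (r.val : ℤ_[p]) with ha
  have har : PadicInt.toZMod a = r := by simp [ha]
  have hr0 : r ≠ 0 := by
    rintro rfl
    have : PadicInt.toZMod u = 0 := by simpa using hr
    rw [← padicInt_norm_lt_one_iff] at this
    exact this.ne hu
  have h1 : ‖a * a - u‖ < 1 := by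
    rw [padicInt_norm_lt_one_iff]
    simp [har, hr]
  -- The derivative of `X² - u` at the approximate root is a unit because `p` is odd, so Hensel's
  -- condition is only `‖a² - u‖ < 1`.
  have h2 : ‖(2 : ℤ_[p]) * a‖ = 1 := by
    refine le_antisymm (PadicInt.norm_le_one _) (not_lt.mp fun hlt => ?_)
    rw [padicInt_norm_lt_one_iff, map_mul, har, map_ofNat] at hlt
    exact (mul_ne_zero (two_ne_zero_zmod hp) hr0) hlt
  have h3 : (Polynomial.X ^ 2 - Polynomial.C u : Polynomial ℤ_[p]).derivative =
      2 * Polynomial.X := by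
    rw [Polynomial.derivative_sub, Polynomial.derivative_C, Polynomial.derivative_X_sq, sub_zero]
    rfl
  obtain ⟨z, hz, -⟩ := hensels_lemma (F := (Polynomial.X ^ 2 - Polynomial.C u : Polynomial ℤ_[p]))
    (a := a) (by
      rw [h3]
      have : (Polynomial.aeval a) (2 * Polynomial.X : Polynomial ℤ_[p]) = 2 * a := by simp
      rw [this, h2]
      simpa [pow_two] using h1)
  refine ⟨z, ?_⟩
  have : z ^ 2 - u = 0 := by simpa using hz
  linear_combination -this

lemma isSquare_iff_toZMod (hp : p ≠ 2) {u : ℤ_[p]} (hu : ‖u‖ = 1) :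
    IsSquare (u : ℚ_[p]) ↔ IsSquare (PadicInt.toZMod u) := by
  constructor
  · rintro ⟨r, hr⟩
    have hr1 : ‖r‖ ≤ 1 := by
      have h : ‖r‖ * ‖r‖ = 1 := by
        rw [← norm_mul, ← hr]
        exact hu
      nlinarith [norm_nonneg r]
    obtain ⟨r, rfl⟩ := exists_padicInt_coe hr1
    refine ⟨PadicInt.toZMod r, ?_⟩
    rw [← map_mul]
    congr 1
    exact Subtype.ext hr
  · intro h
    obtain ⟨r, hr⟩ := padicInt_isSquare_of_toZMod hp hu h
    exact ⟨r, by rw [hr]; push_cast; rfl⟩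

/-- The unit part `a p^{-ord a}`. -/
def unitPart (a : ℚ_[p]) : ℚ_[p] := a * (p : ℚ_[p]) ^ (-a.valuation)

lemma unitPart_ne_zero {a : ℚ_[p]} (ha : a ≠ 0) : unitPart a ≠ 0 :=
  mul_ne_zero ha (zpow_ne_zero _ cast_p_ne_zero)

lemma norm_unitPart {a : ℚ_[p]} (ha : a ≠ 0) : ‖unitPart a‖ = 1 := by
  rw [unitPart, norm_mul, Padic.norm_p_zpow, neg_neg, Padic.norm_eq_zpow_neg_valuation ha,
    ← zpow_add₀ cast_p_pos.ne', neg_add_cancel, zpow_zero]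

lemma unitPart_mul {a b : ℚ_[p]} (ha : a ≠ 0) (hb : b ≠ 0) :
    unitPart (a * b) = unitPart a * unitPart b := by
  rw [unitPart, unitPart, unitPart, Padic.valuation_mul ha hb, neg_add,
    zpow_add₀ cast_p_ne_zero]
  ring

lemma unitPart_mul_zpow (a : ℚ_[p]) : unitPart a * (p : ℚ_[p]) ^ a.valuation = a := by
  rw [unitPart, mul_assoc, ← zpow_add₀ cast_p_ne_zero, neg_add_cancel, zpow_zero, mul_one]

lemma valuation_eq_zero_of_norm_eq_one {u : ℚ_[p]} (hu : ‖u‖ = 1) : u.valuation = 0 := by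
  have hu0 : u ≠ 0 := by rintro rfl; simp at hu
  rw [Padic.norm_eq_zpow_neg_valuation hu0] at hu
  have := zpow_right_injective₀ cast_p_pos one_lt_cast_p.ne' (hu.trans (zpow_zero _).symm)
  simpa using this

lemma valuation_eq_of_norm_eq {a b : ℚ_[p]} (ha : a ≠ 0) (h : ‖a‖ = ‖b‖) :
    a.valuation = b.valuation := by
  have hb : b ≠ 0 := by rintro rfl; simp at h; exact ha h
  rw [Padic.norm_eq_zpow_neg_valuation ha, Padic.norm_eq_zpow_neg_valuation hb] at h
  have := zpow_right_injective₀ cast_p_pos one_lt_cast_p.ne' h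
  simpa using this

lemma unitPart_of_norm_eq_one {u : ℚ_[p]} (hu : ‖u‖ = 1) : unitPart u = u := by
  simp [unitPart, valuation_eq_zero_of_norm_eq_one hu]

open Classical in
/-- The quadratic residue symbol of the unit part. -/
def leg (a : ℚ_[p]) : ℤˣ := if IsSquare (unitPart a) then 1 else -1

/-- Modulo `p` this is multiplicativity of the `±1`-valued quadratic character; that a product of
two nonsquares is a square uses the finite residue field. -/
lemma isSquare_mul_iff_of_norm_eq_one (hp : p ≠ 2) {u v : ℚ_[p]} (hu : ‖u‖ = 1) (hv : ‖v‖ = 1) :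
    IsSquare (u * v) ↔ (IsSquare u ↔ IsSquare v) := by
  obtain ⟨u, rfl⟩ := exists_padicInt_coe hu.le
  obtain ⟨v, rfl⟩ := exists_padicInt_coe hv.le
  rw [← PadicInt.norm_def] at hu hv
  have huv : ‖u * v‖ = 1 := by rw [norm_mul, hu, hv, one_mul]
  rw [isSquare_iff_toZMod hp hu, isSquare_iff_toZMod hp hv, ← PadicInt.coe_mul,
    isSquare_iff_toZMod hp huv, map_mul]
  have hx : PadicInt.toZMod u ≠ 0 := fun h => ((padicInt_norm_lt_one_iff _).mpr h).ne hu
  have hy : PadicInt.toZMod v ≠ 0 := fun h => ((padicInt_norm_lt_one_iff _).mpr h).ne hv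
  rw [← quadraticChar_one_iff_isSquare hx, ← quadraticChar_one_iff_isSquare hy,
    ← quadraticChar_one_iff_isSquare (mul_ne_zero hx hy), map_mul]
  rcases quadraticChar_dichotomy hx with h | h <;> rcases quadraticChar_dichotomy hy with h' | h' <;>
    rw [h, h'] <;> norm_num

lemma leg_mul (hp : p ≠ 2) {a b : ℚ_[p]} (ha : a ≠ 0) (hb : b ≠ 0) :
    leg (a * b) = leg a * leg b := by
  unfold leg
  rw [unitPart_mul ha hb]
  have := isSquare_mul_iff_of_norm_eq_one hp (norm_unitPart ha) (norm_unitPart hb)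
  split_ifs <;> first | rfl | (exfalso; tauto)

lemma leg_mul_self_left (a : ℚ_[p]) : leg a * leg a = 1 := Int.units_mul_self _

/-- The quotient `a / b` is congruent to `1` modulo `p`, hence a square. This is what allows an
entry to be replaced by its dominant term in the case analysis for `rowPhase`. -/
lemma leg_of_norm_sub_lt (hp : p ≠ 2) {a b : ℚ_[p]} (hb : b ≠ 0) (h : ‖a - b‖ < ‖b‖) :
    leg a = leg b := by
  have hn : ‖a‖ = ‖b‖ := by
    have h1 := IsUltrametricDist.norm_add_eq_max_of_norm_ne_norm h.ne
    rw [sub_add_cancel] at h1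
    rw [h1, max_eq_right h.le]
  have ha : a ≠ 0 := by rw [← norm_ne_zero_iff, hn]; exact norm_ne_zero_iff.mpr hb
  have hq : ‖a / b‖ = 1 := by rw [norm_div, hn, div_self (norm_ne_zero_iff.mpr hb)]
  have hsq : IsSquare (a / b) := by
    obtain ⟨u, hu⟩ := exists_padicInt_coe hq.le
    rw [← hu, ← PadicInt.norm_def] at hq
    rw [← hu, isSquare_iff_toZMod hp hq]
    have h0 : PadicInt.toZMod (u - 1) = 0 := by
      rw [← padicInt_norm_lt_one_iff, PadicInt.norm_def, PadicInt.coe_sub, hu, PadicInt.coe_one,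
        div_sub_one hb, norm_div, div_lt_one (norm_pos_iff.mpr hb)]
      exact h
    rw [map_sub, map_one, sub_eq_zero] at h0
    rw [h0]
    exact ⟨1, by simp⟩
  have h1 : leg (a / b) = 1 := by
    unfold leg
    rw [unitPart_of_norm_eq_one hq, if_pos hsq]
  have h2 : leg (a / b * b) = leg b := by
    rw [leg_mul hp (div_ne_zero ha hb) hb, h1, one_mul]
  rwa [div_mul_cancel₀ _ hb] at h2

lemma leg_eq_one_iff {u : ℚ_[p]} (hu : ‖u‖ = 1) : leg u = 1 ↔ IsSquare u := by
  unfold leg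
  rw [unitPart_of_norm_eq_one hu]
  split_ifs with h <;> simp [h]

lemma leg_inv (a : ℚ_[p]) : leg a⁻¹ = leg a := by
  unfold leg
  have : unitPart a⁻¹ = (unitPart a)⁻¹ := by
    unfold unitPart
    rw [Padic.valuation_inv, mul_inv, ← zpow_neg]
  have h2 : IsSquare (unitPart a⁻¹) ↔ IsSquare (unitPart a) := by rw [this, isSquare_inv]
  split_ifs <;> tauto

lemma leg_p : leg (p : ℚ_[p]) = 1 := by
  have : unitPart (p : ℚ_[p]) = 1 := by simp [unitPart]
  unfold leg
  rw [this, if_pos IsSquare.one]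

lemma leg_one : leg (1 : ℚ_[p]) = 1 := (leg_eq_one_iff norm_one).mpr IsSquare.one

lemma hilbertSymbol_comm (a b : ℚ_[p]) : hilbertSymbol a b = hilbertSymbol b a := by
  unfold hilbertSymbol
  congr 1
  rw [eq_iff_iff]
  constructor <;>
  · rintro ⟨x, y, z, h0, h⟩
    refine ⟨y, x, z, fun h1 => h0 ?_, by rw [h]; ring⟩
    simp only [Prod.mk.injEq] at h1 ⊢
    tauto

lemma hilbertSymbol_mul_sq_right (a b : ℚ_[p]) {c : ℚ_[p]} (hc : c ≠ 0) :
    hilbertSymbol a (b * c ^ 2) = hilbertSymbol a b := by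
  unfold hilbertSymbol
  congr 1
  rw [eq_iff_iff]
  constructor
  · rintro ⟨x, y, z, h0, h⟩
    refine ⟨x, c * y, z, fun h1 => h0 ?_, by rw [h]; ring⟩
    simp only [Prod.mk.injEq, mul_eq_zero, hc, false_or] at h1 ⊢
    exact h1
  · rintro ⟨x, y, z, h0, h⟩
    refine ⟨x, y / c, z, fun h1 => h0 ?_, by rw [h]; field_simp⟩
    simp only [Prod.mk.injEq, div_eq_zero_iff, hc, or_false] at h1 ⊢
    exact h1

lemma hilbertSymbol_eq_one_of_sq_right (a : ℚ_[p]) {b : ℚ_[p]} (hb : IsSquare b) :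
    hilbertSymbol a b = 1 := by
  obtain ⟨r, rfl⟩ := hb
  unfold hilbertSymbol
  exact if_pos ⟨0, 1, r, by simp, by ring⟩

lemma hilbertSymbol_eq_one_of_add_eq_one {a b : ℚ_[p]} (h : a + b = 1) :
    hilbertSymbol a b = 1 := by
  unfold hilbertSymbol
  exact if_pos ⟨1, 1, 1, by simp, by linear_combination -h⟩

/-- `(a, b) = (a, -ab)`. -/
lemma hilbertSymbol_eq_neg_mul {a b : ℚ_[p]} (ha : a ≠ 0) (hb : b ≠ 0) :
    hilbertSymbol a b = hilbertSymbol a (-(a * b)) := by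
  unfold hilbertSymbol
  congr 1
  rw [eq_iff_iff]
  constructor
  · rintro ⟨x, y, z, h0, h⟩
    by_cases hz : z = 0 ∧ x = 0
    · obtain ⟨rfl, rfl⟩ := hz
      have : y = 0 := by
        have : b * y ^ 2 = 0 := by linear_combination -h
        simpa [hb] using this
      subst this
      simp at h0
    · refine ⟨z, y, a * x, fun h1 => hz ?_, by linear_combination -a * h⟩
      simp only [Prod.mk.injEq, mul_eq_zero, ha, false_or] at h1
      exact ⟨h1.1, h1.2.2⟩
  · rintro ⟨x, y, z, h0, h⟩
    by_cases hz : z = 0 ∧ x = 0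
    · obtain ⟨rfl, rfl⟩ := hz
      have : y = 0 := by
        have : a * b * y ^ 2 = 0 := by linear_combination h
        simpa [ha, hb] using this
      subst this
      simp at h0
    · refine ⟨z, a * y, a * x, fun h1 => hz ?_, by linear_combination -a * h⟩
      simp only [Prod.mk.injEq, mul_eq_zero, ha, false_or] at h1
      exact ⟨h1.1, h1.2.2⟩

/-- Over the residue field `u x² + v y² = 1` has a solution by counting. Any lifts of `x` and `y`
will do: the resulting value is `1` modulo `p`, hence a square, so only `z` comes from Hensel's
lemma. -/
lemma hilbertSymbol_units (hp : p ≠ 2) {u v : ℚ_[p]} (hu : ‖u‖ = 1) (hv : ‖v‖ = 1) :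
    hilbertSymbol u v = 1 := by
  obtain ⟨u, rfl⟩ := exists_padicInt_coe hu.le
  obtain ⟨v, rfl⟩ := exists_padicInt_coe hv.le
  rw [← PadicInt.norm_def] at hu hv
  set u' := PadicInt.toZMod u
  set v' := PadicInt.toZMod v
  have hu' : u' ≠ 0 := fun h => ((padicInt_norm_lt_one_iff _).mpr h).ne hu
  have hv' : v' ≠ 0 := fun h => ((padicInt_norm_lt_one_iff _).mpr h).ne hv
  obtain ⟨x', y', hxy⟩ : ∃ x' y' : ZMod p, u' * x' ^ 2 + (v' * y' ^ 2 - 1) = 0 := by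
    have h := FiniteField.exists_root_sum_quadratic (R := ZMod p)
      (f := Polynomial.C u' * Polynomial.X ^ 2)
      (g := Polynomial.C v' * Polynomial.X ^ 2 - Polynomial.C 1)
      (Polynomial.degree_C_mul_X_pow 2 hu')
      (by
        rw [Polynomial.degree_sub_eq_left_of_degree_lt]
        · exact Polynomial.degree_C_mul_X_pow 2 hv'
        · rw [Polynomial.degree_C_mul_X_pow 2 hv']
          exact Polynomial.degree_C_le.trans_lt (by norm_num))
      (by
        rw [ZMod.card]
        exact (Nat.Prime.eq_two_or_odd Fact.out).resolve_left hp)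
    obtain ⟨a, b, hab⟩ := h
    exact ⟨a, b, by simpa using hab⟩
  set x : ℤ_[p] := (x'.val : ℤ_[p])
  set y : ℤ_[p] := (y'.val : ℤ_[p])
  have hx : PadicInt.toZMod x = x' := by simp [x]
  have hy : PadicInt.toZMod y = y' := by simp [y]
  have hw : PadicInt.toZMod (u * x ^ 2 + v * y ^ 2) = 1 := by
    rw [map_add, map_mul, map_mul, map_pow, map_pow, hx, hy]
    linear_combination hxy
  have hwn : ‖u * x ^ 2 + v * y ^ 2‖ = 1 := by
    refine le_antisymm (PadicInt.norm_le_one _) (not_lt.mp fun hlt => ?_)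
    rw [padicInt_norm_lt_one_iff, hw] at hlt
    exact one_ne_zero hlt
  obtain ⟨z, hz⟩ := padicInt_isSquare_of_toZMod hp hwn (by rw [hw]; exact ⟨1, by simp⟩)
  unfold hilbertSymbol
  refine if_pos ⟨x, y, z, ?_, ?_⟩
  · intro h
    simp only [Prod.mk.injEq, PadicInt.coe_eq_zero] at h
    rw [h.2.2] at hz
    rw [hz] at hwn
    simp at hwn
  · rw [pow_two, ← PadicInt.coe_mul, ← hz]
    push_cast
    ring

/-- For a nonsquare `u` the two terms `u x²` and `p v y²` have valuations of different parity, so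
one dominates. In the first case `z²` would have a nonsquare unit part, in the second an odd
valuation. -/
lemma hilbertSymbol_unit_uniformizer (hp : p ≠ 2) {u v : ℚ_[p]} (hu : ‖u‖ = 1) (hv : ‖v‖ = 1) :
    hilbertSymbol u (p * v) = leg u := by
  by_cases hsq : IsSquare u
  · rw [hilbertSymbol_comm, hilbertSymbol_eq_one_of_sq_right _ hsq, (leg_eq_one_iff hu).mpr hsq]
  have hleg : leg u = -1 := by
    rcases Int.units_eq_one_or (leg u) with h | h
    · exact absurd ((leg_eq_one_iff hu).mp h) hsq
    · exact h
  rw [hleg]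
  unfold hilbertSymbol
  refine if_neg ?_
  rintro ⟨x, y, z, h0, h⟩
  have hu0 : u ≠ 0 := norm_ne_zero_iff.mp (by rw [hu]; exact one_ne_zero)
  have hv0 : v ≠ 0 := norm_ne_zero_iff.mp (by rw [hv]; exact one_ne_zero)
  have hpn : ‖(p : ℚ_[p])‖ = (p : ℝ)⁻¹ := by simp
  have hpv : ‖(p : ℚ_[p]) * v * y ^ 2‖ = (p : ℝ)⁻¹ * ‖y‖ ^ 2 := by
    rw [norm_mul, norm_mul, hv, hpn, norm_pow, mul_one]
  have hx0 : x ≠ 0 := by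
    rintro rfl
    have hz : z ^ 2 = p * v * y ^ 2 := by rw [h]; ring
    have hy0 : y ≠ 0 := by
      rintro rfl
      have : z = 0 := by simpa using hz
      exact h0 (by rw [this])
    have hz0 : z ≠ 0 := by
      rintro rfl
      have : p * v * y ^ 2 ≠ 0 := mul_ne_zero (mul_ne_zero cast_p_ne_zero hv0) (pow_ne_zero 2 hy0)
      exact this (by rw [← hz]; ring)
    have h1 := congrArg Padic.valuation hz
    rw [Padic.valuation_mul (mul_ne_zero cast_p_ne_zero hv0) (pow_ne_zero 2 hy0),
      Padic.valuation_mul cast_p_ne_zero hv0, Padic.valuation_p, Padic.valuation_pow,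
      Padic.valuation_pow, valuation_eq_zero_of_norm_eq_one hv] at h1
    push_cast at h1
    omega
  by_cases hlt : ‖(p : ℚ_[p]) * v * y ^ 2‖ < ‖u * x ^ 2‖
  · have hux : u * x ^ 2 ≠ 0 := mul_ne_zero hu0 (pow_ne_zero 2 hx0)
    have h1 : leg (z ^ 2) = leg (u * x ^ 2) := by
      refine leg_of_norm_sub_lt hp hux ?_
      rwa [h, add_sub_cancel_left]
    have hz0 : z ≠ 0 := by
      rintro rfl
      have h2 : u * x ^ 2 = -(p * v * y ^ 2) := by linear_combination -h
      rw [h2, norm_neg] at hlt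
      exact lt_irrefl _ hlt
    rw [pow_two, pow_two, leg_mul hp hz0 hz0, leg_mul hp hu0 (mul_ne_zero hx0 hx0),
      leg_mul hp hx0 hx0, leg_mul_self_left, leg_mul_self_left, hleg] at h1
    exact absurd h1 (by decide)
  · have hy0 : y ≠ 0 := by
      rintro rfl
      apply hlt
      simpa [hu] using pow_pos (norm_pos_iff.mpr hx0) 2
    have hne : ‖u * x ^ 2‖ ≠ ‖(p : ℚ_[p]) * v * y ^ 2‖ := by
      intro he
      have h1 := valuation_eq_of_norm_eq (mul_ne_zero hu0 (pow_ne_zero 2 hx0)) he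
      rw [Padic.valuation_mul (mul_ne_zero cast_p_ne_zero hv0) (pow_ne_zero 2 hy0),
        Padic.valuation_mul cast_p_ne_zero hv0, Padic.valuation_p, Padic.valuation_pow,
        Padic.valuation_mul hu0 (pow_ne_zero 2 hx0), Padic.valuation_pow,
        valuation_eq_zero_of_norm_eq_one hv, valuation_eq_zero_of_norm_eq_one hu] at h1
      push_cast at h1
      omega
    have h1 : ‖z ^ 2‖ = ‖(p : ℚ_[p]) * v * y ^ 2‖ := by
      rw [h, IsUltrametricDist.norm_add_eq_max_of_norm_ne_norm hne, max_eq_right (not_lt.mp hlt)]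
    have hz0 : z ≠ 0 := by
      rintro rfl
      have : p * v * y ^ 2 ≠ 0 := mul_ne_zero (mul_ne_zero cast_p_ne_zero hv0) (pow_ne_zero 2 hy0)
      apply norm_ne_zero_iff.mpr this
      rw [← h1]
      simp
    have h2 := valuation_eq_of_norm_eq (pow_ne_zero 2 hz0) h1
    rw [Padic.valuation_mul (mul_ne_zero cast_p_ne_zero hv0) (pow_ne_zero 2 hy0),
      Padic.valuation_mul cast_p_ne_zero hv0, Padic.valuation_p, Padic.valuation_pow,
      Padic.valuation_pow, valuation_eq_zero_of_norm_eq_one hv] at h2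
    push_cast at h2
    omega

lemma eq_unitPart_mul_sq (a : ℚ_[p]) :
    ∃ c : ℚ_[p], c ≠ 0 ∧ (Even a.valuation ∧ a = unitPart a * c ^ 2 ∨
      Odd a.valuation ∧ a = p * unitPart a * c ^ 2) := by
  have h := unitPart_mul_zpow a
  rcases Int.even_or_odd a.valuation with he | ho
  · obtain ⟨k, hk⟩ := id he
    refine ⟨(p : ℚ_[p]) ^ k, zpow_ne_zero _ cast_p_ne_zero, Or.inl ⟨he, ?_⟩⟩
    rw [pow_two, ← zpow_add₀ cast_p_ne_zero, ← hk, h]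
  · obtain ⟨k, hk⟩ := id ho
    refine ⟨(p : ℚ_[p]) ^ k, zpow_ne_zero _ cast_p_ne_zero, Or.inr ⟨ho, ?_⟩⟩
    nth_rewrite 1 [← h]
    rw [hk, zpow_add₀ cast_p_ne_zero, two_mul, zpow_add₀ cast_p_ne_zero, zpow_one]
    ring

lemma leg_unitPart {a : ℚ_[p]} (ha : a ≠ 0) : leg (unitPart a) = leg a := by
  unfold leg
  rw [unitPart_of_norm_eq_one (norm_unitPart ha)]

lemma units_zpow_of_even {x : ℤˣ} {n : ℤ} (hn : Even n) : x ^ n = 1 := by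
  obtain ⟨k, rfl⟩ := hn
  rw [zpow_add, ← mul_zpow, Int.units_mul_self, one_zpow]

lemma units_zpow_of_odd {x : ℤˣ} {n : ℤ} (hn : Odd n) : x ^ n = x := by
  obtain ⟨k, rfl⟩ := hn
  rw [zpow_add, units_zpow_of_even (even_two_mul k), one_mul, zpow_one]

lemma neg_one_ne_zero_padic : (-1 : ℚ_[p]) ≠ 0 := neg_ne_zero.mpr one_ne_zero

/-- The Hilbert symbol for odd `p` is the tame symbol. -/
lemma hilbertSymbol_eq (hp : p ≠ 2) {a b : ℚ_[p]} (ha : a ≠ 0) (hb : b ≠ 0) :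
    hilbertSymbol a b =
      leg (-1 : ℚ_[p]) ^ (a.valuation * b.valuation) * leg a ^ b.valuation *
        leg b ^ a.valuation := by
  have hua := norm_unitPart ha
  have hub := norm_unitPart hb
  have hua0 := unitPart_ne_zero ha
  have hub0 := unitPart_ne_zero hb
  obtain ⟨c, hc, ⟨ea, ha'⟩ | ⟨oa, ha'⟩⟩ := eq_unitPart_mul_sq a <;>
    obtain ⟨d, hd, ⟨eb, hb'⟩ | ⟨ob, hb'⟩⟩ := eq_unitPart_mul_sq b
  · rw [units_zpow_of_even ea, units_zpow_of_even eb, units_zpow_of_even (ea.mul_right _)]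
    nth_rewrite 1 [ha', hb']
    rw [hilbertSymbol_mul_sq_right _ _ hd, hilbertSymbol_comm, hilbertSymbol_mul_sq_right _ _ hc,
      hilbertSymbol_units hp hub hua]
    rfl
  · rw [units_zpow_of_even ea, units_zpow_of_odd ob, units_zpow_of_even (ea.mul_right _)]
    nth_rewrite 1 [ha', hb']
    rw [hilbertSymbol_mul_sq_right _ _ hd, hilbertSymbol_comm, hilbertSymbol_mul_sq_right _ _ hc,
      hilbertSymbol_comm, hilbertSymbol_unit_uniformizer hp hua hub, leg_unitPart ha, one_mul,
      mul_one]
  · rw [units_zpow_of_odd oa, units_zpow_of_even eb, units_zpow_of_even (eb.mul_left _)]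
    nth_rewrite 1 [ha', hb']
    rw [hilbertSymbol_mul_sq_right _ _ hd, hilbertSymbol_comm, hilbertSymbol_mul_sq_right _ _ hc,
      hilbertSymbol_unit_uniformizer hp hub hua, leg_unitPart hb, one_mul, one_mul]
  · rw [units_zpow_of_odd oa, units_zpow_of_odd ob, units_zpow_of_odd (oa.mul ob)]
    nth_rewrite 1 [ha', hb']
    -- With both valuations odd, `(a, b) = (a, -ab)` trades `b` for an element of even valuation.
    have h2 : -((p : ℚ_[p]) * unitPart a * (p * unitPart b)) =
        -1 * unitPart a * unitPart b * (p : ℚ_[p]) ^ 2 := by ring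
    rw [hilbertSymbol_mul_sq_right _ _ hd, hilbertSymbol_comm, hilbertSymbol_mul_sq_right _ _ hc,
      hilbertSymbol_comm, hilbertSymbol_eq_neg_mul (mul_ne_zero cast_p_ne_zero hua0)
        (mul_ne_zero cast_p_ne_zero hub0), h2, hilbertSymbol_mul_sq_right _ _ cast_p_ne_zero,
      hilbertSymbol_comm, hilbertSymbol_unit_uniformizer hp (by simp [hua, hub]) hua,
      leg_mul hp (mul_ne_zero neg_one_ne_zero_padic hua0) hub0, leg_mul hp neg_one_ne_zero_padic hua0,
      leg_unitPart ha, leg_unitPart hb]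

lemma hilbertSymbol_mul_right (hp : p ≠ 2) {a b c : ℚ_[p]} (ha : a ≠ 0) (hb : b ≠ 0)
    (hc : c ≠ 0) : hilbertSymbol a (b * c) = hilbertSymbol a b * hilbertSymbol a c := by
  rw [hilbertSymbol_eq hp ha (mul_ne_zero hb hc), hilbertSymbol_eq hp ha hb,
    hilbertSymbol_eq hp ha hc, Padic.valuation_mul hb hc, leg_mul hp hb hc, mul_zpow, mul_add,
    zpow_add, zpow_add]
  simp only [mul_comm, mul_left_comm, mul_assoc]

lemma hilbertSymbol_inv_right (a : ℚ_[p]) {b : ℚ_[p]} (hb : b ≠ 0) :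
    hilbertSymbol a b⁻¹ = hilbertSymbol a b := by
  have h := hilbertSymbol_mul_sq_right a b⁻¹ hb
  rw [← h]
  congr 1
  field_simp

lemma hilbertSymbol_neg_self (a : ℚ_[p]) : hilbertSymbol a (-a) = 1 := by
  unfold hilbertSymbol
  exact if_pos ⟨1, 1, 0, by simp, by ring⟩

lemma hilbertSymbol_one_right (a : ℚ_[p]) : hilbertSymbol a 1 = 1 :=
  hilbertSymbol_eq_one_of_sq_right a IsSquare.one

/-- For a unit `u`, the symbol `(u, a)` is `(u/p)^{ord a}`. -/
lemma hilbertSymbol_unit_left (hp : p ≠ 2) {u a : ℚ_[p]} (hu : ‖u‖ = 1) (ha : a ≠ 0) :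
    hilbertSymbol u a = leg u ^ a.valuation := by
  have hu0 : u ≠ 0 := norm_ne_zero_iff.mp (by rw [hu]; exact one_ne_zero)
  rw [hilbertSymbol_eq hp hu0 ha, valuation_eq_zero_of_norm_eq_one hu]
  simp

end

section

/-! ### Integration over `ℚ_p` -/

instance : (padicHaar p).IsAddHaarMeasure := by unfold padicHaar; infer_instance

instance : SigmaFinite (padicHaar p) := by unfold padicHaar; infer_instance

variable (p) in
/-- The ball of radius `p^n`. -/
abbrev ball (n : ℤ) : Set ℚ_[p] := Metric.closedBall 0 ((p : ℝ) ^ n)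

lemma mem_ball {x : ℚ_[p]} {n : ℤ} : x ∈ ball p n ↔ ‖x‖ ≤ (p : ℝ) ^ n := by simp

lemma ball_zero : ball p 0 = Metric.closedBall (0 : ℚ_[p]) 1 := by simp [ball]

lemma isOpen_ball (n : ℤ) : IsOpen (ball p n) :=
  IsUltrametricDist.isOpen_closedBall _ (zpow_ne_zero _ cast_p_pos.ne')

lemma isCompact_ball (n : ℤ) : IsCompact (ball p n) := isCompact_closedBall _ _

lemma measurableSet_ball (n : ℤ) : MeasurableSet (ball p n) := (isOpen_ball n).measurableSet

lemma measure_ball_lt_top (n : ℤ) : padicHaar p (ball p n) < ⊤ := (isCompact_ball n).measure_lt_top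

lemma padicHaar_ball_zero : padicHaar p (ball p 0) = 1 := by
  rw [ball_zero]
  exact Measure.addHaarMeasure_self

lemma existsUnique_digit {x : ℚ_[p]} (hx : ‖x‖ ≤ 1) (m : ℕ) :
    ∃! i : ℕ, i < p ^ m ∧ ‖x - i‖ ≤ (p : ℝ) ^ (-m : ℤ) := by
  obtain ⟨x, rfl⟩ := exists_padicInt_coe hx
  refine ⟨x.appr m, ⟨PadicInt.appr_lt x m, ?_⟩, ?_⟩
  · have h := PadicInt.appr_spec m x
    rw [← PadicInt.norm_le_pow_iff_mem_span_pow, PadicInt.norm_def] at h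
    simpa using h
  · rintro j ⟨hj, hj'⟩
    have h := PadicInt.appr_spec m x
    have hj2 : x - (j : ℤ_[p]) ∈ Ideal.span {(p : ℤ_[p]) ^ m} := by
      rw [← PadicInt.norm_le_pow_iff_mem_span_pow, PadicInt.norm_def]
      simpa using hj'
    have h3 := PadicInt.zmod_congr_of_sub_mem_span m x j (x.appr m) hj2 h
    rw [ZMod.natCast_eq_natCast_iff'] at h3
    rwa [Nat.mod_eq_of_lt hj, Nat.mod_eq_of_lt (PadicInt.appr_lt x m)] at h3

lemma norm_natCast_le_one (i : ℕ) : ‖(i : ℚ_[p])‖ ≤ 1 := by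
  simpa using Padic.norm_int_le_one (p := p) i

lemma norm_add_le_of_le {x y : ℚ_[p]} {r : ℝ} (hx : ‖x‖ ≤ r) (hy : ‖y‖ ≤ r) : ‖x + y‖ ≤ r :=
  (IsUltrametricDist.norm_add_le_max x y).trans (max_le hx hy)

lemma norm_sub_le_of_le {x y : ℚ_[p]} {r : ℝ} (hx : ‖x‖ ≤ r) (hy : ‖y‖ ≤ r) : ‖x - y‖ ≤ r := by
  rw [sub_eq_add_neg]
  exact norm_add_le_of_le hx (by rwa [norm_neg])

lemma zpow_neg_natCast_le_one (m : ℕ) : (p : ℝ) ^ (-m : ℤ) ≤ 1 :=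
  zpow_le_one_of_nonpos₀ one_lt_cast_p.le (by simp)

lemma ball_zero_eq_iUnion (m : ℕ) :
    ball p 0 = ⋃ i ∈ Finset.range (p ^ m), Metric.closedBall (i : ℚ_[p]) ((p : ℝ) ^ (-m : ℤ)) := by
  ext x
  simp only [Set.mem_iUnion, Finset.mem_range, Metric.mem_closedBall, dist_eq_norm, exists_prop]
  rw [sub_zero, zpow_zero]
  constructor
  · intro hx
    obtain ⟨i, hi, -⟩ := existsUnique_digit hx m
    exact ⟨i, hi⟩
  · rintro ⟨i, -, hi⟩
    have h := norm_add_le_of_le (hi.trans (zpow_neg_natCast_le_one m)) (norm_natCast_le_one (p := p) i)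
    simpa using h

lemma pairwiseDisjoint_digit (m : ℕ) :
    ((Finset.range (p ^ m) : Finset ℕ) : Set ℕ).PairwiseDisjoint
      fun i : ℕ => Metric.closedBall (i : ℚ_[p]) ((p : ℝ) ^ (-m : ℤ)) := by
  intro i hi j hj hij
  rw [Function.onFun, Set.disjoint_left]
  intro x hx hx'
  rw [Metric.mem_closedBall, dist_eq_norm] at hx hx'
  have hx1 : ‖x‖ ≤ 1 := by
    have h := norm_add_le_of_le (hx.trans (zpow_neg_natCast_le_one m)) (norm_natCast_le_one (p := p) i)
    simpa using h
  exact hij ((existsUnique_digit hx1 m).unique ⟨by simpa using hi, hx⟩ ⟨by simpa using hj, hx'⟩)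

lemma closedBall_eq_preimage (a : ℚ_[p]) (r : ℝ) :
    Metric.closedBall a r = (fun x => x + -a) ⁻¹' Metric.closedBall 0 r := by
  ext x
  simp [dist_eq_norm, sub_eq_add_neg]

/-- `ℤ_p` is tiled by `p ^ m` translates of this ball. -/
lemma padicHaar_ball_neg (m : ℕ) : padicHaar p (ball p (-m)) = ENNReal.ofReal ((p : ℝ) ^ (-m : ℤ)) := by
  have h1 : ∀ i : ℕ, padicHaar p (Metric.closedBall (i : ℚ_[p]) ((p : ℝ) ^ (-m : ℤ))) =
      padicHaar p (ball p (-m)) := by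
    intro i
    rw [closedBall_eq_preimage, measure_preimage_add_right]
  have h := padicHaar_ball_zero (p := p)
  rw [ball_zero_eq_iUnion m, measure_biUnion_finset (pairwiseDisjoint_digit m)
    (fun i _ => Metric.isClosed_closedBall.measurableSet)] at h
  simp only [h1, Finset.sum_const, Finset.card_range, nsmul_eq_mul] at h
  rw [zpow_neg, ENNReal.ofReal_inv_of_pos (zpow_pos cast_p_pos _)]
  refine ENNReal.eq_inv_of_mul_eq_one_left ?_
  rw [mul_comm, ← h]
  congr 1
  rw [zpow_natCast, ← Nat.cast_pow, ENNReal.ofReal_natCast]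

/-- Multiplication by `c ≠ 0`, as a measurable equivalence. -/
def mulEquiv {c : ℚ_[p]} (hc : c ≠ 0) : ℚ_[p] ≃ᵐ ℚ_[p] := (Homeomorph.mulLeft₀ c hc).toMeasurableEquiv

lemma mulEquiv_apply {c : ℚ_[p]} (hc : c ≠ 0) (x : ℚ_[p]) : mulEquiv hc x = c * x := rfl

lemma map_mulEquiv_eq_smul {c : ℚ_[p]} (hc : c ≠ 0) :
    (padicHaar p).map (mulEquiv hc) = padicHaar p {x | ‖c * x‖ ≤ 1} • padicHaar p := by
  have : SigmaFinite ((padicHaar p).map (mulEquiv hc)) := (mulEquiv hc).sigmaFinite_map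
  have : ((padicHaar p).map (mulEquiv hc)).IsAddLeftInvariant :=
    isAddLeftInvariant_map (AddHom.mk (mulEquiv hc) (fun x y => mul_add c x y))
      (mulEquiv hc).measurable (mulEquiv hc).surjective
  have h := Measure.addHaarMeasure_unique ((padicHaar p).map (mulEquiv hc)) (padicIntegral p)
  rw [MeasurableEquiv.map_apply] at h
  have h2 : (mulEquiv hc) ⁻¹' (padicIntegral p : Set ℚ_[p]) = {x | ‖c * x‖ ≤ 1} := by
    ext x
    change c * x ∈ Metric.closedBall 0 1 ↔ _
    simp
  rw [h2] at h
  exact h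

lemma exists_norm_eq_zpow {c : ℚ_[p]} (hc : c ≠ 0) : ∃ n : ℤ, ‖c‖ = (p : ℝ) ^ n :=
  ⟨_, Padic.norm_eq_zpow_neg_valuation hc⟩

/-- The scaling factor is the measure of the preimage of `ℤ_p`. It is computed for `‖c‖ ≥ 1`, where
the preimage is a ball contained in `ℤ_p`; the remaining `c` follow by inverting the statement for
`c⁻¹`. -/
lemma map_mulEquiv {c : ℚ_[p]} (hc : c ≠ 0) :
    (padicHaar p).map (mulEquiv hc) = ENNReal.ofReal ‖c‖⁻¹ • padicHaar p := by
  have key : ∀ {c : ℚ_[p]} (hc : c ≠ 0), 1 ≤ ‖c‖ →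
      (padicHaar p).map (mulEquiv hc) = ENNReal.ofReal ‖c‖⁻¹ • padicHaar p := by
    intro c hc h1
    obtain ⟨n, hn⟩ := exists_norm_eq_zpow hc
    have hn0 : 0 ≤ n := by
      by_contra hneg
      push Not at hneg
      have := zpow_lt_one_of_neg₀ one_lt_cast_p hneg (a := (p : ℝ))
      linarith
    obtain ⟨m, rfl⟩ := Int.eq_ofNat_of_zero_le hn0
    rw [map_mulEquiv_eq_smul, hn, ← zpow_neg, ← padicHaar_ball_neg m]
    congr 2
    ext x
    rw [Set.mem_ofPred_eq, mem_ball, norm_mul, hn, zpow_neg, mul_comm,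
      ← le_div_iff₀ (zpow_pos cast_p_pos _), one_div]
  rcases le_total 1 ‖c‖ with h | h
  · exact key hc h
  · have h2 := key (inv_ne_zero hc) (by rw [norm_inv]; exact (one_le_inv₀ (norm_pos_iff.mpr hc)).mpr h)
    have h3 : ((padicHaar p).map (mulEquiv (inv_ne_zero hc))).map (mulEquiv hc) = padicHaar p := by
      rw [Measure.map_map (mulEquiv hc).measurable (mulEquiv (inv_ne_zero hc)).measurable]
      have : (mulEquiv hc) ∘ (mulEquiv (inv_ne_zero hc)) = id := by
        ext x
        simp [mulEquiv_apply, hc]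
      rw [this, Measure.map_id]
    rw [h2, Measure.map_smul, norm_inv, inv_inv] at h3
    rw [← h3, smul_smul, ← ENNReal.ofReal_mul (by positivity),
      inv_mul_cancel₀ (norm_ne_zero_iff.mpr hc)]
    rw [h3]
    simp

lemma integral_comp_mul {c : ℚ_[p]} (hc : c ≠ 0) (f : ℚ_[p] → ℂ) :
    ∫ x, f (c * x) ∂padicHaar p = (‖c‖⁻¹ : ℝ) • ∫ x, f x ∂padicHaar p := by
  have h := integral_map_equiv (μ := padicHaar p) (mulEquiv hc) f
  rw [map_mulEquiv, integral_smul_measure, ENNReal.toReal_ofReal (by positivity)] at h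
  exact h.symm

lemma setIntegral_comp_mul {c : ℚ_[p]} (hc : c ≠ 0) (f : ℚ_[p] → ℂ) (s : Set ℚ_[p]) :
    ∫ x in (fun x => c * x) ⁻¹' s, f (c * x) ∂padicHaar p =
      (‖c‖⁻¹ : ℝ) • ∫ x in s, f x ∂padicHaar p := by
  have h := MeasurableEmbedding.setIntegral_map (μ := padicHaar p) (mulEquiv hc).measurableEmbedding f s
  rw [map_mulEquiv, Measure.restrict_smul, integral_smul_measure,
    ENNReal.toReal_ofReal (by positivity)] at h
  exact h.symm

lemma preimage_mul_ball {c : ℚ_[p]} {k : ℤ} (hc : ‖c‖ = (p : ℝ) ^ k) (n : ℤ) :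
    (fun x => c * x) ⁻¹' ball p n = ball p (n - k) := by
  ext x
  rw [Set.mem_preimage, mem_ball, mem_ball, norm_mul, hc, zpow_sub₀ cast_p_pos.ne', le_div_iff₀
    (zpow_pos cast_p_pos _), mul_comm]

lemma setIntegral_ball_comp_mul {c : ℚ_[p]} {k : ℤ} (hc : ‖c‖ = (p : ℝ) ^ k) (n : ℤ)
    (f : ℚ_[p] → ℂ) :
    ∫ x in ball p (n - k), f (c * x) ∂padicHaar p =
      (((p : ℝ) ^ (-k) : ℝ) : ℂ) * ∫ x in ball p n, f x ∂padicHaar p := by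
  have hc0 : c ≠ 0 := by
    rw [← norm_ne_zero_iff, hc]
    exact zpow_ne_zero _ cast_p_pos.ne'
  rw [← preimage_mul_ball hc, setIntegral_comp_mul hc0, hc, zpow_neg]
  rfl

lemma measureReal_ball (n : ℤ) : (padicHaar p).real (ball p n) = (p : ℝ) ^ n := by
  have hc : ‖(p : ℚ_[p]) ^ n‖ = (p : ℝ) ^ (-n) := Padic.norm_p_zpow n
  have h := setIntegral_ball_comp_mul hc 0 (fun _ => 1)
  rw [setIntegral_const, setIntegral_const, measureReal_def, measureReal_def, padicHaar_ball_zero] at h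
  simp only [zero_sub, neg_neg, ENNReal.toReal_one, one_smul, mul_one, Complex.real_smul] at h
  exact_mod_cast h

lemma setIntegral_ball_comp_add (n : ℤ) {y : ℚ_[p]} (hy : y ∈ ball p n) (f : ℚ_[p] → ℂ) :
    ∫ x in ball p n, f (x + y) ∂padicHaar p = ∫ x in ball p n, f x ∂padicHaar p := by
  rw [← integral_indicator (measurableSet_ball n), ← integral_indicator (measurableSet_ball n),
    ← integral_add_right_eq_self ((ball p n).indicator f) y]
  congr 1
  ext x
  rw [mem_ball] at hy
  have : x ∈ ball p n ↔ x + y ∈ ball p n := by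
    rw [mem_ball, mem_ball]
    constructor
    · intro h
      exact norm_add_le_of_le h hy
    · intro h
      have := norm_sub_le_of_le h hy
      simpa using this
  by_cases hx : x ∈ ball p n
  · rw [Set.indicator_of_mem hx, Set.indicator_of_mem (this.mp hx)]
  · rw [Set.indicator_of_notMem hx, Set.indicator_of_notMem (fun h => hx (this.mpr h))]

/-- The shell `‖x‖ = p^n`. -/
def shell (n : ℤ) : Set ℚ_[p] := {x | ‖x‖ = (p : ℝ) ^ n}

lemma ball_eq_union_shell (n : ℤ) : ball p n = ball p (n - 1) ∪ shell n := by
  ext x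
  rw [Set.mem_union, mem_ball, mem_ball, shell, Set.mem_ofPred_eq,
    Padic.norm_le_pow_iff_norm_lt_pow_add_one x (n - 1), sub_add_cancel]
  exact le_iff_lt_or_eq

lemma disjoint_ball_shell (n : ℤ) : Disjoint (ball p (n - 1)) (shell n) := by
  rw [Set.disjoint_left]
  intro x hx hx'
  rw [mem_ball, Padic.norm_le_pow_iff_norm_lt_pow_add_one, sub_add_cancel] at hx
  exact hx.ne hx'

lemma measurableSet_shell (n : ℤ) : MeasurableSet (shell n : Set ℚ_[p]) :=
  measurableSet_eq_fun measurable_norm measurable_const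

lemma shell_subset_ball (n : ℤ) : (shell n : Set ℚ_[p]) ⊆ ball p n :=
  fun _ hx => mem_ball.mpr (le_of_eq hx)

lemma setIntegral_ball_eq_add_shell {E : Type*} [NormedAddCommGroup E] [NormedSpace ℝ E] (n : ℤ)
    {f : ℚ_[p] → E}
    (hf : IntegrableOn f (ball p n) (padicHaar p)) :
    ∫ x in ball p n, f x ∂padicHaar p =
      ∫ x in ball p (n - 1), f x ∂padicHaar p + ∫ x in shell n, f x ∂padicHaar p := by
  have h := ball_eq_union_shell (p := p) n
  rw [h] at hf ⊢
  exact setIntegral_union (disjoint_ball_shell n) (measurableSet_shell n)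
    hf.left_of_union hf.right_of_union

lemma measureReal_shell (n : ℤ) :
    (padicHaar p).real (shell n) = (p : ℝ) ^ n * (1 - (p : ℝ)⁻¹) := by
  have h := setIntegral_ball_eq_add_shell n (f := fun _ : ℚ_[p] => (1 : ℂ))
    (integrableOn_const (measure_ball_lt_top n).ne)
  rw [setIntegral_const, setIntegral_const, setIntegral_const, measureReal_ball, measureReal_ball] at h
  simp only [Complex.real_smul, mul_one] at h
  have h2 : (p : ℝ) ^ n = (p : ℝ) ^ (n - 1) + (padicHaar p).real (shell n) := by exact_mod_cast h
  have h3 : (p : ℝ) ^ (n - 1) = (p : ℝ) ^ n * (p : ℝ)⁻¹ := by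
    rw [zpow_sub_one₀ cast_p_pos.ne']
  linarith

/-- The integral over `ℤ_p` of a function that is periodic modulo `p ^ m`. -/
lemma setIntegral_ball_zero_eq_sum_pow (m : ℕ) {f : ℚ_[p] → ℂ}
    (hf : IntegrableOn f (ball p 0) (padicHaar p))
    (hinv : ∀ x ∈ ball p 0, ∀ y, ‖y‖ ≤ (p : ℝ) ^ (-m : ℤ) → f (x + y) = f x) :
    ∫ x in ball p 0, f x ∂padicHaar p = ((p : ℂ) ^ m)⁻¹ * ∑ i ∈ Finset.range (p ^ m), f i := by
  have hmem : ∀ i : ℕ, Metric.closedBall (i : ℚ_[p]) ((p : ℝ) ^ (-m : ℤ)) ⊆ ball p 0 := by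
    intro i x hx
    rw [Metric.mem_closedBall, dist_eq_norm] at hx
    have h := norm_add_le_of_le (hx.trans (zpow_neg_natCast_le_one m))
      (norm_natCast_le_one (p := p) i)
    simpa using h
  nth_rewrite 1 [ball_zero_eq_iUnion (p := p) m]
  rw [integral_biUnion_finset _ (fun i _ => Metric.isClosed_closedBall.measurableSet)
    (pairwiseDisjoint_digit m) (fun i _ => hf.mono_set (hmem i)), Finset.mul_sum]
  refine Finset.sum_congr rfl fun i _ => ?_
  have hc : ∫ x in Metric.closedBall (i : ℚ_[p]) ((p : ℝ) ^ (-m : ℤ)), f x ∂padicHaar p =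
      ∫ x in Metric.closedBall (i : ℚ_[p]) ((p : ℝ) ^ (-m : ℤ)), f i ∂padicHaar p := by
    refine setIntegral_congr_fun Metric.isClosed_closedBall.measurableSet fun x hx => ?_
    rw [Metric.mem_closedBall, dist_eq_norm] at hx
    have h := hinv i (by rw [mem_ball, zpow_zero]; exact norm_natCast_le_one i) (x - i) hx
    rwa [add_sub_cancel] at h
  have hm : (padicHaar p).real (Metric.closedBall (i : ℚ_[p]) ((p : ℝ) ^ (-m : ℤ))) =
      ((p : ℝ) ^ m)⁻¹ := by
    rw [closedBall_eq_preimage, measureReal_def, measure_preimage_add_right, ← measureReal_def]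
    have := measureReal_ball (p := p) (-m)
    rwa [zpow_neg, zpow_natCast] at this
  rw [hc, setIntegral_const, hm]
  simp

lemma setIntegral_ball_zero_eq_sum {f : ℚ_[p] → ℂ} (hf : IntegrableOn f (ball p 0) (padicHaar p))
    (hinv : ∀ x ∈ ball p 0, ∀ y, ‖y‖ < 1 → f (x + y) = f x) :
    ∫ x in ball p 0, f x ∂padicHaar p = (p : ℂ)⁻¹ * ∑ i ∈ Finset.range p, f i := by
  have h := setIntegral_ball_zero_eq_sum_pow 1 hf fun x hx y hy =>
    hinv x hx y (norm_lt_one_iff_le.mpr (by simpa using hy))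
  simpa using h

end

section

/-! ### Additive characters of conductor `ℤ_p` and the Weil index -/

/-- The kernel of the additive character is `ℤ_p`. -/
def IsUnramifiedChar (ψ : AddChar ℚ_[p] Circle) : Prop := ∀ x : ℚ_[p], ψ x = 1 ↔ ‖x‖ ≤ 1

lemma IsUnramifiedChar.inv {ψ : AddChar ℚ_[p] Circle} (hψ : IsUnramifiedChar ψ) :
    IsUnramifiedChar ψ⁻¹ := by
  intro x
  rw [AddChar.inv_apply, hψ, norm_neg]

lemma IsUnramifiedChar.mulShift {ψ : AddChar ℚ_[p] Circle} (hψ : IsUnramifiedChar ψ) {u : ℚ_[p]}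
    (hu : ‖u‖ = 1) : IsUnramifiedChar (ψ.mulShift u) := by
  intro x
  rw [AddChar.mulShift_apply, hψ, norm_mul, hu, one_mul]

section

variable {ψ : AddChar ℚ_[p] Circle} (hψ : IsUnramifiedChar ψ)

include hψ

lemma psi_eq_one {x : ℚ_[p]} (hx : ‖x‖ ≤ 1) : ψ x = 1 := (hψ x).mpr hx

lemma psi_add_of_norm_le (x : ℚ_[p]) {y : ℚ_[p]} (hy : ‖y‖ ≤ 1) : ψ (x + y) = ψ x := by
  rw [AddChar.map_add_eq_mul, psi_eq_one hψ hy, mul_one]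

lemma psi_congr {x y : ℚ_[p]} (h : ‖x - y‖ ≤ 1) : ψ x = ψ y := by
  rw [← psi_add_of_norm_le hψ y h, add_sub_cancel]

lemma continuous_psi : Continuous fun x => (ψ x : ℂ) := by
  refine continuous_iff_continuousAt.mpr fun x => ?_
  refine ContinuousAt.congr (f := fun _ => (ψ x : ℂ)) continuousAt_const ?_
  have hopen : IsOpen (Metric.closedBall x 1) :=
    IsUltrametricDist.isOpen_closedBall _ one_ne_zero
  filter_upwards [hopen.mem_nhds (Metric.mem_closedBall_self zero_le_one)] with y hy
  rw [Metric.mem_closedBall, dist_eq_norm] at hy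
  rw [psi_congr hψ hy]

lemma integrableOn_psi_comp {f : ℚ_[p] → ℚ_[p]} (hf : Continuous f) (n : ℤ) :
    IntegrableOn (fun x => (ψ (f x) : ℂ)) (ball p n) (padicHaar p) :=
  ((continuous_psi hψ).comp hf).continuousOn.integrableOn_compact (isCompact_ball n)

/-- If `a` is not integral, translation by `1` multiplies the integral by `ψ a ≠ 1`. -/
lemma integral_psi_mul (a : ℚ_[p]) :
    ∫ y in ball p 0, (ψ (a * y) : ℂ) ∂padicHaar p = Set.indicator (Metric.closedBall 0 1) 1 a := by
  by_cases ha : ‖a‖ ≤ 1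
  · rw [Set.indicator_of_mem (by simpa using ha)]
    have : ∫ y in ball p 0, (ψ (a * y) : ℂ) ∂padicHaar p =
        ∫ y in ball p 0, (1 : ℂ) ∂padicHaar p := by
      refine setIntegral_congr_fun (measurableSet_ball 0) fun y hy => ?_
      rw [mem_ball, zpow_zero] at hy
      rw [psi_eq_one hψ]
      · simp
      · rw [norm_mul]
        exact mul_le_one₀ ha (norm_nonneg _) hy
    rw [this, setIntegral_const, measureReal_ball]
    simp
  · rw [Set.indicator_of_notMem (by simpa using ha)]
    have h1 : (ψ a : ℂ) ≠ 1 := by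
      intro h
      exact ha ((hψ a).mp (Circle.ext h))
    have h := setIntegral_ball_comp_add (p := p) 0 (y := 1) (by simp) (fun y => (ψ (a * y) : ℂ))
    simp only [mul_add, mul_one, AddChar.map_add_eq_mul, Circle.coe_mul] at h
    rw [integral_mul_const] at h
    have h2 : (∫ y in ball p 0, (ψ (a * y) : ℂ) ∂padicHaar p) * ((ψ a : ℂ) - 1) = 0 := by
      linear_combination h
    exact (mul_eq_zero.mp h2).resolve_right (sub_ne_zero.mpr h1)

end

lemma psi_natCast_mul (ψ : AddChar ℚ_[p] Circle) (x : ℚ_[p]) (j : ℕ) : (ψ (j * x) : ℂ) = (ψ x : ℂ) ^ j := by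
  rw [← nsmul_eq_mul, AddChar.map_nsmul_eq_pow, Circle.coe_pow]

/-- The Gauss integral of `ψ(u x²)` over `ℤ_p`. -/
def gaussInt (ψ : AddChar ℚ_[p] Circle) (u : ℚ_[p]) : ℂ :=
  ∫ x in ball p 0, (ψ (u * x ^ 2) : ℂ) ∂padicHaar p

lemma shell_add_mem_iff {n : ℤ} {x y : ℚ_[p]} (hy : ‖y‖ < (p : ℝ) ^ n) :
    x ∈ (shell n : Set ℚ_[p]) ↔ x + y ∈ (shell n : Set ℚ_[p]) := by
  have key : ∀ x y : ℚ_[p], ‖y‖ < (p : ℝ) ^ n → ‖x‖ = (p : ℝ) ^ n → ‖x + y‖ = (p : ℝ) ^ n := by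
    intro x y hy hx
    rw [IsUltrametricDist.norm_add_eq_max_of_norm_ne_norm (by rw [hx]; exact hy.ne'), hx,
      max_eq_left hy.le]
  constructor
  · exact key x y hy
  · intro h
    have := key (x + y) (-y) (by rwa [norm_neg]) h
    rwa [add_neg_cancel_right] at this

lemma setIntegral_shell_comp_add {n : ℤ} {y : ℚ_[p]} (hy : ‖y‖ < (p : ℝ) ^ n) (f : ℚ_[p] → ℂ) :
    ∫ x in shell n, f (x + y) ∂padicHaar p = ∫ x in shell n, f x ∂padicHaar p := by
  rw [← integral_indicator (measurableSet_shell n), ← integral_indicator (measurableSet_shell n),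
    ← integral_add_right_eq_self ((shell n).indicator f) y]
  congr 1
  ext x
  by_cases hx : x ∈ (shell n : Set ℚ_[p])
  · rw [Set.indicator_of_mem hx, Set.indicator_of_mem ((shell_add_mem_iff hy).mp hx)]
  · rw [Set.indicator_of_notMem hx,
      Set.indicator_of_notMem (fun h => hx ((shell_add_mem_iff hy).mpr h))]

section

variable {ψ : AddChar ℚ_[p] Circle} (hψ : IsUnramifiedChar ψ)

include hψ

lemma gaussInt_of_norm_le_one {u : ℚ_[p]} (hu : ‖u‖ ≤ 1) : gaussInt ψ u = 1 := by
  have : gaussInt ψ u = ∫ y in ball p 0, (1 : ℂ) ∂padicHaar p := by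
    refine setIntegral_congr_fun (measurableSet_ball 0) fun y hy => ?_
    rw [mem_ball, zpow_zero] at hy
    rw [psi_eq_one hψ]
    · simp
    · rw [norm_mul, norm_pow]
      exact mul_le_one₀ hu (by positivity) (pow_le_one₀ (norm_nonneg _) hy)
  rw [this, setIntegral_const, measureReal_ball]
  simp

/-- Non-stationary phase: translating `x` by `j z` multiplies the integrand by the `j`-th power of
`ψ (2 u x z)`, a nontrivial `p`-th root of unity for every unit `x`, and the sum over `j < p`
vanishes. -/
lemma setIntegral_shell_psi_sq (hp : p ≠ 2) {u : ℚ_[p]} {m : ℕ}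
    (hu : ‖u‖ = (p : ℝ) ^ ((m : ℤ) + 2)) :
    ∫ x in shell 0, (ψ (u * x ^ 2) : ℂ) ∂padicHaar p = 0 := by
  -- This size makes `u z²` integral, so that the quadratic term is invisible, while `2 u x z` has
  -- norm exactly `p`.
  obtain ⟨z, hzn⟩ : ∃ z : ℚ_[p], ‖z‖ = (p : ℝ) ^ (-((m : ℤ) + 1)) :=
    ⟨(p : ℚ_[p]) ^ (m + 1), by rw [Padic.norm_p_pow]; push_cast; rfl⟩
  have hz1 : ‖z‖ < 1 := by
    rw [hzn]
    exact zpow_lt_one_of_neg₀ one_lt_cast_p (by omega)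
  have hshift : ∀ j : ℕ, ∫ x in shell 0, (ψ (u * (x + j * z) ^ 2) : ℂ) ∂padicHaar p =
      ∫ x in shell 0, (ψ (u * x ^ 2) : ℂ) ∂padicHaar p := by
    intro j
    refine setIntegral_shell_comp_add (y := (j : ℚ_[p]) * z) ?_ (fun x => (ψ (u * x ^ 2) : ℂ))
    rw [norm_mul, zpow_zero]
    exact mul_lt_one_of_nonneg_of_lt_one_right (norm_natCast_le_one j) (norm_nonneg _) hz1
  have hsum : ∑ j ∈ Finset.range p, ∫ x in shell 0, (ψ (u * (x + j * z) ^ 2) : ℂ) ∂padicHaar p =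
      0 := by
    rw [← integral_finsetSum]
    · refine setIntegral_eq_zero_of_forall_eq_zero fun x hx => ?_
      have hx1 : ‖x‖ = 1 := by simpa [shell] using hx
      have h1 : ∀ j ∈ Finset.range p, (ψ (u * (x + j * z) ^ 2) : ℂ) =
          (ψ (u * x ^ 2) : ℂ) * (ψ (2 * u * x * z) : ℂ) ^ j := by
        intro j _
        rw [← psi_natCast_mul, ← Circle.coe_mul, ← AddChar.map_add_eq_mul]
        congr 1
        refine psi_congr hψ ?_
        have : u * (x + j * z) ^ 2 - (u * x ^ 2 + j * (2 * u * x * z)) = u * z ^ 2 * (j : ℚ_[p]) ^ 2 := by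
          ring
        rw [this, norm_mul, norm_mul, norm_pow, norm_pow (j : ℚ_[p]), hu, hzn, ← zpow_natCast, ← zpow_mul,
          ← zpow_add₀ cast_p_pos.ne']
        refine mul_le_one₀ ?_ (by positivity) (pow_le_one₀ (norm_nonneg _) (norm_natCast_le_one j))
        exact zpow_le_one_of_nonpos₀ one_lt_cast_p.le (by push_cast; omega)
      have hn : ‖2 * u * x * z‖ = p := by
        rw [norm_mul, norm_mul, norm_mul, norm_two hp, hx1, hu, hzn, one_mul, mul_one,
          ← zpow_add₀ cast_p_pos.ne']
        ring_nf
        simp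
      have hne : (ψ (2 * u * x * z) : ℂ) ≠ 1 := by
        intro h
        have h2 := (hψ _).mp (Circle.ext h)
        rw [hn] at h2
        exact absurd h2 (not_le.mpr one_lt_cast_p)
      have hpow : (ψ (2 * u * x * z) : ℂ) ^ p = 1 := by
        rw [← psi_natCast_mul, psi_eq_one hψ]
        · simp
        · rw [norm_mul, hn]
          simp [cast_p_pos.ne']
      rw [Finset.sum_congr rfl h1, ← Finset.mul_sum]
      have hg := geom_sum_eq hne p
      rw [hpow, sub_self, zero_div] at hg
      rw [hg, mul_zero]
    · intro j _
      exact (integrableOn_psi_comp hψ (f := fun x => u * (x + j * z) ^ 2) (by fun_prop) 0).mono_set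
        (shell_subset_ball 0)
  rw [Finset.sum_congr rfl (fun j _ => hshift j), Finset.sum_const, Finset.card_range,
    nsmul_eq_mul] at hsum
  refine (mul_eq_zero.mp hsum).resolve_left ?_
  exact Nat.cast_ne_zero.mpr (Fact.out : p.Prime).ne_zero

/-- Only `pℤ_p` contributes, and rescaling it to `ℤ_p` costs the factor `p⁻¹`. -/
lemma gaussInt_of_sq_le (hp : p ≠ 2) {u : ℚ_[p]} {m : ℕ} (hu : ‖u‖ = (p : ℝ) ^ ((m : ℤ) + 2)) :
    gaussInt ψ u = (p : ℂ)⁻¹ * gaussInt ψ (u * (p : ℚ_[p]) ^ 2) := by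
  unfold gaussInt
  rw [setIntegral_ball_eq_add_shell 0 (integrableOn_psi_comp hψ (by fun_prop) 0),
    setIntegral_shell_psi_sq hψ hp hu, add_zero]
  have hc : ‖(p : ℚ_[p])‖ = (p : ℝ) ^ (-1 : ℤ) := by simp
  have h := setIntegral_ball_comp_mul hc (-1) (fun x => (ψ (u * x ^ 2) : ℂ))
  have hpc : (p : ℂ) ≠ 0 := Nat.cast_ne_zero.mpr (Fact.out : p.Prime).ne_zero
  norm_num at h
  norm_num
  have h3 : ∀ x : ℚ_[p], u * (p * x) ^ 2 = u * (p : ℚ_[p]) ^ 2 * x ^ 2 := fun x => by ring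
  simp only [h3] at h
  rw [h, ← mul_assoc, inv_mul_cancel₀ hpc, one_mul]

lemma psi_inv_p_pow : (ψ ((p : ℚ_[p])⁻¹) : ℂ) ^ p = 1 := by
  rw [← psi_natCast_mul, mul_inv_cancel₀ cast_p_ne_zero, psi_eq_one hψ norm_one.le]
  simp

/-- The integrand is periodic modulo `p`. Grouping residues by their squares, each `t` has `1 +
χ(t)` square roots; the constant part sums to zero and leaves the quadratic Gauss sum, from which
the twist by `v` extracts `χ(v)`. -/
lemma gaussInt_eq_gaussSum (hp : p ≠ 2) {v : ℤ_[p]} (hv : ‖v‖ = 1) :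
    gaussInt ψ (v * (p : ℚ_[p])⁻¹) = (p : ℂ)⁻¹ *
      (((quadraticChar (ZMod p) (PadicInt.toZMod v) : ℤ) : ℂ) *
        gaussSum ((quadraticChar (ZMod p)).ringHomComp (Int.castRingHom ℂ))
          (AddChar.zmodChar p (psi_inv_p_pow hψ))) := by
  set e := AddChar.zmodChar p (psi_inv_p_pow hψ) with he
  set χ := (quadraticChar (ZMod p)).ringHomComp (Int.castRingHom ℂ) with hχ
  set v' := PadicInt.toZMod v with hv'
  have hv0 : v' ≠ 0 := fun h => ((padicInt_norm_lt_one_iff _).mpr h).ne hv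
  have he_val : ∀ x : ℤ_[p], e (PadicInt.toZMod x) = (ψ (x * (p : ℚ_[p])⁻¹) : ℂ) := by
    intro x
    rw [he, AddChar.zmodChar_apply, ← psi_natCast_mul]
    congr 1
    refine psi_congr hψ ?_
    rw [← sub_mul, norm_mul]
    have h1 : ‖(((PadicInt.toZMod x).val : ℤ_[p]) - x)‖ < 1 := by
      rw [padicInt_norm_lt_one_iff, map_sub, map_natCast, ZMod.natCast_zmod_val, sub_self]
    rw [PadicInt.norm_def] at h1
    push_cast at h1
    rw [norm_lt_one_iff_le] at h1
    rw [norm_inv, Padic.norm_p, inv_inv]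
    calc _ ≤ (p : ℝ)⁻¹ * p := by gcongr
      _ = 1 := inv_mul_cancel₀ cast_p_pos.ne'
  have hint : gaussInt ψ (v * (p : ℚ_[p])⁻¹) = (p : ℂ)⁻¹ *
      ∑ i ∈ Finset.range p, (ψ (v * (p : ℚ_[p])⁻¹ * (i : ℚ_[p]) ^ 2) : ℂ) := by
    refine setIntegral_ball_zero_eq_sum (integrableOn_psi_comp hψ (by fun_prop) 0) ?_
    intro x hx y hy
    congr 1
    refine psi_congr hψ ?_
    have : v * (p : ℚ_[p])⁻¹ * (x + y) ^ 2 - v * (p : ℚ_[p])⁻¹ * x ^ 2 =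
      (v * (2 * x + y)) * (y * (p : ℚ_[p])⁻¹) := by ring
    rw [this, norm_mul, norm_mul]
    rw [mem_ball, zpow_zero] at hx
    rw [PadicInt.norm_def] at hv
    have h2 : ‖2 * x + y‖ ≤ 1 := norm_add_le_of_le (by rw [norm_mul, norm_two hp, one_mul]; exact hx) hy.le
    rw [norm_lt_one_iff_le] at hy
    rw [hv, one_mul]
    refine mul_le_one₀ h2 (norm_nonneg _) ?_
    rw [norm_mul, norm_inv, Padic.norm_p, inv_inv]
    calc _ ≤ (p : ℝ)⁻¹ * p := by gcongr
      _ = 1 := inv_mul_cancel₀ cast_p_pos.ne'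
  have hne : e ≠ 1 := by
    rw [AddChar.zmod_char_ne_one_iff]
    have := he_val 1
    rw [map_one] at this
    rw [this]
    intro h
    have h2 := (hψ _).mp (Circle.ext h)
    simp only [PadicInt.coe_one, one_mul, norm_inv, Padic.norm_p, inv_inv] at h2
    exact absurd h2 (not_le.mpr one_lt_cast_p)
  have hsum : ∑ i ∈ Finset.range p, (ψ (v * (p : ℚ_[p])⁻¹ * (i : ℚ_[p]) ^ 2) : ℂ) =
      ∑ i : ZMod p, e (v' * i ^ 2) := by
    have hsub : ∀ i : ℕ, (ψ (v * (p : ℚ_[p])⁻¹ * (i : ℚ_[p]) ^ 2) : ℂ) = e (v' * (i : ZMod p) ^ 2) := by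
      intro i
      have h1 := he_val (v * (i : ℤ_[p]) ^ 2)
      rw [map_mul, map_pow, map_natCast] at h1
      rw [h1]
      congr 2
      push_cast
      ring
    rw [Finset.sum_congr rfl (fun i _ => hsub i)]
    refine Finset.sum_bij (fun i _ => (i : ZMod p)) (fun _ _ => Finset.mem_univ _) ?_ ?_ ?_
    · intro a ha b hb hab
      rw [ZMod.natCast_eq_natCast_iff'] at hab
      rwa [Nat.mod_eq_of_lt (Finset.mem_range.mp ha), Nat.mod_eq_of_lt (Finset.mem_range.mp hb)] at hab
    · intro b _
      exact ⟨b.val, Finset.mem_range.mpr (ZMod.val_lt b), by simp⟩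
    · intros; rfl
  have hfib : ∑ i : ZMod p, e (v' * i ^ 2) = ∑ t : ZMod p, (χ t + 1) * e (v' * t) := by
    rw [← Finset.sum_fiberwise_of_maps_to (s := Finset.univ) (t := Finset.univ)
      (g := fun i : ZMod p => i ^ 2) (fun _ _ => Finset.mem_univ _)]
    refine Finset.sum_congr rfl fun t _ => ?_
    have h1 : ∀ i ∈ Finset.univ.filter (fun i : ZMod p => i ^ 2 = t), e (v' * i ^ 2) = e (v' * t) := by
      intro i hi
      rw [(Finset.mem_filter.mp hi).2]
    rw [Finset.sum_congr rfl h1, Finset.sum_const, nsmul_eq_mul]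
    congr 1
    have h2 := quadraticChar_card_sqrts (ringChar_zmod_ne_two hp) t
    have h3 : {x : ZMod p | x ^ 2 = t}.toFinset = Finset.univ.filter (fun i : ZMod p => i ^ 2 = t) := by
      ext; simp
    rw [h3] at h2
    have h4 : (((Finset.univ.filter (fun i : ZMod p => i ^ 2 = t)).card : ℤ) : ℂ) =
      ((quadraticChar (ZMod p) t + 1 : ℤ) : ℂ) := by rw [h2]
    push_cast at h4
    rw [h4]
    rfl
  have hshift : e.mulShift v' ≠ 1 := (AddChar.IsPrimitive.of_ne_one hne) hv0
  have hgs : ∑ t : ZMod p, (χ t + 1) * e (v' * t) = gaussSum χ (e.mulShift v') := by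
    have h0 : ∑ t : ZMod p, e.mulShift v' t = 0 := AddChar.sum_eq_zero_of_ne_one hshift
    simp only [add_mul, one_mul, Finset.sum_add_distrib]
    simp only [AddChar.mulShift_apply] at h0
    rw [h0, add_zero]
    rfl
  rw [hint, hsum, hfib, hgs]
  congr 1
  have h5 := gaussSum_mulShift χ e (Units.mk0 v' hv0)
  rw [Units.val_mk0] at h5
  have h6 : χ v' = ((quadraticChar (ZMod p) v' : ℤ) : ℂ) := rfl
  rw [← h6, ← h5, ← mul_assoc]
  have h7 : χ v' * χ v' = 1 := by
    rw [h6]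
    have := quadraticChar_sq_one hv0
    rw [← pow_two]
    exact_mod_cast this
  rw [h7, one_mul]

end

end

/-! ### Evaluation of the Weil index and its multiplicativity. -/

section

lemma leg_eq_quadraticChar (hp : p ≠ 2) {v : ℤ_[p]} (hv : ‖v‖ = 1) :
    ((leg (v : ℚ_[p]) : ℤˣ) : ℤ) = quadraticChar (ZMod p) (PadicInt.toZMod v) := by
  have hv0 : PadicInt.toZMod v ≠ 0 := fun h => ((padicInt_norm_lt_one_iff _).mpr h).ne hv
  have h1 := isSquare_iff_toZMod hp hv
  rw [← leg_eq_one_iff (by rwa [PadicInt.norm_def] at hv), ← quadraticChar_one_iff_isSquare hv0] at h1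
  rcases Int.units_eq_one_or (leg (v : ℚ_[p])) with h | h
  · rw [h1.mp h, h]; rfl
  · rcases quadraticChar_dichotomy hv0 with h' | h'
    · exact absurd (h1.mpr h') (by rw [h]; decide)
    · rw [h', h]; rfl

/-- The normalized quadratic Gauss sum. -/
def gaussSign (ψ : AddChar ℚ_[p] Circle) : ℂ := ((√(p : ℝ) : ℝ) : ℂ) * gaussInt ψ (p : ℚ_[p])⁻¹

open Classical in
/-- The explicit value of the Weil index of `x ↦ ψ(a x²)`. -/
def gam (ψ : AddChar ℚ_[p] Circle) (a : ℚ_[p]) : ℂ :=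
  if Even a.valuation then 1 else ((leg a : ℤ) : ℂ) * gaussSign ψ

omit [Fact p.Prime] in
lemma sqrt_p_sq : ((√(p : ℝ) : ℝ) : ℂ) * ((√(p : ℝ) : ℝ) : ℂ) = p := by
  rw [← Complex.ofReal_mul, Real.mul_self_sqrt (Nat.cast_nonneg p), Complex.ofReal_natCast]

lemma sqrt_p_ne_zero : ((√(p : ℝ) : ℝ) : ℂ) ≠ 0 := (sqrtP p).ne_zero

lemma cast_p_ne_zero_complex : (p : ℂ) ≠ 0 := Nat.cast_ne_zero.mpr (Fact.out : p.Prime).ne_zero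

lemma units_cast_mul_self (x : ℤˣ) : ((x : ℤ) : ℂ) * ((x : ℤ) : ℂ) = 1 := by
  rcases Int.units_eq_one_or x with h | h <;> simp [h]

lemma norm_units_cast (x : ℤˣ) : ‖((x : ℤ) : ℂ)‖ = 1 := by
  rcases Int.units_eq_one_or x with h | h <;> simp [h]

lemma conj_units_cast (x : ℤˣ) : conj ((x : ℤ) : ℂ) = ((x : ℤ) : ℂ) := by
  rcases Int.units_eq_one_or x with h | h <;> simp [h]

lemma zpow_two_mul_sqrt (m : ℕ) : √((p : ℝ) ^ ((m : ℤ) + 2)) = √((p : ℝ) ^ (m : ℤ)) * p := by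
  rw [zpow_add₀ cast_p_pos.ne', Real.sqrt_mul (zpow_nonneg cast_p_pos.le _)]
  congr 1
  rw [show ((p : ℝ) ^ (2 : ℤ)) = (p : ℝ) ^ 2 by norm_cast, Real.sqrt_sq cast_p_pos.le]

lemma gam_mul_sq (ψ : AddChar ℚ_[p] Circle) (hp : p ≠ 2) {a c : ℚ_[p]} (ha : a ≠ 0) (hc : c ≠ 0) :
    gam ψ (a * c ^ 2) = gam ψ a := by
  unfold gam
  have h1 : (a * c ^ 2).valuation = a.valuation + 2 * c.valuation := by
    rw [Padic.valuation_mul ha (pow_ne_zero 2 hc), Padic.valuation_pow]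
    push_cast
    ring
  have h2 : leg (a * c ^ 2) = leg a := by
    rw [pow_two, leg_mul hp ha (mul_ne_zero hc hc), leg_mul hp hc hc, leg_mul_self_left, mul_one]
  have h3 : Even (a * c ^ 2).valuation ↔ Even a.valuation := by
    rw [h1, Int.even_add]
    simp
  simp only [h2, h3]

lemma setIntegral_ball_psi_sq (ψ : AddChar ℚ_[p] Circle) (a : ℚ_[p]) (n : ℕ) :
    ∫ x in Metric.closedBall (0 : ℚ_[p]) ((p : ℝ) ^ n), (ψ.mulShift a (x ^ 2) : ℂ) ∂padicHaar p =
      (p : ℂ) ^ n * gaussInt ψ (a * (((p : ℚ_[p]) ^ n)⁻¹) ^ 2) := by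
  have hc : ‖((p : ℚ_[p]) ^ n)⁻¹‖ = (p : ℝ) ^ (n : ℤ) := by
    rw [norm_inv, Padic.norm_p_pow, zpow_neg, inv_inv]
  have h := setIntegral_ball_comp_mul hc n (fun x => (ψ (a * x ^ 2) : ℂ))
  rw [sub_self] at h
  unfold gaussInt
  have h3 : ∀ x : ℚ_[p], a * (((p : ℚ_[p]) ^ n)⁻¹ * x) ^ 2 = a * ((p : ℚ_[p]) ^ n)⁻¹ ^ 2 * x ^ 2 :=
    fun x => by ring
  simp only [h3] at h
  rw [h, ← mul_assoc]
  have : (p : ℂ) ^ n * (((p : ℝ) ^ (-(n : ℤ)) : ℝ) : ℂ) = 1 := by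
    rw [zpow_neg, zpow_natCast]
    push_cast
    exact mul_inv_cancel₀ (pow_ne_zero _ cast_p_ne_zero_complex)
  rw [this, one_mul]
  simp only [AddChar.mulShift_apply]
  rfl

section

variable {ψ : AddChar ℚ_[p] Circle} (hψ : IsUnramifiedChar ψ) (hp : p ≠ 2)

include hψ hp

lemma gaussInt_of_norm_eq_p {u : ℚ_[p]} (hu : ‖u‖ = p) :
    gaussInt ψ u = ((leg u : ℤ) : ℂ) * gaussInt ψ (p : ℚ_[p])⁻¹ := by
  have hu0 : u ≠ 0 := by rintro rfl; simp at hu; exact cast_p_pos.ne hu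
  have hv1 : ‖u * p‖ = 1 := by
    rw [norm_mul, hu, Padic.norm_p, mul_inv_cancel₀ cast_p_pos.ne']
  obtain ⟨v, hv⟩ := exists_padicInt_coe hv1.le
  have hvn : ‖v‖ = 1 := by rw [PadicInt.norm_def, hv, hv1]
  have h1 := gaussInt_eq_gaussSum hψ hp hvn
  have h2 := gaussInt_eq_gaussSum hψ hp (v := 1) norm_one
  rw [hv, mul_assoc, mul_inv_cancel₀ cast_p_ne_zero, mul_one] at h1
  rw [map_one, map_one, PadicInt.coe_one, one_mul] at h2
  have h3 : leg u = leg (v : ℚ_[p]) := by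
    rw [hv, leg_mul hp hu0 cast_p_ne_zero, leg_p, mul_one]
  rw [h1, h2, h3, leg_eq_quadraticChar hp hvn]
  push_cast
  ring

/-- The square of the quadratic Gauss sum is `χ(-1) p`; the factor `√p` in `gaussSign` together with
the `p⁻¹` of the integral removes `p`. -/
lemma gaussSign_sq : gaussSign ψ * gaussSign ψ = ((leg (-1 : ℚ_[p]) : ℤ) : ℂ) := by
  have h2 := gaussInt_eq_gaussSum hψ hp (v := 1) norm_one
  rw [map_one, map_one, PadicInt.coe_one, one_mul] at h2
  set e := AddChar.zmodChar p (psi_inv_p_pow hψ) with he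
  have hne : e ≠ 1 := by
    rw [AddChar.zmod_char_ne_one_iff, he]
    have := AddChar.zmodChar_apply' (psi_inv_p_pow hψ) 1
    rw [Nat.cast_one, pow_one] at this
    rw [this]
    intro h
    have h2 := (hψ _).mp (Circle.ext h)
    simp only [norm_inv, Padic.norm_p, inv_inv] at h2
    exact absurd h2 (not_le.mpr one_lt_cast_p)
  have hq1 : (quadraticChar (ZMod p)).ringHomComp (Int.castRingHom ℂ) ≠ 1 := by
    rw [MulChar.ringHomComp_ne_one_iff (RingHom.injective_int _)]
    exact quadraticChar_ne_one (ringChar_zmod_ne_two hp)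
  have hg := gaussSum_sq hq1 ((quadraticChar_isQuadratic (ZMod p)).comp _)
    (AddChar.IsPrimitive.of_ne_one hne)
  have hl := leg_eq_quadraticChar hp (v := -1) (by simp)
  have hm : (((-1 : ℤ_[p]) : ℤ_[p]) : ℚ_[p]) = -1 := by simp
  rw [hm, map_neg, map_one] at hl
  rw [hl]
  have hv : ((quadraticChar (ZMod p)).ringHomComp (Int.castRingHom ℂ)) (-1) =
    ((quadraticChar (ZMod p) (-1) : ℤ) : ℂ) := rfl
  rw [hv, ZMod.card] at hg
  unfold gaussSign
  rw [h2]
  have hp0 := cast_p_ne_zero_complex (p := p)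
  push_cast
  rw [one_mul]
  field_simp
  rw [pow_two, sqrt_p_sq, hg]
  ring

lemma norm_gaussSign : ‖gaussSign ψ‖ = 1 := by
  have h := congrArg norm (gaussSign_sq hψ hp)
  rw [norm_mul, norm_units_cast] at h
  nlinarith [norm_nonneg (gaussSign ψ)]

lemma norm_gam (a : ℚ_[p]) : ‖gam ψ a‖ = 1 := by
  unfold gam
  split_ifs
  · simp
  · rw [norm_mul, norm_units_cast, norm_gaussSign hψ hp, one_mul]

/-- The induction goes in steps of two because `gaussInt_of_sq_le` changes `u` by `p²`. Units and
norm `p` are the base cases, the latter being the Gauss sum. -/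
lemma gaussInt_eq_of_zpow (m : ℕ) : ∀ {u : ℚ_[p]}, ‖u‖ = (p : ℝ) ^ (m : ℤ) →
    gaussInt ψ u = gam ψ u * (((√((p : ℝ) ^ (m : ℤ)))⁻¹ : ℝ) : ℂ) := by
  induction m using Nat.twoStepInduction with
  | zero =>
    intro u hu
    have hu1 : ‖u‖ = 1 := by simpa using hu
    rw [gaussInt_of_norm_le_one hψ hu1.le, gam, if_pos]
    · simp
    · rw [valuation_eq_zero_of_norm_eq_one hu1]
      exact Even.zero
  | one =>
    intro u hu
    have hu1 : ‖u‖ = p := by simpa using hu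
    have hval : u.valuation = -1 := by
      have h0 : u ≠ 0 := by rintro rfl; simp at hu1; exact cast_p_pos.ne hu1
      have := valuation_eq_of_norm_eq (a := u) (b := (p : ℚ_[p])⁻¹) h0 (by simp [hu1])
      rw [this, Padic.valuation_inv, Padic.valuation_p]
    rw [gaussInt_of_norm_eq_p hψ hp hu1, gam, if_neg, gaussSign]
    · have := sqrt_p_ne_zero (p := p)
      simp only [Nat.cast_one, zpow_one, Complex.ofReal_inv]
      field_simp
    · rw [hval]
      decide
  | more n ih _ =>
    intro u hu
    have hu0 : u ≠ 0 := by
      rw [← norm_ne_zero_iff, hu]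
      exact zpow_ne_zero _ cast_p_pos.ne'
    have hu' : ‖u * (p : ℚ_[p]) ^ 2‖ = (p : ℝ) ^ (n : ℤ) := by
      rw [norm_mul, hu, Padic.norm_p_pow, ← zpow_add₀ cast_p_pos.ne']
      congr 1
      push_cast
      ring
    push_cast at hu ⊢
    rw [gaussInt_of_sq_le hψ hp hu, ih hu', gam_mul_sq ψ hp hu0 cast_p_ne_zero, zpow_two_mul_sqrt]
    push_cast
    rw [mul_inv]
    ring

lemma gaussInt_eq {u : ℚ_[p]} (hu : 1 ≤ ‖u‖) :
    gaussInt ψ u = gam ψ u * (((√‖u‖)⁻¹ : ℝ) : ℂ) := by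
  have hu0 : u ≠ 0 := by rintro rfl; simp at hu; linarith
  obtain ⟨n, hn⟩ := exists_norm_eq_zpow hu0
  have hn0 : 0 ≤ n := by
    by_contra hneg
    push Not at hneg
    have := zpow_lt_one_of_neg₀ one_lt_cast_p hneg (a := (p : ℝ))
    linarith
  obtain ⟨m, rfl⟩ := Int.eq_ofNat_of_zero_le hn0
  rw [hn]
  exact gaussInt_eq_of_zpow hψ hp m hn

/-- The sequence in the definition is eventually constant: rescaling the ball multiplies `a` by
`p^(-2n)`, which keeps its square class, and once the norm is at least `1` the explicit Gauss
integral applies. -/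
lemma weilIndex_mulShift {a : ℚ_[p]} (ha : a ≠ 0) : weilIndex (ψ.mulShift a) = gam ψ a := by
  unfold weilIndex
  refine Filter.Tendsto.limUnder_eq (tendsto_const_nhds.congr' ?_)
  obtain ⟨k, hk⟩ := exists_norm_eq_zpow ha
  filter_upwards [eventually_ge_atTop k.natAbs] with n hn
  have hc0 : (((p : ℚ_[p]) ^ n)⁻¹) ≠ 0 := inv_ne_zero (pow_ne_zero _ cast_p_ne_zero)
  rw [setIntegral_ball_psi_sq]
  have hle : 1 ≤ ‖a * (((p : ℚ_[p]) ^ n)⁻¹) ^ 2‖ := by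
    rw [norm_mul, hk, norm_pow, norm_inv, Padic.norm_p_pow, zpow_neg, inv_inv, ← zpow_natCast,
      ← zpow_mul, ← zpow_add₀ cast_p_pos.ne']
    refine one_le_zpow₀ one_lt_cast_p.le ?_
    push_cast
    omega
  rw [gaussInt_eq hψ hp hle, gam_mul_sq ψ hp ha hc0]
  set r := (√‖a * (((p : ℚ_[p]) ^ n)⁻¹) ^ 2‖)⁻¹ with hr
  have hr0 : 0 < r := inv_pos.mpr (Real.sqrt_pos.mpr (by linarith))
  rw [norm_mul, norm_mul, norm_gam hψ hp, Complex.norm_real, Real.norm_of_nonneg hr0.le, norm_pow,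
    Complex.norm_natCast]
  have h1 : (p : ℂ) ^ n ≠ 0 := pow_ne_zero _ cast_p_ne_zero_complex
  have h2 : (r : ℂ) ≠ 0 := Complex.ofReal_ne_zero.mpr hr0.ne'
  push_cast
  field_simp

/-- Signs account for everything unless both valuations are odd; there `gaussSign_sq` supplies the
symbol of `-1` occurring in the tame symbol. -/
lemma gam_mul {a b : ℚ_[p]} (ha : a ≠ 0) (hb : b ≠ 0) :
    gam ψ a * gam ψ b = ((hilbertSymbol a b : ℤ) : ℂ) * gam ψ (a * b) := by
  have hs := gaussSign_sq hψ hp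
  unfold gam
  rw [hilbertSymbol_eq hp ha hb, leg_mul hp ha hb, Padic.valuation_mul ha hb]
  rcases Int.even_or_odd a.valuation with h1 | h1 <;> rcases Int.even_or_odd b.valuation with h2 | h2
  · rw [if_pos h1, if_pos h2, if_pos (h1.add h2), units_zpow_of_even h1, units_zpow_of_even h2,
      units_zpow_of_even (h1.mul_right _)]
    simp
  · rw [if_pos h1, if_neg (Int.not_even_iff_odd.mpr h2),
      if_neg (Int.not_even_iff_odd.mpr (h1.add_odd h2)), units_zpow_of_even h1,
      units_zpow_of_odd h2, units_zpow_of_even (h1.mul_right _)]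
    push_cast
    linear_combination -((leg b : ℤ) : ℂ) * gaussSign ψ * units_cast_mul_self (leg a)
  · rw [if_pos h2, if_neg (Int.not_even_iff_odd.mpr h1),
      if_neg (Int.not_even_iff_odd.mpr (h1.add_even h2)), units_zpow_of_even h2,
      units_zpow_of_odd h1, units_zpow_of_even (h2.mul_left _)]
    push_cast
    linear_combination -((leg a : ℤ) : ℂ) * gaussSign ψ * units_cast_mul_self (leg b)
  · rw [if_neg (Int.not_even_iff_odd.mpr h1), if_neg (Int.not_even_iff_odd.mpr h2),
      if_pos (h1.add_odd h2), units_zpow_of_odd h1, units_zpow_of_odd h2,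
      units_zpow_of_odd (h1.mul h2)]
    push_cast
    linear_combination ((leg a : ℤ) : ℂ) * ((leg b : ℤ) : ℂ) * hs

end

lemma gam_of_even (ψ : AddChar ℚ_[p] Circle) {a : ℚ_[p]} (ha : Even a.valuation) : gam ψ a = 1 :=
  if_pos ha

lemma gam_of_norm_eq_one (ψ : AddChar ℚ_[p] Circle) {u : ℚ_[p]} (hu : ‖u‖ = 1) : gam ψ u = 1 :=
  gam_of_even ψ (by rw [valuation_eq_zero_of_norm_eq_one hu]; exact Even.zero)

lemma gam_congr (ψ : AddChar ℚ_[p] Circle) (hp : p ≠ 2) {a a' : ℚ_[p]} (ha : a ≠ 0)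
    (h : ‖a' - a‖ < ‖a‖) : gam ψ a' = gam ψ a := by
  have hn : ‖a'‖ = ‖a‖ := by
    have h1 := IsUltrametricDist.norm_add_eq_max_of_norm_ne_norm h.ne
    rw [sub_add_cancel] at h1
    rw [h1, max_eq_right h.le]
  unfold gam
  rw [leg_of_norm_sub_lt hp ha h, valuation_eq_of_norm_eq ha hn.symm]

section

variable {ψ : AddChar ℚ_[p] Circle} (hψ : IsUnramifiedChar ψ) (hp : p ≠ 2)

include hψ hp

lemma gam_unit_mul {u a : ℚ_[p]} (hu : ‖u‖ = 1) (ha : a ≠ 0) :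
    gam ψ (u * a) = ((hilbertSymbol u a : ℤ) : ℂ) * gam ψ a := by
  have hu0 : u ≠ 0 := norm_ne_zero_iff.mp (by rw [hu]; exact one_ne_zero)
  have h := gam_mul hψ hp hu0 ha
  rw [gam_of_norm_eq_one ψ hu, one_mul] at h
  rw [h, ← mul_assoc, units_cast_mul_self, one_mul]

lemma weilIndex_eq_one : weilIndex ψ = 1 := by
  have h := weilIndex_mulShift hψ hp (one_ne_zero (α := ℚ_[p]))
  rwa [AddChar.mulShift_one, gam_of_norm_eq_one ψ norm_one] at h

/-- The index `γ(ψ)` is `1` for an unramified character, and the factor `(a, -1)` is exactly the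
effect of replacing `a` by `-a`. -/
lemma chiPsi_eq {a : ℚ_[p]} (ha : a ≠ 0) : chiPsi ψ a = gam ψ (-a) := by
  unfold chiPsi
  rw [weilIndex_mulShift hψ hp ha, weilIndex_eq_one hψ hp, div_one, ← neg_one_mul a,
    gam_unit_mul hψ hp (by simp) ha, hilbertSymbol_comm]

lemma gam_mulShift {u a : ℚ_[p]} (hu : ‖u‖ = 1) (ha : a ≠ 0) :
    gam (ψ.mulShift u) a = ((hilbertSymbol u a : ℤ) : ℂ) * gam ψ a := by
  have hu0 : u ≠ 0 := norm_ne_zero_iff.mp (by rw [hu]; exact one_ne_zero)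
  rw [← weilIndex_mulShift (hψ.mulShift hu) hp ha, AddChar.mulShift_mulShift,
    weilIndex_mulShift hψ hp (mul_ne_zero hu0 ha), gam_unit_mul hψ hp hu ha]

end

end

section

/-! ### Square classes over `ZMod 2` -/

/-- The sign character of `ℤ/2`. -/
def sgn (x : ZMod 2) : ℤˣ := if x = 0 then 1 else -1

lemma sgn_add (x y : ZMod 2) : sgn (x + y) = sgn x * sgn y := by
  revert x y; decide

lemma sgn_zero : sgn 0 = 1 := rfl

lemma sgn_eq_one_iff (x : ZMod 2) : sgn x = 1 ↔ x = 0 := by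
  revert x; decide

/-- The parity of the valuation. -/
def vz (a : ℚ_[p]) : ZMod 2 := (a.valuation : ℤ)

open Classical in
/-- The residue class of the unit part modulo squares. -/
def lz (a : ℚ_[p]) : ZMod 2 := if leg a = 1 then 0 else 1

variable (p) in
/-- The square class of `-1`. -/
def lzNeg : ZMod 2 := lz (-1 : ℚ_[p])

lemma leg_eq_sgn (a : ℚ_[p]) : leg a = sgn (lz a) := by
  unfold lz
  rcases Int.units_eq_one_or (leg a) with h | h
  · rw [if_pos h, h]; rfl
  · rw [if_neg (by rw [h]; decide), h]; rfl

lemma lz_eq_of_leg_eq {a b : ℚ_[p]} (h : leg a = leg b) : lz a = lz b := by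
  unfold lz
  rw [h]

lemma vz_mul {a b : ℚ_[p]} (ha : a ≠ 0) (hb : b ≠ 0) : vz (a * b) = vz a + vz b := by
  unfold vz
  rw [Padic.valuation_mul ha hb, Int.cast_add]

lemma sgn_injective : Function.Injective sgn := by decide

lemma lz_mul (hp : p ≠ 2) {a b : ℚ_[p]} (ha : a ≠ 0) (hb : b ≠ 0) : lz (a * b) = lz a + lz b := by
  apply sgn_injective
  rw [sgn_add, ← leg_eq_sgn, ← leg_eq_sgn, ← leg_eq_sgn, leg_mul hp ha hb]

lemma vz_of_norm_eq_one {u : ℚ_[p]} (hu : ‖u‖ = 1) : vz u = 0 := by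
  unfold vz
  rw [valuation_eq_zero_of_norm_eq_one hu, Int.cast_zero]

lemma vz_neg {a : ℚ_[p]} (ha : a ≠ 0) : vz (-a) = vz a := by
  rw [← neg_one_mul a, vz_mul neg_one_ne_zero_padic ha, vz_of_norm_eq_one (by simp), zero_add]

lemma lz_neg (hp : p ≠ 2) {a : ℚ_[p]} (ha : a ≠ 0) : lz (-a) = lzNeg p + lz a := by
  rw [← neg_one_mul a, lz_mul hp neg_one_ne_zero_padic ha]
  rfl

lemma norm_eq_of_norm_sub_lt {a a' : ℚ_[p]} (h : ‖a' - a‖ < ‖a‖) : ‖a'‖ = ‖a‖ := by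
  have h1 := IsUltrametricDist.norm_add_eq_max_of_norm_ne_norm h.ne
  rw [sub_add_cancel] at h1
  rw [h1, max_eq_right h.le]

lemma vz_congr {a a' : ℚ_[p]} (ha : a ≠ 0) (h : ‖a' - a‖ < ‖a‖) : vz a' = vz a := by
  unfold vz
  rw [valuation_eq_of_norm_eq ha (norm_eq_of_norm_sub_lt h).symm]

lemma vz_eq_of_norm_eq {a a' : ℚ_[p]} (ha : a ≠ 0) (h : ‖a‖ = ‖a'‖) : vz a = vz a' := by
  unfold vz
  rw [valuation_eq_of_norm_eq ha h]

lemma lz_congr (hp : p ≠ 2) {a a' : ℚ_[p]} (ha : a ≠ 0) (h : ‖a' - a‖ < ‖a‖) : lz a' = lz a :=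
  lz_eq_of_leg_eq (leg_of_norm_sub_lt hp ha h)

lemma lz_one : lz (1 : ℚ_[p]) = 0 := if_pos leg_one

lemma lz_inv (a : ℚ_[p]) : lz a⁻¹ = lz a := lz_eq_of_leg_eq (leg_inv a)

lemma vz_inv (a : ℚ_[p]) : vz a⁻¹ = vz a := by
  unfold vz
  rw [Padic.valuation_inv, Int.cast_neg]
  generalize ((a.valuation : ℤ) : ZMod 2) = x
  revert x; decide

lemma vz_eq_zero_iff (a : ℚ_[p]) : vz a = 0 ↔ Even a.valuation :=
  ZMod.intCast_eq_zero_iff_even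

lemma sgn_mul_intCast (x : ZMod 2) (n : ℤ) : sgn (x * (n : ZMod 2)) = sgn x ^ n := by
  rcases Int.even_or_odd n with h | h
  · rw [(ZMod.intCast_eq_zero_iff_even).mpr h, units_zpow_of_even h, mul_zero, sgn_zero]
  · rw [(ZMod.intCast_eq_one_iff_odd).mpr h, units_zpow_of_odd h, mul_one]

/-- Over `ZMod 2` the symbol is the sign of a polynomial in parities and residue classes, so
identities among products of symbols become finite checks for `decide`. -/
lemma hilbertSymbol_eq_sgn (hp : p ≠ 2) {a b : ℚ_[p]} (ha : a ≠ 0) (hb : b ≠ 0) :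
    hilbertSymbol a b = sgn (lzNeg p * vz a * vz b + lz a * vz b + lz b * vz a) := by
  rw [hilbertSymbol_eq hp ha hb, sgn_add, sgn_add]
  unfold vz
  rw [sgn_mul_intCast, sgn_mul_intCast, sgn_mul_intCast, sgn_mul_intCast, ← zpow_mul, lzNeg,
    leg_eq_sgn, leg_eq_sgn a, leg_eq_sgn b]

/-- The part of the Weil index that depends only on the parity of the valuation. -/
def gamPar (ψ : AddChar ℚ_[p] Circle) (x : ZMod 2) : ℂ := if x = 0 then 1 else gaussSign ψ

/-- Separates the sign from the part that may be a fourth root of unity. The latter depends on the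
parity alone; when two phases of equal parity are compared, only signs remain. -/
lemma gam_eq_sgn (ψ : AddChar ℚ_[p] Circle) (a : ℚ_[p]) :
    gam ψ a = ((sgn (lz a * vz a) : ℤ) : ℂ) * gamPar ψ (vz a) := by
  unfold gam gamPar
  by_cases h : Even a.valuation
  · rw [if_pos h, (vz_eq_zero_iff a).mpr h, if_pos rfl, mul_zero, sgn_zero]
    simp
  · have h1 : vz a = 1 := ZMod.intCast_eq_one_iff_odd.mpr (Int.not_even_iff_odd.mp h)
    rw [if_neg h, h1, if_neg one_ne_zero, mul_one, leg_eq_sgn]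

open Classical in
/-- The phase of the vector `ω(g) 1_{ℤ_p}`, in terms of the bottom row `(c, d)` of `g`. -/
def rowPhase (ψ : AddChar ℚ_[p] Circle) (c d : ℚ_[p]) : ℂ :=
  if ‖d‖ ≤ ‖c‖ then gam ψ (-c)
  else if c = 0 then gam ψ (-d) else ((hilbertSymbol (-c) d : ℤ) : ℂ) * gam ψ (-d)

lemma ne_zero_of_norm_eq_one {u : ℚ_[p]} (hu : ‖u‖ = 1) : u ≠ 0 :=
  norm_ne_zero_iff.mp (by rw [hu]; exact one_ne_zero)

lemma mem_slIntegral {k : SL2 p} : k ∈ slIntegral p ↔ ∀ i j, ‖k i j‖ ≤ 1 := Iff.rfl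

lemma splitSign_of_eq_zero {k : SL2 p} (h : k 1 0 = 0) : splitSign k = 1 := by
  unfold splitSign
  rw [if_neg]
  simp [h]

lemma splitSign_of_norm_eq_one {k : SL2 p} (h : ‖k 1 0‖ = 1) : splitSign k = 1 := by
  unfold splitSign
  rw [if_neg]
  rw [valuation_eq_zero_of_norm_eq_one h]
  simp

/-- The parity condition in `splitSign` can be dropped here, since `(c, d)` with `d` a unit is
trivial when `ord c` is even. -/
lemma splitSign_of_norm_lt_one (hp : p ≠ 2) {k : SL2 p} (h0 : k 1 0 ≠ 0) (hd : ‖k 1 1‖ = 1) :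
    splitSign k = hilbertSymbol (k 1 0) (k 1 1) := by
  unfold splitSign
  split_ifs with h
  · rfl
  · have h1 : ¬ Odd (k 1 0).valuation := fun ho => h ⟨mul_ne_zero h0 (ne_zero_of_norm_eq_one hd), ho⟩
    rw [hilbertSymbol_comm, hilbertSymbol_unit_left hp hd h0,
      units_zpow_of_even (Int.not_odd_iff_even.mp h1)]

lemma sl_det (g : SL2 p) : g 0 0 * g 1 1 - g 0 1 * g 1 0 = 1 := by
  have h := g.det_coe
  rwa [Matrix.det_fin_two] at h

lemma norm_diag_of_norm_lt_one {k : SL2 p} (hk : k ∈ slIntegral p) (hc : ‖k 1 0‖ < 1) :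
    ‖k 0 0‖ = 1 ∧ ‖k 1 1‖ = 1 := by
  have hdet := sl_det k
  rw [mem_slIntegral] at hk
  have h1 : ‖k 0 1 * k 1 0‖ < 1 := by
    rw [norm_mul]
    exact mul_lt_one_of_nonneg_of_lt_one_right (hk 0 1) (norm_nonneg _) hc
  have h2 : ‖k 0 0 * k 1 1‖ = 1 := by
    have : ‖k 0 0 * k 1 1 - 1‖ < ‖(1 : ℚ_[p])‖ := by
      rw [norm_one]
      have h3 : k 0 0 * k 1 1 - 1 = k 0 1 * k 1 0 := by linear_combination hdet
      rwa [h3]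
    rw [norm_eq_of_norm_sub_lt this, norm_one]
  rw [norm_mul] at h2
  have ha := hk 0 0
  have hd := hk 1 1
  constructor
  · nlinarith [norm_nonneg (k 0 0), norm_nonneg (k 1 1)]
  · nlinarith [norm_nonneg (k 0 0), norm_nonneg (k 1 1)]

lemma sl_mul_row (g k : SL2 p) :
    (g * k) 1 0 = g 1 0 * k 0 0 + g 1 1 * k 1 0 ∧ (g * k) 1 1 = g 1 0 * k 0 1 + g 1 1 * k 1 1 := by
  constructor <;> simp [Matrix.mul_apply, Fin.sum_univ_two]

lemma sl_row_ne_zero (g : SL2 p) : g 1 0 ≠ 0 ∨ g 1 1 ≠ 0 := by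
  by_contra h
  push Not at h
  have := sl_det g
  rw [h.1, h.2] at this
  simp at this

end

/-! ### Behaviour of the phase under right translation by `SL₂(ℤ_p)`. -/

section

lemma xCoord_of_ne_zero {g : SL2 p} (h : g 1 0 ≠ 0) : xCoord g = g 1 0 := if_pos h

lemma xCoord_of_eq_zero {g : SL2 p} (h : g 1 0 = 0) : xCoord g = g 1 1 := if_neg (by simp [h])

lemma rowPhase_of_le (ψ : AddChar ℚ_[p] Circle) {c d : ℚ_[p]} (h : ‖d‖ ≤ ‖c‖) :
    rowPhase ψ c d = gam ψ (-c) := if_pos h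

lemma rowPhase_of_lt (ψ : AddChar ℚ_[p] Circle) {c d : ℚ_[p]} (h : ‖c‖ < ‖d‖) (hc : c ≠ 0) :
    rowPhase ψ c d = ((hilbertSymbol (-c) d : ℤ) : ℂ) * gam ψ (-d) := by
  unfold rowPhase
  rw [if_neg (not_le.mpr h), if_neg hc]

lemma rowPhase_zero (ψ : AddChar ℚ_[p] Circle) {d : ℚ_[p]} (hd : d ≠ 0) :
    rowPhase ψ 0 d = gam ψ (-d) := by
  unfold rowPhase
  rw [if_neg (by simpa using hd), if_pos rfl]

lemma ne_zero_of_norm_lt {c d : ℚ_[p]} (h : ‖c‖ < ‖d‖) : d ≠ 0 :=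
  norm_pos_iff.mp ((norm_nonneg c).trans_lt h)

/-- `(x, y)` is trivial when `x + y = 1`, in terms of square classes. -/
lemma steinberg_relation (hp : p ≠ 2) {a b s : ℚ_[p]} (ha : a ≠ 0) (hb : b ≠ 0) (hs : s ≠ 0)
    (h : a + b = s) :
    lzNeg p * (vz a + vz s) * (vz b + vz s) + (lz a + lz s) * (vz b + vz s) +
      (lz b + lz s) * (vz a + vz s) = 0 := by
  have h1 : hilbertSymbol (a * s⁻¹) (b * s⁻¹) = 1 :=
    hilbertSymbol_eq_one_of_add_eq_one (by rw [← add_mul, h, mul_inv_cancel₀ hs])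
  have hs' := inv_ne_zero hs
  rw [hilbertSymbol_eq_sgn hp (mul_ne_zero ha hs') (mul_ne_zero hb hs'), sgn_eq_one_iff,
    vz_mul ha hs', vz_mul hb hs', lz_mul hp ha hs', lz_mul hp hb hs', vz_inv, lz_inv] at h1
  exact h1

lemma phase_eq (ψ : AddChar ℚ_[p] Circle) {x y v : ZMod 2} (h : x = y) :
    ((sgn x : ℤ) : ℂ) * gamPar ψ v = ((sgn y : ℤ) : ℂ) * gamPar ψ v := by rw [h]

lemma sgn_cast_mul_phase (ψ : AddChar ℚ_[p] Circle) (x y v : ZMod 2) :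
    ((sgn x : ℤ) : ℂ) * (((sgn y : ℤ) : ℂ) * gamPar ψ v) = ((sgn (x + y) : ℤ) : ℂ) * gamPar ψ v := by
  rw [sgn_add]
  push_cast
  ring

lemma norm_mul_unit_right {a u : ℚ_[p]} (hu : ‖u‖ = 1) : ‖a * u‖ = ‖a‖ := by
  rw [norm_mul, hu, mul_one]

lemma norm_mul_lt {a u : ℚ_[p]} {r : ℝ} (ha : ‖a‖ < r) (hu : ‖u‖ ≤ 1) : ‖a * u‖ < r := by
  rw [norm_mul]
  exact (mul_le_of_le_one_right (norm_nonneg _) hu).trans_lt ha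

lemma norm_mul_le_of_le {a u : ℚ_[p]} {r : ℝ} (ha : ‖a‖ ≤ r) (hu : ‖u‖ ≤ 1) : ‖a * u‖ ≤ r := by
  rw [norm_mul]
  exact (mul_le_of_le_one_right (norm_nonneg _) hu).trans ha

lemma norm_mul_lt_of_le {a u : ℚ_[p]} (ha : a ≠ 0) (hu : ‖u‖ < 1) : ‖a * u‖ < ‖a‖ := by
  rw [norm_mul]
  exact mul_lt_of_lt_one_right (norm_pos_iff.mpr ha) hu

section

variable (ψ : AddChar ℚ_[p] Circle) (hp : p ≠ 2) {g k : SL2 p} (hk : k ∈ slIntegral p)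

include hp hk

/-- Right translation by an upper triangular integral matrix. -/
lemma rowPhase_mul_of_eq_zero (hck : k 1 0 = 0) :
    rowPhase ψ ((g * k) 1 0) ((g * k) 1 1) =
      (((cocycle g k * splitSign k : ℤˣ) : ℤ) : ℂ) * rowPhase ψ (g 1 0) (g 1 1) := by
  obtain ⟨hc', hd'⟩ := sl_mul_row g k
  have hdet := sl_det k
  obtain ⟨ha1, hd1⟩ := norm_diag_of_norm_lt_one hk (by rw [hck]; simp)
  rw [mem_slIntegral] at hk
  have ha0 := ne_zero_of_norm_eq_one ha1
  have hd0 := ne_zero_of_norm_eq_one hd1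
  have hva := vz_of_norm_eq_one ha1
  have hvd := vz_of_norm_eq_one hd1
  have hx2 : xCoord k = k 1 1 := xCoord_of_eq_zero hck
  rw [hck, mul_zero, add_zero] at hc'
  rw [hck, mul_zero, sub_zero] at hdet
  have hlad : lz (k 0 0) = lz (k 1 1) := by
    rw [eq_inv_of_mul_eq_one_left hdet, lz_inv]
  rw [splitSign_of_eq_zero hck, mul_one]
  unfold cocycle
  rw [hx2]
  -- An upper triangular integral `k` does not change which entry of the bottom row dominates, so
  -- both phases fall under the same clause of `rowPhase`.
  rcases le_or_gt ‖g 1 1‖ ‖g 1 0‖ with hle | hlt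
  · have hc0 : g 1 0 ≠ 0 := by
      intro h
      rw [h, norm_zero] at hle
      rcases sl_row_ne_zero g with h1 | h1
      · exact h1 h
      · exact h1 (norm_le_zero_iff.mp hle)
    have hc0' : (g * k) 1 0 ≠ 0 := by rw [hc']; exact mul_ne_zero hc0 ha0
    have hle' : ‖(g * k) 1 1‖ ≤ ‖(g * k) 1 0‖ := by
      rw [hc', hd', norm_mul_unit_right ha1]
      exact norm_add_le_of_le (norm_mul_le_of_le le_rfl (hk 0 1)) (norm_mul_le_of_le hle (hk 1 1))
    rw [rowPhase_of_le ψ hle, rowPhase_of_le ψ hle', xCoord_of_ne_zero hc0, xCoord_of_ne_zero hc0']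
    have hl := lz_mul hp hc0 ha0
    have hv := vz_mul hc0 ha0
    rw [← hc', hva, add_zero] at hv
    rw [← hc'] at hl
    rw [hilbertSymbol_eq_sgn hp (mul_ne_zero hc0 hc0') (mul_ne_zero hd0 hc0'), gam_eq_sgn, gam_eq_sgn,
      lz_neg hp hc0, lz_neg hp hc0', vz_neg hc0, vz_neg hc0', lz_mul hp hc0 hc0', lz_mul hp hd0 hc0',
      vz_mul hc0 hc0', vz_mul hd0 hc0', hl, hv, hvd, hlad, sgn_cast_mul_phase]
    refine phase_eq ψ ?_
    generalize vz (g 1 0) = x; generalize lz (g 1 0) = y; generalize lz (k 1 1) = z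
    generalize lzNeg p = n
    revert x y z n; decide
  · have hd0g := ne_zero_of_norm_lt hlt
    have hdd : ‖(g * k) 1 1 - g 1 1 * k 1 1‖ < ‖g 1 1 * k 1 1‖ := by
      rw [hd', add_sub_cancel_right, norm_mul_unit_right hd1]
      exact norm_mul_lt hlt (hk 0 1)
    have hd0p := mul_ne_zero hd0g hd0
    have hl := lz_congr hp hd0p hdd
    have hv := vz_congr hd0p hdd
    have hn := norm_eq_of_norm_sub_lt hdd
    rw [norm_mul_unit_right hd1] at hn
    rw [lz_mul hp hd0g hd0] at hl
    rw [vz_mul hd0g hd0, hvd, add_zero] at hv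
    have hd0' : (g * k) 1 1 ≠ 0 := by
      rw [← norm_ne_zero_iff, hn]
      exact norm_ne_zero_iff.mpr hd0g
    by_cases hc0 : g 1 0 = 0
    · have hc0' : (g * k) 1 0 = 0 := by rw [hc', hc0, zero_mul]
      rw [hc0, hc0', rowPhase_zero ψ hd0g, rowPhase_zero ψ hd0', xCoord_of_eq_zero hc0,
        xCoord_of_eq_zero hc0', hilbertSymbol_eq_sgn hp (mul_ne_zero hd0g hd0') (mul_ne_zero hd0 hd0'),
        gam_eq_sgn, gam_eq_sgn,
        lz_neg hp hd0g, lz_neg hp hd0', vz_neg hd0g, vz_neg hd0', lz_mul hp hd0g hd0',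
        lz_mul hp hd0 hd0', vz_mul hd0g hd0', vz_mul hd0 hd0', hl, hv, hvd, sgn_cast_mul_phase]
      refine phase_eq ψ ?_
      generalize vz (g 1 1) = x; generalize lz (g 1 1) = y; generalize lz (k 1 1) = z
      generalize lzNeg p = n
      revert x y z n; decide
    · have hc0' : (g * k) 1 0 ≠ 0 := by rw [hc']; exact mul_ne_zero hc0 ha0
      have hlt' : ‖(g * k) 1 0‖ < ‖(g * k) 1 1‖ := by rwa [hn, hc', norm_mul_unit_right ha1]
      have hl2 := lz_mul hp hc0 ha0
      have hv2 := vz_mul hc0 ha0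
      rw [← hc', hva, add_zero] at hv2
      rw [← hc'] at hl2
      rw [rowPhase_of_lt ψ hlt hc0, rowPhase_of_lt ψ hlt' hc0', xCoord_of_ne_zero hc0,
        xCoord_of_ne_zero hc0', hilbertSymbol_eq_sgn hp (mul_ne_zero hc0 hc0') (mul_ne_zero hd0 hc0'),
        hilbertSymbol_eq_sgn hp (neg_ne_zero.mpr hc0) hd0g,
        hilbertSymbol_eq_sgn hp (neg_ne_zero.mpr hc0') hd0',
        gam_eq_sgn, gam_eq_sgn,
        lz_neg hp hd0g, lz_neg hp hd0', vz_neg hd0g, vz_neg hd0',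
        lz_neg hp hc0, lz_neg hp hc0', vz_neg hc0, vz_neg hc0', lz_mul hp hc0 hc0',
        lz_mul hp hd0 hc0', vz_mul hc0 hc0', vz_mul hd0 hc0', hl, hv, hl2, hv2, hvd, hlad,
        sgn_cast_mul_phase, sgn_cast_mul_phase, sgn_cast_mul_phase]
      refine phase_eq ψ ?_
      generalize vz (g 1 1) = x; generalize lz (g 1 1) = y; generalize lz (k 1 1) = z
      generalize vz (g 1 0) = x'; generalize lz (g 1 0) = y'
      generalize lzNeg p = n
      revert x y z n x' y'; decide

/-- Right translation by an integral matrix whose lower left entry is a unit. -/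
lemma rowPhase_mul_of_norm_eq_one (hck : ‖k 1 0‖ = 1) :
    rowPhase ψ ((g * k) 1 0) ((g * k) 1 1) =
      (((cocycle g k * splitSign k : ℤˣ) : ℤ) : ℂ) * rowPhase ψ (g 1 0) (g 1 1) := by
  obtain ⟨hc', hd'⟩ := sl_mul_row g k
  have hdet := sl_det k
  rw [mem_slIntegral] at hk
  have hck0 := ne_zero_of_norm_eq_one hck
  have hvk := vz_of_norm_eq_one hck
  have hx2 : xCoord k = k 1 0 := xCoord_of_ne_zero hck0
  -- The old entry recovered from the new row through `k⁻¹`; it yields the dominant term of `g 1 0`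
  -- when the new row is dominated by its second entry.
  have hrel : g 1 0 = (g * k) 1 0 * k 1 1 - (g * k) 1 1 * k 1 0 := by
    rw [hc', hd']
    linear_combination -(g 1 0) * hdet
  rw [splitSign_of_norm_eq_one hck, mul_one]
  unfold cocycle
  rw [hx2]
  rcases le_or_gt ‖g 1 1‖ ‖g 1 0‖ with hle | hlt
  · have hc0 : g 1 0 ≠ 0 := by
      intro h
      rw [h, norm_zero] at hle
      rcases sl_row_ne_zero g with h1 | h1
      · exact h1 h
      · exact h1 (norm_le_zero_iff.mp hle)
    rw [rowPhase_of_le ψ hle, xCoord_of_ne_zero hc0]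
    rcases le_or_gt ‖(g * k) 1 1‖ ‖(g * k) 1 0‖ with hle' | hlt'
    · have hn : ‖g 1 0‖ = ‖(g * k) 1 0‖ := by
        apply le_antisymm
        · rw [hrel]
          exact norm_sub_le_of_le (norm_mul_le_of_le le_rfl (hk 1 1))
            (norm_mul_le_of_le hle' hck.le)
        · rw [hc']
          exact norm_add_le_of_le (norm_mul_le_of_le le_rfl (hk 0 0)) (norm_mul_le_of_le hle hck.le)
      have hc0' : (g * k) 1 0 ≠ 0 := by
        rw [← norm_ne_zero_iff, ← hn]
        exact norm_ne_zero_iff.mpr hc0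
      have hv := vz_eq_of_norm_eq hc0 hn
      rw [rowPhase_of_le ψ hle', xCoord_of_ne_zero hc0',
        hilbertSymbol_eq_sgn hp (mul_ne_zero hc0 hc0') (mul_ne_zero hck0 hc0'), gam_eq_sgn, gam_eq_sgn,
        lz_neg hp hc0, lz_neg hp hc0', vz_neg hc0, vz_neg hc0', lz_mul hp hc0 hc0',
        lz_mul hp hck0 hc0', vz_mul hc0 hc0', vz_mul hck0 hc0', hv, hvk, sgn_cast_mul_phase]
      refine phase_eq ψ ?_
      generalize vz ((g * k) 1 0) = x; generalize lz (g 1 0) = y; generalize lz (k 1 0) = z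
      generalize lz ((g * k) 1 0) = w; generalize lzNeg p = n
      revert x y z w n; decide
    · have hd0' := ne_zero_of_norm_lt hlt'
      have hp0 : -((g * k) 1 1 * k 1 0) ≠ 0 := neg_ne_zero.mpr (mul_ne_zero hd0' hck0)
      have hcc : ‖g 1 0 - -((g * k) 1 1 * k 1 0)‖ < ‖-((g * k) 1 1 * k 1 0)‖ := by
        rw [norm_neg, norm_mul_unit_right hck]
        have : g 1 0 - -((g * k) 1 1 * k 1 0) = (g * k) 1 0 * k 1 1 := by linear_combination hrel
        rw [this]
        exact norm_mul_lt hlt' (hk 1 1)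
      have hl := lz_congr hp hp0 hcc
      have hv := vz_congr hp0 hcc
      rw [lz_neg hp (mul_ne_zero hd0' hck0), lz_mul hp hd0' hck0] at hl
      rw [vz_neg (mul_ne_zero hd0' hck0), vz_mul hd0' hck0, hvk, add_zero] at hv
      by_cases hc0' : (g * k) 1 0 = 0
      · rw [hc0', rowPhase_zero ψ hd0', xCoord_of_eq_zero hc0',
          hilbertSymbol_eq_sgn hp (mul_ne_zero hc0 hd0') (mul_ne_zero hck0 hd0'), gam_eq_sgn, gam_eq_sgn,
          lz_neg hp hc0, lz_neg hp hd0', vz_neg hc0, vz_neg hd0', lz_mul hp hc0 hd0',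
          lz_mul hp hck0 hd0', vz_mul hc0 hd0', vz_mul hck0 hd0', hv, hl, hvk, sgn_cast_mul_phase]
        refine phase_eq ψ ?_
        generalize vz ((g * k) 1 1) = x; generalize lz ((g * k) 1 1) = y; generalize lz (k 1 0) = z
        generalize lzNeg p = n
        revert x y z n; decide
      · rw [rowPhase_of_lt ψ hlt' hc0', xCoord_of_ne_zero hc0',
          hilbertSymbol_eq_sgn hp (mul_ne_zero hc0 hc0') (mul_ne_zero hck0 hc0'),
          hilbertSymbol_eq_sgn hp (neg_ne_zero.mpr hc0') hd0', gam_eq_sgn, gam_eq_sgn,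
          lz_neg hp hc0, lz_neg hp hd0', vz_neg hc0, vz_neg hd0', lz_neg hp hc0', vz_neg hc0',
          lz_mul hp hc0 hc0', lz_mul hp hck0 hc0', vz_mul hc0 hc0', vz_mul hck0 hc0', hv, hl, hvk,
          sgn_cast_mul_phase, sgn_cast_mul_phase]
        refine phase_eq ψ ?_
        generalize vz ((g * k) 1 1) = x; generalize lz ((g * k) 1 1) = y; generalize lz (k 1 0) = z
        generalize vz ((g * k) 1 0) = x'; generalize lz ((g * k) 1 0) = y'
        generalize lzNeg p = n
        revert x y z n x' y'; decide
  · have hd0g := ne_zero_of_norm_lt hlt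
    have hp0 := mul_ne_zero hd0g hck0
    have hcc : ‖(g * k) 1 0 - g 1 1 * k 1 0‖ < ‖g 1 1 * k 1 0‖ := by
      rw [hc', add_sub_cancel_right, norm_mul_unit_right hck]
      exact norm_mul_lt hlt (hk 0 0)
    have hl := lz_congr hp hp0 hcc
    have hv := vz_congr hp0 hcc
    have hn := norm_eq_of_norm_sub_lt hcc
    rw [norm_mul_unit_right hck] at hn
    rw [lz_mul hp hd0g hck0] at hl
    rw [vz_mul hd0g hck0, hvk, add_zero] at hv
    have hc0' : (g * k) 1 0 ≠ 0 := by
      rw [← norm_ne_zero_iff, hn]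
      exact norm_ne_zero_iff.mpr hd0g
    have hle' : ‖(g * k) 1 1‖ ≤ ‖(g * k) 1 0‖ := by
      rw [hn, hd']
      exact norm_add_le_of_le (norm_mul_le_of_le hlt.le (hk 0 1)) (norm_mul_le_of_le le_rfl (hk 1 1))
    rw [rowPhase_of_le ψ hle', xCoord_of_ne_zero hc0']
    by_cases hc0 : g 1 0 = 0
    · rw [hc0, rowPhase_zero ψ hd0g, xCoord_of_eq_zero hc0,
        hilbertSymbol_eq_sgn hp (mul_ne_zero hd0g hc0') (mul_ne_zero hck0 hc0'), gam_eq_sgn, gam_eq_sgn,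
        lz_neg hp hd0g, lz_neg hp hc0', vz_neg hd0g, vz_neg hc0', lz_mul hp hd0g hc0',
        lz_mul hp hck0 hc0', vz_mul hd0g hc0', vz_mul hck0 hc0', hv, hl, hvk, sgn_cast_mul_phase]
      refine phase_eq ψ ?_
      generalize vz (g 1 1) = x; generalize lz (g 1 1) = y; generalize lz (k 1 0) = z
      generalize lzNeg p = n
      revert x y z n; decide
    · rw [rowPhase_of_lt ψ hlt hc0, xCoord_of_ne_zero hc0,
        hilbertSymbol_eq_sgn hp (mul_ne_zero hc0 hc0') (mul_ne_zero hck0 hc0'),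
        hilbertSymbol_eq_sgn hp (neg_ne_zero.mpr hc0) hd0g, gam_eq_sgn, gam_eq_sgn,
        lz_neg hp hd0g, lz_neg hp hc0', vz_neg hd0g, vz_neg hc0', lz_neg hp hc0, vz_neg hc0,
        lz_mul hp hc0 hc0', lz_mul hp hck0 hc0', vz_mul hc0 hc0', vz_mul hck0 hc0', hv, hl, hvk,
        sgn_cast_mul_phase, sgn_cast_mul_phase]
      refine phase_eq ψ ?_
      generalize vz (g 1 1) = x; generalize lz (g 1 1) = y; generalize lz (k 1 0) = z
      generalize vz (g 1 0) = x'; generalize lz (g 1 0) = y'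
      generalize lzNeg p = n
      revert x y z n x' y'; decide

/-- Right translation by an element of `Γ₀(p)` that is not upper triangular. -/
lemma rowPhase_mul_of_norm_lt_one (hck0 : k 1 0 ≠ 0) (hck : ‖k 1 0‖ < 1) :
    rowPhase ψ ((g * k) 1 0) ((g * k) 1 1) =
      (((cocycle g k * splitSign k : ℤˣ) : ℤ) : ℂ) * rowPhase ψ (g 1 0) (g 1 1) := by
  obtain ⟨hc', hd'⟩ := sl_mul_row g k
  have hdet := sl_det k
  obtain ⟨ha1, hd1⟩ := norm_diag_of_norm_lt_one hk hck
  rw [mem_slIntegral] at hk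
  have ha0 := ne_zero_of_norm_eq_one ha1
  have hd0 := ne_zero_of_norm_eq_one hd1
  have hva := vz_of_norm_eq_one ha1
  have hvd := vz_of_norm_eq_one hd1
  have hx2 : xCoord k = k 1 0 := xCoord_of_ne_zero hck0
  have hlad : lz (k 0 0) = lz (k 1 1) := by
    have h1 : ‖k 0 0 * k 1 1 - 1‖ < ‖(1 : ℚ_[p])‖ := by
      have : k 0 0 * k 1 1 - 1 = k 1 0 * k 0 1 := by linear_combination hdet
      rw [this, norm_one]
      exact norm_mul_lt hck (hk 0 1)
    have h2 := lz_congr hp one_ne_zero h1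
    rw [lz_mul hp ha0 hd0, lz_one] at h2
    generalize lz (k 0 0) = x at h2 ⊢
    generalize lz (k 1 1) = y at h2 ⊢
    revert x y; decide
  -- Written as a sum of two terms so that `steinberg_relation` applies when all three are nonzero.
  have hrel : g 1 0 + (g * k) 1 1 * k 1 0 = (g * k) 1 0 * k 1 1 := by
    rw [hc', hd']
    linear_combination -(g 1 0) * hdet
  rw [splitSign_of_norm_lt_one hp hck0 hd1]
  unfold cocycle
  rw [hx2]
  rcases le_or_gt ‖g 1 1‖ ‖g 1 0‖ with hle | hlt
  · have hc0 : g 1 0 ≠ 0 := by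
      intro h
      rw [h, norm_zero] at hle
      rcases sl_row_ne_zero g with h1 | h1
      · exact h1 h
      · exact h1 (norm_le_zero_iff.mp hle)
    have hcc : ‖(g * k) 1 0 - g 1 0 * k 0 0‖ < ‖g 1 0 * k 0 0‖ := by
      rw [hc', add_sub_cancel_left, norm_mul_unit_right ha1, norm_mul]
      have := norm_pos_iff.mpr hc0
      nlinarith [norm_nonneg (g 1 1), norm_nonneg (k 1 0)]
    have hp0 := mul_ne_zero hc0 ha0
    have hl := lz_congr hp hp0 hcc
    have hv := vz_congr hp0 hcc
    have hn := norm_eq_of_norm_sub_lt hcc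
    rw [norm_mul_unit_right ha1] at hn
    rw [lz_mul hp hc0 ha0] at hl
    rw [vz_mul hc0 ha0, hva, add_zero] at hv
    have hc0' : (g * k) 1 0 ≠ 0 := by
      rw [← norm_ne_zero_iff, hn]
      exact norm_ne_zero_iff.mpr hc0
    have hle' : ‖(g * k) 1 1‖ ≤ ‖(g * k) 1 0‖ := by
      rw [hn, hd']
      exact norm_add_le_of_le (norm_mul_le_of_le le_rfl (hk 0 1)) (norm_mul_le_of_le hle (hk 1 1))
    rw [rowPhase_of_le ψ hle, rowPhase_of_le ψ hle', xCoord_of_ne_zero hc0, xCoord_of_ne_zero hc0',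
      hilbertSymbol_eq_sgn hp (mul_ne_zero hc0 hc0') (mul_ne_zero hck0 hc0'),
      hilbertSymbol_eq_sgn hp hck0 hd0, ← sgn_add, gam_eq_sgn, gam_eq_sgn,
      lz_neg hp hc0, lz_neg hp hc0', vz_neg hc0, vz_neg hc0', lz_mul hp hc0 hc0', lz_mul hp hck0 hc0',
      vz_mul hc0 hc0', vz_mul hck0 hc0', hl, hv, hvd, hlad, sgn_cast_mul_phase]
    refine phase_eq ψ ?_
    generalize vz (g 1 0) = x; generalize lz (g 1 0) = y; generalize lz (k 1 1) = z
    generalize vz (k 1 0) = x'; generalize lz (k 1 0) = y'; generalize lzNeg p = n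
    revert x y z n x' y'; decide
  · have hd0g := ne_zero_of_norm_lt hlt
    have hdd : ‖(g * k) 1 1 - g 1 1 * k 1 1‖ < ‖g 1 1 * k 1 1‖ := by
      rw [hd', add_sub_cancel_right, norm_mul_unit_right hd1]
      exact norm_mul_lt hlt (hk 0 1)
    have hd0p := mul_ne_zero hd0g hd0
    have hl := lz_congr hp hd0p hdd
    have hv := vz_congr hd0p hdd
    have hn := norm_eq_of_norm_sub_lt hdd
    rw [norm_mul_unit_right hd1] at hn
    rw [lz_mul hp hd0g hd0] at hl
    rw [vz_mul hd0g hd0, hvd, add_zero] at hv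
    have hd0' : (g * k) 1 1 ≠ 0 := by
      rw [← norm_ne_zero_iff, hn]
      exact norm_ne_zero_iff.mpr hd0g
    have hlt' : ‖(g * k) 1 0‖ < ‖(g * k) 1 1‖ := by
      rw [hn, hc']
      exact (IsUltrametricDist.norm_add_le_max _ _).trans_lt
        (max_lt (norm_mul_lt hlt (hk 0 0)) (norm_mul_lt_of_le hd0g hck))
    by_cases hc0 : g 1 0 = 0
    · rw [hc0, zero_mul, zero_add] at hc'
      have hc0' : (g * k) 1 0 ≠ 0 := by rw [hc']; exact mul_ne_zero hd0g hck0
      have hl2 := lz_mul hp hd0g hck0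
      have hv2 := vz_mul hd0g hck0
      rw [← hc'] at hl2 hv2
      rw [hc0, rowPhase_zero ψ hd0g, rowPhase_of_lt ψ hlt' hc0', xCoord_of_eq_zero hc0,
        xCoord_of_ne_zero hc0',
        hilbertSymbol_eq_sgn hp (mul_ne_zero hd0g hc0') (mul_ne_zero hck0 hc0'),
        hilbertSymbol_eq_sgn hp hck0 hd0, ← sgn_add,
        hilbertSymbol_eq_sgn hp (neg_ne_zero.mpr hc0') hd0', gam_eq_sgn, gam_eq_sgn,
        lz_neg hp hd0g, lz_neg hp hd0', vz_neg hd0g, vz_neg hd0', lz_neg hp hc0', vz_neg hc0',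
        lz_mul hp hd0g hc0', lz_mul hp hck0 hc0',
        vz_mul hd0g hc0', vz_mul hck0 hc0', hl, hv, hl2, hv2, hvd,
        sgn_cast_mul_phase, sgn_cast_mul_phase]
      refine phase_eq ψ ?_
      generalize vz (g 1 1) = x; generalize lz (g 1 1) = y; generalize lz (k 1 1) = z
      generalize vz (k 1 0) = x'; generalize lz (k 1 0) = y'; generalize lzNeg p = n
      revert x y z n x' y'; decide
    by_cases hc0' : (g * k) 1 0 = 0
    · have hp0 := mul_ne_zero hd0' hck0
      have hcc : g 1 0 = -((g * k) 1 1 * k 1 0) := by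
        rw [hc0', zero_mul] at hrel
        linear_combination hrel
      have hl2 := lz_neg hp hp0
      have hv2 := vz_neg hp0
      rw [← hcc, lz_mul hp hd0' hck0] at hl2
      rw [← hcc, vz_mul hd0' hck0] at hv2
      rw [hc0', rowPhase_zero ψ hd0', rowPhase_of_lt ψ hlt hc0, xCoord_of_eq_zero hc0',
        xCoord_of_ne_zero hc0,
        hilbertSymbol_eq_sgn hp (mul_ne_zero hc0 hd0') (mul_ne_zero hck0 hd0'),
        hilbertSymbol_eq_sgn hp hck0 hd0, ← sgn_add,
        hilbertSymbol_eq_sgn hp (neg_ne_zero.mpr hc0) hd0g, gam_eq_sgn, gam_eq_sgn,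
        lz_neg hp hd0g, lz_neg hp hd0', vz_neg hd0g, vz_neg hd0', lz_neg hp hc0, vz_neg hc0,
        lz_mul hp hc0 hd0', lz_mul hp hck0 hd0',
        vz_mul hc0 hd0', vz_mul hck0 hd0', hl2, hv2, hl, hv, hvd,
        sgn_cast_mul_phase, sgn_cast_mul_phase]
      refine phase_eq ψ ?_
      generalize vz (g 1 1) = x; generalize lz (g 1 1) = y; generalize lz (k 1 1) = z
      generalize vz (k 1 0) = x'; generalize lz (k 1 0) = y'; generalize lzNeg p = n
      revert x y z n x' y'; decide
    -- The generic case: no term of `hrel` need dominate, so the square classes of the old and new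
    -- lower left entries are linked only through `(x, 1 - x) = 1`.
    · have hst := steinberg_relation hp hc0 (mul_ne_zero hd0' hck0) (mul_ne_zero hc0' hd0) hrel
      rw [vz_mul hd0' hck0, lz_mul hp hd0' hck0, vz_mul hc0' hd0, lz_mul hp hc0' hd0, hl, hv,
        hvd] at hst
      rw [rowPhase_of_lt ψ hlt hc0, rowPhase_of_lt ψ hlt' hc0', xCoord_of_ne_zero hc0,
        xCoord_of_ne_zero hc0',
        hilbertSymbol_eq_sgn hp (mul_ne_zero hc0 hc0') (mul_ne_zero hck0 hc0'),
        hilbertSymbol_eq_sgn hp hck0 hd0, ← sgn_add,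
        hilbertSymbol_eq_sgn hp (neg_ne_zero.mpr hc0) hd0g,
        hilbertSymbol_eq_sgn hp (neg_ne_zero.mpr hc0') hd0', gam_eq_sgn, gam_eq_sgn,
        lz_neg hp hd0g, lz_neg hp hd0', vz_neg hd0g, vz_neg hd0', lz_neg hp hc0, vz_neg hc0,
        lz_neg hp hc0', vz_neg hc0', lz_mul hp hc0 hc0', lz_mul hp hck0 hc0',
        vz_mul hc0 hc0', vz_mul hck0 hc0', hl, hv, hvd,
        sgn_cast_mul_phase, sgn_cast_mul_phase, sgn_cast_mul_phase]
      refine phase_eq ψ ?_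
      generalize vz (g 1 1) = x at hst ⊢
      generalize lz (g 1 1) = y at hst ⊢
      generalize lz (k 1 1) = z at hst ⊢
      generalize vz (k 1 0) = x' at hst ⊢
      generalize lz (k 1 0) = y' at hst ⊢
      generalize vz (g 1 0) = x'' at hst ⊢
      generalize lz (g 1 0) = y'' at hst ⊢
      generalize vz ((g * k) 1 0) = v at hst ⊢
      generalize lz ((g * k) 1 0) = w at hst ⊢
      generalize lzNeg p = n at hst ⊢
      clear hl hv hvd hva hlad
      grind

/-- The phase of `ω(g) 1_{ℤ_p}` is equivariant under `SL₂(ℤ_p)`. -/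
theorem rowPhase_mul :
    rowPhase ψ ((g * k) 1 0) ((g * k) 1 1) =
      (((cocycle g k * splitSign k : ℤˣ) : ℤ) : ℂ) * rowPhase ψ (g 1 0) (g 1 1) := by
  by_cases h0 : k 1 0 = 0
  · exact rowPhase_mul_of_eq_zero ψ hp hk h0
  · rcases (mem_slIntegral.mp hk 1 0).lt_or_eq with h | h
    · exact rowPhase_mul_of_norm_lt_one ψ hp hk h0 h
    · exact rowPhase_mul_of_norm_eq_one ψ hp hk h

end

end

section

/-! ### The spherical vector of the Weil representation -/

open Classical in
/-- The entry of larger norm in a row `(c, d)`. -/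
def rowMax (c d : ℚ_[p]) : ℚ_[p] := if ‖d‖ ≤ ‖c‖ then c else d

open Classical in
/-- The quotient of the entries in the column of `rowMax`. -/
def rowQuot (g : SL2 p) : ℚ_[p] :=
  if ‖g 1 1‖ ≤ ‖g 1 0‖ then g 0 0 / g 1 0 else g 0 1 / g 1 1

lemma rowMax_of_le {c d : ℚ_[p]} (h : ‖d‖ ≤ ‖c‖) : rowMax c d = c := if_pos h

lemma rowMax_of_lt {c d : ℚ_[p]} (h : ‖c‖ < ‖d‖) : rowMax c d = d := if_neg (not_le.mpr h)

lemma norm_rowMax (c d : ℚ_[p]) : ‖rowMax c d‖ = max ‖c‖ ‖d‖ := by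
  unfold rowMax
  split_ifs with h
  · rw [max_eq_left h]
  · rw [max_eq_right (not_le.mp h).le]

lemma sl_left_ne_zero_of_le {g : SL2 p} (h : ‖g 1 1‖ ≤ ‖g 1 0‖) : g 1 0 ≠ 0 := by
  intro h0
  rw [h0, norm_zero] at h
  rcases sl_row_ne_zero g with h1 | h1
  · exact h1 h0
  · exact h1 (norm_le_zero_iff.mp h)

lemma rowMax_ne_zero (g : SL2 p) : rowMax (g 1 0) (g 1 1) ≠ 0 := by
  rcases le_or_gt ‖g 1 1‖ ‖g 1 0‖ with h | h
  · rw [rowMax_of_le h]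
    exact sl_left_ne_zero_of_le h
  · rw [rowMax_of_lt h]
    exact ne_zero_of_norm_lt h

lemma gam_inv (ψ : AddChar ℚ_[p] Circle) (a : ℚ_[p]) : gam ψ a⁻¹ = gam ψ a := by
  rw [gam_eq_sgn, gam_eq_sgn, lz_inv, vz_inv]

lemma charZp_neg (x : ℚ_[p]) : (charZp (-x) : ℂ) = charZp x := by
  unfold charZp
  simp [Set.indicator]

lemma charZp_congr {x y : ℚ_[p]} (h : ‖x‖ = ‖y‖) : (charZp x : ℂ) = charZp y := by
  unfold charZp
  simp [Set.indicator, h]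

lemma charZp_of_le {x : ℚ_[p]} (h : ‖x‖ ≤ 1) : (charZp x : ℂ) = 1 := by
  unfold charZp
  simp [Set.indicator, h]

lemma charZp_of_lt {x : ℚ_[p]} (h : 1 < ‖x‖) : (charZp x : ℂ) = 0 := by
  unfold charZp
  simp [Set.indicator, h]

lemma integral_mul_charZp (f : ℚ_[p] → ℂ) :
    ∫ x, f x * charZp x ∂padicHaar p = ∫ x in ball p 0, f x ∂padicHaar p := by
  rw [← integral_indicator (measurableSet_ball 0)]
  congr 1
  ext x
  unfold charZp
  rw [ball_zero]
  by_cases h : x ∈ Metric.closedBall (0 : ℚ_[p]) 1 <;> simp [Set.indicator, h]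

lemma cocycle_tMat_sMat {c : ℚ_[p]} (hc : c ≠ 0) :
    cocycle (tMat (-(Units.mk0 c hc)⁻¹)) sMat = hilbertSymbol (-c * c) (-1 * c) := by
  have h1 : xCoord (tMat (-(Units.mk0 c hc)⁻¹)) = -c := by
    rw [xCoord_of_eq_zero (by simp [tMat])]
    simp [tMat]
  have h2 : xCoord (sMat : SL2 p) = -1 := by
    rw [xCoord_of_ne_zero (by simp [sMat])]
    simp [sMat]
  have h3 : (tMat (-(Units.mk0 c hc)⁻¹) * sMat : SL2 p) 1 0 = c := by
    rw [(sl_mul_row _ _).1]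
    simp [tMat, sMat]
  unfold cocycle
  rw [h1, h2, xCoord_of_ne_zero (by rw [h3]; exact hc), h3]

lemma rpow_half_norm_inv (c : ℚ_[p]) : ‖c⁻¹‖ ^ (1 / 2 : ℝ) = (√‖c‖)⁻¹ := by
  rw [← Real.sqrt_eq_rpow, norm_inv, Real.sqrt_inv]

section

variable {ψ : AddChar ℚ_[p] Circle} (hψ : IsUnramifiedChar ψ) (hp : p ≠ 2)

include hψ hp

/-- The cocycle sign and `χ_ψ(-1/c)` from the big-cell formula merge into one Weil index. -/
lemma cocycle_mul_chiPsi {c : ℚ_[p]} (hc : c ≠ 0) :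
    ((hilbertSymbol (-c * c) (-1 * c) : ℤ) : ℂ) * chiPsi ψ (-c⁻¹) = gam ψ (-c) := by
  rw [chiPsi_eq hψ hp (neg_ne_zero.mpr (inv_ne_zero hc)), neg_neg, gam_inv, neg_one_mul,
    hilbertSymbol_eq_sgn hp (mul_ne_zero (neg_ne_zero.mpr hc) hc) (neg_ne_zero.mpr hc), gam_eq_sgn,
    gam_eq_sgn, lz_mul hp (neg_ne_zero.mpr hc) hc, vz_mul (neg_ne_zero.mpr hc) hc, lz_neg hp hc,
    vz_neg hc, sgn_cast_mul_phase]
  refine phase_eq ψ ?_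
  generalize vz c = x; generalize lz c = y; generalize lzNeg p = n
  revert x y n; decide

/-- The Fourier transform of a Gaussian on `ℤ_p`. -/
lemma integral_psi_quadratic {u : ℚ_[p]} (hu : 1 < ‖u‖) (y : ℚ_[p]) :
    ∫ z in ball p 0, (ψ (u * z ^ 2 + 2 * y * z) : ℂ) ∂padicHaar p =
      charZp (y / u) * ψ (-(y ^ 2 / u)) * gaussInt ψ u := by
  have hu0 : u ≠ 0 := norm_pos_iff.mp (one_pos.trans hu)
  rcases le_or_gt ‖y / u‖ 1 with h | h
  · rw [charZp_of_le h, one_mul]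
    unfold gaussInt
    rw [← setIntegral_ball_comp_add (p := p) 0 (y := y / u) (by rwa [mem_ball, zpow_zero])
      (fun z => (ψ (u * z ^ 2) : ℂ)), ← integral_const_mul]
    congr 1
    ext z
    rw [← Circle.coe_mul, ← AddChar.map_add_eq_mul]
    congr 2
    field_simp
    ring
  · rw [charZp_of_lt h, zero_mul, zero_mul]
    have hy0 : y ≠ 0 := by rintro rfl; simp at h; linarith
    have hlt : ‖u‖ < ‖y‖ := by
      rwa [norm_div, lt_div_iff₀ (norm_pos_iff.mpr hu0), one_mul] at h
    -- With this `w`, `2 y w = 1/p` lies outside the kernel of `ψ`, while `u w` and `w` are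
    -- integral. Translation by `w` therefore multiplies the integral by a constant different from
    -- `1`.
    set w : ℚ_[p] := (2 * y * p)⁻¹ with hw
    have hwn : ‖w‖ = p / ‖y‖ := by
      rw [hw, norm_inv, norm_mul, norm_mul, norm_two hp, Padic.norm_p, one_mul, mul_inv, inv_inv]
      field_simp
    have huw : ‖u * w‖ ≤ 1 := by
      have h1 : ‖(y / u)⁻¹‖ < 1 := by
        rw [norm_inv]
        exact inv_lt_one_of_one_lt₀ h
      rw [norm_lt_one_iff_le, norm_inv, norm_div] at h1
      rw [norm_mul, hwn]
      have h2 : ‖u‖ * (p / ‖y‖) = p * (‖y‖ / ‖u‖)⁻¹ := by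
        rw [inv_div]
        ring
      rw [h2]
      calc _ ≤ (p : ℝ) * (p : ℝ)⁻¹ := by gcongr
        _ = 1 := mul_inv_cancel₀ cast_p_pos.ne'
    have hw1 : ‖w‖ ≤ 1 := by
      rw [norm_mul] at huw
      nlinarith [norm_nonneg w]
    have hne : (ψ (2 * y * w) : ℂ) ≠ 1 := by
      intro h1
      have h2 := (hψ _).mp (Circle.ext h1)
      rw [norm_mul, norm_mul, norm_two hp, hwn, one_mul,
        mul_div_cancel₀ _ (norm_ne_zero_iff.mpr hy0)] at h2
      exact absurd h2 (not_le.mpr one_lt_cast_p)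
    have hshift := setIntegral_ball_comp_add (p := p) 0 (y := w) (by rwa [mem_ball, zpow_zero])
      (fun z => (ψ (u * z ^ 2 + 2 * y * z) : ℂ))
    have hcong : ∫ z in ball p 0, (ψ (u * (z + w) ^ 2 + 2 * y * (z + w)) : ℂ) ∂padicHaar p =
        ∫ z in ball p 0, (ψ (u * z ^ 2 + 2 * y * z) : ℂ) * (ψ (2 * y * w) : ℂ) ∂padicHaar p := by
      refine setIntegral_congr_fun (measurableSet_ball 0) fun z hz => ?_
      rw [mem_ball, zpow_zero] at hz
      rw [← Circle.coe_mul, ← AddChar.map_add_eq_mul]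
      congr 1
      refine psi_congr hψ ?_
      have : u * (z + w) ^ 2 + 2 * y * (z + w) - (u * z ^ 2 + 2 * y * z + 2 * y * w) =
        (u * w) * (2 * z + w) := by ring
      rw [this]
      refine norm_mul_le_of_le huw (norm_add_le_of_le ?_ hw1)
      rwa [norm_mul, norm_two hp, one_mul]
    rw [hcong, integral_mul_const] at hshift
    have h2 : (∫ z in ball p 0, (ψ (u * z ^ 2 + 2 * y * z) : ℂ) ∂padicHaar p) *
        ((ψ (2 * y * w) : ℂ) - 1) = 0 := by
      linear_combination hshift
    exact (mul_eq_zero.mp h2).resolve_right (sub_ne_zero.mpr hne)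

/-- The operator `ω_ψ(g)` on `1_{ℤ_p}`, on the big cell. -/
lemma weilRep_charZp_of_ne_zero {g : SL2 p} (hc : g 1 0 ≠ 0) (x : ℚ_[p]) :
    weilRep ψ ⟨g, 1⟩ charZp x = gam ψ (-(g 1 0)) * (((√‖g 1 0‖)⁻¹ : ℝ) : ℂ) *
      (ψ (g 0 0 / g 1 0 * x ^ 2) *
        ∫ z in ball p 0, (ψ (g 1 1 / g 1 0 * z ^ 2 + 2 * (-(x / g 1 0)) * z) : ℂ) ∂padicHaar p) := by
  unfold weilRep
  rw [dif_neg hc]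
  simp only [Pi.smul_apply, smul_eq_mul, weilN, weilT, weilS, one_mul]
  rw [cocycle_tMat_sMat, weilIndex_eq_one hψ hp, one_mul, norm_neg, rpow_half_norm_inv,
    ← cocycle_mul_chiPsi hψ hp hc]
  have h : ∫ y, (ψ (g 1 1 / g 1 0 * y ^ 2) : ℂ) * charZp y * (ψ (2 * (-(g 1 0)⁻¹ * x) * y) : ℂ)
      ∂padicHaar p =
      ∫ z in ball p 0, (ψ (g 1 1 / g 1 0 * z ^ 2 + 2 * (-(x / g 1 0)) * z) : ℂ) ∂padicHaar p := by
    rw [← integral_mul_charZp]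
    congr 1
    ext y
    rw [AddChar.map_add_eq_mul, Circle.coe_mul]
    have : 2 * (-(g 1 0)⁻¹ * x) * y = 2 * (-(x / g 1 0)) * y := by
      rw [div_eq_mul_inv]
      ring
    rw [this]
    ring
  rw [h]
  ring

/-- The image is a Gaussian supported on `m ℤ_p`, where `m` is the dominant entry of the bottom row.
If `c` dominates, the inner quadratic phase is trivial on `ℤ_p`. If `d` dominates, completing the
square produces the index of `d/c`, which combines with that of `-c` by `gam_mul`. The upper row
enters only through `rowQuot`. -/
theorem weilRep_charZp (g : SL2 p) (x : ℚ_[p]) :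
    weilRep ψ ⟨g, 1⟩ charZp x =
      rowPhase ψ (g 1 0) (g 1 1) * (((√‖rowMax (g 1 0) (g 1 1)‖)⁻¹ : ℝ) : ℂ) *
        (ψ (rowQuot g * x ^ 2) * charZp (x / rowMax (g 1 0) (g 1 1))) := by
  by_cases hc : g 1 0 = 0
  · have hdet := sl_det g
    rw [hc, mul_zero, sub_zero] at hdet
    have hd0 : g 1 1 ≠ 0 := right_ne_zero_of_mul (hdet ▸ one_ne_zero)
    have ha : g 0 0 = (g 1 1)⁻¹ := eq_inv_of_mul_eq_one_left hdet
    have hlt : ‖g 1 0‖ < ‖g 1 1‖ := by rw [hc, norm_zero]; exact norm_pos_iff.mpr hd0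
    rw [rowMax_of_lt hlt, rowQuot, if_neg (not_le.mpr hlt), hc, rowPhase_zero ψ hd0]
    unfold weilRep
    rw [dif_pos hc]
    simp only [Pi.smul_apply, smul_eq_mul, weilN, weilT]
    rw [ha, chiPsi_eq hψ hp (inv_ne_zero hd0), rpow_half_norm_inv, ← inv_neg, gam_inv]
    have h1 : (g 1 1)⁻¹ * g 0 1 = g 0 1 / g 1 1 := by rw [div_eq_mul_inv, mul_comm]
    have h2 : (g 1 1)⁻¹ * x = x / g 1 1 := by rw [div_eq_mul_inv, mul_comm]
    rw [h1, h2]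
    simp only [Units.val_one, Int.cast_one]
    ring
  rw [weilRep_charZp_of_ne_zero hψ hp hc]
  rcases le_or_gt ‖g 1 1‖ ‖g 1 0‖ with hle | hlt
  · rw [rowMax_of_le hle, rowQuot, if_pos hle, rowPhase_of_le ψ hle]
    congr 2
    have h1 : ∫ z in ball p 0, (ψ (g 1 1 / g 1 0 * z ^ 2 + 2 * (-(x / g 1 0)) * z) : ℂ) ∂padicHaar p =
        ∫ z in ball p 0, (ψ ((2 * (-(x / g 1 0))) * z) : ℂ) ∂padicHaar p := by
      refine setIntegral_congr_fun (measurableSet_ball 0) fun z hz => ?_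
      rw [mem_ball, zpow_zero] at hz
      congr 1
      refine psi_congr hψ ?_
      rw [add_sub_cancel_right, norm_mul, norm_pow, norm_div]
      refine mul_le_one₀ (div_le_one_of_le₀ hle (norm_nonneg _)) (by positivity)
        (pow_le_one₀ (norm_nonneg _) hz)
    rw [h1, integral_psi_mul hψ]
    exact charZp_congr (by rw [norm_mul, norm_two hp, one_mul, norm_neg])
  · have hd0 := ne_zero_of_norm_lt hlt
    have hu : 1 < ‖g 1 1 / g 1 0‖ := by
      rw [norm_div, one_lt_div (norm_pos_iff.mpr hc)]
      exact hlt
    rw [rowMax_of_lt hlt, rowQuot, if_neg (not_le.mpr hlt), rowPhase_of_lt ψ hlt hc,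
      integral_psi_quadratic hψ hp hu, gaussInt_eq hψ hp hu.le]
    have h1 : -(x / g 1 0) / (g 1 1 / g 1 0) = -(x / g 1 1) := by field_simp
    -- `a/c - 1/(cd) = b/d` because the determinant is `1`.
    have h2 : (ψ (g 0 1 / g 1 1 * x ^ 2) : ℂ) =
        ψ (g 0 0 / g 1 0 * x ^ 2) * ψ (-((-(x / g 1 0)) ^ 2 / (g 1 1 / g 1 0))) := by
      rw [← Circle.coe_mul, ← AddChar.map_add_eq_mul]
      congr 2
      field_simp
      linear_combination (-x ^ 2) * sl_det g
    have h3 : gam ψ (-(g 1 0)) * gam ψ (g 1 1 / g 1 0) =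
        ((hilbertSymbol (-(g 1 0)) (g 1 1) : ℤ) : ℂ) * gam ψ (-(g 1 1)) := by
      rw [div_eq_mul_inv, gam_mul hψ hp (neg_ne_zero.mpr hc) (mul_ne_zero hd0 (inv_ne_zero hc)),
        hilbertSymbol_mul_right hp (neg_ne_zero.mpr hc) hd0 (inv_ne_zero hc),
        hilbertSymbol_inv_right _ hc]
      have h4 := hilbertSymbol_neg_self (g 1 0)
      rw [hilbertSymbol_comm] at h4
      rw [h4, mul_one]
      congr 2
      field_simp
    have h5 : (√‖g 1 0‖)⁻¹ * (√‖g 1 1 / g 1 0‖)⁻¹ = (√‖g 1 1‖)⁻¹ := by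
      rw [← mul_inv, ← Real.sqrt_mul (norm_nonneg _), ← norm_mul, mul_div_cancel₀ _ hc]
    rw [h1, charZp_neg, h2, ← h3, ← h5]
    push_cast
    ring

end

end

section

/-! ### The matrix coefficient of the spherical vector of the Weil representation -/

/-- The matrix coefficient of `1_{ℤ_p}` for the Weil representation. -/
def weilMC (ψ : AddChar ℚ_[p] Circle) (g : SL2 p) : ℂ :=
  ∫ x in ball p 0, weilRep ψ ⟨g, 1⟩ charZp x ∂padicHaar p

lemma conj_charZp (x : ℚ_[p]) : conj (charZp x : ℂ) = charZp x := by
  unfold charZp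
  by_cases h : x ∈ Metric.closedBall (0 : ℚ_[p]) 1 <;> simp [Set.indicator, h]

lemma weilPairing_charZp_right (φ : ℚ_[p] → ℂ) :
    weilPairing φ charZp = ∫ x in ball p 0, φ x ∂padicHaar p := by
  unfold weilPairing
  simp_rw [conj_charZp]
  exact integral_mul_charZp φ

lemma setIntegral_charZp : ∫ x in ball p 0, (charZp x : ℂ) ∂padicHaar p = 1 := by
  have h : ∫ x in ball p 0, (charZp x : ℂ) ∂padicHaar p = ∫ _ in ball p 0, (1 : ℂ) ∂padicHaar p :=
    setIntegral_congr_fun (measurableSet_ball 0) fun x hx =>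
      charZp_of_le (by simpa using mem_ball.mp hx)
  rw [h, setIntegral_const, measureReal_ball]
  simp

lemma weilCoeff_charZp (ψ : AddChar ℚ_[p] Circle) (g : SL2 p) :
    weilCoeff ψ charZp g = weilMC ψ g := by
  unfold weilCoeff weilMC
  rw [weilPairing_charZp_right, weilPairing_charZp_right, setIntegral_charZp, div_one]

lemma sl_mul_apply (g k : SL2 p) (i j : Fin 2) :
    (g * k) i j = g i 0 * k 0 j + g i 1 * k 1 j := by
  simp [Matrix.mul_apply, Fin.sum_univ_two]

lemma sl_ext {g k : SL2 p} (h00 : g 0 0 = k 0 0) (h01 : g 0 1 = k 0 1) (h10 : g 1 0 = k 1 0)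
    (h11 : g 1 1 = k 1 1) : g = k := by
  ext i j
  fin_cases i <;> fin_cases j
  exacts [h00, h01, h10, h11]

/-- The determinant of the columns `i` of `g` and `j` of `g * k`. -/
lemma sl_mul_minor (g k : SL2 p) (j : Fin 2) :
    g 0 0 * (g * k) 1 j - (g * k) 0 j * g 1 0 = k 1 j ∧
      g 0 1 * (g * k) 1 j - (g * k) 0 j * g 1 1 = -k 0 j := by
  have hdet := sl_det g
  rw [sl_mul_apply, sl_mul_apply]
  exact ⟨by linear_combination k 1 j * hdet, by linear_combination -(k 0 j) * hdet⟩

lemma norm_rowMax_mul {g k : SL2 p} (hk : k ∈ slIntegral p) :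
    ‖rowMax ((g * k) 1 0) ((g * k) 1 1)‖ ≤ ‖rowMax (g 1 0) (g 1 1)‖ := by
  rw [mem_slIntegral] at hk
  rw [norm_rowMax, norm_rowMax, (sl_mul_row g k).1, (sl_mul_row g k).2]
  have h' : ∀ i j l, ‖g 1 l * k i j‖ ≤ max ‖g 1 0‖ ‖g 1 1‖ := by
    intro i j l
    rw [norm_mul]
    refine (mul_le_of_le_one_right (norm_nonneg _) (hk i j)).trans ?_
    fin_cases l
    · exact le_max_left _ _
    · exact le_max_right _ _
  exact max_le (norm_add_le_of_le (h' _ _ _) (h' _ _ _)) (norm_add_le_of_le (h' _ _ _) (h' _ _ _))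

lemma slIntegral_mul {g k : SL2 p} (hg : g ∈ slIntegral p) (hk : k ∈ slIntegral p) :
    g * k ∈ slIntegral p := by
  rw [mem_slIntegral] at *
  intro i j
  rw [sl_mul_apply]
  exact norm_add_le_of_le (norm_mul_le_of_le (hg _ _) (hk _ _))
    (norm_mul_le_of_le (hg _ _) (hk _ _))

lemma sl_inv_apply (g : SL2 p) :
    g⁻¹ 0 0 = g 1 1 ∧ g⁻¹ 0 1 = -g 0 1 ∧ g⁻¹ 1 0 = -g 1 0 ∧ g⁻¹ 1 1 = g 0 0 := by
  simp [Matrix.SpecialLinearGroup.coe_inv, Matrix.adjugate_fin_two]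

lemma slIntegral_inv {k : SL2 p} (hk : k ∈ slIntegral p) : k⁻¹ ∈ slIntegral p := by
  rw [mem_slIntegral] at *
  obtain ⟨h1, h2, h3, h4⟩ := sl_inv_apply k
  intro i j
  fin_cases i <;> fin_cases j
  · exact h1 ▸ hk 1 1
  · exact h2 ▸ (norm_neg (k 0 1)).symm ▸ hk 0 1
  · exact h3 ▸ (norm_neg (k 1 0)).symm ▸ hk 1 0
  · exact h4 ▸ hk 0 0

lemma norm_rowMax_mul_eq {g k : SL2 p} (hk : k ∈ slIntegral p) :
    ‖rowMax ((g * k) 1 0) ((g * k) 1 1)‖ = ‖rowMax (g 1 0) (g 1 1)‖ := by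
  refine le_antisymm (norm_rowMax_mul hk) ?_
  have h := norm_rowMax_mul (g := g * k) (slIntegral_inv hk)
  rwa [mul_inv_cancel_right] at h

lemma norm_quot_sub_le {a c a' c' e : ℚ_[p]} {r : ℝ} (hc : c ≠ 0) (hc' : c' ≠ 0)
    (he : a * c' - a' * c = e) (h1 : ‖e‖ ≤ 1) (h2 : ‖c‖ = r) (h3 : ‖c'‖ = r) :
    ‖a' / c' - a / c‖ ≤ (r ^ 2)⁻¹ := by
  have h : a' / c' - a / c = -e / (c * c') := by
    rw [← he]
    field_simp
    ring
  have hr : 0 < r := h2 ▸ norm_pos_iff.mpr hc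
  rw [h, norm_div, norm_neg, norm_mul, h2, h3, ← sq, div_eq_mul_inv]
  exact mul_le_of_le_one_left (by positivity) h1

/-- A difference of two quotients is, up to sign, a minor over a product of denominators; the minor
is an entry of `k` up to sign and both denominators have norm `‖rowMax‖`. Thus the quadratic phase
is unchanged on the support of the Gaussian. -/
lemma norm_rowQuot_mul_sub {g k : SL2 p} (hk : k ∈ slIntegral p) :
    ‖rowQuot (g * k) - rowQuot g‖ ≤ (‖rowMax (g 1 0) (g 1 1)‖ ^ 2)⁻¹ := by
  have hr := norm_rowMax_mul_eq (g := g) hk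
  have h0 := rowMax_ne_zero g
  have h0' := rowMax_ne_zero (g * k)
  rw [mem_slIntegral] at hk
  have hk' : ∀ j, ‖-k 0 j‖ ≤ 1 := fun j => (norm_neg (k 0 j)).symm ▸ hk 0 j
  unfold rowQuot
  rcases le_or_gt ‖g 1 1‖ ‖g 1 0‖ with h | h <;>
    rcases le_or_gt ‖(g * k) 1 1‖ ‖(g * k) 1 0‖ with h' | h'
  · rw [rowMax_of_le h] at *
    rw [rowMax_of_le h'] at *
    rw [if_pos h, if_pos h']
    exact norm_quot_sub_le h0 h0' (sl_mul_minor g k 0).1 (hk 1 0) rfl hr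
  · rw [rowMax_of_le h] at *
    rw [rowMax_of_lt h'] at *
    rw [if_pos h, if_neg h'.not_ge]
    exact norm_quot_sub_le h0 h0' (sl_mul_minor g k 1).1 (hk 1 1) rfl hr
  · rw [rowMax_of_lt h] at *
    rw [rowMax_of_le h'] at *
    rw [if_neg h.not_ge, if_pos h']
    exact norm_quot_sub_le h0 h0' (sl_mul_minor g k 0).2 (hk' 0) rfl hr
  · rw [rowMax_of_lt h] at *
    rw [rowMax_of_lt h'] at *
    rw [if_neg h.not_ge, if_neg h'.not_ge]
    exact norm_quot_sub_le h0 h0' (sl_mul_minor g k 1).2 (hk' 1) rfl hr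

/-- The reflection of a matrix at its antidiagonal, an anti-automorphism of `SL₂`. -/
def antiRefl (g : SL2 p) : SL2 p :=
  ⟨!![g 1 1, g 0 1; g 1 0, g 0 0], by
    rw [Matrix.det_fin_two_of, mul_comm]
    exact sl_det g⟩

lemma antiRefl_apply (g : SL2 p) :
    antiRefl g 0 0 = g 1 1 ∧ antiRefl g 0 1 = g 0 1 ∧ antiRefl g 1 0 = g 1 0 ∧
      antiRefl g 1 1 = g 0 0 := by
  simp [antiRefl]

lemma antiRefl_mul (g k : SL2 p) : antiRefl (g * k) = antiRefl k * antiRefl g := by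
  apply sl_ext <;> rw [sl_mul_apply] <;> simp only [antiRefl_apply, sl_mul_apply] <;> ring

lemma antiRefl_mem {k : SL2 p} (hk : k ∈ slIntegral p) : antiRefl k ∈ slIntegral p := by
  rw [mem_slIntegral] at *
  intro i j
  fin_cases i <;> fin_cases j <;> simp [antiRefl, hk]

lemma exists_xCoord_antiRefl (g : SL2 p) :
    ∃ e : ℚ_[p], e ≠ 0 ∧ xCoord (antiRefl g) = xCoord g * e ^ 2 := by
  obtain ⟨-, -, h10, h11⟩ := antiRefl_apply g
  by_cases hc : g 1 0 = 0
  · have hdet := sl_det g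
    rw [hc, mul_zero, sub_zero] at hdet
    refine ⟨g 0 0, left_ne_zero_of_mul (hdet ▸ one_ne_zero), ?_⟩
    rw [xCoord_of_eq_zero (h10.trans hc), xCoord_of_eq_zero hc, h11]
    linear_combination -(g 0 0) * hdet
  · refine ⟨1, one_ne_zero, ?_⟩
    rw [xCoord_of_ne_zero (h10 ▸ hc), xCoord_of_ne_zero hc, h10]
    ring

/-- The reflection changes `xCoord` only by a square, because `a = d⁻¹` when `c = 0`, and the
Hilbert symbol is symmetric. -/
lemma cocycle_antiRefl (g k : SL2 p) : cocycle (antiRefl k) (antiRefl g) = cocycle g k := by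
  obtain ⟨e1, h1, e1'⟩ := exists_xCoord_antiRefl g
  obtain ⟨e2, h2, e2'⟩ := exists_xCoord_antiRefl k
  obtain ⟨e3, h3, e3'⟩ := exists_xCoord_antiRefl (g * k)
  unfold cocycle
  rw [← antiRefl_mul, e1', e2', e3']
  have a1 : xCoord k * e2 ^ 2 * (xCoord (g * k) * e3 ^ 2) =
      xCoord k * xCoord (g * k) * (e2 * e3) ^ 2 := by ring
  have a2 : xCoord g * e1 ^ 2 * (xCoord (g * k) * e3 ^ 2) =
      xCoord g * xCoord (g * k) * (e1 * e3) ^ 2 := by ring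
  rw [a1, a2, hilbertSymbol_mul_sq_right _ _ (mul_ne_zero h1 h3), hilbertSymbol_comm,
    hilbertSymbol_mul_sq_right _ _ (mul_ne_zero h2 h3)]

lemma splitSign_antiRefl (hp : p ≠ 2) {k : SL2 p} (hk : k ∈ slIntegral p) :
    splitSign (antiRefl k) = splitSign k := by
  obtain ⟨-, -, h10, h11⟩ := antiRefl_apply k
  by_cases h0 : k 1 0 = 0
  · rw [splitSign_of_eq_zero (h10.trans h0), splitSign_of_eq_zero h0]
  rcases (mem_slIntegral.mp hk 1 0).lt_or_eq with h | h
  · obtain ⟨ha, hd⟩ := norm_diag_of_norm_lt_one hk h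
    rw [splitSign_of_norm_lt_one hp (h10 ▸ h0) (h11 ▸ ha), splitSign_of_norm_lt_one hp h0 hd, h10,
      h11]
    have hdet := sl_det k
    have h1 : leg (k 0 0 * k 1 1) = 1 := by
      rw [leg_of_norm_sub_lt hp (b := 1) (by simp), leg_one]
      have : k 0 0 * k 1 1 - 1 = k 0 1 * k 1 0 := by linear_combination hdet
      rw [this, norm_one]
      rw [norm_mul]
      exact mul_lt_one_of_nonneg_of_lt_one_right (mem_slIntegral.mp hk 0 1) (norm_nonneg _) h
    rw [leg_mul hp (ne_zero_of_norm_eq_one ha) (ne_zero_of_norm_eq_one hd)] at h1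
    rw [hilbertSymbol_comm, hilbertSymbol_unit_left hp ha h0, hilbertSymbol_comm,
      hilbertSymbol_unit_left hp hd h0, eq_inv_of_mul_eq_one_left h1, Int.units_inv_eq_self]
  · rw [splitSign_of_norm_eq_one (h10 ▸ h), splitSign_of_norm_eq_one h]

section

variable {ψ : AddChar ℚ_[p] Circle} (hψ : IsUnramifiedChar ψ) (hp : p ≠ 2)

include hψ hp

/-- Support, absolute value and quadratic phase on the support are all unchanged; only `rowPhase`
registers `k`. So `1_{ℤ_p}` is spherical with respect to the splitting. -/
lemma weilRep_charZp_mul {g k : SL2 p} (hk : k ∈ slIntegral p) (x : ℚ_[p]) :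
    weilRep ψ ⟨g * k, 1⟩ charZp x =
      (((cocycle g k * splitSign k : ℤˣ) : ℤ) : ℂ) * weilRep ψ ⟨g, 1⟩ charZp x := by
  have hr := norm_rowMax_mul_eq (g := g) hk
  have h0 := rowMax_ne_zero g
  rw [weilRep_charZp hψ hp, weilRep_charZp hψ hp, rowPhase_mul ψ hp hk, hr,
    charZp_congr (x := x / rowMax ((g * k) 1 0) ((g * k) 1 1)) (y := x / rowMax (g 1 0) (g 1 1))
      (by rw [norm_div, norm_div, hr])]
  rcases le_or_gt ‖x / rowMax (g 1 0) (g 1 1)‖ 1 with h | h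
  · have : ψ (rowQuot (g * k) * x ^ 2) = ψ (rowQuot g * x ^ 2) := by
      refine psi_congr hψ ?_
      rw [← sub_mul, norm_mul, norm_pow]
      rw [norm_div, div_le_one (norm_pos_iff.mpr h0)] at h
      calc _ ≤ (‖rowMax (g 1 0) (g 1 1)‖ ^ 2)⁻¹ * ‖rowMax (g 1 0) (g 1 1)‖ ^ 2 := by
            gcongr
            exact norm_rowQuot_mul_sub hk
        _ = 1 := inv_mul_cancel₀ (by positivity)
    rw [this]
    ring
  · rw [charZp_of_lt h]
    ring

lemma weilMC_mul {g k : SL2 p} (hk : k ∈ slIntegral p) :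
    weilMC ψ (g * k) = (((cocycle g k * splitSign k : ℤˣ) : ℤ) : ℂ) * weilMC ψ g := by
  unfold weilMC
  simp_rw [weilRep_charZp_mul hψ hp hk]
  rw [integral_const_mul]

lemma weilMC_of_eq_zero {g : SL2 p} (hc : g 1 0 = 0) :
    weilMC ψ g = gam ψ (-g 1 1) * (((√‖g 1 1‖)⁻¹ : ℝ) : ℂ) *
      ∫ x, (ψ (g 0 1 / g 1 1 * x ^ 2) : ℂ) * charZp (x / g 1 1) * charZp x ∂padicHaar p := by
  have hd0 : g 1 1 ≠ 0 := (sl_row_ne_zero g).resolve_left (not_not.mpr hc)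
  have hlt : ‖g 1 0‖ < ‖g 1 1‖ := by rw [hc, norm_zero]; exact norm_pos_iff.mpr hd0
  unfold weilMC
  simp_rw [weilRep_charZp hψ hp, rowMax_of_lt hlt, rowQuot, if_neg (not_le.mpr hlt), hc,
    rowPhase_zero ψ hd0]
  rw [integral_const_mul, integral_mul_charZp]

lemma weilMC_antiRefl_of_eq_zero {g : SL2 p} (hc : g 1 0 = 0) :
    weilMC ψ (antiRefl g) = weilMC ψ g := by
  obtain ⟨h00, h01, h10, h11⟩ := antiRefl_apply g
  have hd0 : g 1 1 ≠ 0 := (sl_row_ne_zero g).resolve_left (not_not.mpr hc)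
  have hdet := sl_det g
  rw [hc, mul_zero, sub_zero] at hdet
  have ha : g 0 0 = (g 1 1)⁻¹ := eq_inv_of_mul_eq_one_left hdet
  rw [weilMC_of_eq_zero hψ hp hc, weilMC_of_eq_zero hψ hp (h10.trans hc), h01, h11, ha, ← inv_neg,
    gam_inv]
  have h := integral_comp_mul hd0
    fun x => (ψ (g 0 1 / g 1 1 * x ^ 2) : ℂ) * charZp (x / g 1 1) * charZp x
  have h' : (fun x => (ψ (g 0 1 / (g 1 1)⁻¹ * x ^ 2) : ℂ) * charZp (x / (g 1 1)⁻¹) * charZp x) =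
      fun x => (ψ (g 0 1 / g 1 1 * (g 1 1 * x) ^ 2) : ℂ) * charZp (g 1 1 * x / g 1 1) *
        charZp (g 1 1 * x) := by
    ext x
    have e1 : g 0 1 / (g 1 1)⁻¹ * x ^ 2 = g 0 1 / g 1 1 * (g 1 1 * x) ^ 2 := by field_simp
    have e2 : g 1 1 * x / g 1 1 = x := by field_simp
    have e3 : x / (g 1 1)⁻¹ = g 1 1 * x := by field_simp
    rw [e1, e2, e3]
    ring
  rw [h', h, Complex.real_smul, norm_inv]
  have h2 : (√‖g 1 1‖⁻¹)⁻¹ * ‖g 1 1‖⁻¹ = (√‖g 1 1‖)⁻¹ := by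
    have h3 : 0 < √‖g 1 1‖ := Real.sqrt_pos.mpr (norm_pos_iff.mpr hd0)
    have h4 := Real.sq_sqrt (norm_nonneg (g 1 1))
    rw [Real.sqrt_inv, inv_inv]
    nth_rw 2 [← h4]
    field_simp
  rw [← h2]
  push_cast
  ring

/-- On the big cell the coefficient is a double integral over `ℤ_p × ℤ_p` of `ψ((a x² - 2 x y + d
y²)/c)`; exchanging `x` and `y` exchanges `a` and `d`. -/
lemma weilMC_antiRefl (g : SL2 p) : weilMC ψ (antiRefl g) = weilMC ψ g := by
  obtain ⟨h00, h01, h10, h11⟩ := antiRefl_apply g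
  unfold weilMC
  by_cases hc : g 1 0 = 0
  · exact weilMC_antiRefl_of_eq_zero hψ hp hc
  · have hc' : antiRefl g 1 0 ≠ 0 := by rwa [h10]
    simp_rw [weilRep_charZp_of_ne_zero hψ hp hc, weilRep_charZp_of_ne_zero hψ hp hc', h00, h10, h11]
    rw [integral_const_mul, integral_const_mul]
    congr 1
    simp_rw [← integral_const_mul, ← Circle.coe_mul, ← AddChar.map_add_eq_mul]
    rw [integral_integral_swap]
    · congr 1
      ext x
      congr 1
      ext y
      congr 2
      ring
    · rw [Measure.prod_restrict]
      refine ContinuousOn.integrableOn_compact ((isCompact_ball 0).prod (isCompact_ball 0)) ?_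
      exact ((continuous_psi hψ).comp (by fun_prop)).continuousOn

/-- Right equivariance transported by `antiRefl`, which preserves the cocycle, the splitting sign
and the coefficient. -/
lemma weilMC_mul_left {g k : SL2 p} (hk : k ∈ slIntegral p) :
    weilMC ψ (k * g) = (((cocycle k g * splitSign k : ℤˣ) : ℤ) : ℂ) * weilMC ψ g := by
  rw [← weilMC_antiRefl hψ hp, antiRefl_mul, weilMC_mul hψ hp (antiRefl_mem hk), cocycle_antiRefl,
    splitSign_antiRefl hp hk, weilMC_antiRefl hψ hp]

lemma weilMC_tMat_pow {n : ℕ} {u : ℚ_[p]ˣ} (hu : (u : ℚ_[p]) = (p : ℚ_[p]) ^ n) :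
    weilMC ψ (tMat u) = gam ψ (-(p : ℚ_[p]) ^ n) * (((√p : ℝ) ^ n : ℝ) : ℂ)⁻¹ := by
  have h10 : tMat u 1 0 = 0 := by simp [tMat]
  have h11 : tMat u 1 1 = ((p : ℚ_[p]) ^ n)⁻¹ := by simp [tMat, hu]
  have h01 : tMat u 0 1 = 0 := by simp [tMat]
  rw [weilMC_of_eq_zero hψ hp h10, h11, h01, ← inv_neg, gam_inv, integral_mul_charZp]
  have h : ∫ x in ball p 0, (ψ (0 / ((p : ℚ_[p]) ^ n)⁻¹ * x ^ 2) : ℂ) *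
      charZp (x / ((p : ℚ_[p]) ^ n)⁻¹) ∂padicHaar p = ∫ x in ball p 0, charZp x ∂padicHaar p := by
    refine setIntegral_congr_fun (measurableSet_ball 0) fun x hx => ?_
    rw [mem_ball, zpow_zero] at hx
    have h1 : ‖x / ((p : ℚ_[p]) ^ n)⁻¹‖ ≤ 1 := by
      rw [div_inv_eq_mul, norm_mul, norm_pow, Padic.norm_p]
      exact mul_le_one₀ hx (by positivity) (pow_le_one₀ (by positivity)
        (inv_le_one_of_one_le₀ one_lt_cast_p.le))
    simp only [zero_div, zero_mul, AddChar.map_zero_eq_one, Circle.coe_one, one_mul]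
    rw [charZp_of_le hx, charZp_of_le h1]
  rw [h, setIntegral_charZp, mul_one, norm_inv, norm_pow, Padic.norm_p, inv_pow, inv_inv]
  have hs : √((p : ℝ) ^ n) = √(p : ℝ) ^ n :=
    (Real.sqrt_eq_iff_mul_self_eq (by positivity) (by positivity)).mpr
      (by rw [← mul_pow, Real.mul_self_sqrt (Nat.cast_nonneg p)])
  rw [hs]
  push_cast
  rfl

end

end

section

/-! ### Spherical averages of Iwahori-invariant functions -/

open Classical in
/-- The function of a row `(c, d)` that takes the value `α` for `|c| < |d|` and `β` otherwise. -/
def nu (α β : ℂ) (c d : ℚ_[p]) : ℂ := if ‖c‖ < ‖d‖ then α else β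

lemma nu_of_lt {α β : ℂ} {c d : ℚ_[p]} (h : ‖c‖ < ‖d‖) : nu α β c d = α := if_pos h

lemma nu_of_le {α β : ℂ} {c d : ℚ_[p]} (h : ‖d‖ ≤ ‖c‖) : nu α β c d = β := if_neg h.not_gt

lemma existsUnique_digit_one {x : ℚ_[p]} (hx : ‖x‖ ≤ 1) : ∃! i : ℕ, i < p ∧ ‖x - i‖ < 1 := by
  have h := existsUnique_digit hx 1
  simpa [norm_lt_one_iff_le] using h

/-- Among these `p + 1` rows exactly one has its first entry strictly smaller: this picks out one
point of the projective line over the residue field. The sum is therefore `α + p β`. -/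
lemma sum_nu {α β : ℂ} (hαβ : α + p * β = 0) {c d : ℚ_[p]} (h : c ≠ 0 ∨ d ≠ 0) :
    nu α β c d + ∑ i ∈ Finset.range p, nu α β (d + (i : ℚ_[p]) * c) c = 0 := by
  rcases lt_or_ge ‖c‖ ‖d‖ with hlt | hle
  · rw [nu_of_lt hlt]
    have : ∀ i ∈ Finset.range p, nu α β (d + (i : ℚ_[p]) * c) c = β := by
      intro i _
      refine nu_of_le ?_
      have h1 : ‖(i : ℚ_[p]) * c‖ < ‖d‖ := by
        rw [norm_mul]
        exact (mul_le_of_le_one_left (norm_nonneg _) (norm_natCast_le_one i)).trans_lt hlt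
      rw [norm_eq_of_norm_sub_lt (a := d) (a' := d + (i : ℚ_[p]) * c) (by rwa [add_sub_cancel_left])]
      exact hlt.le
    rw [Finset.sum_congr rfl this, Finset.sum_const, Finset.card_range, nsmul_eq_mul, hαβ]
  · have hc : c ≠ 0 := by
      rintro rfl
      rw [norm_zero] at hle
      exact h.elim (fun h => h rfl) fun h => h (norm_le_zero_iff.mp hle)
    rw [nu_of_le hle]
    obtain ⟨i, ⟨hi, hi1⟩, huniq⟩ := existsUnique_digit_one (x := -(d / c)) (by
      rw [norm_neg, norm_div]
      exact div_le_one_of_le₀ hle (norm_nonneg _))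
    have key : ∀ j : ℕ, ‖d + j * c‖ < ‖c‖ ↔ ‖-(d / c) - j‖ < 1 := by
      intro j
      have e : d + j * c = -(c * (-(d / c) - j)) := by field_simp; ring
      rw [e, norm_neg, norm_mul]
      exact mul_lt_iff_lt_one_right (norm_pos_iff.mpr hc)
    rw [← Finset.add_sum_erase _ _ (Finset.mem_range.mpr hi), nu_of_lt ((key i).mpr hi1)]
    have : ∀ j ∈ (Finset.range p).erase i, nu α β (d + (j : ℚ_[p]) * c) c = β := by
      intro j hj
      rw [Finset.mem_erase, Finset.mem_range] at hj
      refine nu_of_le (not_lt.mp fun hlt => hj.1 (huniq j ⟨hj.2, (key j).mp hlt⟩))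
    rw [Finset.sum_congr rfl this, Finset.sum_const, Finset.card_erase_of_mem
      (Finset.mem_range.mpr hi), Finset.card_range, nsmul_eq_mul,
      Nat.cast_sub (Fact.out : p.Prime).one_le]
    linear_combination hαβ

lemma sMat_mem : (sMat : SL2 p) ∈ slIntegral p := by
  rw [mem_slIntegral]
  intro i j
  fin_cases i <;> fin_cases j <;> simp [sMat]

lemma nMat_mem {x : ℚ_[p]} (hx : ‖x‖ ≤ 1) : nMat x ∈ slIntegral p := by
  rw [mem_slIntegral]
  intro i j
  fin_cases i <;> fin_cases j <;> simp [nMat, hx]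

variable (p) in
/-- A topological group `G` between `SL₂(ℚ_p)` and the matrix algebra, with a left Haar measure that
is right invariant under the compact subgroup of integral elements. -/
structure MatrixGroup (G : Type) [Group G] [TopologicalSpace G] [MeasurableSpace G] where
  /-- the matrix of an element -/
  m : G →* Matrix (Fin 2) (Fin 2) ℚ_[p]
  /-- the embedding of `SL₂` -/
  ι : SL2 p →* G
  /-- the measure -/
  μ : Measure G
  continuous_m : Continuous m
  m_ι : ∀ g i j, m (ι g) i j = g i j
  isCompact : IsCompact {k : G | ∀ i j, ‖m k i j‖ ≤ 1 ∧ ‖m k⁻¹ i j‖ ≤ 1}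
  finite : IsFiniteMeasureOnCompacts μ
  left : μ.IsMulLeftInvariant
  right : ∀ k : G, (∀ i j, ‖m k i j‖ ≤ 1 ∧ ‖m k⁻¹ i j‖ ≤ 1) → μ.map (· * k) = μ

namespace MatrixGroup

set_option linter.unusedSectionVars false

variable {G : Type} [Group G] [TopologicalSpace G] [IsTopologicalGroup G] [T2Space G]
  [MeasurableSpace G] [BorelSpace G] (M : MatrixGroup p G)

lemma m_mul (x y : G) (i j : Fin 2) :
    M.m (x * y) i j = M.m x i 0 * M.m y 0 j + M.m x i 1 * M.m y 1 j := by
  rw [map_mul, Matrix.mul_apply, Fin.sum_univ_two]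

/-- The subgroup of integral elements. -/
def K : Subgroup G where
  carrier := {k : G | ∀ i j, ‖M.m k i j‖ ≤ 1 ∧ ‖M.m k⁻¹ i j‖ ≤ 1}
  one_mem' := by
    intro i j
    rw [inv_one, map_one, and_self]
    exact one_mem_integralMatrices p i j
  mul_mem' := by
    intro x y hx hy i j
    rw [mul_inv_rev, M.m_mul, M.m_mul]
    exact ⟨norm_add_le_of_le (norm_mul_le_of_le (hx _ _).1 (hy _ _).1)
      (norm_mul_le_of_le (hx _ _).1 (hy _ _).1),
      norm_add_le_of_le (norm_mul_le_of_le (hy _ _).2 (hx _ _).2)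
      (norm_mul_le_of_le (hy _ _).2 (hx _ _).2)⟩
  inv_mem' := by
    intro x hx i j
    rw [inv_inv]
    exact (hx i j).symm

lemma mem_K {k : G} : k ∈ M.K ↔ ∀ i j, ‖M.m k i j‖ ≤ 1 ∧ ‖M.m k⁻¹ i j‖ ≤ 1 := Iff.rfl

lemma norm_row {k : G} (hk : k ∈ M.K) : ‖M.m k 1 0‖ = 1 ∨ ‖M.m k 1 1‖ = 1 := by
  by_contra h
  push Not at h
  have h0 := ((M.mem_K.mp hk) 1 0).1.lt_of_ne h.1
  have h1 := ((M.mem_K.mp hk) 1 1).1.lt_of_ne h.2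
  have e : M.m k 1 0 * M.m k⁻¹ 0 1 + M.m k 1 1 * M.m k⁻¹ 1 1 = 1 := by
    rw [← M.m_mul, mul_inv_cancel, map_one, Matrix.one_apply_eq]
  have hlt : ∀ i, ∀ a : ℚ_[p], ‖a‖ < 1 → ‖a * M.m k⁻¹ i 1‖ < 1 := fun i a ha => by
    rw [norm_mul]
    exact mul_lt_one_of_nonneg_of_lt_one_left (norm_nonneg _) ha ((M.mem_K.mp hk) i 1).2
  have := (IsUltrametricDist.norm_add_le_max _ _).trans_lt (max_lt (hlt 0 _ h0) (hlt 1 _ h1))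
  rw [e, norm_one] at this
  exact lt_irrefl _ this

lemma norm_lt_one_iff {k : G} (hk : k ∈ M.K) : ‖M.m k 1 0‖ < 1 ↔ ‖M.m k 1 0‖ < ‖M.m k 1 1‖ := by
  constructor
  · intro h
    rwa [(M.norm_row hk).resolve_left h.ne]
  · exact fun h => h.trans_le ((M.mem_K.mp hk) 1 1).1

/-- The Iwahori subgroup. -/
def Γ : Subgroup G where
  carrier := {k : G | k ∈ M.K ∧ ‖M.m k 1 0‖ < 1}
  one_mem' := ⟨one_mem _, by simp⟩
  mul_mem' := by
    rintro x y ⟨hx, hx'⟩ ⟨hy, hy'⟩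
    refine ⟨mul_mem hx hy, ?_⟩
    rw [M.m_mul]
    refine (IsUltrametricDist.norm_add_le_max _ _).trans_lt (max_lt ?_ ?_)
    · rw [norm_mul]
      exact mul_lt_one_of_nonneg_of_lt_one_left (norm_nonneg _) hx' (hy _ _).1
    · rw [norm_mul]
      exact mul_lt_one_of_nonneg_of_lt_one_right (hx _ _).1 (norm_nonneg _) hy'
  inv_mem' := by
    rintro x ⟨hx, hx'⟩
    refine ⟨inv_mem hx, ?_⟩
    have hd : ‖M.m x 1 1‖ = 1 := (M.norm_row hx).resolve_left hx'.ne
    have e : M.m x 1 0 * M.m x⁻¹ 0 0 + M.m x 1 1 * M.m x⁻¹ 1 0 = 0 := by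
      rw [← M.m_mul, mul_inv_cancel, map_one, Matrix.one_apply_ne (by simp)]
    have h : ‖M.m x⁻¹ 1 0‖ = ‖M.m x 1 0 * M.m x⁻¹ 0 0‖ := by
      rw [eq_neg_of_add_eq_zero_left e, norm_neg, norm_mul, hd, one_mul]
    rw [h, norm_mul]
    exact mul_lt_one_of_nonneg_of_lt_one_left (norm_nonneg _) hx' (hx _ _).2

lemma Γ_le : M.Γ ≤ M.K := fun _ h => h.1

lemma isOpen_K : IsOpen (M.K : Set G) := by
  have h : (M.K : Set G) = ⋂ i : Fin 2, ⋂ j : Fin 2,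
      ((fun k => M.m k i j) ⁻¹' ball p 0 ∩ (fun k => M.m k⁻¹ i j) ⁻¹' ball p 0) := by
    ext k
    simp only [SetLike.mem_coe, M.mem_K, Set.mem_iInter, Set.mem_inter_iff, Set.mem_preimage,
      mem_ball, zpow_zero]
  rw [h]
  have hc : ∀ i j, Continuous fun k => M.m k i j := fun i j =>
    (continuous_apply_apply i j).comp M.continuous_m
  exact isOpen_iInter_of_finite fun i => isOpen_iInter_of_finite fun j =>
    ((isOpen_ball 0).preimage (hc i j)).inter ((isOpen_ball 0).preimage ((hc i j).comp continuous_inv))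

lemma isOpen_Γ : IsOpen (M.Γ : Set G) := by
  have h : (M.Γ : Set G) = (M.K : Set G) ∩ {k | ‖M.m k 1 0‖ < 1} := rfl
  rw [h]
  exact M.isOpen_K.inter (isOpen_lt
    (((continuous_apply_apply 1 0).comp M.continuous_m).norm) continuous_const)

lemma measurableSet_K : MeasurableSet (M.K : Set G) := M.isOpen_K.measurableSet

lemma measurableSet_Γ : MeasurableSet (M.Γ : Set G) := M.isOpen_Γ.measurableSet

lemma isCompact_K : IsCompact (M.K : Set G) := M.isCompact

lemma isCompact_Γ : IsCompact (M.Γ : Set G) :=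
  M.isCompact_K.of_isClosed_subset (Subgroup.isClosed_of_isOpen _ M.isOpen_Γ) M.Γ_le

lemma isCompact_diff : IsCompact ((M.K : Set G) \ M.Γ) := M.isCompact_K.diff M.isOpen_Γ

lemma nu_of_mem {α β : ℂ} {k : G} (hk : k ∈ M.Γ) : nu α β (M.m k 1 0) (M.m k 1 1) = α :=
  nu_of_lt ((M.norm_lt_one_iff hk.1).mp hk.2)

lemma nu_of_notMem {α β : ℂ} {k : G} (hk : k ∈ (M.K : Set G) \ M.Γ) :
    nu α β (M.m k 1 0) (M.m k 1 1) = β :=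
  nu_of_le (not_lt.mp fun h => hk.2 ⟨hk.1, (M.norm_lt_one_iff hk.1).mpr h⟩)

lemma setIntegral_mul_right {E : Type*} [NormedAddCommGroup E] [NormedSpace ℝ E] {k₀ : G}
    (hk : k₀ ∈ M.K) {S : Set G} (hS : (· * k₀) ⁻¹' S = S) (f : G → E) :
    ∫ k in S, f (k * k₀) ∂M.μ = ∫ k in S, f k ∂M.μ := by
  have hmp : MeasurePreserving (· * k₀) M.μ M.μ :=
    ⟨(continuous_mul_const k₀).measurable, M.right k₀ hk⟩
  have := hmp.setIntegral_preimage_emb (Homeomorph.mulRight k₀).measurableEmbedding f S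
  rwa [hS] at this

lemma preimage_mul_K {k₀ : G} (hk : k₀ ∈ M.K) : (· * k₀) ⁻¹' (M.K : Set G) = M.K := by
  ext k
  exact M.K.mul_mem_cancel_right hk

lemma continuous_of_invariant {P : G → ℂ} (hP : ∀ x, ∀ γ ∈ M.Γ, P (x * γ) = P x) :
    Continuous P := by
  refine IsLocallyConstant.continuous ((IsLocallyConstant.iff_exists_open P).mpr fun x => ?_)
  refine ⟨(x⁻¹ * ·) ⁻¹' M.Γ, M.isOpen_Γ.preimage (continuous_const_mul _), ?_, fun y hy => ?_⟩
  · simp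
  · have := hP x _ hy
    rwa [mul_inv_cancel_left] at this

/-- The average of `P` over `K x`, weighted by the function `nu α β` of the bottom row. -/
def sphAvg (P : G → ℂ) (α β : ℂ) (x : G) : ℂ :=
  ∫ k in (M.K : Set G), P (k * x) * nu α β (M.m k 1 0) (M.m k 1 1) ∂M.μ

section

variable {P : G → ℂ} (hP : ∀ x, ∀ γ ∈ M.Γ, P (x * γ) = P x) {α β : ℂ}

include hP

lemma sphAvg_mul_mem (x : G) {γ : G} (hγ : γ ∈ M.Γ) :
    M.sphAvg P α β (x * γ) = M.sphAvg P α β x := by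
  unfold sphAvg
  simp_rw [← mul_assoc, hP _ γ hγ]

lemma integrableOn_mul_nu (x : G) :
    IntegrableOn (fun k => P (k * x) * nu α β (M.m k 1 0) (M.m k 1 1)) (M.K : Set G) M.μ := by
  have := M.finite
  have hc : ∀ z : ℂ, Continuous (fun k => P (k * x) * z) := fun z =>
    ((M.continuous_of_invariant hP).comp (continuous_mul_const x)).mul continuous_const
  rw [← Set.union_sdiff_cancel M.Γ_le]
  refine IntegrableOn.union ?_ ?_
  · refine (((hc α).continuousOn.integrableOn_compact M.isCompact_Γ).congr_fun ?_ M.measurableSet_Γ)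
    exact fun k hk => by simp only [M.nu_of_mem hk]
  · refine (((hc β).continuousOn.integrableOn_compact M.isCompact_diff).congr_fun ?_
      (M.measurableSet_K.diff M.measurableSet_Γ))
    exact fun k hk => by simp only [M.nu_of_notMem hk]

lemma sphAvg_eq_add (x : G) :
    M.sphAvg P α β x = α * ∫ k in (M.Γ : Set G), P (k * x) ∂M.μ +
      β * ∫ k in (M.K : Set G) \ M.Γ, P (k * x) ∂M.μ := by
  have hint := M.integrableOn_mul_nu hP (α := α) (β := β) x
  have h1 : (M.K : Set G) = (M.Γ : Set G) ∪ (M.K : Set G) \ M.Γ := (Set.union_sdiff_cancel M.Γ_le).symm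
  unfold sphAvg
  rw [h1] at hint
  rw [h1, setIntegral_union Set.disjoint_sdiff_right (M.measurableSet_K.diff M.measurableSet_Γ)
    (hint.mono_set Set.subset_union_left) (hint.mono_set Set.subset_union_right), ← h1,
    mul_comm α, mul_comm β, ← integral_mul_const, ← integral_mul_const]
  congr 1
  · exact setIntegral_congr_fun M.measurableSet_Γ fun k hk => by simp only [M.nu_of_mem hk]
  · exact setIntegral_congr_fun (M.measurableSet_K.diff M.measurableSet_Γ)
      fun k hk => by simp only [M.nu_of_notMem hk]

omit hP in
-- Right translation of the integration variable moves `k₀` onto the weight. Hence left relations of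
-- the average come from `nu` and right relations from `P`.
lemma sphAvg_mul_left {k₀ : G} (hk : k₀ ∈ M.K) (x : G) :
    M.sphAvg P α β (k₀ * x) = ∫ k in (M.K : Set G),
      P (k * x) * nu α β (M.m (k * k₀⁻¹) 1 0) (M.m (k * k₀⁻¹) 1 1) ∂M.μ := by
  rw [← M.setIntegral_mul_right hk (M.preimage_mul_K hk)]
  unfold sphAvg
  simp_rw [mul_inv_cancel_right, mul_assoc]

lemma integrableOn_mul_nu_inv {k₀ : G} (hk : k₀ ∈ M.K) (x : G) :
    IntegrableOn (fun k => P (k * x) * nu α β (M.m (k * k₀⁻¹) 1 0) (M.m (k * k₀⁻¹) 1 1))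
      (M.K : Set G) M.μ := by
  have hmp : MeasurePreserving (· * k₀⁻¹) M.μ M.μ :=
    ⟨(continuous_mul_const k₀⁻¹).measurable, M.right _ (inv_mem hk)⟩
  have h := (hmp.integrableOn_comp_preimage (Homeomorph.mulRight k₀⁻¹).measurableEmbedding).mpr
    (M.integrableOn_mul_nu hP (α := α) (β := β) (k₀ * x))
  rw [M.preimage_mul_K (inv_mem hk)] at h
  refine h.congr_fun (fun k _ => ?_) M.measurableSet_K
  simp only [Function.comp_apply]
  rw [← mul_assoc, inv_mul_cancel_right]

omit hP in
lemma sphAvg_mem_mul {γ : G} (hγ : γ ∈ M.Γ) (x : G) :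
    M.sphAvg P α β (γ * x) = M.sphAvg P α β x := by
  rw [M.sphAvg_mul_left (M.Γ_le hγ)]
  refine setIntegral_congr_fun M.measurableSet_K fun k hk => ?_
  congr 1
  by_cases h : k ∈ M.Γ
  · rw [M.nu_of_mem h, M.nu_of_mem (mul_mem h (inv_mem hγ))]
  · rw [M.nu_of_notMem ⟨hk, h⟩, M.nu_of_notMem ⟨mul_mem hk (inv_mem (M.Γ_le hγ)), fun h' => h ?_⟩]
    exact (M.Γ.mul_mem_cancel_right (inv_mem hγ)).mp h'

omit hP in
lemma ι_mem_K {g : SL2 p} (hg : g ∈ slIntegral p) : M.ι g ∈ M.K := by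
  intro i j
  rw [← map_inv, M.m_ι, M.m_ι]
  exact ⟨mem_slIntegral.mp hg i j, mem_slIntegral.mp (slIntegral_inv hg) i j⟩

omit hP in
lemma ι_mem_Γ {g : SL2 p} (hg : g ∈ slGamma0 p) : M.ι g ∈ M.Γ :=
  ⟨M.ι_mem_K hg.1, by rw [M.m_ι]; exact hg.2⟩

/-- The sum over the lower neighbours vanishes. -/
lemma sphAvg_left_relation (hαβ : α + p * β = 0) (x : G) :
    M.sphAvg P α β x + ∑ i ∈ Finset.range p, M.sphAvg P α β (M.ι (sMat * nMat i) * x) = 0 := by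
  have hmem : ∀ i : ℕ, M.ι (sMat * nMat (i : ℚ_[p])) ∈ M.K := fun i =>
    M.ι_mem_K (slIntegral_mul sMat_mem (nMat_mem (norm_natCast_le_one i)))
  rw [Finset.sum_congr rfl fun i _ => M.sphAvg_mul_left (hmem i) x,
    ← integral_finsetSum _ fun i _ => M.integrableOn_mul_nu_inv hP (hmem i) x]
  unfold sphAvg
  rw [← integral_add (M.integrableOn_mul_nu hP x)
    (integrable_finsetSum _ fun i _ => M.integrableOn_mul_nu_inv hP (hmem i) x)]
  refine (setIntegral_congr_fun M.measurableSet_K fun k hk => ?_).trans (integral_zero _ _)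
  rw [← Finset.mul_sum, ← mul_add]
  refine mul_eq_zero_of_right _ ?_
  have h1 : ∀ i : ℕ, M.m (k * (M.ι (sMat * nMat (i : ℚ_[p])))⁻¹) 1 0 =
      M.m k 1 1 + i * -M.m k 1 0 := by
    intro i
    rw [← map_inv, M.m_mul, M.m_ι, M.m_ι, (sl_inv_apply _).1, (sl_inv_apply _).2.2.1, sl_mul_apply,
      sl_mul_apply]
    simp [sMat, nMat]
    ring
  have h2 : ∀ i : ℕ, M.m (k * (M.ι (sMat * nMat (i : ℚ_[p])))⁻¹) 1 1 = -M.m k 1 0 := by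
    intro i
    rw [← map_inv, M.m_mul, M.m_ι, M.m_ι, (sl_inv_apply _).2.1, (sl_inv_apply _).2.2.2, sl_mul_apply,
      sl_mul_apply]
    simp [sMat, nMat]
  simp_rw [h1, h2]
  have h3 : nu α β (M.m k 1 0) (M.m k 1 1) = nu α β (-M.m k 1 0) (M.m k 1 1) := by
    unfold nu
    rw [norm_neg]
  rw [h3]
  refine sum_nu hαβ ?_
  rcases M.norm_row hk with h | h
  · exact Or.inl (neg_ne_zero.mpr (ne_zero_of_norm_eq_one h))
  · exact Or.inr (ne_zero_of_norm_eq_one h)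

lemma sphAvg_right_relation
    (hsum : ∀ x, P x + ∑ i ∈ Finset.range p, P (x * M.ι (nMat (i : ℚ_[p]) * sMat)) = 0) (x : G) :
    M.sphAvg P α β x + ∑ i ∈ Finset.range p,
      M.sphAvg P α β (x * M.ι (nMat (i : ℚ_[p]) * sMat)) = 0 := by
  unfold sphAvg
  rw [← integral_finsetSum _ fun i _ => M.integrableOn_mul_nu hP _,
    ← integral_add (M.integrableOn_mul_nu hP x)
    (integrable_finsetSum _ fun i _ => M.integrableOn_mul_nu hP _)]
  refine (setIntegral_congr_fun M.measurableSet_K fun k hk => ?_).trans (integral_zero _ _)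
  rw [← Finset.sum_mul, ← add_mul]
  simp_rw [← mul_assoc]
  rw [hsum, zero_mul]

end

/-- The index of the Iwahori subgroup, read off from the left relation for `P = 1`: with weight `p`
on `Γ` and `-1` off it the average is a constant, and `p + 1` copies of it sum to zero. -/
lemma measureReal_diff :
    M.μ.real ((M.K : Set G) \ M.Γ) = p * M.μ.real M.Γ := by
  have h := M.sphAvg_left_relation (P := fun _ => 1) (fun _ _ _ => rfl) (α := p) (β := -1)
    (by ring) 1
  have h1 : ∀ x, M.sphAvg (fun _ => 1) p (-1) x = M.sphAvg (fun _ => 1) p (-1) 1 := fun _ => rfl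
  simp_rw [h1] at h
  rw [Finset.sum_const, Finset.card_range, nsmul_eq_mul, ← one_add_mul] at h
  have h2 : (1 + (p : ℂ)) ≠ 0 := by
    rw [add_comm]
    exact Nat.cast_add_one_ne_zero p
  have h3 := (mul_eq_zero.mp h).resolve_left h2
  rw [M.sphAvg_eq_add (fun _ _ _ => rfl), setIntegral_const, setIntegral_const] at h3
  simp only [Complex.real_smul, mul_one] at h3
  have h4 : ((M.μ.real ((M.K : Set G) \ M.Γ) : ℝ) : ℂ) = ((p * M.μ.real M.Γ : ℝ) : ℂ) := by
    push_cast
    linear_combination -h3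
  exact_mod_cast h4

end MatrixGroup

end

section

/-! ### The torus and the values of Steinberg functions on it -/

/-- The lower triangular unipotent matrix. -/
def nLow (z : ℚ_[p]) : SL2 p := ⟨!![1, 0; z, 1], by simp [Matrix.det_fin_two]⟩

variable (p) in
/-- The matrix `diag(p ^ n, p ^ (-n))`. -/
def tp (n : ℤ) : SL2 p := tMat (uniformizer p ^ n)

lemma tp_apply (n : ℤ) : tp p n 0 0 = (p : ℚ_[p]) ^ n ∧ tp p n 0 1 = 0 ∧ tp p n 1 0 = 0 ∧
    tp p n 1 1 = ((p : ℚ_[p]) ^ n)⁻¹ := by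
  simp [tp, tMat, uniformizer]

lemma sMat_apply : (sMat : SL2 p) 0 0 = 0 ∧ (sMat : SL2 p) 0 1 = 1 ∧ (sMat : SL2 p) 1 0 = -1 ∧
    (sMat : SL2 p) 1 1 = 0 := by
  simp [sMat]

lemma nMat_apply (x : ℚ_[p]) : nMat x 0 0 = 1 ∧ nMat x 0 1 = x ∧ nMat x 1 0 = 0 ∧
    nMat x 1 1 = 1 := by
  simp [nMat]

lemma nLow_apply (x : ℚ_[p]) : nLow x 0 0 = 1 ∧ nLow x 0 1 = 0 ∧ nLow x 1 0 = x ∧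
    nLow x 1 1 = 1 := by
  simp [nLow]

lemma mem_slGamma0_of_entries {k : SL2 p} (h00 : ‖k 0 0‖ ≤ 1) (h01 : ‖k 0 1‖ ≤ 1)
    (h10 : ‖k 1 0‖ < 1) (h11 : ‖k 1 1‖ ≤ 1) : k ∈ slGamma0 p := by
  refine ⟨mem_slIntegral.mpr fun i j => ?_, h10⟩
  fin_cases i <;> fin_cases j
  exacts [h00, h01, h10.le, h11]

lemma nMat_mem_slGamma0 {x : ℚ_[p]} (hx : ‖x‖ ≤ 1) : nMat x ∈ slGamma0 p :=
  ⟨nMat_mem hx, by simp [nMat]⟩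

lemma nLow_mem_slGamma0 {x : ℚ_[p]} (hx : ‖x‖ < 1) : nLow x ∈ slGamma0 p := by
  apply mem_slGamma0_of_entries <;> simp [nLow, hx]

lemma tp_mul_nMat (n : ℤ) (x : ℚ_[p]) :
    tp p n * nMat x = nMat (((p : ℚ_[p]) ^ n) ^ 2 * x) * tp p n := by
  have h0 : (p : ℚ_[p]) ^ n ≠ 0 := zpow_ne_zero _ cast_p_ne_zero
  obtain ⟨a1, a2, a3, a4⟩ := tp_apply (p := p) n
  obtain ⟨b1, b2, b3, b4⟩ := nMat_apply x
  obtain ⟨c1, c2, c3, c4⟩ := nMat_apply (((p : ℚ_[p]) ^ n) ^ 2 * x)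
  apply sl_ext <;> simp only [sl_mul_apply, a1, a2, a3, a4, b1, b2, b3, b4, c1, c2, c3, c4] <;>
    field_simp <;> ring

lemma nLow_mul_tp (n : ℤ) (x : ℚ_[p]) :
    nLow x * tp p n = tp p n * nLow (((p : ℚ_[p]) ^ n) ^ 2 * x) := by
  have h0 : (p : ℚ_[p]) ^ n ≠ 0 := zpow_ne_zero _ cast_p_ne_zero
  obtain ⟨a1, a2, a3, a4⟩ := tp_apply (p := p) n
  obtain ⟨b1, b2, b3, b4⟩ := nLow_apply x
  obtain ⟨c1, c2, c3, c4⟩ := nLow_apply (((p : ℚ_[p]) ^ n) ^ 2 * x)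
  apply sl_ext <;> simp only [sl_mul_apply, a1, a2, a3, a4, b1, b2, b3, b4, c1, c2, c3, c4] <;>
    field_simp <;> ring

lemma sMat_mul_tp (n : ℤ) : sMat * tp p n = tp p (-n) * sMat := by
  obtain ⟨a1, a2, a3, a4⟩ := tp_apply (p := p) n
  obtain ⟨b1, b2, b3, b4⟩ := tp_apply (p := p) (-n)
  obtain ⟨c1, c2, c3, c4⟩ := sMat_apply (p := p)
  apply sl_ext <;> simp only [sl_mul_apply, a1, a2, a3, a4, b1, b2, b3, b4, c1, c2, c3, c4] <;>
    simp

/-- The upper triangular matrix with first row `(u, x)`. -/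
def upMat {u : ℚ_[p]} (hu : u ≠ 0) (x : ℚ_[p]) : SL2 p :=
  ⟨!![u, x; 0, u⁻¹], by simp [Matrix.det_fin_two, hu]⟩

lemma upMat_apply {u : ℚ_[p]} (hu : u ≠ 0) (x : ℚ_[p]) : upMat hu x 0 0 = u ∧ upMat hu x 0 1 = x ∧
    upMat hu x 1 0 = 0 ∧ upMat hu x 1 1 = u⁻¹ := by
  simp [upMat]

lemma upMat_mem {u : ℚ_[p]} (hu : ‖u‖ = 1) {x : ℚ_[p]} (hx : ‖x‖ ≤ 1) (h0 : u ≠ 0) :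
    upMat h0 x ∈ slGamma0 p := by
  apply mem_slGamma0_of_entries <;> simp [upMat, hu, hx]

/-- For a unit `u` the product can be rewritten with a lower unipotent, which a nontrivial positive
power of the torus contracts. This collapses the terms `i ≠ 0` of the left relation. -/
lemma exists_sMat_mul_nMat {u : ℚ_[p]} (hu : ‖u‖ = 1) :
    ∃ γ ∈ slGamma0 p, sMat * nMat u = γ * nLow u⁻¹ := by
  have h0 := ne_zero_of_norm_eq_one hu
  have h1 : -u⁻¹ ≠ 0 := neg_ne_zero.mpr (inv_ne_zero h0)
  refine ⟨upMat h1 1, upMat_mem (by simp [hu]) (by simp) h1, ?_⟩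
  obtain ⟨a1, a2, a3, a4⟩ := nMat_apply u
  obtain ⟨b1, b2, b3, b4⟩ := nLow_apply u⁻¹
  obtain ⟨c1, c2, c3, c4⟩ := sMat_apply (p := p)
  obtain ⟨d1, d2, d3, d4⟩ := upMat_apply h1 1
  apply sl_ext <;> simp only [sl_mul_apply, a1, a2, a3, a4, b1, b2, b3, b4, c1, c2, c3, c4, d1, d2,
    d3, d4] <;> simp [h0, inv_neg]

lemma exists_nMat_mul_sMat {u : ℚ_[p]} (hu : ‖u‖ = 1) :
    ∃ γ ∈ slGamma0 p, nMat u * sMat = nLow u⁻¹ * γ := by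
  have h0 := ne_zero_of_norm_eq_one hu
  have h1 : -u ≠ 0 := neg_ne_zero.mpr h0
  refine ⟨upMat h1 1, upMat_mem (by simp [hu]) (by simp) h1, ?_⟩
  obtain ⟨a1, a2, a3, a4⟩ := nMat_apply u
  obtain ⟨b1, b2, b3, b4⟩ := nLow_apply u⁻¹
  obtain ⟨c1, c2, c3, c4⟩ := sMat_apply (p := p)
  obtain ⟨d1, d2, d3, d4⟩ := upMat_apply h1 1
  apply sl_ext <;> simp only [sl_mul_apply, a1, a2, a3, a4, b1, b2, b3, b4, c1, c2, c3, c4, d1, d2,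
    d3, d4] <;> simp [h0, inv_neg]

lemma norm_natCast_eq_one {i : ℕ} (hi : i < p) (h0 : i ≠ 0) : ‖(i : ℚ_[p])‖ = 1 := by
  refine le_antisymm (norm_natCast_le_one i) (not_lt.mp fun h => ?_)
  have h' : ‖((i : ℤ) : ℚ_[p])‖ < 1 := by simpa using h
  rw [Padic.norm_intCast_lt_one_iff] at h'
  have := Nat.le_of_dvd (Nat.pos_of_ne_zero h0) (Int.natCast_dvd_natCast.mp h')
  omega

/-- The identities satisfied by the matrix coefficients of a newvector of a special
representation. -/
structure IsSteinbergCoeff (F : SL2 p → ℂ) : Prop where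
  left : ∀ γ ∈ slGamma0 p, ∀ x, F (γ * x) = F x
  right : ∀ γ ∈ slGamma0 p, ∀ x, F (x * γ) = F x
  left_relation : ∀ x, F x + ∑ i ∈ Finset.range p, F (sMat * nMat (i : ℚ_[p]) * x) = 0
  right_relation : ∀ x, F x + ∑ i ∈ Finset.range p, F (x * (nMat (i : ℚ_[p]) * sMat)) = 0

lemma sum_range_eq_of_ne_zero {f : ℕ → ℂ} {z : ℂ} (h : ∀ i < p, i ≠ 0 → f i = z) :
    ∑ i ∈ Finset.range p, f i = f 0 + (p - 1) * z := by
  have hp := (Fact.out : p.Prime)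
  rw [← Finset.add_sum_erase _ _ (Finset.mem_range.mpr hp.pos),
    Finset.sum_congr rfl fun i hi => h i (Finset.mem_range.mp (Finset.mem_of_mem_erase hi))
      (Finset.ne_of_mem_erase hi), Finset.sum_const,
    Finset.card_erase_of_mem (Finset.mem_range.mpr hp.pos), Finset.card_range, nsmul_eq_mul,
    Nat.cast_sub hp.one_le, Nat.cast_one]

lemma norm_p_pow_le (n : ℕ) : ‖(p : ℚ_[p]) ^ (n : ℤ)‖ ≤ 1 := by
  rw [Padic.norm_p_zpow]
  exact zpow_neg_natCast_le_one n

lemma norm_p_pow_lt {n : ℕ} (hn : n ≠ 0) : ‖(p : ℚ_[p]) ^ (n : ℤ)‖ < 1 := by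
  rw [zpow_natCast, norm_pow, Padic.norm_p]
  exact pow_lt_one₀ (by positivity) (inv_lt_one_of_one_lt₀ one_lt_cast_p) hn

lemma nMat_zero : (nMat 0 : SL2 p) = 1 := by
  apply sl_ext <;> simp [nMat]

lemma nMat_add (x y : ℚ_[p]) : nMat (x + y) = nMat x * nMat y := by
  obtain ⟨a1, a2, a3, a4⟩ := nMat_apply x
  obtain ⟨b1, b2, b3, b4⟩ := nMat_apply y
  obtain ⟨c1, c2, c3, c4⟩ := nMat_apply (x + y)
  apply sl_ext <;> simp only [sl_mul_apply, a1, a2, a3, a4, b1, b2, b3, b4, c1, c2, c3, c4] <;> ring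

lemma norm_sq_mul_lt {a b : ℚ_[p]} (ha : ‖a‖ < 1) (hb : ‖b‖ ≤ 1) : ‖a ^ 2 * b‖ < 1 := by
  rw [norm_mul, norm_pow]
  exact mul_lt_one_of_nonneg_of_lt_one_left (by positivity)
    (pow_lt_one₀ (norm_nonneg _) ha two_ne_zero) hb

namespace IsSteinbergCoeff

variable {F : SL2 p → ℂ} (hF : IsSteinbergCoeff F)

include hF

/-- Conjugation by `t^n` keeps `n(i)` integral, so the `p` translates in the right relation all have
the value at `t^n s`. -/
lemma tp_mul_s (n : ℕ) : F (tp p n * sMat) = -(p : ℂ)⁻¹ * F (tp p n) := by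
  have h := hF.right_relation (tp p n)
  have h1 : ∀ i ∈ Finset.range p, F (tp p n * (nMat (i : ℚ_[p]) * sMat)) = F (tp p n * sMat) := by
    intro i _
    rw [← mul_assoc, tp_mul_nMat, mul_assoc]
    refine hF.left _ (nMat_mem_slGamma0 ?_) _
    exact norm_mul_le_of_le (by
      rw [norm_pow]
      exact pow_le_one₀ (norm_nonneg _) (norm_p_pow_le n)) (norm_natCast_le_one i)
  rw [Finset.sum_congr rfl h1, Finset.sum_const, Finset.card_range, nsmul_eq_mul] at h
  have hp : (p : ℂ) ≠ 0 := cast_p_ne_zero_complex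
  field_simp
  linear_combination h

/-- In the left relation at `t^n`, the term `i = 0` is `s t^n = t^(-n) s`, and the `p - 1` others
equal `F(t^n)` because `t^n` contracts lower unipotents. For `n = 0` this contraction into `Γ₀(p)`
fails. -/
lemma tp_neg_mul_s {n : ℕ} (hn : n ≠ 0) : F (tp p (-n) * sMat) = -p * F (tp p n) := by
  have h := hF.left_relation (tp p n)
  have h1 : ∀ i < p, i ≠ 0 → F (sMat * nMat (i : ℚ_[p]) * tp p n) = F (tp p n) := by
    intro i hi h0
    have hu := norm_natCast_eq_one hi h0
    obtain ⟨γ, hγ, e⟩ := exists_sMat_mul_nMat hu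
    rw [e, mul_assoc, hF.left γ hγ, nLow_mul_tp]
    refine hF.right _ (nLow_mem_slGamma0 ?_) _
    exact norm_sq_mul_lt (norm_p_pow_lt hn) (by rw [norm_inv, hu, inv_one])
  rw [sum_range_eq_of_ne_zero h1, Nat.cast_zero, nMat_zero, mul_one, sMat_mul_tp] at h
  linear_combination h

/-- The right relation at `t^(-n)` reads `p F(t^(-n)) + F(t^(-n) s) = 0`; its second term is already
known. -/
lemma tp_neg {n : ℕ} (hn : n ≠ 0) : F (tp p (-n)) = F (tp p n) := by
  have h := hF.right_relation (tp p (-n))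
  have h1 : ∀ i < p, i ≠ 0 → F (tp p (-n) * (nMat (i : ℚ_[p]) * sMat)) = F (tp p (-n)) := by
    intro i hi h0
    have hu := norm_natCast_eq_one hi h0
    obtain ⟨γ, hγ, e⟩ := exists_nMat_mul_sMat hu
    rw [e, ← mul_assoc, hF.right γ hγ]
    have e2 : tp p (-n) * nLow (i : ℚ_[p])⁻¹ =
        nLow (((p : ℚ_[p]) ^ (n : ℤ)) ^ 2 * (i : ℚ_[p])⁻¹) * tp p (-n) := by
      have hp0 : (p : ℚ_[p]) ^ (n : ℤ) ≠ 0 := zpow_ne_zero _ cast_p_ne_zero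
      rw [nLow_mul_tp, zpow_neg]
      congr 2
      field_simp
    rw [e2]
    refine hF.left _ (nLow_mem_slGamma0 ?_) _
    exact norm_sq_mul_lt (norm_p_pow_lt hn) (by rw [norm_inv, hu, inv_one])
  rw [sum_range_eq_of_ne_zero h1, Nat.cast_zero, nMat_zero, one_mul, hF.tp_neg_mul_s hn] at h
  have hp : (p : ℂ) ≠ 0 := cast_p_ne_zero_complex
  apply mul_left_cancel₀ hp
  linear_combination h

end IsSteinbergCoeff

/-! ### Spherical averages evaluated on the torus. -/

namespace MatrixGroup

set_option linter.unusedSectionVars false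

variable {G : Type} [Group G] [TopologicalSpace G] [IsTopologicalGroup G] [T2Space G]
  [MeasurableSpace G] [BorelSpace G] (M : MatrixGroup p G)
  {P : G → ℂ} (hP : ∀ x, ∀ γ ∈ M.Γ, P (x * γ) = P x) {α β : ℂ}

include hP in
lemma isSteinbergCoeff_sphAvg (hαβ : α + p * β = 0)
    (hsum : ∀ x, P x + ∑ i ∈ Finset.range p, P (x * M.ι (nMat (i : ℚ_[p]) * sMat)) = 0) :
    IsSteinbergCoeff fun x => M.sphAvg P α β (M.ι x) where
  left γ hγ x := by
    rw [map_mul]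
    exact M.sphAvg_mem_mul (M.ι_mem_Γ hγ) _
  right γ hγ x := by
    rw [map_mul]
    exact M.sphAvg_mul_mem hP _ (M.ι_mem_Γ hγ)
  left_relation x := by
    simp_rw [map_mul M.ι _ x]
    exact M.sphAvg_left_relation hP hαβ _
  right_relation x := by
    simp_rw [map_mul M.ι x]
    exact M.sphAvg_right_relation hP hsum _

include hP in
-- Moving `n(y)` to the right across `t^n` divides `y` by `p^(2n)`, which explains the period.
lemma apply_s_nMat_add_tp (n : ℕ) (x : ℚ_[p]) {y : ℚ_[p]}
    (hy : ‖y‖ ≤ (p : ℝ) ^ (-(2 * n : ℕ) : ℤ)) :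
    P (M.ι (sMat * nMat (x + y) * tp p n)) = P (M.ι (sMat * nMat x * tp p n)) := by
  have hp0 : (p : ℚ_[p]) ^ (n : ℤ) ≠ 0 := zpow_ne_zero _ cast_p_ne_zero
  have e : sMat * nMat (x + y) * tp p n =
      sMat * nMat x * tp p n * nMat ((((p : ℚ_[p]) ^ (n : ℤ)) ^ 2)⁻¹ * y) := by
    rw [mul_assoc _ (tp p n), tp_mul_nMat, mul_inv_cancel_left₀ (pow_ne_zero 2 hp0), nMat_add]
    simp only [mul_assoc]
  rw [e, map_mul, hP _ _ (M.ι_mem_Γ (nMat_mem_slGamma0 ?_))]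
  rw [norm_mul, norm_inv, norm_pow, Padic.norm_p_zpow]
  calc _ ≤ (((p : ℝ) ^ (-(n : ℤ))) ^ 2)⁻¹ * (p : ℝ) ^ (-(2 * n : ℕ) : ℤ) := by gcongr
    _ = 1 := by
      have h1 : (p : ℝ) ^ (-(2 * n : ℕ) : ℤ) = ((p : ℝ) ^ (-(n : ℤ))) ^ 2 := by
        rw [← zpow_natCast, ← zpow_mul]
        congr 1
        push_cast
        ring
      rw [h1, inv_mul_cancel₀]
      exact pow_ne_zero 2 (zpow_ne_zero _ cast_p_pos.ne')

include hP in
lemma continuous_apply_s_nMat_tp (n : ℕ) :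
    Continuous fun y => P (M.ι (sMat * nMat y * tp p n)) := by
  refine IsLocallyConstant.continuous ((IsLocallyConstant.iff_exists_open _).mpr fun x => ?_)
  refine ⟨Metric.closedBall x ((p : ℝ) ^ (-(2 * n : ℕ) : ℤ)),
    IsUltrametricDist.isOpen_closedBall _ (zpow_ne_zero _ cast_p_pos.ne'),
    Metric.mem_closedBall_self (zpow_nonneg cast_p_pos.le _), fun y hy => ?_⟩
  rw [Metric.mem_closedBall, dist_eq_norm] at hy
  rw [← M.apply_s_nMat_add_tp hP n x hy, add_sub_cancel]

variable (hPb : ∀ b ∈ M.K, M.m b 1 0 = 0 → ∀ x, P (b * x) = P x)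

include hPb

/-- Off the Iwahori subgroup the lower left entry is a unit, so the Bruhat factorization has an
integral upper triangular factor, to which `P` is blind, followed by `s n(d/c)`. -/
lemma apply_mul_of_notMem {k : G} (hk : k ∈ (M.K : Set G) \ M.Γ) (x : G) :
    P (k * x) = P (M.ι (sMat * nMat (M.m k 1 1 / M.m k 1 0)) * x) := by
  have hc : ‖M.m k 1 0‖ = 1 := le_antisymm (M.mem_K.mp hk.1 1 0).1 (not_lt.mp fun h => hk.2 ⟨hk.1, h⟩)
  have h0 := ne_zero_of_norm_eq_one hc
  set y := M.m k 1 1 / M.m k 1 0 with hy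
  have hy1 : ‖y‖ ≤ 1 := by
    rw [hy, norm_div, hc, div_one]
    exact (M.mem_K.mp hk.1 1 1).1
  have hmem := M.ι_mem_K (slIntegral_mul sMat_mem (nMat_mem hy1))
  have e : k * x = k * (M.ι (sMat * nMat y))⁻¹ * (M.ι (sMat * nMat y) * x) := by
    rw [← mul_assoc, inv_mul_cancel_right]
  rw [e, hPb (k * (M.ι (sMat * nMat y))⁻¹) (mul_mem hk.1 (inv_mem hmem))]
  rw [← map_inv, M.m_mul, M.m_ι, M.m_ι, (sl_inv_apply _).1, (sl_inv_apply _).2.2.1, sl_mul_apply,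
    sl_mul_apply]
  simp [sMat, nMat, hy]
  field_simp
  ring

include hP in
-- An Iwahori element is an integral upper triangular matrix times a lower unipotent, and `t^n`
-- carries the latter into `Γ` on the right.
lemma apply_mul_tp_of_mem {k : G} (hk : k ∈ M.Γ) (n : ℕ) :
    P (k * M.ι (tp p n)) = P (M.ι (tp p n)) := by
  have hd : ‖M.m k 1 1‖ = 1 := (M.norm_row hk.1).resolve_left hk.2.ne
  have h0 := ne_zero_of_norm_eq_one hd
  set z := M.m k 1 0 / M.m k 1 1 with hz
  have hz1 : ‖z‖ < 1 := by
    rw [hz, norm_div, hd, div_one]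
    exact hk.2
  have hmem := M.ι_mem_Γ (nLow_mem_slGamma0 hz1)
  have e : k * M.ι (tp p n) = k * (M.ι (nLow z))⁻¹ * M.ι (nLow z * tp p n) := by
    rw [map_mul, ← mul_assoc, inv_mul_cancel_right]
  rw [e, hPb _ (mul_mem hk.1 (inv_mem hmem.1)), nLow_mul_tp, map_mul, hP _ _ (M.ι_mem_Γ
    (nLow_mem_slGamma0 ?_))]
  · rw [norm_mul, norm_pow]
    exact mul_lt_one_of_nonneg_of_lt_one_right (pow_le_one₀ (norm_nonneg _) (norm_p_pow_le n))
      (norm_nonneg _) hz1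
  · rw [← map_inv, M.m_mul, M.m_ι, M.m_ι, (sl_inv_apply _).1, (sl_inv_apply _).2.2.1]
    simp [nLow, hz]
    field_simp
    ring

include hP in
-- Averaging over right translates by `n(i)`, `i < p^(2n)`, does not change the integral, but it
-- turns the integrand into a complete sum over residues. This sum is independent of `k` and
-- represents the integral over `ℤ_p`, so no disintegration of the Haar measure is needed.
lemma setIntegral_diff_apply_mul_tp (n : ℕ) :
    ∫ k in (M.K : Set G) \ M.Γ, P (k * M.ι (tp p n)) ∂M.μ = (M.μ.real ((M.K : Set G) \ M.Γ) : ℂ) *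
      ∫ y in ball p 0, P (M.ι (sMat * nMat y * tp p n)) ∂padicHaar p := by
  set q : ℚ_[p] → ℂ := fun y => P (M.ι (sMat * nMat y * tp p n)) with hq
  have hper : ∀ x y, ‖y‖ ≤ (p : ℝ) ^ (-(2 * n : ℕ) : ℤ) → q (x + y) = q x :=
    fun x y hy => M.apply_s_nMat_add_tp hP n x hy
  have hcont : Continuous q := M.continuous_apply_s_nMat_tp hP n
  have hsum : ∀ y ∈ ball p 0, ∑ i ∈ Finset.range (p ^ (2 * n)), q (y + i) =
      (p : ℂ) ^ (2 * n) * ∫ y in ball p 0, q y ∂padicHaar p := by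
    intro y hy
    have h := setIntegral_ball_zero_eq_sum_pow (2 * n) (f := fun x => q (x + y))
      ((hcont.comp (continuous_add_const y)).continuousOn.integrableOn_compact (isCompact_ball 0))
      fun x _ z hz => by rw [add_right_comm, hper _ z hz]
    rw [setIntegral_ball_comp_add 0 hy] at h
    rw [h, mul_inv_cancel_left₀ (pow_ne_zero _ cast_p_ne_zero_complex)]
    exact Finset.sum_congr rfl fun i _ => by rw [add_comm]
  have := M.finite
  have hint : IntegrableOn (fun k => P (k * M.ι (tp p n))) ((M.K : Set G) \ M.Γ) M.μ :=
    ((M.continuous_of_invariant hP).comp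
      (continuous_mul_const _)).continuousOn.integrableOn_compact M.isCompact_diff
  have hpre : ∀ i : ℕ, (· * M.ι (nMat (i : ℚ_[p]))) ⁻¹' ((M.K : Set G) \ M.Γ) =
      (M.K : Set G) \ M.Γ := by
    intro i
    have hi := M.ι_mem_Γ (nMat_mem_slGamma0 (norm_natCast_le_one (p := p) i))
    ext k
    simp only [Set.mem_preimage, Set.mem_sdiff, SetLike.mem_coe, M.K.mul_mem_cancel_right hi.1,
      M.Γ.mul_mem_cancel_right hi]
  have hintegral : ∀ i : ℕ, ∫ k in (M.K : Set G) \ M.Γ,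
      P (k * M.ι (nMat (i : ℚ_[p])) * M.ι (tp p n)) ∂M.μ =
      ∫ k in (M.K : Set G) \ M.Γ, P (k * M.ι (tp p n)) ∂M.μ := fun i =>
    M.setIntegral_mul_right (M.ι_mem_K (nMat_mem (norm_natCast_le_one i))) (hpre i)
      fun k => P (k * M.ι (tp p n))
  have htotal : ∫ k in (M.K : Set G) \ M.Γ, ∑ i ∈ Finset.range (p ^ (2 * n)),
      P (k * M.ι (nMat (i : ℚ_[p])) * M.ι (tp p n)) ∂M.μ =
      (p : ℂ) ^ (2 * n) * ∫ k in (M.K : Set G) \ M.Γ, P (k * M.ι (tp p n)) ∂M.μ := by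
    rw [integral_finsetSum]
    · rw [Finset.sum_congr rfl fun i _ => hintegral i, Finset.sum_const, Finset.card_range,
        nsmul_eq_mul]
      push_cast
      rfl
    · intro i _
      exact ((M.continuous_of_invariant hP).comp ((continuous_mul_const _).comp
        (continuous_mul_const _))).continuousOn.integrableOn_compact M.isCompact_diff
  have hvalue : ∀ k ∈ (M.K : Set G) \ M.Γ, ∑ i ∈ Finset.range (p ^ (2 * n)),
      P (k * M.ι (nMat (i : ℚ_[p])) * M.ι (tp p n)) =
        (p : ℂ) ^ (2 * n) * ∫ y in ball p 0, q y ∂padicHaar p := by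
    intro k hk
    rw [← hsum (M.m k 1 1 / M.m k 1 0)]
    · refine Finset.sum_congr rfl fun i _ => ?_
      rw [mul_assoc, M.apply_mul_of_notMem hPb hk, ← map_mul, ← map_mul]
      simp only [hq]
      rw [nMat_add]
      simp only [mul_assoc]
    · have hc : ‖M.m k 1 0‖ = 1 :=
        le_antisymm (M.mem_K.mp hk.1 1 0).1 (not_lt.mp fun h => hk.2 ⟨hk.1, h⟩)
      rw [mem_ball, zpow_zero, norm_div, hc, div_one]
      exact (M.mem_K.mp hk.1 1 1).1
  rw [setIntegral_congr_fun (M.measurableSet_K.diff M.measurableSet_Γ) hvalue, setIntegral_const,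
    Complex.real_smul] at htotal
  apply mul_left_cancel₀ (pow_ne_zero (2 * n) (cast_p_ne_zero_complex (p := p)))
  linear_combination -htotal

include hP in
-- The two terms are the contributions of `Γ` and its complement in `K`, whose volumes are in the
-- ratio `1 : p`.
theorem sphAvg_tp (n : ℕ) :
    M.sphAvg P α β (M.ι (tp p n)) = (M.μ.real M.Γ : ℂ) * (α * P (M.ι (tp p n)) +
      p * β * ∫ y in ball p 0, P (M.ι (sMat * nMat y * tp p n)) ∂padicHaar p) := by
  rw [M.sphAvg_eq_add hP, M.setIntegral_diff_apply_mul_tp hP hPb, M.measureReal_diff,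
    setIntegral_congr_fun M.measurableSet_Γ fun k hk => M.apply_mul_tp_of_mem hP hPb hk n,
    setIntegral_const, Complex.real_smul]
  push_cast
  ring

end MatrixGroup

end

section

/-! ### The groups `SL₂` and `GL₂` -/

instance : SecondCountableTopology (Matrix (Fin 2) (Fin 2) ℚ_[p]) :=
  inferInstanceAs (SecondCountableTopology (Fin 2 → Fin 2 → ℚ_[p]))

instance : SecondCountableTopology (SL2 p) :=
  Matrix.SpecialLinearGroup.isClosedEmbedding_val.isEmbedding.secondCountableTopology

instance : SecondCountableTopology (GL2 p) :=
  have : SecondCountableTopology (Matrix (Fin 2) (Fin 2) ℚ_[p])ᵐᵒᵖ :=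
    MulOpposite.opHomeomorph.symm.isEmbedding.secondCountableTopology
  Units.isEmbedding_embedProduct.secondCountableTopology

/-- The right translate is again left invariant and gives `K₀` the same mass, so uniqueness of Haar
measure applies; unimodularity is not needed. -/
lemma map_mul_right_haarMeasure {G : Type*} [Group G] [TopologicalSpace G] [IsTopologicalGroup G]
    [MeasurableSpace G] [BorelSpace G] [SecondCountableTopology G]
    (K₀ : TopologicalSpace.PositiveCompacts G) {k : G} (hk : (· * k) ⁻¹' (K₀ : Set G) = K₀)
    (hK : MeasurableSet (K₀ : Set G)) :
    (Measure.haarMeasure K₀).map (· * k) = Measure.haarMeasure K₀ := by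
  have hm : Measurable (· * k) := (continuous_mul_const k).measurable
  have : SigmaFinite ((Measure.haarMeasure K₀).map (· * k)) :=
    (Homeomorph.mulRight k).toMeasurableEquiv.sigmaFinite_map
  have : ((Measure.haarMeasure K₀).map (· * k)).IsMulLeftInvariant := inferInstance
  refine ((Measure.haarMeasure_eq_iff K₀ _).mpr ?_).symm
  rw [Measure.map_apply hm hK, hk, Measure.haarMeasure_self]

lemma isOpen_slIntegral : IsOpen (slIntegral p : Set (SL2 p)) :=
  (isOpen_integralMatrices p).preimage continuous_subtype_val

lemma isOpen_glIntegral : IsOpen (glIntegral p : Set (GL2 p)) :=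
  ((isOpen_integralMatrices p).preimage Units.continuous_val).inter
    ((isOpen_integralMatrices p).preimage (Units.continuous_val.comp continuous_inv))

lemma mem_glIntegral {k : GL2 p} : k ∈ glIntegral p ↔
    ∀ i j, ‖(k : Matrix (Fin 2) (Fin 2) ℚ_[p]) i j‖ ≤ 1 ∧
      ‖((k⁻¹ : GL2 p) : Matrix (Fin 2) (Fin 2) ℚ_[p]) i j‖ ≤ 1 :=
  ⟨fun h i j => ⟨h.1 i j, h.2 i j⟩, fun h => ⟨fun i j => (h i j).1, fun i j => (h i j).2⟩⟩

lemma mem_slIntegral_iff {k : SL2 p} : k ∈ slIntegral p ↔ ∀ i j, ‖k i j‖ ≤ 1 ∧ ‖k⁻¹ i j‖ ≤ 1 :=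
  ⟨fun h i j => ⟨mem_slIntegral.mp h i j, mem_slIntegral.mp (slIntegral_inv h) i j⟩,
    fun h => mem_slIntegral.mpr fun i j => (h i j).1⟩

lemma preimage_mul_slIntegral {k : SL2 p} (hk : k ∈ slIntegral p) :
    (· * k) ⁻¹' (slIntegral p : Set (SL2 p)) = slIntegral p := by
  ext x
  refine ⟨fun h => ?_, fun h => slIntegral_mul h hk⟩
  have := slIntegral_mul h (slIntegral_inv hk)
  rwa [mul_inv_cancel_right] at this

lemma glIntegral_mul {x y : GL2 p} (hx : x ∈ glIntegral p) (hy : y ∈ glIntegral p) :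
    x * y ∈ glIntegral p := by
  rw [mem_glIntegral] at *
  intro i j
  rw [mul_inv_rev, Units.val_mul, Units.val_mul, Matrix.mul_apply, Matrix.mul_apply,
    Fin.sum_univ_two, Fin.sum_univ_two]
  exact ⟨norm_add_le_of_le (norm_mul_le_of_le (hx _ _).1 (hy _ _).1)
    (norm_mul_le_of_le (hx _ _).1 (hy _ _).1),
    norm_add_le_of_le (norm_mul_le_of_le (hy _ _).2 (hx _ _).2)
    (norm_mul_le_of_le (hy _ _).2 (hx _ _).2)⟩

lemma glIntegral_inv {x : GL2 p} (hx : x ∈ glIntegral p) : x⁻¹ ∈ glIntegral p := by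
  rw [mem_glIntegral] at *
  intro i j
  rw [inv_inv]
  exact (hx i j).symm

lemma preimage_mul_glIntegral {k : GL2 p} (hk : k ∈ glIntegral p) :
    (· * k) ⁻¹' (glIntegral p : Set (GL2 p)) = glIntegral p := by
  ext x
  refine ⟨fun h => ?_, fun h => glIntegral_mul h hk⟩
  have := glIntegral_mul h (glIntegral_inv hk)
  rwa [mul_inv_cancel_right] at this

variable (p) in
/-- `SL₂(ℚ_p)` as a matrix group. -/
def slGroup : MatrixGroup p (SL2 p) where
  m :=
    { toFun := fun g => (g : Matrix (Fin 2) (Fin 2) ℚ_[p])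
      map_one' := Matrix.SpecialLinearGroup.coe_one
      map_mul' := Matrix.SpecialLinearGroup.coe_mul }
  ι := MonoidHom.id _
  μ := slHaar p
  continuous_m := continuous_subtype_val
  m_ι _ _ _ := rfl
  isCompact := by
    convert (slIntegral p).isCompact using 1
    ext k
    exact mem_slIntegral_iff.symm
  finite := ⟨fun S hS => by
    rw [slHaar, Measure.smul_apply, smul_eq_mul]
    exact ENNReal.mul_lt_top ENNReal.ofReal_lt_top hS.measure_lt_top⟩
  left := by unfold slHaar; infer_instance
  right k hk := by
    unfold slHaar
    rw [Measure.map_smul, map_mul_right_haarMeasure _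
      (preimage_mul_slIntegral (mem_slIntegral_iff.mpr hk)) isOpen_slIntegral.measurableSet]

variable (p) in
/-- `GL₂(ℚ_p)` as a matrix group. -/
def glGroup : MatrixGroup p (GL2 p) where
  m := Units.coeHom _
  ι := Matrix.SpecialLinearGroup.toGL
  μ := glHaar p
  continuous_m := Units.continuous_val
  m_ι _ _ _ := rfl
  isCompact := by
    convert (glIntegral p).isCompact using 1
    ext k
    exact mem_glIntegral.symm
  finite := by unfold glHaar; infer_instance
  left := by unfold glHaar; infer_instance
  right k hk := by
    unfold glHaar
    exact map_mul_right_haarMeasure _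
      (preimage_mul_glIntegral (mem_glIntegral.mpr hk)) isOpen_glIntegral.measurableSet

lemma coe_slGroup_K : ((slGroup p).K : Set (SL2 p)) = slIntegral p := by
  ext k
  exact mem_slIntegral_iff.symm

lemma coe_glGroup_K : ((glGroup p).K : Set (GL2 p)) = glIntegral p := by
  ext k
  exact mem_glIntegral.symm

lemma mem_slGroup_Γ {k : SL2 p} : k ∈ (slGroup p).Γ ↔ k ∈ slGamma0 p :=
  and_congr_left' mem_slIntegral_iff.symm

lemma mem_glGroup_Γ {k : GL2 p} : k ∈ (glGroup p).Γ ↔ k ∈ glGamma0 p :=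
  and_congr_left' mem_glIntegral.symm

lemma MatrixGroup.measureReal_Γ {G : Type} [Group G] [TopologicalSpace G] [IsTopologicalGroup G]
    [T2Space G] [MeasurableSpace G] [BorelSpace G] (M : MatrixGroup p G) :
    (p + 1) * M.μ.real M.Γ = M.μ.real M.K := by
  have := M.finite
  have h := measureReal_sdiff_add_inter (μ := M.μ) (s := (M.K : Set G)) M.measurableSet_Γ
    M.isCompact_K.measure_lt_top.ne
  rw [Set.inter_eq_right.mpr M.Γ_le, M.measureReal_diff] at h
  linarith

lemma slGroup_measureReal_K : (slGroup p).μ.real (slGroup p).K = 1 - (p : ℝ)⁻¹ ^ 2 := by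
  rw [coe_slGroup_K]
  change (slHaar p).real _ = _
  have h : (p : ℝ)⁻¹ ^ 2 ≤ 1 :=
    pow_le_one₀ (by positivity) (inv_le_one_of_one_le₀ one_lt_cast_p.le)
  rw [slHaar, measureReal_ennreal_smul_apply, measureReal_def, Measure.haarMeasure_self,
    ENNReal.toReal_ofReal (by linarith), ENNReal.toReal_one, mul_one]

lemma glGroup_measureReal_K : (glGroup p).μ.real (glGroup p).K = 1 := by
  rw [coe_glGroup_K]
  change (glHaar p).real _ = _
  rw [glHaar, measureReal_def, Measure.haarMeasure_self, ENNReal.toReal_one]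

end

section

/-! ### The matrix coefficient of the newvector of `ξ St` -/

lemma setIntegral_ball_add_eq_sum_shell (a : ℤ) (m : ℕ) {f : ℚ_[p] → ℂ}
    (hf : IntegrableOn f (ball p (a + m)) (padicHaar p)) :
    ∫ x in ball p (a + m), f x ∂padicHaar p = ∫ x in ball p a, f x ∂padicHaar p +
      ∑ j ∈ Finset.range m, ∫ x in shell (a + 1 + j), f x ∂padicHaar p := by
  induction m with
  | zero => simp
  | succ m ih =>
    have e : a + ((m + 1 : ℕ) : ℤ) - 1 = a + m := by push_cast; ring
    have e' : a + ((m + 1 : ℕ) : ℤ) = a + 1 + m := by push_cast; ring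
    have hsub : ball p (a + m) ⊆ ball p (a + ((m + 1 : ℕ) : ℤ)) := by
      rw [ball_eq_union_shell (a + ((m + 1 : ℕ) : ℤ)), e]
      exact Set.subset_union_left
    rw [setIntegral_ball_eq_add_shell _ hf, e, ih (hf.mono_set hsub), Finset.sum_range_succ, e',
      add_assoc]

lemma setIntegral_shell_of_eq {n : ℤ} {f : ℚ_[p] → ℂ} {z : ℂ} (h : ∀ x ∈ shell n, f x = z) :
    ∫ x in shell n, f x ∂padicHaar p = (p : ℂ) ^ n * (1 - (p : ℂ)⁻¹) * z := by
  rw [setIntegral_congr_fun (measurableSet_shell n) h, setIntegral_const, measureReal_shell,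
    Complex.real_smul]
  push_cast
  ring

lemma setIntegral_ball_of_eq {n : ℤ} {f : ℚ_[p] → ℂ} {z : ℂ} (h : ∀ x ∈ ball p n, f x = z) :
    ∫ x in ball p n, f x ∂padicHaar p = (p : ℂ) ^ n * z := by
  rw [setIntegral_congr_fun (measurableSet_ball n) h, setIntegral_const, measureReal_ball,
    Complex.real_smul]
  push_cast
  ring

omit [Fact p.Prime] in
lemma sum_geometric_shell (m : ℕ) :
    ∑ j ∈ Finset.range m, ((p : ℂ)⁻¹) ^ (j + 1) * (1 - (p : ℂ)⁻¹) =
      (p : ℂ)⁻¹ * (1 - ((p : ℂ)⁻¹) ^ m) := by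
  induction m with
  | zero => simp
  | succ m ih =>
    rw [Finset.sum_range_succ, ih]
    ring

lemma IsSteinbergCoeff.div_const {F : SL2 p → ℂ} (hF : IsSteinbergCoeff F) (z : ℂ) :
    IsSteinbergCoeff fun x => F x / z where
  left γ hγ x := by rw [hF.left γ hγ]
  right γ hγ x := by rw [hF.right γ hγ]
  left_relation x := by rw [← Finset.sum_div, ← add_div, hF.left_relation, zero_div]
  right_relation x := by rw [← Finset.sum_div, ← add_div, hF.right_relation, zero_div]

lemma sl_row_s_nMat_tp (n : ℤ) (y : ℚ_[p]) :
    (sMat * nMat y * tp p n : SL2 p) 1 0 = -(p : ℚ_[p]) ^ n ∧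
      (sMat * nMat y * tp p n : SL2 p) 1 1 = -(y * ((p : ℚ_[p]) ^ n)⁻¹) := by
  obtain ⟨a1, a2, a3, a4⟩ := tp_apply (p := p) n
  obtain ⟨b1, b2, b3, b4⟩ := nMat_apply y
  obtain ⟨-, -, c3, c4⟩ := sMat_apply (p := p)
  simp only [sl_mul_apply, a1, a2, a3, a4, b1, b2, b3, b4, c3, c4]
  exact ⟨by ring, by ring⟩

lemma conj_mul_self_add_ne_zero {α β : ℂ} (hβ : β ≠ 0) :
    conj α * α + p * (conj β * β) ≠ 0 := by
  rw [← Complex.normSq_eq_conj_mul_self, ← Complex.normSq_eq_conj_mul_self]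
  have h1 : 0 < Complex.normSq α + p * Complex.normSq β :=
    add_pos_of_nonneg_of_pos (Complex.normSq_nonneg _)
      (mul_pos cast_p_pos (Complex.normSq_pos.mpr hβ))
  exact_mod_cast h1.ne'

lemma nu_neg_left (α β : ℂ) (c d : ℚ_[p]) : nu α β (-c) d = nu α β c d := by
  unfold nu
  rw [norm_neg]

lemma conj_nu (α β : ℂ) (c d : ℚ_[p]) : conj (nu α β c d) = nu (conj α) (conj β) c d := by
  unfold nu
  split_ifs <;> rfl

lemma norm_rowMax_step (i : ℕ) (c d : ℚ_[p]) : ‖rowMax (d + (i : ℚ_[p]) * c) c‖ = ‖rowMax c d‖ := by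
  rw [norm_rowMax, norm_rowMax]
  have hi : ‖(i : ℚ_[p]) * c‖ ≤ ‖c‖ := by
    rw [norm_mul]
    exact mul_le_of_le_one_left (norm_nonneg _) (norm_natCast_le_one i)
  refine le_antisymm (max_le (norm_add_le_of_le (le_max_right _ _) (hi.trans (le_max_left _ _)))
    (le_max_left _ _)) (max_le (le_max_right _ _) ?_)
  have e : d = d + (i : ℚ_[p]) * c - i * c := by ring
  nth_rw 1 [e]
  exact norm_sub_le_of_le (le_max_left _ _) (hi.trans (le_max_right _ _))

section

variable {ξ : ℚ_[p]ˣ →* ℂˣ} {φ : GL2 p → ℂ}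

lemma gl_upper_norms {b : GL2 p} (hb : b ∈ (glGroup p).K) (h0 : b 1 0 = 0) :
    ‖b 0 0‖ = 1 ∧ ‖b 1 1‖ = 1 := by
  have h1 : (b⁻¹ : GL2 p) 0 0 * b 0 0 + (b⁻¹ : GL2 p) 0 1 * b 1 0 = 1 := by
    have := (glGroup p).m_mul b⁻¹ b 0 0
    rw [inv_mul_cancel, map_one, Matrix.one_apply_eq] at this
    exact this.symm
  have hd : ‖b 1 1‖ = 1 :=
    ((glGroup p).norm_row hb).resolve_left fun h => by
      change ‖b 1 0‖ = 1 at h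
      rw [h0, norm_zero] at h
      exact zero_ne_one h
  refine ⟨le_antisymm (hb 0 0).1 ?_, hd⟩
  rw [h0, mul_zero, add_zero] at h1
  have h2 : ‖(b⁻¹ : GL2 p) 0 0‖ * ‖b 0 0‖ = 1 := by rw [← norm_mul, h1, norm_one]
  have h3 : ‖(b⁻¹ : GL2 p) 0 0‖ ≤ 1 := (hb 0 0).2
  calc (1 : ℝ) = _ := h2.symm
    _ ≤ 1 * ‖b 0 0‖ := by gcongr
    _ = _ := one_mul _

lemma gl_det_of_upper {b : GL2 p} (h0 : b 1 0 = 0) :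
    ((Matrix.GeneralLinearGroup.det b : ℚ_[p]ˣ) : ℚ_[p]) = b 0 0 * b 1 1 := by
  rw [Matrix.GeneralLinearGroup.val_det_apply, Matrix.det_fin_two, h0, mul_zero, sub_zero]

lemma IsGLSpecial.apply_upper_mul (h : IsGLSpecial ξ φ) (hξ : IsUnramified ξ) :
    ∀ b ∈ (glGroup p).K, (glGroup p).m b 1 0 = 0 → ∀ x, φ (b * x) = φ x := by
  intro b hb h0 x
  obtain ⟨h1, h2⟩ := gl_upper_norms hb h0
  rw [h.transform b x h0, hξ, norm_div, h1, h2]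
  · simp
  · rw [gl_det_of_upper h0, norm_mul, h1, h2, one_mul]

lemma det_toGL (g : SL2 p) :
    Matrix.GeneralLinearGroup.det (Matrix.SpecialLinearGroup.toGL g) = 1 := by
  ext
  rw [Matrix.GeneralLinearGroup.val_det_apply]
  exact g.det_coe

namespace IsGLNewvector

variable (hφ : IsGLNewvector ξ φ) (hξ : IsUnramified ξ)

include hφ

lemma apply_mul_mem : ∀ x, ∀ γ ∈ (glGroup p).Γ, φ (x * γ) = φ x := fun x γ hγ =>
  hφ.fixed γ (mem_glGroup_Γ.mp hγ) x

lemma apply_mul_toGL (x : GL2 p) {g : SL2 p} (hg : g ∈ slGamma0 p) :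
    φ (x * Matrix.SpecialLinearGroup.toGL g) = φ x :=
  hφ.apply_mul_mem x _ ((glGroup p).ι_mem_Γ hg)

lemma apply_mul_sl (x : GL2 p) (g : SL2 p) (h0 : (x * (Matrix.SpecialLinearGroup.toGL g)⁻¹) 1 0 = 0)
    (r : ℚ_[p]) (hr : (x * (Matrix.SpecialLinearGroup.toGL g)⁻¹) 1 1 = r) (hr0 : r ≠ 0) :
    φ x = (ξ (Matrix.GeneralLinearGroup.det x) : ℂ) *
      ((‖(Matrix.GeneralLinearGroup.det x : ℚ_[p])‖ * (‖r‖ ^ 2)⁻¹ : ℝ) : ℂ) *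
        φ (Matrix.SpecialLinearGroup.toGL g) := by
  have hdet : Matrix.GeneralLinearGroup.det (x * (Matrix.SpecialLinearGroup.toGL g)⁻¹) =
      Matrix.GeneralLinearGroup.det x := by rw [map_mul, map_inv, det_toGL, inv_one, mul_one]
  have e : x = x * (Matrix.SpecialLinearGroup.toGL g)⁻¹ * Matrix.SpecialLinearGroup.toGL g := by
    rw [inv_mul_cancel_right]
  have h1 := gl_det_of_upper h0
  rw [hdet, hr] at h1
  have h2 : ‖(x * (Matrix.SpecialLinearGroup.toGL g)⁻¹) 0 0 /
      (x * (Matrix.SpecialLinearGroup.toGL g)⁻¹) 1 1‖ =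
        ‖(Matrix.GeneralLinearGroup.det x : ℚ_[p])‖ * (‖r‖ ^ 2)⁻¹ := by
    have h3 : 0 < ‖r‖ := norm_pos_iff.mpr hr0
    rw [h1, hr, norm_div, norm_mul]
    field_simp
  nth_rw 1 [e]
  rw [hφ.mem.transform _ _ h0, hdet, h2]

include hξ

lemma apply_eq_nu_of_mem {k : GL2 p} (hk : k ∈ (glGroup p).K) :
    φ k = nu (φ 1) (φ (Matrix.SpecialLinearGroup.toGL sMat)) (k 1 0) (k 1 1) := by
  by_cases h : k ∈ (glGroup p).Γ
  · rw [show nu (φ 1) _ (k 1 0) (k 1 1) = _ from (glGroup p).nu_of_mem h]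
    simpa using hφ.apply_mul_mem 1 k h
  · rw [show nu (φ 1) _ (k 1 0) (k 1 1) = _ from (glGroup p).nu_of_notMem ⟨hk, h⟩]
    have h1 := (glGroup p).apply_mul_of_notMem (hφ.mem.apply_upper_mul hξ) ⟨hk, h⟩ 1
    rw [mul_one, mul_one, map_mul, hφ.apply_mul_mem _ _ ((glGroup p).ι_mem_Γ
      (nMat_mem_slGamma0 ?_))] at h1
    · exact h1
    · have hc : ‖(glGroup p).m k 1 0‖ = 1 :=
        le_antisymm (hk 1 0).1 (not_lt.mp fun h' => h ⟨hk, h'⟩)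
      rw [norm_div, hc, div_one]
      exact (hk 1 1).1

omit hξ in
-- The Iwasawa decomposition with compact factor `s n(d/c)` or the lower unipotent with entry `c/d`,
-- according to the dominant entry. A `K₀(p)`-fixed vector distinguishes only these two cases.
theorem apply_eq (x : GL2 p) :
    φ x = (ξ (Matrix.GeneralLinearGroup.det x) : ℂ) *
      ((‖(Matrix.GeneralLinearGroup.det x : ℚ_[p])‖ * (‖rowMax (x 1 0) (x 1 1)‖ ^ 2)⁻¹ : ℝ) : ℂ) *
        nu (φ 1) (φ (Matrix.SpecialLinearGroup.toGL sMat)) (x 1 0) (x 1 1) := by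
  have hm : ∀ g : SL2 p, ∀ j, (x * (Matrix.SpecialLinearGroup.toGL g)⁻¹) 1 j =
      x 1 0 * g⁻¹ 0 j + x 1 1 * g⁻¹ 1 j := by
    intro g j
    rw [← map_inv]
    exact (glGroup p).m_mul x _ 1 j
  have hne : x 1 0 ≠ 0 ∨ x 1 1 ≠ 0 := by
    by_contra h
    push Not at h
    have := (Matrix.GeneralLinearGroup.det x).ne_zero
    rw [Matrix.GeneralLinearGroup.val_det_apply, Matrix.det_fin_two, h.1, h.2] at this
    simp at this
  rcases le_or_gt ‖x 1 1‖ ‖x 1 0‖ with h | h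
  · have hc : x 1 0 ≠ 0 := by
      intro h0
      rw [h0, norm_zero] at h
      exact hne.elim (fun h' => h' h0) fun h' => h' (norm_le_zero_iff.mp h)
    have hy : ‖x 1 1 / x 1 0‖ ≤ 1 := by
      rw [norm_div]
      exact div_le_one_of_le₀ h (norm_nonneg _)
    rw [nu_of_le h, rowMax_of_le h, hφ.apply_mul_sl x (sMat * nMat (x 1 1 / x 1 0)) ?_ (-x 1 0) ?_
      (neg_ne_zero.mpr hc), norm_neg, map_mul, hφ.apply_mul_toGL _ (nMat_mem_slGamma0 hy)]
    · rw [hm, (sl_inv_apply _).1, (sl_inv_apply _).2.2.1, sl_mul_apply, sl_mul_apply]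
      simp [sMat, nMat]
      field_simp
      ring
    · rw [hm, (sl_inv_apply _).2.1, (sl_inv_apply _).2.2.2, sl_mul_apply, sl_mul_apply]
      simp [sMat, nMat]
  · have hd := ne_zero_of_norm_lt h
    have hz : ‖x 1 0 / x 1 1‖ < 1 := by
      rw [norm_div, div_lt_one (norm_pos_iff.mpr hd)]
      exact h
    have h1 := hφ.apply_mul_toGL 1 (nLow_mem_slGamma0 hz)
    rw [one_mul] at h1
    rw [nu_of_lt h, rowMax_of_lt h, hφ.apply_mul_sl x (nLow (x 1 0 / x 1 1)) ?_ (x 1 1) ?_ hd]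
    · exact congrArg _ h1
    · rw [hm, (sl_inv_apply _).1, (sl_inv_apply _).2.2.1]
      simp [nLow]
      field_simp
      ring
    · rw [hm, (sl_inv_apply _).2.1, (sl_inv_apply _).2.2.2]
      simp [nLow]

/-- On `GL₂(ℤ_p)` the function has two values, on the Iwahori subgroup and off it, with volumes in
the ratio `1 : p`; this is the vanishing of its mean. -/
lemma apply_one_add : φ 1 + p * φ (Matrix.SpecialLinearGroup.toGL sMat) = 0 := by
  have h := hφ.mem.vanishing
  rw [← coe_glGroup_K, setIntegral_congr_fun (glGroup p).measurableSet_K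
    fun k hk => hφ.apply_eq_nu_of_mem hξ hk] at h
  have h1 := (glGroup p).sphAvg_eq_add (P := fun _ => 1) (fun _ _ _ => rfl) (α := φ 1)
    (β := φ (Matrix.SpecialLinearGroup.toGL sMat)) 1
  unfold MatrixGroup.sphAvg at h1
  simp_rw [one_mul] at h1
  rw [setIntegral_const, setIntegral_const, (glGroup p).measureReal_diff] at h1
  simp only [Complex.real_smul, mul_one] at h1
  have h2 : ((glGroup p).μ.real (glGroup p).Γ : ℂ) ≠ 0 := by
    have h3 := (glGroup p).measureReal_Γ
    rw [glGroup_measureReal_K] at h3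
    intro h4
    rw [Complex.ofReal_eq_zero.mp h4, mul_zero] at h3
    exact zero_ne_one h3
  have h3 := h1.symm.trans h
  push_cast at h3
  refine (mul_eq_zero.mp (?_ : _ * ((glGroup p).μ.real (glGroup p).Γ : ℂ) = 0)).resolve_right h2
  linear_combination h3

lemma apply_s_ne_zero : φ (Matrix.SpecialLinearGroup.toGL sMat) ≠ 0 := by
  intro h
  have h1 := hφ.apply_one_add hξ
  rw [h, mul_zero, add_zero] at h1
  refine hφ.ne_zero (funext fun x => ?_)
  rw [hφ.apply_eq x, h, h1]
  unfold nu
  simp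

/-- All `p + 1` translates share the determinant and the norm of `rowMax`, so only `nu` varies and
`sum_nu` applies. -/
lemma sum_apply_mul (x : GL2 p) : φ x + ∑ i ∈ Finset.range p,
    φ (x * (glGroup p).ι (nMat (i : ℚ_[p]) * sMat)) = 0 := by
  have h0 : ∀ i : ℕ, (x * (glGroup p).ι (nMat (i : ℚ_[p]) * sMat)) 1 0 =
      -(x 1 1 + i * x 1 0) := by
    intro i
    have := (glGroup p).m_mul x ((glGroup p).ι (nMat (i : ℚ_[p]) * sMat)) 1 0
    rw [(glGroup p).m_ι, (glGroup p).m_ι, sl_mul_apply, sl_mul_apply] at this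
    refine this.trans ?_
    simp [sMat, nMat]
    change -((glGroup p).m x 1 0 * i) + -(glGroup p).m x 1 1 =
      -(i * (glGroup p).m x 1 0) + -(glGroup p).m x 1 1
    ring
  have h1 : ∀ i : ℕ, (x * (glGroup p).ι (nMat (i : ℚ_[p]) * sMat)) 1 1 = x 1 0 := by
    intro i
    have := (glGroup p).m_mul x ((glGroup p).ι (nMat (i : ℚ_[p]) * sMat)) 1 1
    rw [(glGroup p).m_ι, (glGroup p).m_ι, sl_mul_apply, sl_mul_apply] at this
    refine this.trans ?_
    simp [sMat, nMat]
    rfl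
  have hdet : ∀ i : ℕ, Matrix.GeneralLinearGroup.det (x * (glGroup p).ι (nMat (i : ℚ_[p]) * sMat)) =
      Matrix.GeneralLinearGroup.det x := by
    intro i
    rw [map_mul]
    exact (congrArg _ (det_toGL _)).trans (mul_one _)
  have hr : ∀ i : ℕ, ‖rowMax (-(x 1 1 + (i : ℚ_[p]) * x 1 0)) (x 1 0)‖ = ‖rowMax (x 1 0) (x 1 1)‖ := by
    intro i
    rw [← norm_rowMax_step i (x 1 0) (x 1 1), norm_rowMax, norm_rowMax, norm_neg]
  have hne : x 1 0 ≠ 0 ∨ x 1 1 ≠ 0 := by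
    by_contra h
    push Not at h
    have := (Matrix.GeneralLinearGroup.det x).ne_zero
    rw [Matrix.GeneralLinearGroup.val_det_apply, Matrix.det_fin_two, h.1, h.2] at this
    simp at this
  rw [hφ.apply_eq x, Finset.sum_congr rfl fun i _ => by
    rw [hφ.apply_eq, h0, h1, hdet, hr, nu_neg_left]]
  rw [← Finset.mul_sum, ← mul_add, sum_nu (hφ.apply_one_add hξ) hne, mul_zero]

lemma glPairing_eq (x : SL2 p) :
    glPairing (fun y => φ (y * Matrix.SpecialLinearGroup.toGL x)) φ =
      (glGroup p).sphAvg φ (conj (φ 1)) (conj (φ (Matrix.SpecialLinearGroup.toGL sMat)))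
        ((glGroup p).ι x) := by
  unfold glPairing MatrixGroup.sphAvg
  rw [← coe_glGroup_K]
  refine setIntegral_congr_fun (glGroup p).measurableSet_K fun k hk => ?_
  simp only
  rw [hφ.apply_eq_nu_of_mem hξ hk, conj_nu]
  rfl

omit hξ in
lemma apply_toGL (g : SL2 p) : φ (Matrix.SpecialLinearGroup.toGL g) =
    (((‖rowMax (g 1 0) (g 1 1)‖ ^ 2)⁻¹ : ℝ) : ℂ) *
      nu (φ 1) (φ (Matrix.SpecialLinearGroup.toGL sMat)) (g 1 0) (g 1 1) := by
  rw [hφ.apply_eq, det_toGL]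
  simp

/-- The bottom row is `(-p^n, -y p^(-n))`. The ball `|y| ≤ p^(-2n)` contributes `φ(s)`; each larger
shell up to `|y| = 1` contributes a geometric term in `φ(1) = -p φ(s)`. The total telescopes to
`p^(-2n) φ(s)`. -/
lemma setIntegral_apply_tp (n : ℕ) :
    ∫ y in ball p 0, φ (Matrix.SpecialLinearGroup.toGL (sMat * nMat y * tp p n)) ∂padicHaar p =
      ((p : ℂ)⁻¹) ^ (2 * n) * φ (Matrix.SpecialLinearGroup.toGL sMat) := by
  have hp0 : (p : ℝ) ≠ 0 := cast_p_pos.ne'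
  have hpc : (p : ℂ) ≠ 0 := cast_p_ne_zero_complex
  have hc : ‖-(p : ℚ_[p]) ^ (n : ℤ)‖ = (p : ℝ) ^ (-(n : ℤ)) := by
    rw [norm_neg, Padic.norm_p_zpow]
  have hd : ∀ y : ℚ_[p], ‖-(y * ((p : ℚ_[p]) ^ (n : ℤ))⁻¹)‖ = ‖y‖ * (p : ℝ) ^ (n : ℤ) := by
    intro y
    rw [norm_neg, norm_mul, norm_inv, Padic.norm_p_zpow, zpow_neg, inv_inv]
  have hball : ∀ y ∈ ball p (-(2 * n : ℕ)),
      φ (Matrix.SpecialLinearGroup.toGL (sMat * nMat y * tp p n)) =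
        (p : ℂ) ^ (2 * n) * φ (Matrix.SpecialLinearGroup.toGL sMat) := by
    intro y hy
    rw [mem_ball] at hy
    have hle : ‖-(y * ((p : ℚ_[p]) ^ (n : ℤ))⁻¹)‖ ≤ ‖-(p : ℚ_[p]) ^ (n : ℤ)‖ := by
      rw [hc, hd]
      calc _ ≤ (p : ℝ) ^ (-(2 * n : ℕ) : ℤ) * (p : ℝ) ^ (n : ℤ) := by gcongr
        _ = _ := by
          rw [← zpow_add₀ hp0]
          congr 1
          push_cast
          ring
    rw [hφ.apply_toGL, (sl_row_s_nMat_tp n y).1, (sl_row_s_nMat_tp n y).2, nu_of_le hle, rowMax_of_le hle, hc]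
    congr 1
    rw [zpow_neg, inv_pow, inv_inv, zpow_natCast, ← pow_mul, mul_comm n]
    push_cast
    rfl
  have hshell : ∀ j : ℕ, ∀ y ∈ shell (-(2 * n : ℕ) + 1 + j : ℤ),
      φ (Matrix.SpecialLinearGroup.toGL (sMat * nMat y * tp p n)) =
        ((p : ℂ) ^ (-(2 * n : ℕ) + 1 + j : ℤ))⁻¹ * ((p : ℂ)⁻¹) ^ (j + 1) * φ 1 := by
    intro j y hy
    have hy' : ‖y‖ = (p : ℝ) ^ (-(2 * n : ℕ) + 1 + j : ℤ) := hy
    have hd' : ‖-(y * ((p : ℚ_[p]) ^ (n : ℤ))⁻¹)‖ = (p : ℝ) ^ (-(n : ℤ) + (1 + j)) := by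
      rw [hd, hy', ← zpow_add₀ hp0]
      congr 1
      push_cast
      ring
    have hlt : ‖-(p : ℚ_[p]) ^ (n : ℤ)‖ < ‖-(y * ((p : ℚ_[p]) ^ (n : ℤ))⁻¹)‖ := by
      rw [hc, hd']
      exact zpow_lt_zpow_right₀ one_lt_cast_p (by omega)
    rw [hφ.apply_toGL, (sl_row_s_nMat_tp n y).1, (sl_row_s_nMat_tp n y).2, nu_of_lt hlt, rowMax_of_lt hlt, hd']
    congr 1
    push_cast
    rw [← zpow_natCast, ← zpow_natCast, ← zpow_mul, ← zpow_neg, ← zpow_neg, inv_zpow',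
      ← zpow_add₀ hpc]
    congr 1
    push_cast
    ring
  have hcont := (glGroup p).continuous_apply_s_nMat_tp hφ.apply_mul_mem n
  have hint : IntegrableOn
      (fun y => φ (Matrix.SpecialLinearGroup.toGL (sMat * nMat y * tp p n)))
      (ball p (-(2 * n : ℕ) + (2 * n : ℕ))) (padicHaar p) :=
    hcont.continuousOn.integrableOn_compact (isCompact_ball _)
  have h := setIntegral_ball_add_eq_sum_shell (-(2 * n : ℕ)) (2 * n) hint
  have hA : φ 1 = -(p * φ (Matrix.SpecialLinearGroup.toGL sMat)) :=
    eq_neg_of_add_eq_zero_left (hφ.apply_one_add hξ)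
  have hterm : ∀ j ∈ Finset.range (2 * n), ∫ y in shell (-(2 * n : ℕ) + 1 + j : ℤ),
      φ (Matrix.SpecialLinearGroup.toGL (sMat * nMat y * tp p n)) ∂padicHaar p =
        ((p : ℂ)⁻¹) ^ (j + 1) * (1 - (p : ℂ)⁻¹) * φ 1 := by
    intro j _
    rw [setIntegral_shell_of_eq (hshell j)]
    have := zpow_ne_zero (-(2 * n : ℕ) + 1 + j : ℤ) hpc
    field_simp
  rw [Finset.sum_congr rfl hterm, ← Finset.sum_mul, sum_geometric_shell, setIntegral_ball_of_eq hball,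
    neg_add_cancel, zpow_neg, zpow_natCast, inv_mul_cancel_left₀ (pow_ne_zero _ hpc)] at h
  rw [h, hA]
  field_simp
  ring

/-- The value at `t^n` and the integral over `ℤ_p` scale by the same factor, so the average is a
multiple of its value at the identity. -/
lemma sphAvg_tp (n : ℕ) :
    (glGroup p).sphAvg φ (conj (φ 1)) (conj (φ (Matrix.SpecialLinearGroup.toGL sMat)))
      ((glGroup p).ι (tp p n)) = ((p : ℂ)⁻¹) ^ (2 * n) * ((glGroup p).μ.real (glGroup p).Γ *
        (conj (φ 1) * φ 1 + p * (conj (φ (Matrix.SpecialLinearGroup.toGL sMat)) *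
          φ (Matrix.SpecialLinearGroup.toGL sMat)))) := by
  have h := (glGroup p).sphAvg_tp hφ.apply_mul_mem (hφ.mem.apply_upper_mul hξ) (α := conj (φ 1))
    (β := conj (φ (Matrix.SpecialLinearGroup.toGL sMat))) n
  have h1 : φ ((glGroup p).ι (tp p n)) = ((p : ℂ)⁻¹) ^ (2 * n) * φ 1 := by
    refine (hφ.apply_toGL (tp p n)).trans ?_
    have hlt : ‖(0 : ℚ_[p])‖ < ‖((p : ℚ_[p]) ^ (n : ℤ))⁻¹‖ := by
      rw [norm_zero]
      exact norm_pos_iff.mpr (inv_ne_zero (zpow_ne_zero _ cast_p_ne_zero))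
    rw [(tp_apply _).2.2.1, (tp_apply _).2.2.2, nu_of_lt hlt, rowMax_of_lt hlt, norm_inv,
      Padic.norm_p_zpow, zpow_neg, inv_inv, zpow_natCast, ← pow_mul, mul_comm n, inv_pow]
    push_cast
    rfl
  rw [h, h1]
  have h2 := hφ.setIntegral_apply_tp hξ n
  change ∫ y in ball p 0, φ ((glGroup p).ι (sMat * nMat y * tp p n)) ∂padicHaar p = _ at h2
  rw [h2]
  ring

theorem isSteinbergCoeff_glCoeff : IsSteinbergCoeff (glCoeff φ) := by
  have h := ((glGroup p).isSteinbergCoeff_sphAvg hφ.apply_mul_mem (α := conj (φ 1))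
    (β := conj (φ (Matrix.SpecialLinearGroup.toGL sMat))) ?_ (hφ.sum_apply_mul hξ)).div_const
      (glPairing φ φ)
  · convert h using 2 with x
    unfold glCoeff
    rw [hφ.glPairing_eq hξ]
  · have := congrArg conj (hφ.apply_one_add hξ)
    simpa using this

theorem glCoeff_tp (n : ℕ) : glCoeff φ (tp p n) = ((p : ℂ)⁻¹) ^ (2 * n) := by
  have h0 : glPairing φ φ = (glGroup p).μ.real (glGroup p).Γ *
        (conj (φ 1) * φ 1 + p * (conj (φ (Matrix.SpecialLinearGroup.toGL sMat)) *
          φ (Matrix.SpecialLinearGroup.toGL sMat))) := by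
    -- At `n = 0` the average is the squared norm itself, which will cancel in the normalized
    -- coefficient.
    have h := hφ.sphAvg_tp hξ 0
    rw [← hφ.glPairing_eq hξ] at h
    have e : tp p ((0 : ℕ) : ℤ) = 1 := by apply sl_ext <;> simp [tp_apply]
    rw [e] at h
    simpa using h
  have hne : glPairing φ φ ≠ 0 := by
    rw [h0]
    refine mul_ne_zero ?_ ?_
    · have h3 := (glGroup p).measureReal_Γ
      rw [glGroup_measureReal_K] at h3
      intro h4
      rw [Complex.ofReal_eq_zero.mp h4, mul_zero] at h3
      exact zero_ne_one h3
    · exact conj_mul_self_add_ne_zero (hφ.apply_s_ne_zero hξ)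
  unfold glCoeff
  rw [hφ.glPairing_eq hξ, hφ.sphAvg_tp hξ, ← h0, mul_div_assoc, div_self hne, mul_one]

end IsGLNewvector

end

end

section

/-! ### The newvector of the special representation of the metaplectic group -/

lemma mp_mul (g k : SL2 p) (ε η : ℤˣ) :
    (⟨g, ε⟩ * ⟨k, η⟩ : Mp p) = ⟨g * k, cocycle g k * ε * η⟩ := rfl

lemma cocycle_one_left (g : SL2 p) : cocycle 1 g = 1 := by
  unfold cocycle
  exact hilbertSymbol_eq_one_of_sq_right _ ⟨xCoord g, by rw [one_mul]⟩

section

variable {ψ : AddChar ℚ_[p] Circle} (hp : p ≠ 2)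

include hp in
-- This is equivariance at `g = 1`. It identifies the splitting sign with the phase, and thereby
-- shows that the sign trivializes the cocycle on `SL₂(ℤ_p)`.
lemma rowPhase_of_mem {k : SL2 p} (hk : k ∈ slIntegral p) :
    rowPhase ψ (k 1 0) (k 1 1) = ((splitSign k : ℤ) : ℂ) := by
  have h := rowPhase_mul ψ hp (g := 1) hk
  rw [one_mul, cocycle_one_left, one_mul] at h
  rw [h]
  have h1 : rowPhase ψ ((1 : SL2 p) 1 0) ((1 : SL2 p) 1 1) = 1 := by
    have e0 : (1 : SL2 p) 1 0 = 0 := by simp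
    have e1 : (1 : SL2 p) 1 1 = 1 := by simp
    rw [e0, e1, rowPhase_zero ψ one_ne_zero, gam_of_norm_eq_one ψ (by simp)]
  rw [h1, mul_one]

include hp in
lemma splitSign_mul {k l : SL2 p} (hk : k ∈ slIntegral p) (hl : l ∈ slIntegral p) :
    splitSign (k * l) = cocycle k l * splitSign k * splitSign l := by
  -- The phase relation holds for every additive character; the trivial one suffices for an identity
  -- between signs.
  have h := rowPhase_mul (1 : AddChar ℚ_[p] Circle) hp (g := k) hl
  rw [rowPhase_of_mem hp (slIntegral_mul hk hl), rowPhase_of_mem hp hk] at h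
  have h1 : ((splitSign (k * l) : ℤ) : ℂ) = ((cocycle k l * splitSign k * splitSign l : ℤˣ) : ℤ) := by
    rw [h]
    push_cast
    ring
  exact Units.ext (by exact_mod_cast h1)

include hp in
lemma split_mul {k l : SL2 p} (hk : k ∈ slIntegral p) (hl : l ∈ slIntegral p) :
    split (k * l) = split k * split l := by
  unfold split
  rw [mp_mul, splitSign_mul hp hk hl]

end

lemma hilbertSymbol_unit_congr (hp : p ≠ 2) {u a b : ℚ_[p]} (hu : ‖u‖ = 1) (ha : a ≠ 0)
    (h : ‖a‖ = ‖b‖) : hilbertSymbol u a = hilbertSymbol u b := by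
  have hb : b ≠ 0 := norm_ne_zero_iff.mp (h ▸ norm_ne_zero_iff.mpr ha)
  rw [hilbertSymbol_unit_left hp hu ha, hilbertSymbol_unit_left hp hu hb, valuation_eq_of_norm_eq ha h]

lemma split_of_eq_zero {b : SL2 p} (h : b 1 0 = 0) : split b = ⟨b, 1⟩ := by
  rw [split, splitSign_of_eq_zero h]

lemma split_of_norm_eq_one {b : SL2 p} (h : ‖b 1 0‖ = 1) : split b = ⟨b, 1⟩ := by
  rw [split, splitSign_of_norm_eq_one h]

namespace IsMpNewvector

variable {ψ : AddChar ℚ_[p] Circle} {δ : ℚ_[p]} {h : Mp p → ℂ} (hh : IsMpNewvector ψ δ h)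
  (hψ : IsUnramifiedChar ψ) (hp : p ≠ 2) (hδ : ‖δ‖ = 1)

include hh hψ hp

lemma apply_upper_mul {b : SL2 p} (hb : b 1 0 = 0) (x : Mp p) :
    h (⟨b, 1⟩ * x) = gam ψ (-b 1 1) * ((hilbertSymbol δ (b 0 0) : ℤ) : ℂ) *
      ((‖b 0 0‖ ^ (3 / 2 : ℝ) : ℝ) : ℂ) * h x := by
  have hdet := sl_det b
  rw [hb, mul_zero, sub_zero] at hdet
  have ha : b 0 0 = (b 1 1)⁻¹ := eq_inv_of_mul_eq_one_left hdet
  have ha0 : b 0 0 ≠ 0 := left_ne_zero_of_mul (hdet ▸ one_ne_zero)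
  rw [hh.mem.transform b 1 x hb, chiPsi_eq hψ hp ha0]
  nth_rw 1 [ha]
  rw [← inv_neg, gam_inv]
  simp

lemma apply_sign (g : SL2 p) (ε : ℤˣ) : h ⟨g, ε⟩ = ((ε : ℤ) : ℂ) * h ⟨g, 1⟩ := by
  have h1 := hh.mem.transform 1 ε ⟨g, 1⟩ (by simp)
  have e : (1 : SL2 p) 0 0 = 1 := by simp
  rw [mp_mul, cocycle_one_left, one_mul, one_mul, mul_one, e, hilbertSymbol_one_right,
    chiPsi_eq hψ hp one_ne_zero, gam_of_norm_eq_one ψ (by simp)] at h1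
  simpa using h1

lemma apply_mul_split (g : SL2 p) (k : SL2 p) : h (⟨g, 1⟩ * split k) =
    (((cocycle g k * splitSign k : ℤˣ) : ℤ) : ℂ) * h ⟨g * k, 1⟩ := by
  unfold split
  rw [mp_mul, hh.apply_sign hψ hp, mul_one]

lemma apply_split_mul (g : SL2 p) (k : SL2 p) : h (split k * ⟨g, 1⟩) =
    (((cocycle k g * splitSign k : ℤˣ) : ℤ) : ℂ) * h ⟨k * g, 1⟩ := by
  unfold split
  rw [mp_mul, hh.apply_sign hψ hp, mul_one]

omit hψ hp in
lemma apply_split_of_mem {k : SL2 p} (hk : k ∈ slGamma0 p) : h (split k) = h ⟨1, 1⟩ := by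
  have h1 := hh.fixed k hk ⟨1, 1⟩
  unfold split at h1
  rw [mp_mul, cocycle_one_left, one_mul, one_mul, one_mul] at h1
  exact h1

omit hψ in
lemma apply_split_s_nMat {y : ℚ_[p]} (hy : ‖y‖ ≤ 1) : h (split (sMat * nMat y)) = h ⟨sMat, 1⟩ := by
  rw [split_mul hp sMat_mem (nMat_mem hy), hh.fixed _ (nMat_mem_slGamma0 hy),
    split_of_norm_eq_one (by simp [sMat])]

/-- The values along an Iwasawa decomposition. -/
lemma apply_upper_mul_mem {b k : SL2 p} (hb : b 1 0 = 0) (hk : k ∈ slIntegral p) :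
    h ⟨b * k, 1⟩ = rowPhase ψ ((b * k) 1 0) ((b * k) 1 1) * ((hilbertSymbol δ (b 0 0) : ℤ) : ℂ) *
      ((‖b 0 0‖ ^ (3 / 2 : ℝ) : ℝ) : ℂ) * h (split k) := by
  have h1 := hh.apply_upper_mul hψ hp hb (split k)
  rw [hh.apply_mul_split hψ hp] at h1
  rw [rowPhase_mul ψ hp hk, hb, rowPhase_zero ψ ((sl_row_ne_zero b).resolve_left (not_not.mpr hb))]
  have h2 := units_cast_mul_self (cocycle b k * splitSign k)
  linear_combination (((cocycle b k * splitSign k : ℤˣ) : ℤ) : ℂ) * h1 - h ⟨b * k, 1⟩ * h2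

include hδ

/-- The same Iwasawa decomposition as for `GL₂`. The whole metaplectic phase is `rowPhase`, just as
for the spherical Weil vector, up to the unramified sign `(δ, ·)`; this is what makes the product of
the two coefficients tractable. -/
theorem apply_eq (g : SL2 p) :
    h ⟨g, 1⟩ = rowPhase ψ (g 1 0) (g 1 1) *
      ((hilbertSymbol δ (rowMax (g 1 0) (g 1 1)) : ℤ) : ℂ) *
        ((‖(rowMax (g 1 0) (g 1 1))⁻¹‖ ^ (3 / 2 : ℝ) : ℝ) : ℂ) *
          nu (h ⟨1, 1⟩) (h ⟨sMat, 1⟩) (g 1 0) (g 1 1) := by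
  have key : ∀ k : SL2 p, k ∈ slIntegral p → (g * k⁻¹) 1 0 = 0 →
      ‖(g * k⁻¹) 1 1‖ = ‖rowMax (g 1 0) (g 1 1)‖ →
      h ⟨g, 1⟩ = rowPhase ψ (g 1 0) (g 1 1) *
      ((hilbertSymbol δ (rowMax (g 1 0) (g 1 1)) : ℤ) : ℂ) *
        ((‖(rowMax (g 1 0) (g 1 1))⁻¹‖ ^ (3 / 2 : ℝ) : ℝ) : ℂ) * h (split k) := by
    intro k hk h0 h1
    have h2 := hh.apply_upper_mul_mem hψ hp h0 hk
    rw [inv_mul_cancel_right] at h2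
    have hdet := sl_det (g * k⁻¹)
    rw [h0, mul_zero, sub_zero] at hdet
    have ha : (g * k⁻¹) 0 0 = ((g * k⁻¹) 1 1)⁻¹ := eq_inv_of_mul_eq_one_left hdet
    have hd0 : (g * k⁻¹) 1 1 ≠ 0 := right_ne_zero_of_mul (hdet ▸ one_ne_zero)
    rw [h2, ha, hilbertSymbol_inv_right _ hd0, hilbertSymbol_unit_congr hp hδ hd0 h1, norm_inv, h1,
      norm_inv]
  rcases le_or_gt ‖g 1 1‖ ‖g 1 0‖ with hle | hlt
  · have hc := sl_left_ne_zero_of_le hle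
    have hy : ‖g 1 1 / g 1 0‖ ≤ 1 := by
      rw [norm_div]
      exact div_le_one_of_le₀ hle (norm_nonneg _)
    rw [key _ (slIntegral_mul sMat_mem (nMat_mem hy)), hh.apply_split_s_nMat hp hy, nu_of_le hle]
    · rw [sl_mul_apply, (sl_inv_apply _).1, (sl_inv_apply _).2.2.1, sl_mul_apply, sl_mul_apply]
      simp [sMat, nMat]
      field_simp
      ring
    · rw [sl_mul_apply, (sl_inv_apply _).2.1, (sl_inv_apply _).2.2.2, sl_mul_apply, sl_mul_apply,
        rowMax_of_le hle]
      simp [sMat, nMat]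
  · have hd := ne_zero_of_norm_lt hlt
    have hz : ‖g 1 0 / g 1 1‖ < 1 := by
      rw [norm_div, div_lt_one (norm_pos_iff.mpr hd)]
      exact hlt
    rw [key _ (nLow_mem_slGamma0 hz).1, hh.apply_split_of_mem (nLow_mem_slGamma0 hz), nu_of_lt hlt]
    · rw [sl_mul_apply, (sl_inv_apply _).1, (sl_inv_apply _).2.2.1]
      simp [nLow]
      field_simp
      ring
    · rw [sl_mul_apply, (sl_inv_apply _).2.1, (sl_inv_apply _).2.2.2, rowMax_of_lt hlt]
      simp [nLow]

lemma apply_split {k : SL2 p} (hk : k ∈ slIntegral p) :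
    h (split k) = nu (h ⟨1, 1⟩) (h ⟨sMat, 1⟩) (k 1 0) (k 1 1) := by
  have hr : ‖rowMax (k 1 0) (k 1 1)‖ = 1 := by
    have h1 := norm_rowMax_mul_eq (g := 1) hk
    rw [one_mul] at h1
    rw [h1, norm_rowMax]
    simp
  rw [split, hh.apply_sign hψ hp, hh.apply_eq hψ hp hδ, rowPhase_of_mem hp hk,
    hilbertSymbol_units hp hδ hr, norm_inv, hr, inv_one, Real.one_rpow]
  have h2 := units_cast_mul_self (splitSign k)
  push_cast
  linear_combination nu (h ⟨1, 1⟩) (h ⟨sMat, 1⟩) (k 1 0) (k 1 1) * h2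

/-- Along the splitting the phase and the absolute value are constant; only the choice between the
two values of `nu` moves with `k`. -/
lemma apply_mul_split_eq (g : SL2 p) {k : SL2 p} (hk : k ∈ slIntegral p) :
    h (⟨g, 1⟩ * split k) = rowPhase ψ (g 1 0) (g 1 1) *
      ((hilbertSymbol δ (rowMax (g 1 0) (g 1 1)) : ℤ) : ℂ) *
        ((‖(rowMax (g 1 0) (g 1 1))⁻¹‖ ^ (3 / 2 : ℝ) : ℝ) : ℂ) *
          nu (h ⟨1, 1⟩) (h ⟨sMat, 1⟩) ((g * k) 1 0) ((g * k) 1 1) := by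
  have hr := norm_rowMax_mul_eq (g := g) hk
  rw [hh.apply_mul_split hψ hp, hh.apply_eq hψ hp hδ, rowPhase_mul ψ hp hk,
    hilbertSymbol_unit_congr hp hδ (rowMax_ne_zero _) hr, norm_inv, hr, norm_inv]
  have h2 := units_cast_mul_self (cocycle g k * splitSign k)
  linear_combination rowPhase ψ (g 1 0) (g 1 1) *
      ((hilbertSymbol δ (rowMax (g 1 0) (g 1 1)) : ℤ) : ℂ) *
        ((‖rowMax (g 1 0) (g 1 1)‖⁻¹ ^ (3 / 2 : ℝ) : ℝ) : ℂ) *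
          nu (h ⟨1, 1⟩) (h ⟨sMat, 1⟩) ((g * k) 1 0) ((g * k) 1 1) * h2

end IsMpNewvector

end

section

/-! ### The values of the metaplectic newvector on `s n(x)` -/

lemma cocycle_s_nMat (x : ℚ_[p]) : cocycle sMat (nMat x) = 1 := by
  have h1 : (sMat * nMat x : SL2 p) 1 0 = -1 := by
    rw [sl_mul_apply]
    simp [sMat, nMat]
  unfold cocycle
  rw [xCoord_of_ne_zero (g := sMat) (by simp [sMat]),
    xCoord_of_ne_zero (g := sMat * nMat x) (by simp [h1]),
    xCoord_of_eq_zero (g := nMat x) (by simp [nMat]), h1, hilbertSymbol_comm]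
  exact hilbertSymbol_eq_one_of_sq_right _ ⟨1, by simp [sMat]⟩

lemma sl_row_s_nMat (x : ℚ_[p]) :
    (sMat * nMat x : SL2 p) 1 0 = -1 ∧ (sMat * nMat x : SL2 p) 1 1 = -x := by
  rw [sl_mul_apply, sl_mul_apply]
  simp [sMat, nMat]

lemma rpow_three_halves_zpow (n : ℤ) : ((p : ℝ) ^ (2 * n)) ^ (3 / 2 : ℝ) = (p : ℝ) ^ (3 * n) := by
  rw [← Real.rpow_intCast, ← Real.rpow_mul cast_p_pos.le, ← Real.rpow_intCast]
  congr 1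
  push_cast
  ring

lemma valuation_of_mem_shell {m : ℤ} {x : ℚ_[p]} (hx : x ∈ shell m) : x.valuation = -m := by
  have hx' : ‖x‖ = (p : ℝ) ^ m := hx
  have h0 : x ≠ 0 := norm_ne_zero_iff.mp (hx' ▸ zpow_ne_zero _ cast_p_pos.ne')
  rw [Padic.norm_eq_zpow_neg_valuation h0] at hx'
  have := zpow_right_injective₀ cast_p_pos one_lt_cast_p.ne' hx'
  omega

/-- Even exponents are used so that passing to the next ball adds one odd and one even shell. -/
lemma aecover_ball : AECover (padicHaar p) atTop fun n : ℕ => ball p (2 * n) where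
  ae_eventually_mem := by
    refine Eventually.of_forall fun x => ?_
    obtain ⟨N, hN⟩ := pow_unbounded_of_one_lt ‖x‖ (one_lt_cast_p (p := p))
    filter_upwards [eventually_ge_atTop N] with n hn
    rw [mem_ball]
    refine hN.le.trans ?_
    rw [← zpow_natCast]
    exact zpow_le_zpow_right₀ one_lt_cast_p.le (by omega)
  measurableSet n := measurableSet_ball _

namespace IsMpNewvector

variable {ψ : AddChar ℚ_[p] Circle} {δ : ℚ_[p]} {h : Mp p → ℂ} (hh : IsMpNewvector ψ δ h)
  (hψ : IsUnramifiedChar ψ) (hp : p ≠ 2) (hδ : ‖δ‖ = 1) (hδ' : leg δ = -1)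

include hh hψ hp hδ

omit hψ hδ in
lemma apply_s_nMat_of_le {x : ℚ_[p]} (hx : ‖x‖ ≤ 1) : h ⟨sMat * nMat x, 1⟩ = h ⟨sMat, 1⟩ := by
  rw [← split_of_norm_eq_one (b := sMat * nMat x) (by simp [(sl_row_s_nMat x).1])]
  exact hh.apply_split_s_nMat hp hx

lemma apply_s_nMat_of_lt {x : ℚ_[p]} (hx : 1 < ‖x‖) :
    h ⟨sMat * nMat x, 1⟩ = gam ψ x * ((hilbertSymbol δ x : ℤ) : ℂ) *
      ((‖x‖⁻¹ ^ (3 / 2 : ℝ) : ℝ) : ℂ) * h ⟨1, 1⟩ := by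
  have hlt : ‖(-1 : ℚ_[p])‖ < ‖-x‖ := by simpa using hx
  have hx0 : x ≠ 0 := norm_pos_iff.mp (one_pos.trans hx)
  have h1 : hilbertSymbol (-(-1)) (-x) = 1 := by
    rw [neg_neg, hilbertSymbol_comm, hilbertSymbol_one_right]
  rw [hh.apply_eq hψ hp hδ, (sl_row_s_nMat x).1, (sl_row_s_nMat x).2, rowPhase_of_lt ψ hlt
    neg_one_ne_zero_padic, rowMax_of_lt hlt, nu_of_lt hlt, h1, neg_neg, norm_inv, norm_neg,
    hilbertSymbol_unit_congr hp hδ (neg_ne_zero.mpr hx0) (norm_neg x)]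
  simp

lemma norm_apply_s_nMat_of_lt {x : ℚ_[p]} (hx : 1 < ‖x‖) :
    ‖h ⟨sMat * nMat x, 1⟩‖ = ‖x‖⁻¹ ^ (3 / 2 : ℝ) * ‖h ⟨1, 1⟩‖ := by
  rw [hh.apply_s_nMat_of_lt hψ hp hδ hx, norm_mul, norm_mul, norm_mul, norm_gam hψ hp,
    norm_units_cast, one_mul, one_mul, Complex.norm_real, Real.norm_of_nonneg (by positivity)]

lemma apply_s_nMat_add (x : ℚ_[p]) {y : ℚ_[p]} (hy : ‖y‖ ≤ 1) :
    h ⟨sMat * nMat (x + y), 1⟩ = h ⟨sMat * nMat x, 1⟩ := by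
  rcases le_or_gt ‖x‖ 1 with hx | hx
  · rw [hh.apply_s_nMat_of_le hp hx,
      hh.apply_s_nMat_of_le hp (norm_add_le_of_le hx hy)]
  · have h1 : ‖x + y - x‖ < ‖x‖ := by
      rw [add_sub_cancel_left]
      exact hy.trans_lt hx
    have hx0 : x ≠ 0 := norm_pos_iff.mp (one_pos.trans hx)
    have h2 := norm_eq_of_norm_sub_lt h1
    rw [hh.apply_s_nMat_of_lt hψ hp hδ hx, hh.apply_s_nMat_of_lt hψ hp hδ (h2 ▸ hx),
      gam_congr ψ hp hx0 h1, h2, hilbertSymbol_unit_congr hp hδ hx0 h2.symm]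

lemma continuous_apply_s_nMat : Continuous fun x => h ⟨sMat * nMat x, 1⟩ := by
  refine IsLocallyConstant.continuous ((IsLocallyConstant.iff_exists_open _).mpr fun x => ?_)
  refine ⟨Metric.closedBall x 1, IsUltrametricDist.isOpen_closedBall _ one_ne_zero,
    Metric.mem_closedBall_self zero_le_one, fun y hy => ?_⟩
  rw [Metric.mem_closedBall, dist_eq_norm] at hy
  rw [← hh.apply_s_nMat_add hψ hp hδ x hy, add_sub_cancel]

lemma integrableOn_apply_s_nMat (m : ℤ) :
    IntegrableOn (fun x => h ⟨sMat * nMat x, 1⟩) (ball p m) (padicHaar p) :=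
  (hh.continuous_apply_s_nMat hψ hp hδ).continuousOn.integrableOn_compact (isCompact_ball m)

/-- Every sign and Weil index is trivial at even valuation; `|x|^(-3/2) = p^(-3n)` meets the volume
`p^(2n) (1 - p⁻¹)`. -/
lemma setIntegral_even_shell {n : ℤ} (hn : 0 < n) :
    ∫ x in shell (2 * n), h ⟨sMat * nMat x, 1⟩ ∂padicHaar p =
      (p : ℂ) ^ (-n) * (1 - (p : ℂ)⁻¹) * h ⟨1, 1⟩ := by
  have hpc : (p : ℂ) ≠ 0 := cast_p_ne_zero_complex
  rw [setIntegral_shell_of_eq (z := (p : ℂ) ^ (-(3 * n)) * h ⟨1, 1⟩)]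
  · have e : (p : ℂ) ^ (-n) = (p : ℂ) ^ (2 * n) * (p : ℂ) ^ (-(3 * n)) := by
      rw [← zpow_add₀ hpc]
      congr 1
      ring
    rw [e]
    ring
  · intro x hx
    have hx' : ‖x‖ = (p : ℝ) ^ (2 * n) := hx
    have hlt : 1 < ‖x‖ := by
      rw [hx']
      exact one_lt_zpow₀ one_lt_cast_p (by omega)
    have hx0 : x ≠ 0 := norm_pos_iff.mp (one_pos.trans hlt)
    have hv : Even x.valuation := ⟨-n, by rw [valuation_of_mem_shell hx]; ring⟩
    rw [hh.apply_s_nMat_of_lt hψ hp hδ hlt, gam_of_even ψ hv, hilbertSymbol_unit_left hp hδ hx0,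
      units_zpow_of_even hv, hx', Real.inv_rpow (zpow_nonneg cast_p_pos.le _),
      rpow_three_halves_zpow, zpow_neg]
    push_cast
    ring

include hδ' in
-- The substitution `x ↦ δ x` preserves the shell. At odd valuation it reverses the sign of the Weil
-- index, because `δ` is a nonsquare unit, and leaves the other factors alone.
lemma setIntegral_odd_shell {m : ℤ} (hm : 0 < m) (hodd : Odd m) :
    ∫ x in shell m, h ⟨sMat * nMat x, 1⟩ ∂padicHaar p = 0 := by
  have h1 := setIntegral_comp_mul (ne_zero_of_norm_eq_one hδ) (fun x => h ⟨sMat * nMat x, 1⟩)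
    (shell m)
  have hpre : (fun x => δ * x) ⁻¹' shell m = shell m := by
    ext x
    change ‖δ * x‖ = _ ↔ ‖x‖ = _
    rw [norm_mul, hδ, one_mul]
  rw [hpre, hδ, inv_one, one_smul] at h1
  have h2 : ∫ x in shell m, h ⟨sMat * nMat (δ * x), 1⟩ ∂padicHaar p =
      ∫ x in shell m, -h ⟨sMat * nMat x, 1⟩ ∂padicHaar p := by
    refine setIntegral_congr_fun (measurableSet_shell m) fun x hx => ?_
    have hx' : ‖x‖ = (p : ℝ) ^ m := hx
    have hlt : 1 < ‖x‖ := by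
      rw [hx']
      exact one_lt_zpow₀ one_lt_cast_p hm
    have hx0 : x ≠ 0 := norm_pos_iff.mp (one_pos.trans hlt)
    have hn : ‖δ * x‖ = ‖x‖ := by rw [norm_mul, hδ, one_mul]
    have hv : Odd x.valuation := by
      rw [valuation_of_mem_shell hx]
      exact hodd.neg
    rw [hh.apply_s_nMat_of_lt hψ hp hδ hlt, hh.apply_s_nMat_of_lt hψ hp hδ (hn ▸ hlt),
      gam_unit_mul hψ hp hδ hx0, hn, hilbertSymbol_unit_congr hp hδ hx0 hn.symm,
      hilbertSymbol_unit_left hp hδ (mul_ne_zero (ne_zero_of_norm_eq_one hδ) hx0),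
      ← valuation_eq_of_norm_eq hx0 hn.symm, units_zpow_of_odd hv, hδ']
    push_cast
    ring
  rw [h2, integral_neg] at h1
  linear_combination -(1 / 2 : ℂ) * h1

include hδ' in
lemma setIntegral_apply_s_nMat (n : ℕ) :
    ∫ x in ball p (2 * n), h ⟨sMat * nMat x, 1⟩ ∂padicHaar p =
      h ⟨sMat, 1⟩ + (p : ℂ)⁻¹ * (1 - (p : ℂ)⁻¹ ^ n) * h ⟨1, 1⟩ := by
  induction n with
  | zero =>
    rw [setIntegral_ball_of_eq (z := h ⟨sMat, 1⟩)]
    · simp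
    · intro x hx
      exact hh.apply_s_nMat_of_le hp (by simpa using mem_ball.mp hx)
  | succ n ih =>
    have e1 : (2 * ((n + 1 : ℕ) : ℤ)) - 1 = 2 * n + 1 := by push_cast; ring
    have e2 : (2 * (n : ℤ) + 1) - 1 = 2 * n := by ring
    rw [setIntegral_ball_eq_add_shell _ (hh.integrableOn_apply_s_nMat hψ hp hδ _), e1,
      setIntegral_ball_eq_add_shell _ (hh.integrableOn_apply_s_nMat hψ hp hδ _), e2, ih,
      hh.setIntegral_odd_shell hψ hp hδ hδ' (by omega) ⟨n, rfl⟩,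
      hh.setIntegral_even_shell hψ hp hδ (by positivity), zpow_neg, zpow_natCast, ← inv_pow]
    ring

lemma setIntegral_norm_shell {m : ℤ} (hm : 0 < m) :
    ∫ x in shell m, ‖h ⟨sMat * nMat x, 1⟩‖ ∂padicHaar p =
      (p : ℝ) ^ m * (1 - (p : ℝ)⁻¹) * (((p : ℝ) ^ m)⁻¹ ^ (3 / 2 : ℝ) * ‖h ⟨1, 1⟩‖) := by
  have h1 : ∀ x ∈ shell m, ‖h ⟨sMat * nMat x, 1⟩‖ =
      ((p : ℝ) ^ m)⁻¹ ^ (3 / 2 : ℝ) * ‖h ⟨1, 1⟩‖ := by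
    intro x hx
    have hx' : ‖x‖ = (p : ℝ) ^ m := hx
    rw [hh.norm_apply_s_nMat_of_lt hψ hp hδ (hx' ▸ one_lt_zpow₀ one_lt_cast_p hm), hx']
  rw [setIntegral_congr_fun (measurableSet_shell m) h1, setIntegral_const, measureReal_shell,
    smul_eq_mul]

/-- Absolute integrability is needed before the integral over `ℚ_p` can be computed along balls.
Each added pair of shells contributes at most `2 p^(-n) (1 - p⁻¹) ‖h(1)‖`, so the bound telescopes.
-/
lemma integral_norm_bounded (n : ℕ) :
    ∫ x in ball p (2 * n), ‖h ⟨sMat * nMat x, 1⟩‖ ∂padicHaar p ≤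
      ‖h ⟨sMat, 1⟩‖ + 2 * (1 - (p : ℝ)⁻¹ ^ n) * ‖h ⟨1, 1⟩‖ := by
  have hint : ∀ m, IntegrableOn (fun x => ‖h ⟨sMat * nMat x, 1⟩‖) (ball p m) (padicHaar p) :=
    fun m => (hh.integrableOn_apply_s_nMat hψ hp hδ m).norm
  have hp0 : (p : ℝ) ≠ 0 := cast_p_pos.ne'
  have hq : 0 ≤ 1 - (p : ℝ)⁻¹ := sub_nonneg.mpr (inv_le_one_of_one_le₀ one_lt_cast_p.le)
  induction n with
  | zero =>
    have h1 : ∀ x ∈ ball p (2 * (0 : ℕ)), ‖h ⟨sMat * nMat x, 1⟩‖ = ‖h ⟨sMat, 1⟩‖ := fun x hx => by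
      rw [hh.apply_s_nMat_of_le hp (by simpa using mem_ball.mp hx)]
    rw [setIntegral_congr_fun (measurableSet_ball _) h1, setIntegral_const, measureReal_ball]
    simp
  | succ n ih =>
    have e1 : (2 * ((n + 1 : ℕ) : ℤ)) - 1 = 2 * n + 1 := by push_cast; ring
    have e2 : (2 * (n : ℤ) + 1) - 1 = 2 * n := by ring
    rw [setIntegral_ball_eq_add_shell _ (hint _), e1, setIntegral_ball_eq_add_shell _ (hint _), e2,
      hh.setIntegral_norm_shell hψ hp hδ (by omega), hh.setIntegral_norm_shell hψ hp hδ (by omega)]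
    have b1 : (p : ℝ) ^ (2 * (n : ℤ) + 1) * ((p : ℝ) ^ (2 * (n : ℤ) + 1))⁻¹ ^ (3 / 2 : ℝ) ≤
        (p : ℝ)⁻¹ ^ n := by
      -- The half-integral exponent `3(2n + 1)/2` is weakened to the integer `3n + 1`, which still
      -- suffices.
      have b2 : ((p : ℝ) ^ (2 * (n : ℤ) + 1))⁻¹ ^ (3 / 2 : ℝ) ≤ (p : ℝ) ^ (-(3 * n + 1) : ℤ) := by
        rw [← zpow_neg, ← Real.rpow_intCast, ← Real.rpow_mul cast_p_pos.le, ← Real.rpow_intCast]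
        refine Real.rpow_le_rpow_of_exponent_le one_lt_cast_p.le ?_
        push_cast
        linarith
      calc _ ≤ (p : ℝ) ^ (2 * (n : ℤ) + 1) * (p : ℝ) ^ (-(3 * n + 1) : ℤ) := by gcongr
        _ = _ := by
          rw [← zpow_add₀ hp0, inv_pow, ← zpow_natCast, ← zpow_neg]
          congr 1
          ring
    have b3 : (p : ℝ) ^ (2 * ((n + 1 : ℕ) : ℤ)) * ((p : ℝ) ^ (2 * ((n + 1 : ℕ) : ℤ)))⁻¹ ^ (3 / 2 : ℝ) ≤
        (p : ℝ)⁻¹ ^ n := by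
      rw [Real.inv_rpow (zpow_nonneg cast_p_pos.le _), rpow_three_halves_zpow, ← zpow_neg,
        ← zpow_add₀ hp0, inv_pow, ← zpow_natCast, ← zpow_neg]
      exact zpow_le_zpow_right₀ one_lt_cast_p.le (by push_cast; omega)
    have hα := norm_nonneg (h ⟨1, 1⟩)
    have c1 := mul_le_mul_of_nonneg_right b1 (mul_nonneg hq hα)
    have c2 := mul_le_mul_of_nonneg_right b3 (mul_nonneg hq hα)
    rw [pow_succ]
    linarith

lemma integrable_apply_s_nMat : Integrable (fun x => h ⟨sMat * nMat x, 1⟩) (padicHaar p) := by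
  refine (aecover_ball (p := p)).integrable_of_integral_norm_bounded (‖h ⟨sMat, 1⟩‖ + 2 * ‖h ⟨1, 1⟩‖)
    (fun n => hh.integrableOn_apply_s_nMat hψ hp hδ _)
    (Eventually.of_forall fun n => (hh.integral_norm_bounded hψ hp hδ n).trans ?_)
  have h1 : (0 : ℝ) ≤ (p : ℝ)⁻¹ ^ n := by positivity
  nlinarith [norm_nonneg (h ⟨1, 1⟩)]

include hδ' in
-- Only `Δ = 0` of the vanishing condition is used: the integrals over growing balls tend to `h(s) +
-- p⁻¹ h(1)`.
theorem apply_one_add : h ⟨1, 1⟩ + p * h ⟨sMat, 1⟩ = 0 := by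
  have h0 : ∫ x, h ⟨sMat * nMat x, 1⟩ ∂padicHaar p = 0 := by
    rw [← hh.mem.vanishing 0]
    congr 1
    ext x
    rw [mp_mul, cocycle_s_nMat]
    simp
  have h1 := (aecover_ball (p := p)).integral_tendsto_of_countably_generated
    (hh.integrable_apply_s_nMat hψ hp hδ)
  simp_rw [h0, hh.setIntegral_apply_s_nMat hψ hp hδ hδ'] at h1
  have hlt : ‖(p : ℂ)⁻¹‖ < 1 := by
    rw [norm_inv, Complex.norm_natCast]
    exact inv_lt_one_of_one_lt₀ one_lt_cast_p
  have h2 : Tendsto (fun n : ℕ => h ⟨sMat, 1⟩ + (p : ℂ)⁻¹ * (1 - (p : ℂ)⁻¹ ^ n) * h ⟨1, 1⟩) atTop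
      (𝓝 (h ⟨sMat, 1⟩ + (p : ℂ)⁻¹ * (1 - 0) * h ⟨1, 1⟩)) :=
    tendsto_const_nhds.add (((tendsto_const_nhds.sub
      (tendsto_pow_atTop_nhds_zero_of_norm_lt_one hlt)).const_mul _).mul_const _)
  have h3 := tendsto_nhds_unique h1 h2
  have hpc : (p : ℂ) ≠ 0 := cast_p_ne_zero_complex
  field_simp at h3
  linear_combination -h3

end IsMpNewvector

end

section

lemma slGroup_ι (x : SL2 p) : (slGroup p).ι x = x := rfl

/-! ### The product of the metaplectic matrix coefficients -/

/-- The product of `\bar h` and the matrix coefficient of the Weil representation. -/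
def mpProd (Ψ : AddChar ℚ_[p] Circle) (h : Mp p → ℂ) (g : SL2 p) : ℂ :=
  conj (h ⟨g, 1⟩) * weilMC Ψ g

lemma xCoord_tp (n : ℤ) : xCoord (tp p n) = ((p : ℚ_[p]) ^ n)⁻¹ := by
  rw [xCoord_of_eq_zero (tp_apply n).2.2.1, (tp_apply n).2.2.2]

lemma s_nMat_mul_tp (n : ℤ) (y : ℚ_[p]) :
    sMat * nMat y * tp p n = tp p (-n) * (sMat * nMat (((p : ℚ_[p]) ^ n)⁻¹ ^ 2 * y)) := by
  have hp0 : (p : ℚ_[p]) ^ n ≠ 0 := zpow_ne_zero _ cast_p_ne_zero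
  rw [← mul_assoc, ← sMat_mul_tp, mul_assoc sMat (tp p n), tp_mul_nMat, mul_assoc]
  congr 3
  field_simp

/-- Two decompositions of the same element of the metaplectic group. -/
lemma mp_s_nMat_mul_tp (n : ℤ) (y : ℚ_[p]) :
    (⟨sMat * nMat y, 1⟩ * ⟨tp p n, 1⟩ : Mp p) =
      ⟨tp p (-n), 1⟩ * ⟨sMat * nMat (((p : ℚ_[p]) ^ n)⁻¹ ^ 2 * y), 1⟩ := by
  have hp0 : (p : ℚ_[p]) ^ n ≠ 0 := zpow_ne_zero _ cast_p_ne_zero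
  rw [mp_mul, mp_mul, ← s_nMat_mul_tp]
  congr 3
  unfold cocycle
  rw [← s_nMat_mul_tp, xCoord_tp, xCoord_tp]
  have hx : ∀ z : ℚ_[p], xCoord (sMat * nMat z) = -1 := fun z => by
    rw [xCoord_of_ne_zero (by simp [(sl_row_s_nMat z).1]), (sl_row_s_nMat z).1]
  have h3 : xCoord (sMat * nMat y * tp p n) = -(p : ℚ_[p]) ^ n := by
    rw [xCoord_of_ne_zero (by rw [(sl_row_s_nMat_tp n y).1]; exact neg_ne_zero.mpr hp0),
      (sl_row_s_nMat_tp n y).1]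
  rw [hx, hx, h3]
  have e1 : ((p : ℚ_[p]) ^ n)⁻¹ * -(p : ℚ_[p]) ^ n = -1 := by field_simp
  have e2 : ((p : ℚ_[p]) ^ (-n))⁻¹ * -(p : ℚ_[p]) ^ n = -1 * ((p : ℚ_[p]) ^ n) ^ 2 := by
    rw [zpow_neg, inv_inv]
    ring
  have e3 : -1 * -(p : ℚ_[p]) ^ n = (p : ℚ_[p]) ^ n := by ring
  rw [e1, e2, e3, hilbertSymbol_comm (-1 * _), hilbertSymbol_mul_sq_right _ _ hp0]

lemma weilMC_one {Ψ : AddChar ℚ_[p] Circle} (hΨ : IsUnramifiedChar Ψ) (hp : p ≠ 2) :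
    weilMC Ψ 1 = 1 := by
  have h := weilMC_tMat_pow hΨ hp (n := 0) (u := 1) (by simp)
  have e : (tMat 1 : SL2 p) = 1 := by apply sl_ext <;> simp [tMat]
  rw [e, gam_of_norm_eq_one Ψ (by simp)] at h
  simpa using h

lemma tp_zero : tp p 0 = 1 := by
  apply sl_ext <;> simp [tp_apply]

lemma rpow_norm_p_pow (n : ℕ) :
    ‖(p : ℚ_[p]) ^ (n : ℤ)‖ ^ (3 / 2 : ℝ) = ((√(p : ℝ) ^ n)⁻¹) ^ 3 := by
  have h1 : ‖(p : ℚ_[p]) ^ (n : ℤ)‖ = ((√(p : ℝ) ^ n)⁻¹) ^ 2 := by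
    rw [Padic.norm_p_zpow, zpow_neg, zpow_natCast, inv_pow, ← pow_mul, mul_comm n, pow_mul,
      Real.sq_sqrt (Nat.cast_nonneg p)]
  have h2 : (0 : ℝ) ≤ (√(p : ℝ) ^ n)⁻¹ := by positivity
  rw [h1, ← Real.rpow_natCast _ 2, ← Real.rpow_mul h2, ← Real.rpow_natCast _ 3]
  norm_num

namespace IsMpNewvector

variable {Ψ : AddChar ℚ_[p] Circle} {D δ : ℚ_[p]} {h : Mp p → ℂ}
  (hh : IsMpNewvector (Ψ.mulShift D) δ h) (hΨ : IsUnramifiedChar Ψ) (hp : p ≠ 2) (hD : ‖D‖ = 1)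
  (hδ : ‖δ‖ = 1) (hδ' : leg δ = -1)

include hh hΨ hp hD

/-- The sign `cocycle * splitSign` occurs in both factors and cancels, so the product follows `h`
along the splitting. -/
lemma mpProd_mul_eq (g : SL2 p) {k : SL2 p} (hk : k ∈ slIntegral p) :
    mpProd Ψ h (g * k) = conj (h (⟨g, 1⟩ * split k)) * weilMC Ψ g := by
  unfold mpProd
  rw [hh.apply_mul_split (hΨ.mulShift hD) hp, weilMC_mul hΨ hp hk, map_mul, conj_units_cast]
  ring

lemma mpProd_mul_left_eq (g : SL2 p) {k : SL2 p} (hk : k ∈ slIntegral p) :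
    mpProd Ψ h (k * g) = conj (h (split k * ⟨g, 1⟩)) * weilMC Ψ g := by
  unfold mpProd
  rw [hh.apply_split_mul (hΨ.mulShift hD) hp, weilMC_mul_left hΨ hp hk, map_mul, conj_units_cast]
  ring

lemma mpProd_mul_mem : ∀ x, ∀ γ ∈ (slGroup p).Γ, mpProd Ψ h (x * γ) = mpProd Ψ h x := by
  intro x γ hγ
  rw [mem_slGroup_Γ] at hγ
  rw [hh.mpProd_mul_eq hΨ hp hD x hγ.1, hh.fixed γ hγ]
  rfl

include hδ

lemma mpProd_upper_mul : ∀ b ∈ (slGroup p).K, (slGroup p).m b 1 0 = 0 →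
    ∀ x, mpProd Ψ h (b * x) = mpProd Ψ h x := by
  intro b hb h0 x
  have h0' : b 1 0 = 0 := h0
  have hb' : b ∈ slIntegral p := mem_slIntegral_iff.mpr hb
  obtain ⟨ha, hd⟩ := norm_diag_of_norm_lt_one hb' (by rw [h0', norm_zero]; exact one_pos)
  rw [hh.mpProd_mul_left_eq hΨ hp hD x hb', split_of_eq_zero h0',
    hh.apply_upper_mul (hΨ.mulShift hD) hp h0', gam_of_norm_eq_one _ (by rwa [norm_neg]),
    hilbertSymbol_units hp hδ ha, ha, Real.one_rpow]
  simp [mpProd]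

lemma sum_mpProd_mul (hαβ : h ⟨1, 1⟩ + p * h ⟨sMat, 1⟩ = 0) (x : SL2 p) : mpProd Ψ h x +
    ∑ i ∈ Finset.range p, mpProd Ψ h (x * (nMat (i : ℚ_[p]) * sMat)) = 0 := by
  have hrow : ∀ i : ℕ, (x * (nMat (i : ℚ_[p]) * sMat) : SL2 p) 1 0 =
      -(x 1 1 + (i : ℚ_[p]) * x 1 0) ∧
        (x * (nMat (i : ℚ_[p]) * sMat) : SL2 p) 1 1 = x 1 0 := by
    intro i
    constructor
    · rw [sl_mul_apply, sl_mul_apply, sl_mul_apply]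
      simp [sMat, nMat]
      ring
    · rw [sl_mul_apply, sl_mul_apply, sl_mul_apply]
      simp [sMat, nMat]
  set z := rowPhase (Ψ.mulShift D) (x 1 0) (x 1 1) *
      ((hilbertSymbol δ (rowMax (x 1 0) (x 1 1)) : ℤ) : ℂ) *
        ((‖(rowMax (x 1 0) (x 1 1))⁻¹‖ ^ (3 / 2 : ℝ) : ℝ) : ℂ) with hz
  have hterm : ∀ i ∈ Finset.range p, mpProd Ψ h (x * (nMat (i : ℚ_[p]) * sMat)) =
      conj z * weilMC Ψ x * conj (nu (h ⟨1, 1⟩) (h ⟨sMat, 1⟩) (x 1 1 + (i : ℚ_[p]) * x 1 0)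
        (x 1 0)) := by
    intro i _
    have hk : (nMat (i : ℚ_[p]) * sMat : SL2 p) ∈ slIntegral p :=
      slIntegral_mul (nMat_mem (norm_natCast_le_one i)) sMat_mem
    rw [hh.mpProd_mul_eq hΨ hp hD x hk, hh.apply_mul_split_eq (hΨ.mulShift hD) hp hδ x hk,
      (hrow i).1, (hrow i).2, nu_neg_left, map_mul]
    ring
  rw [Finset.sum_congr rfl hterm, mpProd, hh.apply_eq (hΨ.mulShift hD) hp hδ, ← hz, map_mul,
    ← Finset.mul_sum, ← map_sum, mul_right_comm, ← mul_add, ← map_add,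
    sum_nu hαβ (sl_row_ne_zero x), map_zero, mul_zero]

/-- By left equivariance the Weil coefficient can be moved inside the integral over `SL₂(ℤ_p)`, its
sign cancelling that of `h`. The product of coefficients becomes a spherical average of `mpProd`. -/
lemma conj_mpPairing_mul (x : SL2 p) :
    conj (mpPairing (fun y => h (y * ⟨x, 1⟩)) h) * weilMC Ψ x =
      (slGroup p).sphAvg (mpProd Ψ h) (h ⟨1, 1⟩) (h ⟨sMat, 1⟩) ((slGroup p).ι x) := by
  unfold mpPairing MatrixGroup.sphAvg
  rw [← integral_conj, ← integral_mul_const, ← coe_slGroup_K]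
  refine setIntegral_congr_fun (slGroup p).measurableSet_K fun k hk => ?_
  have hk' : k ∈ slIntegral p := mem_slIntegral_iff.mpr hk
  change conj (h (split k * ⟨x, 1⟩) * conj (h (split k))) * weilMC Ψ x =
    mpProd Ψ h (k * x) * nu (h ⟨1, 1⟩) (h ⟨sMat, 1⟩) (k 1 0) (k 1 1)
  rw [hh.mpProd_mul_left_eq hΨ hp hD x hk', ← hh.apply_split (hΨ.mulShift hD) hp hδ hk', map_mul,
    Complex.conj_conj]
  ring

include hδ'

/-- In the cover `s n(y) t^n = t^(-n) s n(p^(-2n) y)`, so after rescaling one integrates `h` over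
the ball of radius `p^(2n)`, which gives `p^(-n) h(s)`. Together with `p^(3n/2)` from `t^(-n)` and
`p^(-2n)` from the rescaling this is `p^(-3n/2)`, the same scaling as at `t^n`. -/
lemma setIntegral_mpProd_tp (n : ℕ) :
    ∫ y in ball p 0, mpProd Ψ h (sMat * nMat y * tp p n) ∂padicHaar p =
      conj (gam (Ψ.mulShift D) (-(p : ℚ_[p]) ^ (n : ℤ))) *
        ((hilbertSymbol δ ((p : ℚ_[p]) ^ (n : ℤ)) : ℤ) : ℂ) *
          ((‖(p : ℚ_[p]) ^ (n : ℤ)‖ ^ (3 / 2 : ℝ) : ℝ) : ℂ) * conj (h ⟨sMat, 1⟩) *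
            weilMC Ψ (tp p n) := by
  have hψ := hΨ.mulShift hD
  have hp0 : (p : ℚ_[p]) ^ (n : ℤ) ≠ 0 := zpow_ne_zero _ cast_p_ne_zero
  have hpc : (p : ℂ) ≠ 0 := cast_p_ne_zero_complex
  obtain ⟨a1, -, a3, a4⟩ := tp_apply (p := p) (-n)
  set z : ℂ := gam (Ψ.mulShift D) (-(p : ℚ_[p]) ^ (n : ℤ)) *
    ((hilbertSymbol δ ((p : ℚ_[p]) ^ (n : ℤ)) : ℤ) : ℂ) *
      ((‖((p : ℚ_[p]) ^ (n : ℤ))⁻¹‖ ^ (3 / 2 : ℝ) : ℝ) : ℂ) with hz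
  have hval : ∀ y ∈ ball p 0, mpProd Ψ h (sMat * nMat y * tp p n) =
      conj (h ⟨sMat * nMat (((p : ℚ_[p]) ^ (n : ℤ))⁻¹ ^ 2 * y), 1⟩) *
        (conj z * weilMC Ψ (tp p n)) := by
    intro y hy
    rw [mem_ball, zpow_zero] at hy
    rw [hh.mpProd_mul_left_eq hΨ hp hD _ (slIntegral_mul sMat_mem (nMat_mem hy)),
      split_of_norm_eq_one (by simp [(sl_row_s_nMat y).1]), mp_s_nMat_mul_tp,
      hh.apply_upper_mul hψ hp a3, a1, a4, zpow_neg, inv_inv, hilbertSymbol_inv_right _ hp0, ← hz,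
      map_mul]
    ring
  have hnorm : ‖((p : ℚ_[p]) ^ (n : ℤ))⁻¹ ^ 2‖ = (p : ℝ) ^ (2 * n : ℤ) := by
    rw [norm_pow, norm_inv, Padic.norm_p_zpow, zpow_neg, inv_inv, mul_comm, zpow_mul]
    norm_cast
  have hA : h ⟨1, 1⟩ = -(p * h ⟨sMat, 1⟩) :=
    eq_neg_of_add_eq_zero_left (hh.apply_one_add hψ hp hδ hδ')
  have hs0 : (((√(p : ℝ) : ℝ) : ℂ) ^ n) ≠ 0 := pow_ne_zero _ sqrt_p_ne_zero
  have hs2 : (p : ℂ) ^ n = (((√(p : ℝ) : ℝ) : ℂ) ^ n) ^ 2 := by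
    rw [← pow_mul, mul_comm n, pow_mul, ← Complex.ofReal_pow, Real.sq_sqrt (Nat.cast_nonneg p)]
    simp
  have hint : ∫ x in ball p (2 * n), conj (h ⟨sMat * nMat x, 1⟩) ∂padicHaar p =
      conj (h ⟨sMat, 1⟩) * ((p : ℂ) ^ n)⁻¹ := by
    have e : h ⟨sMat, 1⟩ + (p : ℂ)⁻¹ * (1 - (p : ℂ)⁻¹ ^ n) * h ⟨1, 1⟩ =
        h ⟨sMat, 1⟩ * ((p : ℂ) ^ n)⁻¹ := by
      rw [hA, inv_pow]
      field_simp
      ring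
    rw [integral_conj, hh.setIntegral_apply_s_nMat hψ hp hδ hδ', e, map_mul, map_inv₀, map_pow,
      Complex.conj_natCast]
  have hscale := setIntegral_ball_comp_mul hnorm (2 * n)
    (fun x => conj (h ⟨sMat * nMat x, 1⟩))
  rw [sub_self, hint] at hscale
  rw [setIntegral_congr_fun (measurableSet_ball 0) hval, integral_mul_const, hscale, hz,
    norm_inv, Real.inv_rpow (norm_nonneg _), rpow_norm_p_pow]
  simp only [map_mul, conj_units_cast, Complex.conj_ofReal]
  rw [zpow_neg, mul_comm (2 : ℤ), zpow_mul, zpow_natCast]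
  push_cast
  rw [zpow_ofNat, hs2]
  field_simp

omit hδ hδ' in
lemma mpProd_tp (n : ℕ) : mpProd Ψ h (tp p n) =
      conj (gam (Ψ.mulShift D) (-(p : ℚ_[p]) ^ (n : ℤ))) *
        ((hilbertSymbol δ ((p : ℚ_[p]) ^ (n : ℤ)) : ℤ) : ℂ) *
          ((‖(p : ℚ_[p]) ^ (n : ℤ)‖ ^ (3 / 2 : ℝ) : ℝ) : ℂ) * conj (h ⟨1, 1⟩) *
            weilMC Ψ (tp p n) := by
  have hp0 : (p : ℚ_[p]) ^ (n : ℤ) ≠ 0 := zpow_ne_zero _ cast_p_ne_zero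
  obtain ⟨a1, -, a3, a4⟩ := tp_apply (p := p) n
  have h1 := hh.apply_upper_mul (hΨ.mulShift hD) hp a3 ⟨1, 1⟩
  have h2 : (⟨tp p n, 1⟩ * ⟨1, 1⟩ : Mp p) = ⟨tp p n, 1⟩ := by
    have e : cocycle (tp p n) 1 = 1 := by
      rw [cocycle, mul_one, hilbertSymbol_comm, hilbertSymbol_eq_one_of_sq_right _ ⟨_, rfl⟩]
    rw [mp_mul, e]
    simp
  rw [h2, a1, a4, ← inv_neg, gam_inv] at h1
  rw [mpProd, h1]
  simp only [map_mul, conj_units_cast, Complex.conj_ofReal]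

omit hh in
-- The Weil indices for the two characters differ by `(D, p^n) = (D/p)^n`, and their common part
-- cancels against its conjugate. Moreover `(δ, p^n) = (-1)^n`, and the absolute values are
-- `p^(-3n/2)` and `p^(-n/2)`.
lemma phase_mul_weilMC_tp (n : ℕ) : conj (gam (Ψ.mulShift D) (-(p : ℚ_[p]) ^ (n : ℤ))) *
      ((hilbertSymbol δ ((p : ℚ_[p]) ^ (n : ℤ)) : ℤ) : ℂ) *
        ((‖(p : ℚ_[p]) ^ (n : ℤ)‖ ^ (3 / 2 : ℝ) : ℝ) : ℂ) * weilMC Ψ (tp p n) =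
      (-((leg D : ℤ) : ℂ) * ((p : ℂ)⁻¹) ^ 2) ^ n := by
  have hp0 : (p : ℚ_[p]) ^ (n : ℤ) ≠ 0 := zpow_ne_zero _ cast_p_ne_zero
  have hw : weilMC Ψ (tp p n) = gam Ψ (-(p : ℚ_[p]) ^ (n : ℤ)) *
      ((√(p : ℝ) ^ n : ℝ) : ℂ)⁻¹ := by
    rw [tp, weilMC_tMat_pow hΨ hp (n := n) (by simp [uniformizer]), zpow_natCast]
  have hu : ((p : ℚ_[p]) ^ (n : ℤ)).valuation = n := by simp
  have hg : conj (gam Ψ (-(p : ℚ_[p]) ^ (n : ℤ))) * gam Ψ (-(p : ℚ_[p]) ^ (n : ℤ)) = 1 := by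
    rw [← Complex.normSq_eq_conj_mul_self, Complex.normSq_eq_norm_sq, norm_gam hΨ hp]
    simp
  have hs2 : (p : ℂ) ^ n = (((√(p : ℝ) : ℝ) : ℂ) ^ n) ^ 2 := by
    rw [← pow_mul, mul_comm n, pow_mul, ← Complex.ofReal_pow, Real.sq_sqrt (Nat.cast_nonneg p)]
    simp
  rw [hw, gam_mulShift hΨ hp hD (neg_ne_zero.mpr hp0), rpow_norm_p_pow,
    hilbertSymbol_unit_left hp hδ hp0,
    hilbertSymbol_unit_congr hp hD (neg_ne_zero.mpr hp0) (norm_neg _), hilbertSymbol_unit_left hp hD hp0,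
    hu, hδ', map_mul, conj_units_cast, mul_pow, ← pow_mul, mul_comm 2 n,
    pow_mul, inv_pow (p : ℂ), hs2, neg_pow, zpow_natCast (leg D),
    zpow_natCast (-1 : ℤˣ)]
  push_cast
  linear_combination (((leg D : ℤ) : ℂ) ^ n * (-1) ^ n * ((((√(p : ℝ) : ℝ) : ℂ) ^ n)⁻¹) ^ 4) * hg

lemma sphAvg_mpProd_tp (n : ℕ) :
    (slGroup p).sphAvg (mpProd Ψ h) (h ⟨1, 1⟩) (h ⟨sMat, 1⟩) ((slGroup p).ι (tp p n)) =
      (slGroup p).μ.real (slGroup p).Γ * (conj (h ⟨1, 1⟩) * h ⟨1, 1⟩ +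
        p * (conj (h ⟨sMat, 1⟩) * h ⟨sMat, 1⟩)) * (-((leg D : ℤ) : ℂ) * ((p : ℂ)⁻¹) ^ 2) ^ n := by
  have hp0 : (p : ℚ_[p]) ^ (n : ℤ) ≠ 0 := zpow_ne_zero _ cast_p_ne_zero
  rw [(slGroup p).sphAvg_tp (hh.mpProd_mul_mem hΨ hp hD) (hh.mpProd_upper_mul hΨ hp hD hδ)]
  simp only [slGroup_ι]
  rw [hh.setIntegral_mpProd_tp hΨ hp hD hδ hδ', hh.mpProd_tp hΨ hp hD]
  rw [← phase_mul_weilMC_tp hΨ hp hD hδ hδ']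
  ring

lemma apply_s_ne_zero : h ⟨sMat, 1⟩ ≠ 0 := by
  intro h0
  have h1 := hh.apply_one_add (hΨ.mulShift hD) hp hδ hδ'
  rw [h0, mul_zero, add_zero] at h1
  refine hh.ne_zero (funext fun x => ?_)
  obtain ⟨g, ε⟩ := x
  rw [hh.apply_sign (hΨ.mulShift hD) hp, hh.apply_eq (hΨ.mulShift hD) hp hδ, h0, h1]
  simp [nu]

theorem isSteinbergCoeff_conj_mpCoeff_mul :
    IsSteinbergCoeff fun x => conj (mpCoeff h x) * weilCoeff Ψ charZp x := by
  have hαβ := hh.apply_one_add (hΨ.mulShift hD) hp hδ hδ'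
  have h := ((slGroup p).isSteinbergCoeff_sphAvg (hh.mpProd_mul_mem hΨ hp hD) hαβ
    (hh.sum_mpProd_mul hΨ hp hD hδ hαβ)).div_const (conj (mpPairing h h))
  convert h using 2 with x
  rw [← hh.conj_mpPairing_mul hΨ hp hD hδ, mpCoeff, weilCoeff_charZp, map_div₀]
  ring

theorem conj_mpCoeff_mul_tp (n : ℕ) :
    conj (mpCoeff h (tp p n)) * weilCoeff Ψ charZp (tp p n) =
      (-((leg D : ℤ) : ℂ) * ((p : ℂ)⁻¹) ^ 2) ^ n := by
  have h0 : conj (mpPairing h h) = (slGroup p).μ.real (slGroup p).Γ * (conj (h ⟨1, 1⟩) * h ⟨1, 1⟩ +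
        p * (conj (h ⟨sMat, 1⟩) * h ⟨sMat, 1⟩)) := by
    -- At `t^0` the Weil coefficient is `1`, and the average is the conjugate of the squared norm of
    -- `h`.
    have h1 := hh.sphAvg_mpProd_tp hΨ hp hD hδ hδ' 0
    rw [← hh.conj_mpPairing_mul hΨ hp hD hδ, Nat.cast_zero, tp_zero, weilMC_one hΨ hp, mul_one,
      pow_zero, mul_one] at h1
    rw [← h1]
    unfold mpPairing
    congr 1
    rw [← coe_slGroup_K]
    refine setIntegral_congr_fun (slGroup p).measurableSet_K fun k hk => ?_
    have e := hh.apply_split_mul (hΨ.mulShift hD) hp 1 k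
    have e2 : cocycle k 1 = 1 := by
      rw [cocycle, mul_one, hilbertSymbol_comm, hilbertSymbol_eq_one_of_sq_right _ ⟨_, rfl⟩]
    rw [e2, one_mul, mul_one, ← hh.apply_sign (hΨ.mulShift hD) hp] at e
    simp only [e]
    rfl
  have hne : conj (mpPairing h h) ≠ 0 := by
    rw [h0]
    refine mul_ne_zero ?_ (conj_mul_self_add_ne_zero (hh.apply_s_ne_zero hΨ hp hD hδ hδ'))
    have h3 := (slGroup p).measureReal_Γ
    rw [slGroup_measureReal_K] at h3
    intro h4
    rw [Complex.ofReal_eq_zero.mp h4, mul_zero] at h3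
    have h5 : ((p : ℝ)⁻¹) ^ 2 < 1 :=
      pow_lt_one₀ (by positivity) (inv_lt_one_of_one_lt₀ one_lt_cast_p) two_ne_zero
    linarith
  rw [mpCoeff, weilCoeff_charZp, map_div₀, div_mul_eq_mul_div, hh.conj_mpPairing_mul hΨ hp hD hδ,
    hh.sphAvg_mpProd_tp hΨ hp hD hδ hδ', ← h0, mul_div_cancel_left₀ _ hne]

end IsMpNewvector

end

section

/-! ### Integration of Iwahori-biinvariant functions on `SL₂(ℚ_p)` -/

lemma mem_slGamma0_iff_right {y : SL2 p} :
    y ∈ slGamma0 p ↔ ‖y 1 0‖ < 1 ∧ ‖y 1 1‖ = 1 ∧ ‖y 0 1‖ ≤ 1 := by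
  constructor
  · intro hy
    exact ⟨hy.2, (norm_diag_of_norm_lt_one hy.1 hy.2).2, mem_slIntegral.mp hy.1 0 1⟩
  · rintro ⟨h10, h11, h01⟩
    have hd := sl_det y
    have h0 : ‖y 0 0 * y 1 1‖ ≤ 1 := by
      have e : y 0 0 * y 1 1 = 1 + y 0 1 * y 1 0 := by linear_combination hd
      rw [e]
      exact norm_add_le_of_le norm_one.le (norm_mul_le_of_le h01 h10.le)
    rw [norm_mul, h11, mul_one] at h0
    exact mem_slGamma0_of_entries h0 h01 h10 h11.le

lemma mem_slGamma0_iff_left {y : SL2 p} :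
    y ∈ slGamma0 p ↔ ‖y 1 0‖ < 1 ∧ ‖y 0 0‖ = 1 ∧ ‖y 0 1‖ ≤ 1 := by
  constructor
  · intro hy
    exact ⟨hy.2, (norm_diag_of_norm_lt_one hy.1 hy.2).1, mem_slIntegral.mp hy.1 0 1⟩
  · rintro ⟨h10, h00, h01⟩
    have hd := sl_det y
    have h0 : ‖y 0 0 * y 1 1‖ ≤ 1 := by
      have e : y 0 0 * y 1 1 = 1 + y 0 1 * y 1 0 := by linear_combination hd
      rw [e]
      exact norm_add_le_of_le norm_one.le (norm_mul_le_of_le h01 h10.le)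
    rw [norm_mul, h00, one_mul] at h0
    exact mem_slGamma0_of_entries h00.le h01 h10 h0

lemma measurableSet_slGamma0 : MeasurableSet (slGamma0 p) := by
  have h : slGamma0 p = ((slGroup p).Γ : Set (SL2 p)) := Set.ext fun _ => mem_slGroup_Γ.symm
  rw [h]
  exact (slGroup p).measurableSet_Γ

lemma measure_slGamma0_lt_top : slHaar p (slGamma0 p) < ⊤ := by
  have h : slGamma0 p = ((slGroup p).Γ : Set (SL2 p)) := Set.ext fun _ => mem_slGroup_Γ.symm
  rw [h]
  have : IsFiniteMeasureOnCompacts (slHaar p) := (slGroup p).finite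
  exact (slGroup p).isCompact_Γ.measure_lt_top

/-- The volume of `Γ₀(p)`. -/
lemma measureReal_slGamma0 :
    (slHaar p).real (slGamma0 p) = (1 - (p : ℝ)⁻¹ ^ 2) / (p + 1) := by
  have h : slGamma0 p = ((slGroup p).Γ : Set (SL2 p)) := Set.ext fun _ => mem_slGroup_Γ.symm
  have h1 := (slGroup p).measureReal_Γ
  rw [slGroup_measureReal_K] at h1
  have hp : (p : ℝ) + 1 ≠ 0 := by positivity
  rw [h, eq_div_iff hp, ← h1]
  exact mul_comm _ _

section Cosets

variable {E : Type*} [NormedAddCommGroup E] [NormedSpace ℝ E] [CompleteSpace E] {f : SL2 p → E}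

/-- The integral over a set that is a union of `p ^ m` left cosets of `Γ₀(p)`, indexed by the
residue of a function `q`. -/
lemma setIntegral_of_cosets (hf : ∀ γ ∈ slGamma0 p, ∀ x, f (x * γ) = f x) {S : Set (SL2 p)}
    {q : SL2 p → ℚ_[p]} {m : ℕ} {x : ℕ → SL2 p}
    (hS : ∀ i g, (x i)⁻¹ * g ∈ slGamma0 p ↔ g ∈ S ∧ ‖q g - i‖ ≤ (p : ℝ) ^ (-m : ℤ))
    (hq : ∀ g ∈ S, ‖q g‖ ≤ 1) {v : E} (hv : ∀ i, f (x i) = v) :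
    MeasurableSet S ∧ IntegrableOn f S (slHaar p) ∧
      ∫ g in S, f g ∂slHaar p = ((p : ℝ) ^ m * (slHaar p).real (slGamma0 p)) • v := by
  have : (slHaar p).IsMulLeftInvariant := (slGroup p).left
  set T : ℕ → Set (SL2 p) := fun i => ((x i)⁻¹ * ·) ⁻¹' slGamma0 p with hT
  have hTm : ∀ i, MeasurableSet (T i) := fun i =>
    measurableSet_slGamma0.preimage (measurable_const_mul _)
  have hST : S = ⋃ i ∈ Finset.range (p ^ m), T i := by
    ext g
    simp only [Set.mem_iUnion, Finset.mem_range, exists_prop]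
    constructor
    · intro hg
      obtain ⟨i, ⟨hi, hi'⟩, -⟩ := existsUnique_digit (hq g hg) m
      exact ⟨i, hi, (hS i g).mpr ⟨hg, hi'⟩⟩
    · rintro ⟨i, -, hi⟩
      exact ((hS i g).mp hi).1
  have hdisj : Set.Pairwise (↑(Finset.range (p ^ m))) (Function.onFun Disjoint T) := by
    intro i hi j hj hij
    refine Set.disjoint_left.mpr fun g hgi hgj => hij ?_
    obtain ⟨h1, h2⟩ := (hS i g).mp hgi
    obtain ⟨-, h3⟩ := (hS j g).mp hgj
    exact (existsUnique_digit (hq g h1) m).unique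
      ⟨Finset.mem_range.mp hi, h2⟩ ⟨Finset.mem_range.mp hj, h3⟩
  have hconst : ∀ i, ∀ g ∈ T i, f g = v := by
    intro i g hg
    rw [← hv i, ← hf _ hg (x i), mul_inv_cancel_left]
  have hμ : ∀ i, slHaar p (T i) = slHaar p (slGamma0 p) := fun i => measure_preimage_mul _ _ _
  have hint : ∀ i, IntegrableOn f (T i) (slHaar p) := fun i =>
    (integrableOn_congr_fun (hconst i) (hTm i)).mpr
      (integrableOn_const (by rw [hμ]; exact measure_slGamma0_lt_top.ne))
  refine ⟨hST ▸ Finset.measurableSet_biUnion _ fun i _ => hTm i, ?_, ?_⟩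
  · rw [hST]
    exact (integrableOn_finset_iUnion).mpr fun i _ => hint i
  · rw [hST, integral_biUnion_finset _ (fun i _ => hTm i) hdisj fun i _ => hint i,
      Finset.sum_congr rfl fun i _ => by
        rw [setIntegral_congr_fun (hTm i) (hconst i), setIntegral_const, Measure.real, hμ],
      Finset.sum_const, Finset.card_range, ← Nat.cast_smul_eq_nsmul ℝ, smul_smul, Nat.cast_pow]
    rfl

/-- Since `‖e‖ = ‖P‖⁻¹`, integrality of an entry of `x⁻¹ g` becomes a congruence for a quotient of
entries of `g`, with modulus governed by `‖P‖²`. -/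
lemma norm_scaled_sub_iff {P b e z : ℚ_[p]} (he : ‖P * e‖ = 1) (r : ℝ) :
    ‖P⁻¹ * (b - z * e)‖ ≤ r ↔ ‖b / e - z‖ ≤ r * ‖P‖ ^ 2 := by
  rw [norm_mul] at he
  have hP : 0 < ‖P‖ := (norm_nonneg P).lt_of_ne fun h => by simp [← h] at he
  have he0 : e ≠ 0 := fun h => by simp [h] at he
  have e1 : b - z * e = e * (b / e - z) := by field_simp
  have e2 : ‖e‖ = ‖P‖⁻¹ := eq_inv_of_mul_eq_one_right he
  rw [e1, norm_mul, norm_mul, norm_inv, e2, ← div_le_iff₀ (by positivity)]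
  field_simp

/-- The double coset of `t ^ n` if `n ≥ 0`. -/
def cosetT (p : ℕ) [Fact p.Prime] (n : ℕ) : Set (SL2 p) :=
  {g | ‖(p : ℚ_[p]) ^ n * g 1 0‖ < 1 ∧ ‖(p : ℚ_[p]) ^ n * g 1 1‖ = 1 ∧
    ‖(p : ℚ_[p]) ^ n * g 0 1‖ ≤ 1}

/-- The double coset of `t ^ n s` if `n ≥ 0`. -/
def cosetTS (p : ℕ) [Fact p.Prime] (n : ℕ) : Set (SL2 p) :=
  {g | ‖(p : ℚ_[p]) ^ n * g 1 0‖ = 1 ∧ ‖(p : ℚ_[p]) ^ n * g 0 0‖ ≤ 1 ∧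
    ‖(p : ℚ_[p]) ^ n * g 1 1‖ ≤ 1}

/-- The double coset of `t ^ (-n)` if `n > 0`. -/
def cosetTinv (p : ℕ) [Fact p.Prime] (n : ℕ) : Set (SL2 p) :=
  {g | ‖(p : ℚ_[p]) ^ n * g 1 0‖ < 1 ∧ ‖(p : ℚ_[p]) ^ n * g 0 0‖ = 1 ∧
    ‖(p : ℚ_[p]) ^ n * g 0 1‖ ≤ 1}

/-- The double coset of `t ^ (-n) s` if `n > 0`. -/
def cosetTinvS (p : ℕ) [Fact p.Prime] (n : ℕ) : Set (SL2 p) :=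
  {g | ‖(p : ℚ_[p]) ^ n * g 0 1‖ = 1 ∧ ‖(p : ℚ_[p]) ^ n * g 0 0‖ < 1 ∧
    ‖(p : ℚ_[p]) ^ n * g 1 1‖ < 1}

lemma norm_div_le_of_scaled {P b e : ℚ_[p]} (he : ‖P * e‖ = 1) {r : ℝ} (hb : ‖P * b‖ ≤ r) :
    ‖b / e‖ ≤ r := by
  have hP : P ≠ 0 := fun h => by simp [h] at he
  rw [← mul_div_mul_left b e hP, norm_div, he, div_one]
  exact hb

lemma norm_scaled_le_of_sub {P b e z : ℚ_[p]} (he : ‖P * e‖ = 1) {r : ℝ} (hz : ‖z‖ ≤ r)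
    (h : ‖P‖ ^ 2 * ‖P⁻¹ * (b - z * e)‖ ≤ r) : ‖P * b‖ ≤ r := by
  have hP0 : P ≠ 0 := fun h => by simp [h] at he
  have e1 : P * b = P ^ 2 * (P⁻¹ * (b - z * e)) + z * (P * e) := by
    field_simp
    ring
  rw [e1]
  refine norm_add_le_of_le ?_ ?_
  · rwa [norm_mul, norm_pow]
  · rwa [norm_mul, he, mul_one]

lemma norm_p_pow (n : ℕ) : ‖(p : ℚ_[p]) ^ n‖ = (p : ℝ) ^ (-n : ℤ) := by
  rw [← zpow_natCast, Padic.norm_p_zpow]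

lemma norm_p_pow_le_one (n : ℕ) : ‖(p : ℚ_[p]) ^ n‖ ≤ 1 := by
  rw [norm_p_pow]
  exact zpow_neg_natCast_le_one n

lemma inv_nMat_mul_tp_mul (i : ℚ_[p]) (n : ℕ) (g : SL2 p) :
    ((nMat i * tp p n)⁻¹ * g) 0 0 = ((p : ℚ_[p]) ^ n)⁻¹ * (g 0 0 - i * g 1 0) ∧
    ((nMat i * tp p n)⁻¹ * g) 0 1 = ((p : ℚ_[p]) ^ n)⁻¹ * (g 0 1 - i * g 1 1) ∧
    ((nMat i * tp p n)⁻¹ * g) 1 0 = (p : ℚ_[p]) ^ n * g 1 0 ∧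
    ((nMat i * tp p n)⁻¹ * g) 1 1 = (p : ℚ_[p]) ^ n * g 1 1 := by
  have hp : (p : ℚ_[p]) ≠ 0 := cast_p_ne_zero
  simp only [sl_mul_apply, sl_inv_apply, tp_apply, nMat_apply, zpow_natCast]
  refine ⟨?_, ?_, ?_, ?_⟩ <;> ring

lemma inv_nLow_mul_tp_mul (i : ℚ_[p]) (n : ℕ) (g : SL2 p) :
    ((nLow i * tp p (-n))⁻¹ * g) 0 0 = (p : ℚ_[p]) ^ n * g 0 0 ∧
    ((nLow i * tp p (-n))⁻¹ * g) 0 1 = (p : ℚ_[p]) ^ n * g 0 1 ∧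
    ((nLow i * tp p (-n))⁻¹ * g) 1 0 = ((p : ℚ_[p]) ^ n)⁻¹ * (g 1 0 - i * g 0 0) ∧
    ((nLow i * tp p (-n))⁻¹ * g) 1 1 = ((p : ℚ_[p]) ^ n)⁻¹ * (g 1 1 - i * g 0 1) := by
  have hp : (p : ℚ_[p]) ≠ 0 := cast_p_ne_zero
  simp only [sl_mul_apply, sl_inv_apply, tp_apply, nLow_apply, zpow_neg, zpow_natCast, inv_inv]
  refine ⟨?_, ?_, ?_, ?_⟩ <;> ring

lemma inv_mul_sMat_mul (x g : SL2 p) :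
    ((x * sMat)⁻¹ * g) 0 0 = -(x⁻¹ * g) 1 0 ∧ ((x * sMat)⁻¹ * g) 0 1 = -(x⁻¹ * g) 1 1 ∧
    ((x * sMat)⁻¹ * g) 1 0 = (x⁻¹ * g) 0 0 ∧ ((x * sMat)⁻¹ * g) 1 1 = (x⁻¹ * g) 0 1 := by
  rw [mul_inv_rev, mul_assoc]
  generalize x⁻¹ * g = y
  simp only [sl_mul_apply _ y, sl_inv_apply, sMat_apply]
  refine ⟨?_, ?_, ?_, ?_⟩ <;> ring

end Cosets

end

/-! ### Integrals over the four kinds of Iwahori double cosets. -/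

section

section CosetIntegrals

variable {E : Type*} [NormedAddCommGroup E] [NormedSpace ℝ E] [CompleteSpace E] {f : SL2 p → E}

lemma norm_div_p_sub_le_iff (x z : ℚ_[p]) (r : ℝ) :
    ‖x / p - z‖ ≤ r ↔ ‖x - p * z‖ ≤ (p : ℝ)⁻¹ * r := by
  have hp : (p : ℚ_[p]) ≠ 0 := cast_p_ne_zero
  have hpos := cast_p_pos (p := p)
  have e : x - p * z = p * (x / p - z) := by field_simp
  rw [e, norm_mul, Padic.norm_p]
  exact (mul_le_mul_iff_of_pos_left (inv_pos.mpr hpos)).symm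

lemma norm_p_mul_natCast_le (i : ℕ) : ‖(p : ℚ_[p]) * i‖ ≤ (p : ℝ)⁻¹ := by
  rw [norm_mul, Padic.norm_p]
  exact mul_le_of_le_one_right (by positivity) (norm_natCast_le_one i)

lemma norm_p_pow_sq (n : ℕ) : ‖(p : ℚ_[p]) ^ n‖ ^ 2 = (p : ℝ) ^ (-(2 * n : ℕ) : ℤ) := by
  rw [norm_p_pow, zpow_neg, zpow_neg, zpow_natCast, zpow_natCast, inv_pow, ← pow_mul, mul_comm]

lemma norm_p_pow_sq_le_one (n : ℕ) : ‖(p : ℚ_[p]) ^ n‖ ^ 2 ≤ 1 :=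
  pow_le_one₀ (norm_nonneg _) (norm_p_pow_le_one n)

variable (hl : ∀ γ ∈ slGamma0 p, ∀ x, f (γ * x) = f x) (hr : ∀ γ ∈ slGamma0 p, ∀ x, f (x * γ) = f x)
include hl hr

/-- The left cosets are those of `n(i) t^n`, with `i` the residue of `b/d` modulo `p^(2n)`. -/
lemma setIntegral_cosetT (n : ℕ) :
    MeasurableSet (cosetT p n) ∧ IntegrableOn f (cosetT p n) (slHaar p) ∧
      ∫ g in cosetT p n, f g ∂slHaar p =
        ((p : ℝ) ^ (2 * n) * (slHaar p).real (slGamma0 p)) • f (tp p n) := by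
  refine setIntegral_of_cosets hr (q := fun g => g 0 1 / g 1 1)
    (x := fun i => nMat (i : ℚ_[p]) * tp p n) (fun i g => ?_) (fun g hg => ?_)
    fun i => hl _ (nMat_mem_slGamma0 (norm_natCast_le_one i)) _
  · obtain ⟨-, e1, e2, e3⟩ := inv_nMat_mul_tp_mul (i : ℚ_[p]) n g
    rw [mem_slGamma0_iff_right, e1, e2, e3, ← norm_p_pow_sq]
    constructor
    · rintro ⟨h1, h2, h3⟩
      refine ⟨⟨h1, h2, norm_scaled_le_of_sub h2 (norm_natCast_le_one i)
        (mul_le_one₀ (norm_p_pow_sq_le_one n) (norm_nonneg _) h3)⟩, ?_⟩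
      simpa using (norm_scaled_sub_iff h2 1).mp h3
    · rintro ⟨⟨h1, h2, -⟩, h4⟩
      exact ⟨h1, h2, (norm_scaled_sub_iff h2 1).mpr (by rwa [one_mul])⟩
  · exact norm_div_le_of_scaled hg.2.1 hg.2.2

/-- The residue of `a/c` classifies the cosets. After multiplication by `s` it governs the lower
left entry, which must have norm strictly below `1`; this raises the modulus to `p^(2n+1)`. -/
lemma setIntegral_cosetTS (n : ℕ) :
    MeasurableSet (cosetTS p n) ∧ IntegrableOn f (cosetTS p n) (slHaar p) ∧
      ∫ g in cosetTS p n, f g ∂slHaar p =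
        ((p : ℝ) ^ (2 * n + 1) * (slHaar p).real (slGamma0 p)) • f (tp p n * sMat) := by
  have hm : (p : ℝ) ^ (-(2 * n + 1 : ℕ) : ℤ) = (p : ℝ)⁻¹ * ‖(p : ℚ_[p]) ^ n‖ ^ 2 := by
    rw [norm_p_pow_sq, zpow_neg, zpow_neg, zpow_natCast, zpow_natCast, pow_succ, mul_inv, mul_comm]
  refine setIntegral_of_cosets hr (q := fun g => g 0 0 / g 1 0)
    (x := fun i => nMat (i : ℚ_[p]) * tp p n * sMat) (fun i g => ?_) (fun g hg => ?_)
    fun i => by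
      rw [mul_assoc]
      exact hl _ (nMat_mem_slGamma0 (norm_natCast_le_one i)) _
  · obtain ⟨e0, e1, e2, e3⟩ := inv_nMat_mul_tp_mul (i : ℚ_[p]) n g
    obtain ⟨s0, s1, s2, -⟩ := inv_mul_sMat_mul (nMat (i : ℚ_[p]) * tp p n) g
    rw [mem_slGamma0_iff_left, s0, s1, s2, e0, e2, e3, norm_neg, norm_neg, hm]
    constructor
    · rintro ⟨h1, h2, h3⟩
      exact ⟨⟨h2, norm_scaled_le_of_sub h2 (norm_natCast_le_one i)
        (mul_le_one₀ (norm_p_pow_sq_le_one n) (norm_nonneg _) h1.le), h3⟩,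
        (norm_scaled_sub_iff h2 _).mp (norm_lt_one_iff_le.mp h1)⟩
    · rintro ⟨⟨h1, -, h3⟩, h4⟩
      exact ⟨norm_lt_one_iff_le.mpr ((norm_scaled_sub_iff h1 _).mpr h4), h1, h3⟩
  · exact norm_div_le_of_scaled hg.1 hg.2.1

/-- Here `c/a` is divisible by `p`, so `c/(pa)` is the integral parameter. The strict inequality on
the lower left entry absorbs that division and leaves the modulus `p^(2n)`. -/
lemma setIntegral_cosetTinv (n : ℕ) :
    MeasurableSet (cosetTinv p n) ∧ IntegrableOn f (cosetTinv p n) (slHaar p) ∧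
      ∫ g in cosetTinv p n, f g ∂slHaar p =
        ((p : ℝ) ^ (2 * n) * (slHaar p).real (slGamma0 p)) • f (tp p (-n)) := by
  refine setIntegral_of_cosets hr (q := fun g => g 1 0 / g 0 0 / p)
    (x := fun i => nLow (p * i : ℚ_[p]) * tp p (-n)) (fun i g => ?_) (fun g hg => ?_)
    fun i => hl _ (nLow_mem_slGamma0 (norm_lt_one_iff_le.mpr (norm_p_mul_natCast_le i))) _
  · obtain ⟨e0, e1, e2, -⟩ := inv_nLow_mul_tp_mul (p * i : ℚ_[p]) n g
    rw [mem_slGamma0_iff_left, e0, e1, e2, ← norm_p_pow_sq, norm_div_p_sub_le_iff]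
    constructor
    · rintro ⟨h1, h2, h3⟩
      refine ⟨⟨norm_lt_one_iff_le.mpr (norm_scaled_le_of_sub h2 (norm_p_mul_natCast_le i) ?_),
        h2, h3⟩, (norm_scaled_sub_iff h2 _).mp (norm_lt_one_iff_le.mp h1)⟩
      exact (mul_le_of_le_one_left (norm_nonneg _) (norm_p_pow_sq_le_one n)).trans
        (norm_lt_one_iff_le.mp h1)
    · rintro ⟨⟨-, h2, h3⟩, h4⟩
      exact ⟨norm_lt_one_iff_le.mpr ((norm_scaled_sub_iff h2 _).mpr h4), h2, h3⟩
  · have h := norm_div_le_of_scaled hg.2.1 (norm_lt_one_iff_le.mp hg.1)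
    have h2 := (norm_div_p_sub_le_iff (g 1 0 / g 0 0) 0 1).mpr (by simpa using h)
    simpa using h2

/-- The parameter is `d/(pb)`. The quotient `d/b` matters modulo `p^(2n+2)`, and dividing by `p`
leaves `p^(2n+1)` classes. The exponent is shifted to `n + 1` because this count needs a positive
exponent. -/
lemma setIntegral_cosetTinvS (n : ℕ) :
    MeasurableSet (cosetTinvS p (n + 1)) ∧ IntegrableOn f (cosetTinvS p (n + 1)) (slHaar p) ∧
      ∫ g in cosetTinvS p (n + 1), f g ∂slHaar p =
        ((p : ℝ) ^ (2 * n + 1) * (slHaar p).real (slGamma0 p)) •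
          f (tp p (-(n + 1 : ℕ)) * sMat) := by
  have hp0 := cast_p_pos (p := p)
  have hm : (p : ℝ)⁻¹ * (p : ℝ) ^ (-(2 * n + 1 : ℕ) : ℤ) = 1 * ‖(p : ℚ_[p]) ^ (n + 1)‖ ^ 2 := by
    rw [norm_p_pow_sq, zpow_neg, zpow_neg, zpow_natCast, zpow_natCast, ← mul_inv, ← pow_succ',
      one_mul]
    rfl
  have hsq : ‖(p : ℚ_[p]) ^ (n + 1)‖ ^ 2 ≤ (p : ℝ)⁻¹ := by
    rw [pow_two]
    refine (mul_le_of_le_one_left (norm_nonneg _) (norm_p_pow_le_one _)).trans ?_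
    rw [← norm_lt_one_iff_le, ← zpow_natCast]
    exact norm_p_pow_lt n.succ_ne_zero
  refine setIntegral_of_cosets hr (q := fun g => g 1 1 / g 0 1 / p)
    (x := fun i => nLow (p * i : ℚ_[p]) * tp p (-(n + 1 : ℕ)) * sMat) (fun i g => ?_)
    (fun g hg => ?_) fun i => by
      rw [mul_assoc]
      exact hl _ (nLow_mem_slGamma0 (norm_lt_one_iff_le.mpr (norm_p_mul_natCast_le i))) _
  · obtain ⟨e0, e1, e2, e3⟩ := inv_nLow_mul_tp_mul (p * i : ℚ_[p]) (n + 1) g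
    obtain ⟨s0, s1, s2, s3⟩ := inv_mul_sMat_mul (nLow (p * i : ℚ_[p]) * tp p (-(n + 1 : ℕ))) g
    rw [mem_slGamma0_iff_right, s1, s2, s3, e0, e1, e3, norm_neg, norm_div_p_sub_le_iff, hm]
    constructor
    · rintro ⟨h1, h2, h3⟩
      refine ⟨⟨h2, h1, norm_lt_one_iff_le.mpr
        (norm_scaled_le_of_sub h2 (norm_p_mul_natCast_le i) ?_)⟩, (norm_scaled_sub_iff h2 _).mp h3⟩
      exact (mul_le_of_le_one_right (by positivity) h3).trans hsq
    · rintro ⟨⟨h1, h2, -⟩, h4⟩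
      exact ⟨h2, h1, (norm_scaled_sub_iff h1 _).mpr h4⟩
  · have h := norm_div_le_of_scaled hg.1 (norm_lt_one_iff_le.mp hg.2.2)
    have h2 := (norm_div_p_sub_le_iff (g 1 1 / g 0 1) 0 1).mpr (by simpa using h)
    simpa using h2

end CosetIntegrals

/-! ### The Cartan decomposition -/

/-- The matrices whose largest entry has norm `p ^ n`. -/
def cartan (p : ℕ) [Fact p.Prime] (n : ℕ) : Set (SL2 p) :=
  {g | (∀ i j, ‖(p : ℚ_[p]) ^ n * g i j‖ ≤ 1) ∧ ∃ i j, ‖(p : ℚ_[p]) ^ n * g i j‖ = 1}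

lemma exists_norm_eq_one_of_mem {g : SL2 p} (hg : ∀ i j, ‖g i j‖ ≤ 1) : ∃ i j, ‖g i j‖ = 1 := by
  by_contra! h
  have h1 : ∀ i j, ‖g i j‖ < 1 := fun i j => (hg i j).lt_of_ne (h i j)
  have h2 : ‖g 0 0 * g 1 1 - g 0 1 * g 1 0‖ ≤ (p : ℝ)⁻¹ := by
    refine norm_sub_le_of_le (norm_lt_one_iff_le.mp ?_) (norm_lt_one_iff_le.mp ?_) <;>
    · rw [norm_mul]
      exact mul_lt_one_of_nonneg_of_lt_one_left (norm_nonneg _) (h1 _ _) (hg _ _)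
  rw [sl_det, norm_one] at h2
  exact absurd h2 (not_le.mpr (inv_lt_one_of_one_lt₀ one_lt_cast_p))

/-- The index is the least `n` for which `p^n g` is integral. Minimality forces an entry of norm `1`
when `n > 0`; for `n = 0` the determinant does. -/
lemma iUnion_cartan : ⋃ n, cartan p n = Set.univ := by
  classical
  refine Set.eq_univ_of_forall fun g => Set.mem_iUnion.mpr ?_
  have hex : ∃ n : ℕ, ∀ i j, ‖(p : ℚ_[p]) ^ n * g i j‖ ≤ 1 := by
    have h1 : ∀ i j, ∃ n : ℕ, ‖g i j‖ ≤ (p : ℝ) ^ n := fun i j =>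
      (pow_unbounded_of_one_lt _ one_lt_cast_p).imp fun _ => le_of_lt
    choose N hN using h1
    refine ⟨N 0 0 + N 0 1 + N 1 0 + N 1 1, fun i j => ?_⟩
    have h2 : N i j ≤ N 0 0 + N 0 1 + N 1 0 + N 1 1 := by
      fin_cases i <;> fin_cases j <;> simp <;> omega
    have h3 := (hN i j).trans (pow_le_pow_right₀ one_lt_cast_p.le h2)
    rw [norm_mul, norm_p_pow, zpow_neg, zpow_natCast]
    exact inv_mul_le_one_of_le₀ h3 (by have := cast_p_pos (p := p); positivity)
  refine ⟨Nat.find hex, Nat.find_spec hex, ?_⟩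
  rcases Nat.eq_zero_or_pos (Nat.find hex) with h0 | hpos
  · have h := Nat.find_spec hex
    rw [h0] at h ⊢
    simp only [pow_zero, one_mul] at h ⊢
    exact exists_norm_eq_one_of_mem h
  · obtain ⟨m, hm⟩ := Nat.exists_eq_succ_of_ne_zero hpos.ne'
    have h1 := Nat.find_min hex (m := m) (by omega)
    push Not at h1
    obtain ⟨i, j, hij⟩ := h1
    refine ⟨i, j, le_antisymm (Nat.find_spec hex i j) (not_lt.mp fun hlt => ?_)⟩
    rw [hm, Nat.succ_eq_add_one, pow_succ', mul_assoc, norm_lt_one_iff_le, norm_mul,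
      Padic.norm_p] at hlt
    have hp0 := cast_p_pos (p := p)
    have := (mul_le_iff_le_one_right (inv_pos.mpr hp0)).mp hlt
    exact absurd this (not_le.mpr hij)

lemma pairwise_disjoint_cartan : Pairwise (Function.onFun Disjoint (cartan p)) := by
  have key : ∀ m n : ℕ, m < n → ∀ g, g ∈ cartan p m → g ∉ cartan p n := by
    rintro m n hmn g ⟨hm, -⟩ ⟨-, i, j, hij⟩
    obtain ⟨k, rfl⟩ := Nat.exists_eq_add_of_lt hmn
    have e : (p : ℚ_[p]) ^ (m + k + 1) * g i j =
        (p : ℚ_[p]) ^ (k + 1) * ((p : ℚ_[p]) ^ m * g i j) := by ring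
    rw [e, norm_mul] at hij
    have h1 : ‖(p : ℚ_[p]) ^ (k + 1)‖ < 1 := by
      rw [← zpow_natCast]
      exact norm_p_pow_lt k.succ_ne_zero
    exact (mul_lt_one_of_nonneg_of_lt_one_left (norm_nonneg _) h1 (hm i j)).ne hij
  intro m n hmn
  refine Set.disjoint_left.mpr fun g hm hn => ?_
  rcases lt_or_gt_of_ne hmn with h | h
  · exact key m n h g hm hn
  · exact key n m h g hn hm

end

/-! ### Cartan cells as disjoint unions of double cosets. -/

section

lemma sl_scaled_det (g : SL2 p) (n : ℕ) :
    ((p : ℚ_[p]) ^ n * g 0 0) * ((p : ℚ_[p]) ^ n * g 1 1) -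
      ((p : ℚ_[p]) ^ n * g 0 1) * ((p : ℚ_[p]) ^ n * g 1 0) = ((p : ℚ_[p]) ^ n) ^ 2 := by
  linear_combination ((p : ℚ_[p]) ^ n) ^ 2 * sl_det g

lemma norm_le_one_of_mul_sub {a b c d q : ℚ_[p]} (h : a * d - b * c = q) (hq : ‖q‖ ≤ 1)
    (hd : ‖d‖ = 1) (hb : ‖b‖ ≤ 1) (hc : ‖c‖ ≤ 1) : ‖a‖ ≤ 1 := by
  have e : a * d = q + b * c := by linear_combination h
  have h1 : ‖a * d‖ ≤ 1 := by
    rw [e]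
    exact norm_add_le_of_le hq (norm_mul_le_of_le hb hc)
  rwa [norm_mul, hd, mul_one] at h1

/-- Modulo `p` the matrix is singular and `bc` vanishes, so the two diagonal entries cannot both be
units. This separates the double cosets in a cell of positive index. -/
lemma not_norm_eq_one_of_mul_sub {a b c d q : ℚ_[p]} (h : a * d - b * c = q) (hq : ‖q‖ < 1)
    (hb : ‖b‖ ≤ 1) (hc : ‖c‖ < 1) (hd : ‖d‖ = 1) : ¬‖a‖ = 1 := by
  intro ha
  have e : a * d = q + b * c := by linear_combination h
  have h1 : ‖a * d‖ ≤ (p : ℝ)⁻¹ := by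
    rw [e]
    refine norm_add_le_of_le (norm_lt_one_iff_le.mp hq) ?_
    rw [norm_mul]
    exact (mul_le_of_le_one_left (norm_nonneg _) hb).trans (norm_lt_one_iff_le.mp hc)
  rw [← norm_lt_one_iff_le, norm_mul, ha, hd, mul_one] at h1
  exact lt_irrefl _ h1

lemma norm_p_pow_sq_le (n : ℕ) : ‖((p : ℚ_[p]) ^ n) ^ 2‖ ≤ 1 := by
  rw [norm_pow]
  exact norm_p_pow_sq_le_one n

lemma cosetT_subset_cartan (n : ℕ) : cosetT p n ⊆ cartan p n := by
  rintro g ⟨h1, h2, h3⟩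
  have h4 := norm_le_one_of_mul_sub (sl_scaled_det g n) (norm_p_pow_sq_le n) h2 h3 h1.le
  refine ⟨fun i j => ?_, 1, 1, h2⟩
  fin_cases i <;> fin_cases j
  exacts [h4, h3, h1.le, h2.le]

lemma cosetTS_subset_cartan (n : ℕ) : cosetTS p n ⊆ cartan p n := by
  rintro g ⟨h1, h2, h3⟩
  have h4 := norm_le_one_of_mul_sub (a := (p : ℚ_[p]) ^ n * g 0 1) (d := (p : ℚ_[p]) ^ n * g 1 0)
    (b := (p : ℚ_[p]) ^ n * g 0 0) (c := (p : ℚ_[p]) ^ n * g 1 1) (q := -((p : ℚ_[p]) ^ n) ^ 2)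
    (by linear_combination -sl_scaled_det g n) (by rw [norm_neg]; exact norm_p_pow_sq_le n) h1 h2 h3
  refine ⟨fun i j => ?_, 1, 0, h1⟩
  fin_cases i <;> fin_cases j
  exacts [h2, h4, h1.le, h3]

lemma cosetTinv_subset_cartan (n : ℕ) : cosetTinv p n ⊆ cartan p n := by
  rintro g ⟨h1, h2, h3⟩
  have h4 := norm_le_one_of_mul_sub (a := (p : ℚ_[p]) ^ n * g 1 1) (d := (p : ℚ_[p]) ^ n * g 0 0)
    (b := (p : ℚ_[p]) ^ n * g 0 1) (c := (p : ℚ_[p]) ^ n * g 1 0) (q := ((p : ℚ_[p]) ^ n) ^ 2)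
    (by linear_combination sl_scaled_det g n) (norm_p_pow_sq_le n) h2 h3 h1.le
  refine ⟨fun i j => ?_, 0, 0, h2⟩
  fin_cases i <;> fin_cases j
  exacts [h2.le, h3, h1.le, h4]

lemma cosetTinvS_subset_cartan (n : ℕ) : cosetTinvS p n ⊆ cartan p n := by
  rintro g ⟨h1, h2, h3⟩
  have h4 := norm_le_one_of_mul_sub (a := (p : ℚ_[p]) ^ n * g 1 0) (d := (p : ℚ_[p]) ^ n * g 0 1)
    (b := (p : ℚ_[p]) ^ n * g 0 0) (c := (p : ℚ_[p]) ^ n * g 1 1) (q := -((p : ℚ_[p]) ^ n) ^ 2)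
    (by linear_combination -sl_scaled_det g n) (by rw [norm_neg]; exact norm_p_pow_sq_le n)
    h1 h2.le h3.le
  refine ⟨fun i j => ?_, 0, 1, h1⟩
  fin_cases i <;> fin_cases j
  exacts [h2.le, h1.le, h4, h3.le]

lemma cartan_zero : cartan p 0 = cosetT p 0 ∪ cosetTS p 0 := by
  refine Set.Subset.antisymm (fun g hg => ?_)
    (Set.union_subset (cosetT_subset_cartan 0) (cosetTS_subset_cartan 0))
  obtain ⟨h, -⟩ := hg
  rcases (h 1 0).lt_or_eq with hc | hc
  · refine Or.inl ⟨hc, ?_, h 0 1⟩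
    simp only [pow_zero, one_mul] at h hc ⊢
    exact (norm_diag_of_norm_lt_one (mem_slIntegral.mpr h) hc).2
  · exact Or.inr ⟨hc, h 0 0, h 1 1⟩

/-- The scaled matrix has a unit entry; the first unit in the order `c`, `d`, `a`, `b` determines
the double coset. -/
lemma cartan_succ (n : ℕ) : cartan p (n + 1) =
    cosetT p (n + 1) ∪ cosetTS p (n + 1) ∪ (cosetTinv p (n + 1) ∪ cosetTinvS p (n + 1)) := by
  refine Set.Subset.antisymm (fun g hg => ?_)
    (Set.union_subset (Set.union_subset (cosetT_subset_cartan _) (cosetTS_subset_cartan _))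
      (Set.union_subset (cosetTinv_subset_cartan _) (cosetTinvS_subset_cartan _)))
  obtain ⟨h, i, j, hij⟩ := hg
  rcases (h 1 0).lt_or_eq with hc | hc
  · rcases (h 1 1).lt_or_eq with hd | hd
    · rcases (h 0 0).lt_or_eq with ha | ha
      · refine Or.inr (Or.inr ⟨?_, ha, hd⟩)
        fin_cases i <;> fin_cases j
        exacts [absurd hij ha.ne, hij, absurd hij hc.ne, absurd hij hd.ne]
      · exact Or.inr (Or.inl ⟨hc, ha, h 0 1⟩)
    · exact Or.inl (Or.inl ⟨hc, hd, h 0 1⟩)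
  · exact Or.inl (Or.inr ⟨hc, h 0 0, h 1 1⟩)

lemma disjoint_cosetT_cosetTS (n : ℕ) : Disjoint (cosetT p n) (cosetTS p n) :=
  Set.disjoint_left.mpr fun _ h h' => h.1.ne h'.1

lemma disjoint_cosetTinv_cosetTinvS (n : ℕ) : Disjoint (cosetTinv p n) (cosetTinvS p n) :=
  Set.disjoint_left.mpr fun _ h h' => h'.2.1.ne h.2.1

lemma disjoint_cosets (n : ℕ) : Disjoint (cosetT p (n + 1) ∪ cosetTS p (n + 1))
    (cosetTinv p (n + 1) ∪ cosetTinvS p (n + 1)) := by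
  have hq : ‖((p : ℚ_[p]) ^ (n + 1)) ^ 2‖ < 1 := by
    rw [← pow_mul, ← zpow_natCast]
    exact norm_p_pow_lt (by omega)
  refine Set.disjoint_left.mpr ?_
  rintro g (h | h) (h' | h')
  · exact not_norm_eq_one_of_mul_sub (sl_scaled_det g (n + 1)) hq h.2.2 h.1 h.2.1 h'.2.1
  · exact h'.2.2.ne h.2.1
  · exact h'.1.ne h.1
  · exact not_norm_eq_one_of_mul_sub (a := (p : ℚ_[p]) ^ (n + 1) * g 0 1)
      (d := (p : ℚ_[p]) ^ (n + 1) * g 1 0) (b := (p : ℚ_[p]) ^ (n + 1) * g 0 0)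
      (c := (p : ℚ_[p]) ^ (n + 1) * g 1 1) (q := -((p : ℚ_[p]) ^ (n + 1)) ^ 2)
      (by linear_combination -sl_scaled_det g (n + 1)) (by rwa [norm_neg]) h'.2.1.le h'.2.2 h.1 h'.1

section

variable {E : Type*} [NormedAddCommGroup E] [NormedSpace ℝ E] [CompleteSpace E] {f : SL2 p → E}
  (hl : ∀ γ ∈ slGamma0 p, ∀ x, f (γ * x) = f x) (hr : ∀ γ ∈ slGamma0 p, ∀ x, f (x * γ) = f x)

include hl hr

lemma setIntegral_cartan_zero :
    MeasurableSet (cartan p 0) ∧ IntegrableOn f (cartan p 0) (slHaar p) ∧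
      ∫ g in cartan p 0, f g ∂slHaar p =
        (slHaar p).real (slGamma0 p) • (f 1 + (p : ℝ) • f sMat) := by
  obtain ⟨m1, i1, e1⟩ := setIntegral_cosetT hl hr 0
  obtain ⟨m2, i2, e2⟩ := setIntegral_cosetTS hl hr 0
  rw [Nat.cast_zero, tp_zero] at e1 e2
  refine ⟨cartan_zero (p := p) ▸ m1.union m2, cartan_zero (p := p) ▸ i1.union i2, ?_⟩
  rw [cartan_zero, setIntegral_union (disjoint_cosetT_cosetTS 0) m2 i1 i2, e1, e2]
  simp only [one_mul, mul_zero, zero_add, pow_zero, pow_one]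
  module

lemma setIntegral_cartan_succ (n : ℕ) :
    MeasurableSet (cartan p (n + 1)) ∧ IntegrableOn f (cartan p (n + 1)) (slHaar p) ∧
      ∫ g in cartan p (n + 1), f g ∂slHaar p =
        ((p : ℝ) ^ (2 * n + 1) * (slHaar p).real (slGamma0 p)) •
          ((p : ℝ) • f (tp p (n + 1 : ℕ)) + (p : ℝ) ^ 2 • f (tp p (n + 1 : ℕ) * sMat) +
            ((p : ℝ) • f (tp p (-(n + 1 : ℕ))) + f (tp p (-(n + 1 : ℕ)) * sMat))) := by
  obtain ⟨m1, i1, e1⟩ := setIntegral_cosetT hl hr (n + 1)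
  obtain ⟨m2, i2, e2⟩ := setIntegral_cosetTS hl hr (n + 1)
  obtain ⟨m3, i3, e3⟩ := setIntegral_cosetTinv hl hr (n + 1)
  obtain ⟨m4, i4, e4⟩ := setIntegral_cosetTinvS hl hr n
  refine ⟨cartan_succ (p := p) n ▸ (m1.union m2).union (m3.union m4),
    cartan_succ (p := p) n ▸ (i1.union i2).union (i3.union i4), ?_⟩
  rw [cartan_succ, setIntegral_union (disjoint_cosets n) (m3.union m4) (i1.union i2) (i3.union i4),
    setIntegral_union (disjoint_cosetT_cosetTS _) m2 i1 i2,
    setIntegral_union (disjoint_cosetTinv_cosetTinvS _) m4 i3 i4, e1, e2, e3, e4]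
  module

end

/-- Summation over the Cartan decomposition. -/
theorem hasSum_setIntegral_cartan {f : SL2 p → ℂ} (hl : ∀ γ ∈ slGamma0 p, ∀ x, f (γ * x) = f x)
    (hr : ∀ γ ∈ slGamma0 p, ∀ x, f (x * γ) = f x)
    (hs : Summable fun n => ∫ g in cartan p n, ‖f g‖ ∂slHaar p) :
    HasSum (fun n => ∫ g in cartan p n, f g ∂slHaar p) (∫ g, f g ∂slHaar p) := by
  have hm : ∀ n, MeasurableSet (cartan p n) ∧ IntegrableOn f (cartan p n) (slHaar p) := by
    rintro (_ | n)
    · exact ⟨(setIntegral_cartan_zero hl hr).1, (setIntegral_cartan_zero hl hr).2.1⟩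
    · exact ⟨(setIntegral_cartan_succ hl hr n).1, (setIntegral_cartan_succ hl hr n).2.1⟩
  have h := hasSum_integral_iUnion (fun n => (hm n).1) pairwise_disjoint_cartan
    (integrableOn_iUnion_of_summable_integral_norm (fun n => (hm n).2) hs)
  rwa [iUnion_cartan, setIntegral_univ] at h

end

section

/-! ### Local factors -/

namespace WDRep

variable {V : Type} [AddCommGroup V] [Module ℂ V]

/-- The `L`-factor, for a basis of Frobenius eigenvectors of the kernel of monodromy. -/
lemma LFactor_eq_prod (ρ : WDRep p V) {ι : Type} [Fintype ι] [DecidableEq ι] {v : ι → V}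
    {c : ι → ℂ} (hv : LinearIndependent ℂ v)
    (hker : LinearMap.ker ρ.N = Submodule.span ℂ (Set.range v)) (hΦ : ∀ i, ρ.Φ (v i) = c i • v i)
    (s : ℂ) : ρ.LFactor s = (∏ i, (1 - (p : ℂ) ^ (-s) * c i))⁻¹ := by
  let b : Module.Basis ι ℂ (LinearMap.ker ρ.N) :=
    (Module.Basis.span hv).map (LinearEquiv.ofEq _ _ hker.symm)
  have hb : ∀ i, (b i : V) = v i := fun i => by
    simp [b, Module.Basis.span_apply]
  have hdiag : LinearMap.toMatrix b b
      (LinearMap.id - (p : ℂ) ^ (-s) • (ρ.Φ : V →ₗ[ℂ] V).restrict ρ.map_ker) =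
        Matrix.diagonal fun i => 1 - (p : ℂ) ^ (-s) * c i := by
    have h : ∀ j, (LinearMap.id - (p : ℂ) ^ (-s) • (ρ.Φ : V →ₗ[ℂ] V).restrict ρ.map_ker :
        LinearMap.ker ρ.N →ₗ[ℂ] LinearMap.ker ρ.N) (b j) =
        (1 - (p : ℂ) ^ (-s) * c j) • b j := by
      intro j
      apply Subtype.ext
      simp [hb, hΦ, sub_smul, mul_smul]
    ext i j
    rw [LinearMap.toMatrix_apply, h j, map_smul, Module.Basis.repr_self, Matrix.diagonal_apply]
    by_cases hij : i = j
    · simp [hij]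
    · simp [hij]
  rw [LFactor, ← LinearMap.det_toMatrix b, hdiag, Matrix.det_diagonal]

end WDRep

lemma trace_end_prod (X : Module.End ℂ (ℂ × ℂ)) :
    LinearMap.trace ℂ (ℂ × ℂ) X = (X (1, 0)).1 + (X (0, 1)).2 := by
  rw [LinearMap.trace_eq_matrix_trace ℂ (Module.Basis.finTwoProd ℂ), Matrix.trace_fin_two]
  simp [LinearMap.toMatrix_apply]

lemma end_prod_ext {X Y : Module.End ℂ (ℂ × ℂ)} (h0 : X (1, 0) = Y (1, 0))
    (h1 : X (0, 1) = Y (0, 1)) : X = Y := by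
  refine LinearMap.ext fun v => ?_
  obtain ⟨a, b⟩ := v
  have e : ((a, b) : ℂ × ℂ) = a • (1, 0) + b • (0, 1) := by simp
  rw [e, map_add, map_add, map_smul, map_smul, map_smul, map_smul, h0, h1]

/-- The endomorphisms of trace zero of `ℂ²`. -/
abbrev Sl2End : Type := LinearMap.ker (LinearMap.trace ℂ (ℂ × ℂ))

/-- The nilpotent endomorphism with `e₀ ↦ e₁`. -/
def sl2N : Sl2End :=
  ⟨LinearMap.inr ℂ ℂ ℂ ∘ₗ LinearMap.fst ℂ ℂ ℂ, by simp [LinearMap.mem_ker, trace_end_prod]⟩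

/-- The endomorphism with `e₀ ↦ e₀` and `e₁ ↦ -e₁`. -/
def sl2H : Sl2End :=
  ⟨LinearMap.id.prodMap (-LinearMap.id), by simp [LinearMap.mem_ker, trace_end_prod]⟩

lemma sl2_apply_snd (X : Sl2End) : (X.1 (0, 1)).2 = -(X.1 (1, 0)).1 := by
  have h := LinearMap.mem_ker.mp X.2
  rw [trace_end_prod] at h
  linear_combination h

lemma ad_N_apply (ξ : ℚ_[p]ˣ →* ℂˣ) (X : Sl2End) :
    (((steinbergWD ξ).ad.N X).1 (1, 0)) = (-(X.1 (0, 1)).1, 2 * (X.1 (1, 0)).1) ∧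
      (((steinbergWD ξ).ad.N X).1 (0, 1)) = (0, (X.1 (0, 1)).1) := by
  have h : ∀ v, ((steinbergWD ξ).ad.N X).1 v =
      (steinbergWD ξ).N (X.1 v) - X.1 ((steinbergWD ξ).N v) := fun v => rfl
  have h2 := sl2_apply_snd X
  rw [h, h]
  constructor
  · ext
    · simp [steinbergWD]
    · simp [steinbergWD, h2]
      ring
  · have e : (steinbergWD ξ).N ((0, 1) : ℂ × ℂ) = 0 := by simp [steinbergWD]
    rw [e, map_zero, sub_zero]
    simp [steinbergWD]

/-- The kernel of `ad N` is the line of `N`, and half of `sl2H` is sent to `N`. Allowing a multiple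
of `N` on the right is what the kernel computation in the tensor product requires. -/
lemma eq_of_ad_N_eq_smul {ξ : ℚ_[p]ˣ →* ℂˣ} {X : Sl2End} {c : ℂ}
    (h : (steinbergWD ξ).ad.N X = c • sl2N) : X = (c / 2) • sl2H + ((X.1 (1, 0)).2) • sl2N := by
  obtain ⟨h0, h1⟩ := ad_N_apply ξ X
  have h2 := sl2_apply_snd X
  rw [h] at h0 h1
  simp [sl2N] at h0 h1
  apply Subtype.ext
  refine end_prod_ext ?_ ?_
  · ext
    · simp [sl2H, sl2N]
      linear_combination -h0.2 / 2
    · simp [sl2H, sl2N]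
  · ext
    · simp [sl2H, sl2N, ← h1]
    · simp [sl2H, sl2N, h2]
      linear_combination -h0.2 / 2

variable (ξ : ℚ_[p]ˣ →* ℂˣ)

lemma ad_N_sl2N : (steinbergWD ξ).ad.N sl2N = 0 := by
  obtain ⟨h0, h1⟩ := ad_N_apply ξ sl2N
  apply Subtype.ext
  refine end_prod_ext (h0.trans ?_) (h1.trans ?_) <;> simp [sl2N]

lemma ad_N_sl2H : (steinbergWD ξ).ad.N sl2H = (2 : ℂ) • sl2N := by
  obtain ⟨h0, h1⟩ := ad_N_apply ξ sl2H
  apply Subtype.ext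
  refine end_prod_ext (h0.trans ?_) (h1.trans ?_) <;> simp [sl2N, sl2H]

lemma sqrtP_mul_self : ((sqrtP p : ℂˣ) : ℂ) * (sqrtP p : ℂˣ) = p := by
  change ((√(p : ℝ) : ℝ) : ℂ) * ((√(p : ℝ) : ℝ) : ℂ) = p
  rw [← Complex.ofReal_mul, Real.mul_self_sqrt (Nat.cast_nonneg p), Complex.ofReal_natCast]

lemma cpow_neg_half : (p : ℂ) ^ (-(1 / 2) : ℂ) = ((sqrtP p : ℂˣ) : ℂ)⁻¹ := by
  rw [Complex.cpow_neg]
  congr 1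
  change _ = ((√(p : ℝ) : ℝ) : ℂ)
  rw [Real.sqrt_eq_rpow, Complex.ofReal_cpow (Nat.cast_nonneg p)]
  simp

lemma steinbergWD_Φ_apply (a b : ℂ) : (steinbergWD ξ).Φ (a, b) =
    ((ξ (uniformizer p) : ℂ) * (sqrtP p : ℂˣ) * a,
      (ξ (uniformizer p) : ℂ) * ((sqrtP p : ℂˣ) : ℂ)⁻¹ * b) := by
  ext <;> simp [steinbergWD, LinearEquiv.smulOfUnit, Units.smul_def]

lemma ad_Φ_eq_smul {X : Sl2End} {c : ℂ}
    (h : ∀ v, (steinbergWD ξ).Φ (X.1 v) = c • X.1 ((steinbergWD ξ).Φ v)) :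
    (steinbergWD ξ).ad.Φ X = c • X := by
  apply Subtype.ext
  refine LinearMap.ext fun v => ?_
  change (steinbergWD ξ).Φ (X.1 ((steinbergWD ξ).Φ.symm v)) = c • X.1 v
  rw [h, LinearEquiv.apply_symm_apply]

lemma ad_Φ_sl2N : (steinbergWD ξ).ad.Φ sl2N = (p : ℂ)⁻¹ • sl2N := by
  refine ad_Φ_eq_smul ξ fun v => ?_
  exact (steinbergWD ξ).comm v

lemma ad_Φ_sl2H : (steinbergWD ξ).ad.Φ sl2H = sl2H := by
  rw [← one_smul ℂ sl2H]
  refine (ad_Φ_eq_smul ξ (c := 1) fun v => ?_).trans (by simp)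
  obtain ⟨a, b⟩ := v
  simp [sl2H, steinbergWD_Φ_apply]

lemma sl2N_ne_zero : sl2N ≠ 0 := by
  intro h
  have h1 := congrArg (fun X : Sl2End => (X.1 (1, 0)).2) h
  simp [sl2N] at h1

/-- `L(1, ξ St, ad) = ζ_p(2)`. -/
theorem LFactor_ad : (steinbergWD ξ).ad.LFactor 1 = (1 - (p : ℂ)⁻¹ ^ 2)⁻¹ := by
  have hker : LinearMap.ker (steinbergWD ξ).ad.N =
      Submodule.span ℂ (Set.range fun _ : Unit => sl2N) := by
    rw [Set.range_const]
    ext X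
    rw [LinearMap.mem_ker, Submodule.mem_span_singleton]
    constructor
    · intro h
      have h1 := eq_of_ad_N_eq_smul (c := 0) (h.trans (zero_smul _ _).symm)
      rw [zero_div, zero_smul, zero_add] at h1
      exact ⟨_, h1.symm⟩
    · rintro ⟨c, rfl⟩
      rw [map_smul, ad_N_sl2N, smul_zero]
  rw [WDRep.LFactor_eq_prod _ (LinearIndependent.of_subsingleton () sl2N_ne_zero) hker
    (c := fun _ => (p : ℂ)⁻¹) (fun _ => ad_Φ_sl2N ξ) 1]
  simp [Complex.cpow_neg_one, sq]

/-- `ε(1/2, ξ St) = -ξ(p)`. -/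
theorem epsFactor_steinbergWD :
    (steinbergWD ξ).epsFactor (1 / 2) = -(ξ (uniformizer p) : ℂ) := by
  have hmem : ∀ v : ℂ × ℂ, v ∈ LinearMap.ker (steinbergWD ξ).N ↔ v.1 = 0 := by
    intro v
    simp [steinbergWD, LinearMap.mem_ker]
  have hfin : Module.finrank ℂ ((ℂ × ℂ) ⧸ LinearMap.ker (steinbergWD ξ).N) = 1 := by
    refine finrank_eq_one (Submodule.Quotient.mk (1, 0)) ?_ fun w => ?_
    · rw [Ne, Submodule.Quotient.mk_eq_zero, hmem]
      exact one_ne_zero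
    · obtain ⟨v, rfl⟩ := Submodule.Quotient.mk_surjective _ w
      refine ⟨v.1, ?_⟩
      rw [← Submodule.Quotient.mk_smul, Submodule.Quotient.eq, hmem]
      simp
  have hs0 : ((sqrtP p : ℂˣ) : ℂ) ≠ 0 := (sqrtP p).ne_zero
  have hmap : -((p : ℂ) ^ (-(1 / 2) : ℂ) • (LinearMap.ker (steinbergWD ξ).N).mapQ
      (LinearMap.ker (steinbergWD ξ).N) ((steinbergWD ξ).Φ : (ℂ × ℂ) →ₗ[ℂ] ℂ × ℂ)
        (steinbergWD ξ).map_ker) = (-(ξ (uniformizer p) : ℂ)) • LinearMap.id := by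
    refine LinearMap.ext fun w => ?_
    obtain ⟨v, rfl⟩ := Submodule.Quotient.mk_surjective _ w
    rw [LinearMap.neg_apply, LinearMap.smul_apply, LinearMap.smul_apply, Submodule.mapQ_apply,
      LinearMap.id_apply, ← Submodule.Quotient.mk_smul, ← Submodule.Quotient.mk_smul,
      ← Submodule.Quotient.mk_neg, Submodule.Quotient.eq, hmem, cpow_neg_half]
    obtain ⟨a, b⟩ := v
    simp [steinbergWD_Φ_apply]
    field_simp
    ring
  rw [WDRep.epsFactor, hmap, LinearMap.det_smul, hfin, LinearMap.det_id, pow_one, mul_one]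

end

section

/-! ### The `L`-factor of the tensor product -/

section

variable {V W : Type} [AddCommGroup V] [Module ℂ V] [AddCommGroup W] [Module ℂ W]

lemma exists_tmul_add_tmul {e₀ e₁ : V} (hV : ∀ v : V, ∃ a b : ℂ, v = a • e₀ + b • e₁)
    (w : V ⊗[ℂ] W) : ∃ X Y : W, w = e₀ ⊗ₜ[ℂ] X + e₁ ⊗ₜ[ℂ] Y := by
  induction w with
  | zero => exact ⟨0, 0, by simp⟩
  | tmul v X =>
    obtain ⟨a, b, rfl⟩ := hV v
    refine ⟨a • X, b • X, ?_⟩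
    rw [TensorProduct.add_tmul, TensorProduct.smul_tmul, TensorProduct.smul_tmul]
  | add x y hx hy =>
    obtain ⟨X, Y, rfl⟩ := hx
    obtain ⟨X', Y', rfl⟩ := hy
    refine ⟨X + X', Y + Y', ?_⟩
    rw [TensorProduct.tmul_add, TensorProduct.tmul_add]
    abel

lemma eq_zero_of_tmul_add_tmul {e₀ e₁ : V} (l : V →ₗ[ℂ] ℂ) (h₀ : l e₀ = 1) (h₁ : l e₁ = 0)
    {X Y : W} (h : e₀ ⊗ₜ[ℂ] X + e₁ ⊗ₜ[ℂ] Y = 0) : X = 0 := by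
  have h1 := congrArg ((TensorProduct.lid ℂ W).toLinearMap ∘ₗ l.rTensor W) h
  simpa [h₀, h₁] using h1

/-- The `L`-factor of the tensor product of the standard and the adjoint representation of
`SL₂`. -/
lemma WDRep.LFactor_tensor (ρ : WDRep p V) (σ : WDRep p W) {e₀ e₁ : V} {n h : W} {a b q : ℂ}
    (hV : ∀ v : V, ∃ a b : ℂ, v = a • e₀ + b • e₁) {l₀ l₁ : V →ₗ[ℂ] ℂ} (h00 : l₀ e₀ = 1)
    (h01 : l₀ e₁ = 0) (h10 : l₁ e₀ = 0) (h11 : l₁ e₁ = 1) (hN₀ : ρ.N e₀ = e₁) (hN₁ : ρ.N e₁ = 0)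
    (hΦ₀ : ρ.Φ e₀ = a • e₀) (hΦ₁ : ρ.Φ e₁ = b • e₁) (hn : n ≠ 0) (hNn : σ.N n = 0)
    (hNh : σ.N h = (2 : ℂ) • n) (hΦn : σ.Φ n = q • n) (hΦh : σ.Φ h = h)
    (hσ : ∀ (X : W) (c : ℂ), σ.N X = c • n → ∃ y : ℂ, X = (c / 2) • h + y • n) (hab : a * q = b)
    (s : ℂ) : (ρ.tensor σ).LFactor s =
      ((1 - (p : ℂ) ^ (-s) * (b * q)) * (1 - (p : ℂ) ^ (-s) * b))⁻¹ := by
  have hN : ∀ X Y, (ρ.tensor σ).N (e₀ ⊗ₜ[ℂ] X + e₁ ⊗ₜ[ℂ] Y) =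
      e₀ ⊗ₜ[ℂ] σ.N X + e₁ ⊗ₜ[ℂ] (X + σ.N Y) := by
    intro X Y
    have ht : ∀ (v : V) (Z : W), (ρ.tensor σ).N (v ⊗ₜ[ℂ] Z) = ρ.N v ⊗ₜ[ℂ] Z + v ⊗ₜ[ℂ] σ.N Z :=
      fun v Z => rfl
    rw [map_add, ht, ht, hN₀, hN₁, TensorProduct.zero_tmul, TensorProduct.tmul_add]
    abel
  have hΦ : ∀ (v : V) (Z : W), (ρ.tensor σ).Φ (v ⊗ₜ[ℂ] Z) = ρ.Φ v ⊗ₜ[ℂ] σ.Φ Z := fun v Z => rfl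
  have hzero : ∀ X Y : W, e₀ ⊗ₜ[ℂ] X + e₁ ⊗ₜ[ℂ] Y = 0 → X = 0 ∧ Y = 0 := fun X Y hXY =>
    ⟨eq_zero_of_tmul_add_tmul l₀ h00 h01 hXY,
      eq_zero_of_tmul_add_tmul l₁ h11 h10 ((add_comm _ _).trans hXY)⟩
  -- One kernel line for each summand of `std ⊗ Sym² = Sym³ ⊕ std`. The coefficient `-1/2` cancels
  -- `N e₀ ⊗ n = e₁ ⊗ n` against `N h = 2 n`.
  set v : Fin 2 → V ⊗[ℂ] W := ![e₁ ⊗ₜ[ℂ] n, e₀ ⊗ₜ[ℂ] n + e₁ ⊗ₜ[ℂ] ((-1 / 2 : ℂ) • h)] with hv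
  have hcomb : ∀ x y : ℂ, x • v 0 + y • v 1 =
      e₀ ⊗ₜ[ℂ] (y • n) + e₁ ⊗ₜ[ℂ] ((-y / 2) • h + x • n) := by
    intro x y
    simp only [hv, Matrix.cons_val_zero, Matrix.cons_val_one, TensorProduct.tmul_add,
      TensorProduct.tmul_smul]
    module
  have hli : LinearIndependent ℂ v := by
    rw [hv, LinearIndependent.pair_iff]
    intro x y hxy
    obtain ⟨h1, h2⟩ := hzero _ _ ((hcomb x y).symm.trans hxy)
    have hy := (smul_eq_zero.mp h1).resolve_right hn
    rw [hy, neg_zero, zero_div, zero_smul, zero_add] at h2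
    exact ⟨(smul_eq_zero.mp h2).resolve_right hn, hy⟩
  have hker : LinearMap.ker (ρ.tensor σ).N = Submodule.span ℂ (Set.range v) := by
    apply le_antisymm
    · intro w hw
      rw [LinearMap.mem_ker] at hw
      obtain ⟨X, Y, rfl⟩ := exists_tmul_add_tmul hV w
      rw [hN] at hw
      obtain ⟨h1, h2⟩ := hzero _ _ hw
      obtain ⟨c, hX⟩ := hσ X 0 (h1.trans (zero_smul _ _).symm)
      rw [zero_div, zero_smul, zero_add] at hX
      obtain ⟨y, hY⟩ := hσ Y (-c) (by
        rw [neg_smul, ← hX]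
        exact eq_neg_of_add_eq_zero_right h2)
      rw [hX, hY, ← hcomb]
      exact add_mem (Submodule.smul_mem _ _ (Submodule.subset_span ⟨0, rfl⟩))
        (Submodule.smul_mem _ _ (Submodule.subset_span ⟨1, rfl⟩))
    · rw [Submodule.span_le]
      rintro _ ⟨i, rfl⟩
      rw [SetLike.mem_coe, LinearMap.mem_ker]
      have hxy : ∀ x y : ℂ, (ρ.tensor σ).N (x • v 0 + y • v 1) = 0 := by
        intro x y
        rw [hcomb, hN, map_add, map_smul, map_smul, map_smul, hNn, hNh]
        have e : y • n + ((-y / 2) • (2 : ℂ) • n + x • (0 : W)) = 0 := by module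
        rw [e]
        simp
      fin_cases i
      · simpa using hxy 1 0
      · simpa using hxy 0 1
  rw [LFactor_eq_prod _ hli hker (c := ![b * q, b]), Fin.prod_univ_two]
  · rfl
  · intro i
    fin_cases i
    · change (ρ.tensor σ).Φ (e₁ ⊗ₜ[ℂ] n) = (b * q) • (e₁ ⊗ₜ[ℂ] n)
      rw [hΦ, hΦ₁, hΦn, TensorProduct.tmul_smul, ← TensorProduct.smul_tmul', smul_smul, mul_comm]
    · change (ρ.tensor σ).Φ (e₀ ⊗ₜ[ℂ] n + e₁ ⊗ₜ[ℂ] ((-1 / 2 : ℂ) • h)) =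
        b • (e₀ ⊗ₜ[ℂ] n + e₁ ⊗ₜ[ℂ] ((-1 / 2 : ℂ) • h))
      rw [map_add, hΦ, hΦ, hΦ₀, hΦ₁, hΦn, map_smul, hΦh, TensorProduct.tmul_smul q,
        ← TensorProduct.smul_tmul', ← TensorProduct.smul_tmul', smul_smul, mul_comm q, hab,
        smul_add]

end

/-- `L(1/2, ξ₁ St × ad(ξ₂ St))`. -/
theorem LFactor_tensor_ad (ξ₁ ξ₂ : ℚ_[p]ˣ →* ℂˣ) :
    ((steinbergWD ξ₁).tensor (steinbergWD ξ₂).ad).LFactor (1 / 2) =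
      ((1 - (ξ₁ (uniformizer p) : ℂ) * (p : ℂ)⁻¹ ^ 2) *
        (1 - (ξ₁ (uniformizer p) : ℂ) * (p : ℂ)⁻¹))⁻¹ := by
  have hs0 : ((sqrtP p : ℂˣ) : ℂ) ≠ 0 := (sqrtP p).ne_zero
  set s : ℂ := ((sqrtP p : ℂˣ) : ℂ) with hs
  set x : ℂ := (ξ₁ (uniformizer p) : ℂ) with hx
  have hss : s * s = p := sqrtP_mul_self
  have h2 : (p : ℂ)⁻¹ = s⁻¹ * s⁻¹ := by rw [← mul_inv, hss]
  rw [WDRep.LFactor_tensor (steinbergWD ξ₁) (steinbergWD ξ₂).ad (e₀ := (1, 0)) (e₁ := (0, 1))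
    (l₀ := LinearMap.fst ℂ ℂ ℂ) (l₁ := LinearMap.snd ℂ ℂ ℂ) (n := sl2N) (h := sl2H) (a := x * s)
    (b := x * s⁻¹) (q := (p : ℂ)⁻¹) (fun v => ⟨v.1, v.2, by simp⟩) rfl rfl rfl rfl
    (by simp [steinbergWD]) (by simp [steinbergWD])
    (by rw [steinbergWD_Φ_apply]; simp [← hs, ← hx])
    (by rw [steinbergWD_Φ_apply]; simp [← hs, ← hx]) sl2N_ne_zero (ad_N_sl2N ξ₂) (ad_N_sl2H ξ₂)
    (ad_Φ_sl2N ξ₂) (ad_Φ_sl2H ξ₂) (fun X c hX => ⟨_, eq_of_ad_N_eq_smul hX⟩)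
    (by rw [h2]; field_simp), cpow_neg_half, ← hs, h2]
  congr 1
  ring

end

section

/-! ### The local period -/

section

variable {T G : SL2 p → ℂ} (hT : IsSteinbergCoeff T) (hG : IsSteinbergCoeff G)

include hT hG

lemma IsSteinbergCoeff.mul_left_invariant : ∀ γ ∈ slGamma0 p, ∀ x, T (γ * x) * G (γ * x) = T x * G x :=
  fun γ hγ x => by rw [hT.left γ hγ, hG.left γ hγ]

lemma IsSteinbergCoeff.mul_right_invariant :
    ∀ γ ∈ slGamma0 p, ∀ x, T (x * γ) * G (x * γ) = T x * G x :=
  fun γ hγ x => by rw [hT.right γ hγ, hG.right γ hγ]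

variable {η : ℂ} (hη : ‖η‖ = 1) (hTt : ∀ n : ℕ, T (tp p n) = (η * (p : ℂ)⁻¹ ^ 2) ^ n)
  (hGt : ∀ n : ℕ, G (tp p n) = ((p : ℂ)⁻¹) ^ (2 * n))

include hTt hGt

/-- The Iwahori subgroup contributes `1`, and its `p` further cosets in `SL₂(ℤ_p)` contribute `p⁻²`
each. -/
lemma setIntegral_cartan_zero_mul : ∫ g in cartan p 0, T g * G g ∂slHaar p =
    ((slHaar p).real (slGamma0 p) : ℂ) * (1 + (p : ℂ)⁻¹) := by
  have hp : (p : ℂ) ≠ 0 := cast_p_ne_zero_complex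
  have h1 := hT.tp_mul_s 0
  have h2 := hG.tp_mul_s 0
  have h3 := hTt 0
  have h4 := hGt 0
  rw [Nat.cast_zero, tp_zero] at h1 h2 h3 h4
  rw [one_mul] at h1 h2
  rw [(setIntegral_cartan_zero (hT.mul_left_invariant hG) (hT.mul_right_invariant hG)).2.2, h1, h2,
    h3, h4]
  simp only [Complex.real_smul]
  push_cast
  field_simp

/-- Relative to `T G` at `t^(n+1)`, the four double cosets have weights `p`, `p² · p⁻²`, `p` and
`p²`, up to a common factor; they add up to `(1 + p)²`. -/
lemma setIntegral_cartan_succ_mul (n : ℕ) : ∫ g in cartan p (n + 1), T g * G g ∂slHaar p =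
    ((slHaar p).real (slGamma0 p) : ℂ) * (1 + p) ^ 2 * (η * (p : ℂ)⁻¹ ^ 3) *
      (η * (p : ℂ)⁻¹ ^ 2) ^ n := by
  have hp : (p : ℂ) ≠ 0 := cast_p_ne_zero_complex
  rw [(setIntegral_cartan_succ (hT.mul_left_invariant hG) (hT.mul_right_invariant hG) n).2.2,
    hT.tp_mul_s, hG.tp_mul_s, hT.tp_neg_mul_s n.succ_ne_zero, hG.tp_neg_mul_s n.succ_ne_zero,
    hT.tp_neg n.succ_ne_zero, hG.tp_neg n.succ_ne_zero, hTt, hGt]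
  simp only [Complex.real_smul]
  push_cast
  rw [mul_add 2 n, pow_add, pow_add, pow_add, pow_one, mul_pow η, ← pow_mul, mul_pow η,
    inv_pow, inv_pow, inv_pow, inv_pow]
  field_simp
  ring

include hη

/-- The same computation with `|η| = 1` gives a convergent geometric series, hence the absolute
convergence required for summing over the cells. -/
lemma setIntegral_cartan_succ_norm_mul (n : ℕ) :
    ∫ g in cartan p (n + 1), ‖T g * G g‖ ∂slHaar p =
      (slHaar p).real (slGamma0 p) * (1 + p) ^ 2 * (p : ℝ)⁻¹ ^ 3 * ((p : ℝ)⁻¹ ^ 2) ^ n := by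
  have hp : (p : ℝ) ≠ 0 := cast_p_pos.ne'
  rw [(setIntegral_cartan_succ (f := fun g => ‖T g * G g‖)
      (fun γ hγ x => by rw [hT.mul_left_invariant hG γ hγ])
      (fun γ hγ x => by rw [hT.mul_right_invariant hG γ hγ]) n).2.2,
    hT.tp_mul_s, hG.tp_mul_s, hT.tp_neg_mul_s n.succ_ne_zero, hG.tp_neg_mul_s n.succ_ne_zero,
    hT.tp_neg n.succ_ne_zero, hG.tp_neg n.succ_ne_zero, hTt, hGt]
  simp only [smul_eq_mul, norm_mul, norm_pow, norm_neg, norm_inv, hη, Complex.norm_natCast, one_mul]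
  rw [mul_add 2 n, pow_add, pow_add, pow_add, pow_one, ← pow_mul,
    inv_pow, inv_pow, inv_pow]
  field_simp
  ring

/-- The integral of a product of two matrix coefficients of special representations. -/
theorem integral_mul_of_isSteinbergCoeff : ∫ g, T g * G g ∂slHaar p =
    (p : ℂ)⁻¹ * (1 - (p : ℂ)⁻¹ ^ 2) * (1 + η * (p : ℂ)⁻¹) / (1 - η * (p : ℂ)⁻¹ ^ 2) := by
  have hp : (p : ℂ) ≠ 0 := cast_p_ne_zero_complex
  have hp1 : (p : ℂ) + 1 ≠ 0 := by exact_mod_cast p.succ_ne_zero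
  have hr : (p : ℝ)⁻¹ ^ 2 < 1 :=
    pow_lt_one₀ (by positivity) (inv_lt_one_of_one_lt₀ one_lt_cast_p) two_ne_zero
  have hnorm : ‖η * (p : ℂ)⁻¹ ^ 2‖ < 1 := by
    rw [norm_mul, hη, one_mul, norm_pow, norm_inv, Complex.norm_natCast]
    exact hr
  have hne : 1 - η * (p : ℂ)⁻¹ ^ 2 ≠ 0 := by
    intro h
    rw [← sub_eq_zero.mp h, norm_one] at hnorm
    exact lt_irrefl _ hnorm
  have hs : Summable fun n => ∫ g in cartan p n, ‖T g * G g‖ ∂slHaar p := by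
    refine (summable_nat_add_iff (f := fun n => ∫ g in cartan p n, ‖T g * G g‖ ∂slHaar p) 1).mp ?_
    simp only [setIntegral_cartan_succ_norm_mul hT hG hη hTt hGt]
    exact (summable_geometric_of_lt_one (by positivity) hr).mul_left _
  have h1 := hasSum_setIntegral_cartan (hT.mul_left_invariant hG) (hT.mul_right_invariant hG) hs
  have h2 : HasSum (fun n => ∫ g in cartan p (n + 1), T g * G g ∂slHaar p)
      (((slHaar p).real (slGamma0 p) : ℂ) * (1 + p) ^ 2 * (η * (p : ℂ)⁻¹ ^ 3) *
        (1 - η * (p : ℂ)⁻¹ ^ 2)⁻¹) := by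
    simp only [setIntegral_cartan_succ_mul hT hG hTt hGt]
    exact (hasSum_geometric_of_norm_lt_one hnorm).mul_left _
  have h3 := (hasSum_nat_add_iff (f := fun n => ∫ g in cartan p n, T g * G g ∂slHaar p) 1).mp h2
  rw [h1.unique h3, Finset.sum_range_one, setIntegral_cartan_zero_mul hT hG hTt hGt,
    measureReal_slGamma0]
  push_cast
  have hne' : (p : ℂ) ^ 2 - η ≠ 0 := by
    intro h
    apply hne
    field_simp
    rw [h, mul_zero]
  field_simp
  ring

end

lemma leg_eq_neg_one_of_not_isSquare {δ : ℤ_[p]ˣ} (hδ : ¬IsSquare δ) :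
    leg ((δ : ℤ_[p]) : ℚ_[p]) = -1 := by
  have hn : ‖((δ : ℤ_[p]) : ℚ_[p])‖ = 1 := PadicInt.norm_units δ
  refine (Int.units_eq_one_or _).resolve_left fun h => hδ ?_
  obtain ⟨r, hr⟩ := (leg_eq_one_iff hn).mp h
  have hr1 : ‖r‖ = 1 := by
    rw [hr, norm_mul] at hn
    nlinarith [norm_nonneg r]
  refine ⟨PadicInt.mkUnits hr1, Units.ext (Subtype.ext ?_)⟩
  rw [hr]
  rfl

end

end LocalPeriod

end

/-! ### Evaluation of the local period. -/

theorem mainTheorem6 (p : ℕ) [Fact p.Prime] (hp : p ≠ 2)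
    (ψ : AddChar ℚ_[p] Circle) (hψ : ∀ x : ℚ_[p], ψ x = 1 ↔ ‖x‖ ≤ 1)
    (ξ₁ ξ₂ : ℚ_[p]ˣ →* ℂˣ)
    (hξ₁ : LocalPeriod.IsUnramified ξ₁) (hξ₁_quadratic : ξ₁ ^ 2 = 1)
    (hξ₂ : LocalPeriod.IsUnramified ξ₂)
    (D : ℤ_[p]ˣ)
    (hD : ((quadraticChar (ZMod p) (PadicInt.toZMod (D : ℤ_[p])) : ℤ) : ℂ) =
      (LocalPeriod.steinbergWD ξ₁).epsFactor (1 / 2))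
    (δ : ℤ_[p]ˣ) (hδ : ¬ IsSquare δ)
    (h : LocalPeriod.Mp p → ℂ)
    (hh : LocalPeriod.IsMpNewvector (ψ⁻¹.mulShift ((D : ℤ_[p]) : ℚ_[p])) ((δ : ℤ_[p]) : ℚ_[p]) h)
    (g : LocalPeriod.GL2 p → ℂ) (hg : LocalPeriod.IsGLNewvector ξ₂ g) :
    LocalPeriod.periodSharp ψ⁻¹ ξ₁ ξ₂ h g LocalPeriod.charZp = (p : ℂ)⁻¹ := by
  have hΨ : LocalPeriod.IsUnramifiedChar ψ⁻¹ := LocalPeriod.IsUnramifiedChar.inv hψ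
  have hDn : ‖((D : ℤ_[p]) : ℚ_[p])‖ = 1 := PadicInt.norm_units D
  have hδn : ‖((δ : ℤ_[p]) : ℚ_[p])‖ = 1 := PadicInt.norm_units δ
  have hδ' := LocalPeriod.leg_eq_neg_one_of_not_isSquare hδ
  set η : ℂ := (ξ₁ (LocalPeriod.uniformizer p) : ℂ) with hη
  have hη2 : η ^ 2 = 1 := by
    have h1 := DFunLike.congr_fun hξ₁_quadratic (LocalPeriod.uniformizer p)
    rw [MonoidHom.pow_apply, MonoidHom.one_apply] at h1
    rw [hη, ← Units.val_pow_eq_pow_val, h1, Units.val_one]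
  -- The root number condition enters only here: `(D/p) = -ξ₁(p)` matches the sign in the
  -- metaplectic coefficient with the one in the `L`-factor of `π_p × ad τ_p`.
  have hleg : -((LocalPeriod.leg ((D : ℤ_[p]) : ℚ_[p]) : ℤ) : ℂ) = η := by
    rw [LocalPeriod.leg_eq_quadraticChar hp (PadicInt.norm_units D), hD,
      LocalPeriod.epsFactor_steinbergWD, neg_neg]
  have hηn : ‖η‖ = 1 := by
    rw [← hleg, norm_neg]
    exact LocalPeriod.norm_units_cast _
  have hT := hh.isSteinbergCoeff_conj_mpCoeff_mul hΨ hp hDn hδn hδ'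
  have hG := hg.isSteinbergCoeff_glCoeff hξ₂
  have hTt := hh.conj_mpCoeff_mul_tp hΨ hp hDn hδn hδ'
  rw [hleg] at hTt
  have hint := LocalPeriod.integral_mul_of_isSteinbergCoeff hT hG hηn hTt (hg.glCoeff_tp hξ₂)
  have hα : LocalPeriod.alphaSharp ψ⁻¹ h g LocalPeriod.charZp =
      (p : ℂ)⁻¹ * (1 - (p : ℂ)⁻¹ ^ 2) * (1 + η * (p : ℂ)⁻¹) / (1 - η * (p : ℂ)⁻¹ ^ 2) := by
    rw [← hint, LocalPeriod.alphaSharp]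
    refine MeasureTheory.integral_congr_ae (Filter.Eventually.of_forall fun x => ?_)
    exact mul_right_comm _ _ _
  have hq : ‖(p : ℂ)⁻¹‖ < 1 := by
    rw [norm_inv, Complex.norm_natCast]
    exact inv_lt_one_of_one_lt₀ LocalPeriod.one_lt_cast_p
  have hne : ∀ z : ℂ, ‖z‖ = 1 → 1 - z * (p : ℂ)⁻¹ ^ 2 ≠ 0 := by
    intro z hz h0
    have h1 := congrArg norm (sub_eq_zero.mp h0)
    rw [norm_one, norm_mul, hz, one_mul, norm_pow] at h1
    exact absurd h1.symm (pow_lt_one₀ (norm_nonneg _) hq two_ne_zero).ne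
  have h1 := hne η hηn
  have h2 := hne 1 norm_one
  rw [one_mul] at h2
  rw [LocalPeriod.periodSharp, LocalPeriod.LFactor_ad, LocalPeriod.LFactor_ad,
    LocalPeriod.LFactor_tensor_ad, hα, ← hη]
  generalize (p : ℂ)⁻¹ = q at h1 h2 ⊢
  rw [mul_comm η (q ^ 2)] at h1 ⊢
  rw [div_inv_eq_mul]
  field_simp
  -- After the factors `1 - η q²` cancel, the identity left is `(1 + η q)(1 - η q) = 1 - q²`.
  linear_combination (-(q ^ 3)) * hη2
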